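/- Let $G=(-1,1)^2$, $\Omega=G\times(-1,1)$ with points $(x,y,z)$, and regard functions of $x,y,z$ as periodic, i.e. as functions on $(\mathbb R/2\mathbb Z)^3$, unless said otherwise. For $\varepsilon,\delta>0$ put $\Delta_\delta=\partial_x^2+\partial_y^2+\delta\partial_z^2$, $\nabla_\varepsilon=(\partial_x,\partial_y,\varepsilon^{-1}\partial_z)$ and $\operatorname{div}_\varepsilon U=\partial_xU_1+\partial_yU_2+\varepsilon^{-1}\partial_zU_3$. Let $$H=H^1_zL^2_{xy},\qquad V=H^1_zH^1_{xy},\qquad V'=H^1_zH^{-1}_{xy}$$ be the spaces of real $\mathbb R^3$-valued periodic functions (distributions in the case of $V'$) whose first two components are even and whose third component is odd in $z$; here $H^r_zX_{xy}=H^r(-1,1;X(G))$, with $X(G)=L^2(G)$, $H^1_{per}(G)$, and $H^{-1}_{per}(G)=(H^1_{per}(G))'$, respectively. Let $\mathbb E_1(T)=L^2(0,T;H^2_{per}(\Omega))\cap H^1(0,T;L^2(\Omega))$. There is a constant $C>0$ depending only on $\Omega$ such that the following holds for all $T,\varepsilon,\delta\in(0,\infty)$. Let $U_0\in H$ and $f\in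 L^2(0,T;V')$. Let $\omega\in L^2((0,T)\times\Omega)$ be a scalar function, periodic in $z$, with $\partial_z\omega\in L^2(0,T;H^1_zL^2_{xy})$ periodic in $z$. Let $\nu\in L^4(0,T;H^2(-1,1;L^4(G)))$ be $\mathbb R^3$-valued, with third component $\nu_3$ periodic in $z$ (i.e. with equal traces at $z=\pm1$). If $U=(U_1,U_2,U_3)\in\mathbb E_1(T)$, together with a periodic pressure $P\in L^1((0,T)\times\Omega)$ that is even in $z$, solves $$\partial_tU-\Delta_\delta U+\partial_z(\omega U)+\partial_z\bigl(\tfrac1\varepsilon U_3\,\nu\bigr)+\nabla_\varepsilon P=f,\qquad \operatorname{div}_\varepsilon U=0,\qquad U(0)=U_0$$ on $(0,T)\times\Omega$ (the first equation in the sense of distributions on $(0,T)\times(\mathbb R/2\mathbb Z)^3$), where $U_1,U_2$ are even and $U_3$ is odd in $z$, then $$\|U\|^2_{L^\infty(0,T;H)}+\|U\|^2_{L^2(0,T;V)}\le C\bigl(\|U_0\|_H^2+\|f\|^2_{L^2(0,T;V')}\bigr)\exp\Bigl(C\bigl(T+\|\partial_z\omega\|^2_{L^2(0,T;H^1_zL^2_{xy})}+\|\nu\|^4_{L^4(0,T;H^2_zL^4_{xy})}\bigr)\Bigr).$$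 -/

import Mathlib

open MeasureTheory Set Filter Topology
open scoped ENNReal

noncomputable section

namespace AnisoTransport

/-! Points of space are written `(z, x, y)` and points of space-time `(t, z, x, y)`, so that
the iterated norms in `t`, then `z`, then `(x, y)` follow the order of the factors.
The vector components and the directions of differentiation are numbered as usual:
`0 ↔ x`, `1 ↔ y`, `2 ↔ z`.
Functions on the box are regarded as functions on the torus `(ℝ/2ℤ)³`: periodicity is expressed
by testing against smooth functions that are `2`-periodic (and need not vanish at the boundary
of the box), values outside the box being irrelevant. -/

/-- Spatial points `(z, x, y)`. -/
abbrev Space := ℝ × ℝ × ℝ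

/-- Space-time points `(t, z, x, y)`. -/
abbrev SpaceTime := ℝ × Space

/-- The horizontal square `G = (-1,1)²`. -/
def horiz : Set (ℝ × ℝ) := Ioo (-1) 1 ×ˢ Ioo (-1) 1

/-- The box `Ω = G × (-1,1)`. -/
def box : Set Space := Ioo (-1) 1 ×ˢ horiz

/-- The cylinder `(0,T) × Ω`. -/
def cyl (T : ℝ) : Set SpaceTime := Ioo 0 T ×ˢ box

/-- The rectangle `(0,T) × (-1,1)` of the variables `(t, z)`. -/
def rect (T : ℝ) : Set (ℝ × ℝ) := Ioo 0 T ×ˢ Ioo (-1) 1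

/-- The unit vectors in the directions `x`, `y`, `z`. -/
def dir : Fin 3 → Space := ![(0, 1, 0), (0, 0, 1), (1, 0, 0)]

/-- The vertical reflection `(t, z, x, y) ↦ (t, -z, x, y)`. -/
def reflect (p : SpaceTime) : SpaceTime := (p.1, -p.2.1, p.2.2)

/-- Parities in `z`: the first two components are even, the third is odd. -/
def paritySign : Fin 3 → ℝ := ![1, 1, -1]

/-! ### Test functions and weak derivatives -/

/-- Smooth functions on `ℝ × ℝ³`, `2`-periodic in each spatial variable, whose support in time is
a compact subset of `(0,T)`. -/
structure IsTest (T : ℝ) (φ : SpaceTime → ℝ) : Prop where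
  smooth : ContDiff ℝ (⊤ : ℕ∞) φ
  periodic : ∀ (i : Fin 3) (t : ℝ) (x : Space), φ (t, x + (2 : ℝ) • dir i) = φ (t, x)
  support : ∃ a b : ℝ, 0 < a ∧ b < T ∧ ∀ (t : ℝ) (x : Space), t ∉ Icc a b → φ (t, x) = 0

/-- The derivative of `φ` in the `i`-th spatial direction. -/
def pderiv (i : Fin 3) (φ : SpaceTime → ℝ) (p : SpaceTime) : ℝ := fderiv ℝ φ p (0, dir i)

/-- The derivative of `φ` in time. -/
def tderiv (φ : SpaceTime → ℝ) (p : SpaceTime) : ℝ := fderiv ℝ φ p (1, 0)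

/-- `v` is the weak derivative `∂ᵢ u` on `(0,T)` times the torus. -/
def HasWeakDeriv (T : ℝ) (i : Fin 3) (u v : SpaceTime → ℝ) : Prop :=
  ∀ φ, IsTest T φ → ∫ p in cyl T, u p * pderiv i φ p = - ∫ p in cyl T, v p * φ p

/-- `v` is the weak derivative `∂ₜ u` on `(0,T)` times the torus. -/
def HasWeakTimeDeriv (T : ℝ) (u v : SpaceTime → ℝ) : Prop :=
  ∀ φ, IsTest T φ → ∫ p in cyl T, u p * tderiv φ p = - ∫ p in cyl T, v p * φ p

/-- `v` is the weak derivative `∂_z u` on the open interval `z ∈ (-1,1)`: no periodicity in `z` is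
implied, since the test functions vanish near `z = ±1`. -/
def HasWeakDerivInterior (T : ℝ) (u v : SpaceTime → ℝ) : Prop :=
  ∀ φ, IsTest T φ →
    (∃ r < 1, ∀ (t z : ℝ) (w : ℝ × ℝ), r ≤ |z| → |z| ≤ 1 → φ (t, z, w) = 0) →
    ∫ p in cyl T, u p * pderiv 2 φ p = - ∫ p in cyl T, v p * φ p

/-- `v` is the weak derivative `∂_z u` on the torus, for time-independent `u`. -/
def HasWeakDerivSpace (u v : Space → ℝ) : Prop :=
  ∀ ψ : Space → ℝ, ContDiff ℝ (⊤ : ℕ∞) ψ →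
    (∀ (i : Fin 3) (x : Space), ψ (x + (2 : ℝ) • dir i) = ψ x) →
    ∫ x in box, u x * fderiv ℝ ψ x (dir 2) = - ∫ x in box, v x * ψ x

/-! ### The horizontal spaces `H¹_per(G)` and `H⁻¹_per(G)` -/

/-- Smooth functions on the horizontal plane that are `2`-periodic in both variables. -/
structure IsHorizTest (ψ : ℝ × ℝ → ℝ) : Prop where
  smooth : ContDiff ℝ (⊤ : ℕ∞) ψ
  periodic_x : ∀ w : ℝ × ℝ, ψ (w.1 + 2, w.2) = ψ w
  periodic_y : ∀ w : ℝ × ℝ, ψ (w.1, w.2 + 2) = ψ w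

theorem memLp_horiz {g : ℝ × ℝ → ℝ} (hg : Continuous g) :
    MemLp g 2 (volume.restrict horiz) := by
  have hc : IsCompact (Icc (-1 : ℝ) 1 ×ˢ Icc (-1 : ℝ) 1) := isCompact_Icc.prod isCompact_Icc
  have hsub : horiz ⊆ Icc (-1 : ℝ) 1 ×ˢ Icc (-1 : ℝ) 1 :=
    Set.prod_mono Ioo_subset_Icc_self Ioo_subset_Icc_self
  obtain ⟨M, hM⟩ := hc.exists_bound_of_continuousOn hg.continuousOn
  have hmeas : MeasurableSet horiz := measurableSet_Ioo.prod measurableSet_Ioo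
  have hfin : volume horiz < ∞ := (measure_mono hsub).trans_lt hc.measure_lt_top
  have : IsFiniteMeasure (volume.restrict horiz) := ⟨by simpa using hfin⟩
  exact MemLp.of_bound hg.aestronglyMeasurable M
    ((ae_restrict_iff' hmeas).2 (ae_of_all _ fun w hw => hM w (hsub hw)))

theorem IsHorizTest.continuous_fderiv {ψ : ℝ × ℝ → ℝ} (h : IsHorizTest ψ) (d : ℝ × ℝ) :
    Continuous fun w => fderiv ℝ ψ w d :=
  (h.smooth.continuous_fderiv (by simp)).clm_apply continuous_const

/-- Triples of functions in `L²(G)`, normed by the sum of squares. -/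
abbrev L2Triple := PiLp 2 fun _ : Fin 3 => Lp ℝ 2 (volume.restrict horiz)

/-- The triple `(ψ, ∂ₓψ, ∂_yψ)`. Its norm is the `H¹(G)`-norm of `ψ`. -/
def IsHorizTest.graph {ψ : ℝ × ℝ → ℝ} (h : IsHorizTest ψ) : L2Triple :=
  WithLp.toLp 2 ![(memLp_horiz h.smooth.continuous).toLp ψ,
    (memLp_horiz (h.continuous_fderiv (1, 0))).toLp _,
    (memLp_horiz (h.continuous_fderiv (0, 1))).toLp _]

/-- `H¹_per(G)`: the closure of the smooth periodic functions in the `H¹(G)`-norm, an element `u`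
being represented by the triple `(u, ∂ₓu, ∂_yu)`. -/
def H1 : Submodule ℝ L2Triple :=
  (Submodule.span ℝ {g | ∃ (ψ : ℝ × ℝ → ℝ) (h : IsHorizTest ψ), g = h.graph}).topologicalClosure

/-- A smooth periodic function as an element of `H¹_per(G)`. -/
def IsHorizTest.toH1 {ψ : ℝ × ℝ → ℝ} (h : IsHorizTest ψ) : H1 :=
  ⟨h.graph, Submodule.le_topologicalClosure _ (Submodule.subset_span ⟨ψ, h, rfl⟩)⟩

/-- `H⁻¹_per(G)`, the dual of `H¹_per(G)`, with the dual norm. -/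
abbrev Hneg1 := H1 →L[ℝ] ℝ

theorem IsTest.slice {T : ℝ} {φ : SpaceTime → ℝ} (h : IsTest T φ) (q : ℝ × ℝ) :
    IsHorizTest fun w => φ (q.1, q.2, w) where
  smooth := h.smooth.comp (by fun_prop)
  periodic_x w := by simpa [dir, Prod.add_def] using h.periodic 0 q.1 (q.2, w)
  periodic_y w := by simpa [dir, Prod.add_def] using h.periodic 1 q.1 (q.2, w)

/-- The action of a function `g` of `(t, z)` with values in `H⁻¹_per(G)` on a test function:
`∫₀ᵀ ∫₋₁¹ ⟨g(t,z), φ(t,·,·,z)⟩ dz dt`. -/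
def pairing {T : ℝ} (g : ℝ × ℝ → Hneg1) {φ : SpaceTime → ℝ} (h : IsTest T φ) : ℝ :=
  ∫ q in rect T, g q (h.slice q).toH1

/-- `gz` is the weak derivative `∂_z g`, for `z`-periodic functions with values in `H⁻¹_per(G)`. -/
def HasWeakDerivDual (T : ℝ) (g gz : ℝ × ℝ → Hneg1) : Prop :=
  ∀ χ : ℝ × ℝ → ℝ, ContDiff ℝ (⊤ : ℕ∞) χ → (∀ t z : ℝ, χ (t, z + 2) = χ (t, z)) →
    (∃ a b : ℝ, 0 < a ∧ b < T ∧ ∀ t z : ℝ, t ∉ Icc a b → χ (t, z) = 0) →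
    ∫ q in rect T, fderiv ℝ χ q (0, 1) • g q = - ∫ q in rect T, χ q • gz q

/-! ### The function spaces -/

/-- `U₀ ∈ H = H¹_z L²_xy` (periodic, with parities even, even, odd), with `U₀z = ∂_z U₀`. -/
structure MemH (U₀ U₀z : Fin 3 → Space → ℝ) : Prop where
  memLp : ∀ i, MemLp (U₀ i) 2 (volume.restrict box)
  memLp_z : ∀ i, MemLp (U₀z i) 2 (volume.restrict box)
  deriv_z : ∀ i, HasWeakDerivSpace (U₀ i) (U₀z i)
  parity : ∀ i, ∀ᵐ x ∂volume.restrict box, U₀ i (-x.1, x.2) = paritySign i * U₀ i x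

/-- `‖U₀‖²_H`. -/
def sqNormH (U₀ U₀z : Fin 3 → Space → ℝ) : ℝ≥0∞ :=
  ∫⁻ x in box, ENNReal.ofReal (∑ i, (U₀ i x ^ 2 + U₀z i x ^ 2))

/-- `f ∈ L²(0,T;V')`, `V' = H¹_z H⁻¹_xy` (periodic, with parities even, even, odd), with
`fz = ∂_z f`. -/
structure MemL2Vdual (T : ℝ) (f fz : Fin 3 → ℝ × ℝ → Hneg1) : Prop where
  memLp : ∀ i, MemLp (f i) 2 (volume.restrict (rect T))
  memLp_z : ∀ i, MemLp (fz i) 2 (volume.restrict (rect T))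
  deriv_z : ∀ i, HasWeakDerivDual T (f i) (fz i)
  parity : ∀ i, ∀ᵐ q ∂volume.restrict (rect T), f i (q.1, -q.2) = paritySign i • f i q

/-- `‖f‖²_{L²(0,T;V')}`. -/
def sqNormL2Vdual (T : ℝ) (f fz : Fin 3 → ℝ × ℝ → Hneg1) : ℝ≥0∞ :=
  ∫⁻ q in rect T, ∑ i, (‖f i q‖ₑ ^ 2 + ‖fz i q‖ₑ ^ 2)

/-- `ω ∈ L²((0,T)×Ω)` is `z`-periodic and `∂_z ω ∈ L²(0,T;H¹_z L²_xy)` is `z`-periodic, with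
`ωz = ∂_z ω` and `ωzz = ∂_z² ω`. No parity is required. (If `ω` is odd and periodic in `z`, then
`ω ∈ L²` follows from `∂_z ω ∈ L²`.) -/
structure MemTransport (T : ℝ) (ω ωz ωzz : SpaceTime → ℝ) : Prop where
  memLp : MemLp ω 2 (volume.restrict (cyl T))
  memLp_z : MemLp ωz 2 (volume.restrict (cyl T))
  memLp_zz : MemLp ωzz 2 (volume.restrict (cyl T))
  deriv_z : HasWeakDeriv T 2 ω ωz
  deriv_zz : HasWeakDeriv T 2 ωz ωzz

/-- `‖∂_z ω‖²_{L²(0,T;H¹_z L²_xy)}`. -/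
def sqNormTransport (T : ℝ) (ωz ωzz : SpaceTime → ℝ) : ℝ≥0∞ :=
  ∫⁻ p in cyl T, ENNReal.ofReal (ωz p ^ 2 + ωzz p ^ 2)

/-- The square `‖g(t,·,·,z)‖²_{L⁴(G)}` for a vector field `g`. -/
def sqNormL4 (g : Fin 3 → SpaceTime → ℝ) (t z : ℝ) : ℝ≥0∞ :=
  (∫⁻ w in horiz, ENNReal.ofReal ((∑ i, g i (t, z, w) ^ 2) ^ 2)) ^ (1 / 2 : ℝ)

/-- `‖ν‖⁴_{L⁴(0,T;H²_z L⁴_xy)}`, with `νz = ∂_z ν` and `νzz = ∂_z² ν`. -/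
def normPowFourL4H2L4 (T : ℝ) (ν νz νzz : Fin 3 → SpaceTime → ℝ) : ℝ≥0∞ :=
  ∫⁻ t in Ioo 0 T,
    (∫⁻ z in Ioo (-1 : ℝ) 1, (sqNormL4 ν t z + sqNormL4 νz t z + sqNormL4 νzz t z)) ^ 2

/-- `ν ∈ L⁴(0,T;H²(-1,1;L⁴(G)))`, with `νz = ∂_z ν` and `νzz = ∂_z² ν`, and the third component of
`ν` is periodic in `z`. -/
structure MemL4H2L4 (T : ℝ) (ν νz νzz : Fin 3 → SpaceTime → ℝ) : Prop where
  meas : ∀ i, AEStronglyMeasurable (ν i) (volume.restrict (cyl T))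
  meas_z : ∀ i, AEStronglyMeasurable (νz i) (volume.restrict (cyl T))
  meas_zz : ∀ i, AEStronglyMeasurable (νzz i) (volume.restrict (cyl T))
  deriv_z : ∀ i, HasWeakDerivInterior T (ν i) (νz i)
  deriv_zz : ∀ i, HasWeakDerivInterior T (νz i) (νzz i)
  periodic : HasWeakDeriv T 2 (ν 2) (νz 2)
  finite : normPowFourL4H2L4 T ν νz νzz < ∞

/-- `U ∈ 𝔼₁(T) = L²(0,T;H²_per(Ω)) ∩ H¹(0,T;L²(Ω))` componentwise, with `Ut i = ∂ₜ Uᵢ`,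
`DU i j = ∂ⱼ Uᵢ` and `D2U i j k = ∂ₖ ∂ⱼ Uᵢ`. -/
structure MemE1 (T : ℝ) (U Ut : Fin 3 → SpaceTime → ℝ) (DU : Fin 3 → Fin 3 → SpaceTime → ℝ)
    (D2U : Fin 3 → Fin 3 → Fin 3 → SpaceTime → ℝ) : Prop where
  memLp : ∀ i, MemLp (U i) 2 (volume.restrict (cyl T))
  memLp_t : ∀ i, MemLp (Ut i) 2 (volume.restrict (cyl T))
  memLp_D : ∀ i j, MemLp (DU i j) 2 (volume.restrict (cyl T))
  memLp_D2 : ∀ i j k, MemLp (D2U i j k) 2 (volume.restrict (cyl T))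
  deriv_t : ∀ i, HasWeakTimeDeriv T (U i) (Ut i)
  deriv : ∀ i j, HasWeakDeriv T j (U i) (DU i j)
  deriv2 : ∀ i j k, HasWeakDeriv T k (DU i j) (D2U i j k)

/-- `‖U‖²_{L^∞(0,T;H)}`, the essential supremum over `t ∈ (0,T)` of `‖U(t)‖²_H`. -/
def sqNormLinftyH (T : ℝ) (U : Fin 3 → SpaceTime → ℝ) (DU : Fin 3 → Fin 3 → SpaceTime → ℝ) :
    ℝ≥0∞ :=
  essSup (fun t => sqNormH (fun i x => U i (t, x)) (fun i x => DU i 2 (t, x)))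
    (volume.restrict (Ioo 0 T))

/-- `‖U‖²_{L²(0,T;V)}` with `V = H¹_z H¹_xy`: the derivatives of order at most one in `z` and at
most one in `(x, y)`. -/
def sqNormL2V (T : ℝ) (U : Fin 3 → SpaceTime → ℝ) (DU : Fin 3 → Fin 3 → SpaceTime → ℝ)
    (D2U : Fin 3 → Fin 3 → Fin 3 → SpaceTime → ℝ) : ℝ≥0∞ :=
  ∫⁻ p in cyl T, ENNReal.ofReal (∑ i,
    (U i p ^ 2 + DU i 0 p ^ 2 + DU i 1 p ^ 2
      + DU i 2 p ^ 2 + D2U i 2 0 p ^ 2 + D2U i 2 1 p ^ 2))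

/-! ### The diffusion-transport system -/

/-- The coefficients of the scaled gradient `∇_ε = (∂ₓ, ∂_y, ε⁻¹ ∂_z)`. -/
def gradScale (ε : ℝ) : Fin 3 → ℝ := ![1, 1, ε⁻¹]

/-- `(U, P)` solves
`∂ₜU - Δ_δ U + ∂_z(ωU) + ∂_z(ε⁻¹ U₃ ν) + ∇_ε P = f`, `div_ε U = 0`, `U(0) = U₀`,
with `U = (U₁, U₂, U₃)` periodic and `U₁`, `U₂`, `P` even, `U₃` odd in `z`. Here `U ∈ 𝔼₁(T)` and `P`
is an integrable periodic function; since `f` takes values in a space of distributions, the first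
equation is understood in the sense of distributions on `(0,T)` times the torus. -/
structure IsSolution (T ε δ : ℝ) (ω : SpaceTime → ℝ) (ν : Fin 3 → SpaceTime → ℝ)
    (f : Fin 3 → ℝ × ℝ → Hneg1) (U₀ : Fin 3 → Space → ℝ)
    (U Ut : Fin 3 → SpaceTime → ℝ) (DU : Fin 3 → Fin 3 → SpaceTime → ℝ)
    (D2U : Fin 3 → Fin 3 → Fin 3 → SpaceTime → ℝ) (P : SpaceTime → ℝ) : Prop where
  memE1 : MemE1 T U Ut DU D2U
  pressure : IntegrableOn P (cyl T)
  momentum : ∀ (i : Fin 3) (φ : SpaceTime → ℝ) (h : IsTest T φ),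
    (∫ p in cyl T, (Ut i p - (D2U i 0 0 p + D2U i 1 1 p + δ * D2U i 2 2 p)) * φ p)
      - (∫ p in cyl T, (ω p * U i p) * pderiv 2 φ p)
      - (∫ p in cyl T, (ε⁻¹ * U 2 p * ν i p) * pderiv 2 φ p)
      - (∫ p in cyl T, P p * (gradScale ε i * pderiv i φ p))
      = pairing (f i) h
  div_free : ∀ᵐ p ∂volume.restrict (cyl T), ∑ i, gradScale ε i * DU i i p = 0
  initial : ∀ i, Tendsto (fun t => ∫⁻ x in box, ENNReal.ofReal ((U i (t, x) - U₀ i x) ^ 2))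
    (𝓝[>] 0 ⊓ ae volume) (𝓝 0)
  parity_U : ∀ i, ∀ᵐ p ∂volume.restrict (cyl T), U i (reflect p) = paritySign i * U i p
  parity_P : ∀ᵐ p ∂volume.restrict (cyl T), P (reflect p) = P p

end AnisoTransport

end

noncomputable section

namespace AnisoTransport

/-! ### The Hartley basis of `L²(-1,1)` -/

/-! The bound is the energy estimate for the test function `U - ∂_z²U`. Write `Y` for the square of
the norm of `U` in `H` and `E` for that of `∇_xy U`. Horizontal diffusion yields `E`; the part with
`δ` has a good sign and is dropped, which makes the constant independent of `δ`. The pressure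
disappears because `div_ε U = 0` and `1 - ∂_z²` acts in the same way on all components. The force
pairs `f` with `U` and `∂_z f` with `∂_z U`. Two nonlinear terms remain, and they have to be
controlled without vertical diffusion.

Transport by `ω`: integration by parts along vertical lines leaves only `∂_z ω` and `∂_z² ω`. On
each line the term is bounded by the `H¹_z` norm of `∂_z ω` times the square of the `H¹_z` norm of
`U` (`sq_integral_transport_le`). Cauchy-Schwarz over `G` and Ladyzhenskaya's inequality for
functions with values in `L²_z` (`lintegral_vert_sq_le`) turn this into `‖∂_z ω‖ (Y (Y + E))^(1/2)`.

The term with `ν`: incompressibility gives `ε⁻¹ ∂_z U₃ = -(∂_x U₁ + ∂_y U₂)`. The odd function `ε⁻¹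
U₃` vanishes on `z = 0` and `z = ±1`, so it is bounded through `E` uniformly in `ε`. The jump of `ν`
between `z = -1` and `z = 1` would produce boundary terms. Subtracting a function linear in `z`
removes it: for the even components the subtracted part contributes nothing by parity, and `ν₃` has
no jump (`sq_integral_vertical_le`). The result is `E^(1/2) ‖ν‖ (Y (Y + E))^(1/4)`. Young's
inequality then leaves `E/2` plus a multiple of `(1 + ‖∂_z ω‖² + ‖ν‖⁴) Y` (`Slice.energy_le`), and
Gronwall's inequality finishes.

To make this rigorous, `-∂_z²` is replaced by `D_h^* D_h` with the periodic difference quotient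
`D_h`, and all bounds are uniform in `h`. Equations are read off as relations between real Fourier
coefficients at almost every time (`IsSolution.slice`). The pressure is only integrable, so it is
cancelled on finite sums of modes, before any limit (`Slice.sum_pressure`). Each coefficient of `U`
is absolutely continuous in time; its square is integrated in time, the squares are summed against
the bounded multiplier of `1 + D_h^* D_h`, and then `h` tends to `0` (`energy_le_of_coeff`). Thus no
continuity of `U` in time with values in `H` has to be known beforehand. -/

/-- The `k`-th Hartley mode `(cos (πks) + sin (πks)) / √2`. These functions form an orthonormal
basis of `L²(-1,1)`, and `e_k' = πk e_{-k}`. -/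
def mode (k : ℤ) (s : ℝ) : ℝ :=
  (Real.cos (Real.pi * k * s) + Real.sin (Real.pi * k * s)) / √2

theorem mode_contDiff (k : ℤ) {n : WithTop ℕ∞} : ContDiff ℝ n (mode k) := by
  unfold mode
  fun_prop

theorem mode_continuous (k : ℤ) : Continuous (mode k) := (mode_contDiff k (n := 0)).continuous

theorem sqrt_two_mul_self : (√2 : ℝ) * √2 = 2 := Real.mul_self_sqrt (by norm_num)

theorem mode_abs_le (k : ℤ) (s : ℝ) : |mode k s| ≤ 2 := by
  have h2 : (1 : ℝ) ≤ √2 := Real.one_le_sqrt.2 (by norm_num)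
  unfold mode
  rw [abs_div, abs_of_pos (by linarith : (0 : ℝ) < √2), div_le_iff₀ (by linarith)]
  have h3 := abs_add_le (Real.cos (Real.pi * k * s)) (Real.sin (Real.pi * k * s))
  have := Real.abs_cos_le_one (Real.pi * k * s)
  have := Real.abs_sin_le_one (Real.pi * k * s)
  linarith

theorem mode_hasDerivAt (k : ℤ) (s : ℝ) :
    HasDerivAt (mode k) (Real.pi * k * mode (-k) s) s := by
  have h1 : HasDerivAt (fun s : ℝ => Real.pi * k * s) (Real.pi * k) s := by
    simpa using (hasDerivAt_id s).const_mul (Real.pi * k)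
  have h2 := (h1.cos.add h1.sin).div_const √2
  refine h2.congr_deriv ?_
  unfold mode
  push_cast
  rw [show Real.pi * -(k : ℝ) * s = -(Real.pi * k * s) by ring, Real.cos_neg, Real.sin_neg]
  ring

theorem mode_deriv (k : ℤ) (s : ℝ) : deriv (mode k) s = Real.pi * k * mode (-k) s :=
  (mode_hasDerivAt k s).deriv

/-- A translation rotates the pair of modes `k`, `-k`. This gives periodicity, and it makes the sum
of the two translations by `±h` a Fourier multiplier. -/
theorem mode_add (k : ℤ) (s h : ℝ) :
    mode k (s + h) = Real.cos (Real.pi * k * h) * mode k s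
      + Real.sin (Real.pi * k * h) * mode (-k) s := by
  unfold mode
  push_cast
  rw [mul_add, Real.cos_add, Real.sin_add,
    show Real.pi * -(k : ℝ) * s = -(Real.pi * k * s) by ring, Real.cos_neg, Real.sin_neg]
  ring

theorem mode_periodic (k : ℤ) (s : ℝ) : mode k (s + 2) = mode k s := by
  rw [mode_add]
  have h1 : Real.pi * k * 2 = k * (2 * Real.pi) := by ring
  rw [h1, Real.cos_int_mul_two_pi]
  have h2 : Real.sin (k * (2 * Real.pi)) = 0 := by
    have := Real.sin_int_mul_pi (2 * k)
    push_cast at this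
    rw [← this]
    ring_nf
  rw [h2]
  ring

theorem mode_zero (s : ℝ) : mode 0 s = 1 / √2 := by simp [mode]

theorem integral_mode (k : ℤ) (hk : k ≠ 0) : ∫ s in (-1 : ℝ)..1, mode k s = 0 := by
  have h1 : ∀ s ∈ uIcc (-1 : ℝ) 1, HasDerivAt (fun s => -mode (-k) s / (Real.pi * k)) (mode k s) s := by
    intro s _
    have := ((mode_hasDerivAt (-k) s).neg).div_const (Real.pi * k)
    refine this.congr_deriv ?_
    have hk' : (k : ℝ) ≠ 0 := by exact_mod_cast hk
    have := Real.pi_ne_zero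
    rw [neg_neg]
    push_cast
    field_simp
  rw [intervalIntegral.integral_eq_sub_of_hasDerivAt h1
    ((mode_continuous k).intervalIntegrable _ _)]
  have := mode_periodic (-k) (-1)
  norm_num at this
  rw [this]
  ring

theorem mode_mul (k l : ℤ) (s : ℝ) :
    mode k s * mode l s = (mode (k - l) s + mode (-(k - l)) s + mode (k + l) s
      - mode (-(k + l)) s) / (2 * √2) := by
  unfold mode
  push_cast
  have h2 := sqrt_two_mul_self
  have e1 : Real.pi * ((k : ℝ) - l) * s = Real.pi * k * s - Real.pi * l * s := by ring
  have e2 : Real.pi * ((k : ℝ) + l) * s = Real.pi * k * s + Real.pi * l * s := by ring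
  have e3 : Real.pi * (-((k : ℝ) - l)) * s = -(Real.pi * k * s - Real.pi * l * s) := by ring
  have e4 : Real.pi * (-((k : ℝ) + l)) * s = -(Real.pi * k * s + Real.pi * l * s) := by ring
  rw [e1, e2, e3, e4]
  simp only [Real.cos_neg, Real.sin_neg, Real.cos_sub, Real.sin_sub, Real.cos_add, Real.sin_add]
  have : (√2 : ℝ) ≠ 0 := by positivity
  field_simp
  ring

theorem integral_mode_mul (k l : ℤ) :
    ∫ s in (-1 : ℝ)..1, mode k s * mode l s = if k = l then 1 else 0 := by
  simp_rw [mode_mul]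
  have hi : ∀ j, IntervalIntegrable (mode j) volume (-1) 1 := fun j =>
    (mode_continuous j).intervalIntegrable _ _
  rw [intervalIntegral.integral_div, intervalIntegral.integral_sub (((hi _).add (hi _)).add (hi _)) (hi _),
    intervalIntegral.integral_add ((hi _).add (hi _)) (hi _),
    intervalIntegral.integral_add (hi _) (hi _)]
  have h0 : ∫ s in (-1 : ℝ)..1, mode 0 s = √2 := by
    simp only [mode_zero, intervalIntegral.integral_const, smul_eq_mul]
    have := sqrt_two_mul_self
    have : (√2 : ℝ) ≠ 0 := by positivity
    field_simp
    nlinarith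
  -- Modes come in pairs `j`, `-j` with equal integrals, also for `j = 0`. The pair `±(k + l)`
  -- enters the product formula with opposite signs, so it cancels without a case distinction.
  have hs : ∀ j : ℤ, (∫ s in (-1 : ℝ)..1, mode j s) - ∫ s in (-1 : ℝ)..1, mode (-j) s = 0 := by
    intro j
    by_cases hj : j = 0
    · simp [hj]
    · rw [integral_mode j hj, integral_mode (-j) (by simpa using hj), sub_zero]
  have hsq : (√2 : ℝ) ≠ 0 := by positivity
  have := hs (k + l)
  split_ifs with h
  · subst h
    simp only [sub_self, neg_zero, h0]
    field_simp
    linarith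
  · rw [integral_mode (k - l) (by omega), integral_mode (-(k - l)) (by omega)]
    field_simp
    linarith

/-! ### Families that separate integrable functions -/

/-- The family `a` separates the integrable functions. -/
def Separates {X ι : Type*} [MeasurableSpace X] (μ : Measure X) (a : ι → X → ℝ) : Prop :=
  ∀ g : X → ℝ, Integrable g μ → (∀ k, ∫ x, g x * a k x ∂μ = 0) → g =ᵐ[μ] 0

theorem integrable_mul_of_bound {X : Type*} [MeasurableSpace X] {μ : Measure X} {g b : X → ℝ}
    (hg : Integrable g μ) (hb : AEStronglyMeasurable b μ) {M : ℝ} (hM : ∀ x, |b x| ≤ M) :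
    Integrable (fun x => g x * b x) μ :=
  hg.mul_bdd hb (ae_of_all _ hM)

theorem ae_eq_zero_of_ae_ae {X Y : Type*} [MeasurableSpace X] [MeasurableSpace Y]
    {μ : Measure X} {ν : Measure Y} [SFinite μ] [SFinite ν] {g : X × Y → ℝ}
    (hg : AEStronglyMeasurable g (μ.prod ν)) (h : ∀ᵐ x ∂μ, ∀ᵐ y ∂ν, g (x, y) = 0) :
    g =ᵐ[μ.prod ν] 0 := by
  refine hg.ae_eq_mk.trans ?_
  refine (Measure.ae_prod_iff_ae_ae
    (measurableSet_eq_fun hg.stronglyMeasurable_mk.measurable measurable_const)).2 ?_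
  filter_upwards [h, Measure.ae_ae_of_ae_prod hg.ae_eq_mk] with x hx hx'
  filter_upwards [hx, hx'] with y hy hy'
  rw [← hy', hy]
  rfl

/-- Fubini: for fixed `l` the function `x ↦ ∫ g(x, y) b_l(y) dy` is annihilated by every `a_k`,
hence vanishes almost everywhere. Countability gives one null set for all `l`, and off it `b`
separates on the fibre. -/
theorem Separates.prod {X Y ι κ : Type*} [MeasurableSpace X] [MeasurableSpace Y] [Countable ι]
    [Countable κ] {μ : Measure X} {ν : Measure Y} [SFinite μ] [SFinite ν]
    {a : ι → X → ℝ} {b : κ → Y → ℝ} (ha : Separates μ a) (hb : Separates ν b)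
    (ham : ∀ k, Measurable (a k)) (hbm : ∀ l, Measurable (b l)) {M : ℝ}
    (haM : ∀ k x, |a k x| ≤ M) (hbM : ∀ l y, |b l y| ≤ M) :
    Separates (μ.prod ν) fun (k : ι × κ) (p : X × Y) => a k.1 p.1 * b k.2 p.2 := by
  intro g hg h0
  have hgl : ∀ l, Integrable (fun p : X × Y => g p * b l p.2) (μ.prod ν) := fun l =>
    integrable_mul_of_bound hg ((hbm l).comp measurable_snd).aestronglyMeasurable
      (fun p => hbM l p.2)
  have h1 : ∀ l, ∀ᵐ x ∂μ, ∫ y, g (x, y) * b l y ∂ν = 0 := by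
    intro l
    refine ha (fun x => ∫ y, g (x, y) * b l y ∂ν) (hgl l).integral_prod_left fun k => ?_
    have h2 := h0 (k, l)
    rw [integral_prod] at h2
    · rw [← h2]
      refine integral_congr_ae (ae_of_all _ fun x => ?_)
      simp only
      rw [← integral_mul_const]
      refine integral_congr_ae (ae_of_all _ fun y => ?_)
      simp only
      ring
    · have := integrable_mul_of_bound (hgl l) ((ham k).comp measurable_fst).aestronglyMeasurable
        (fun p => haM k p.1)
      refine this.congr (ae_of_all _ fun p => ?_)
      simp only [Function.comp]
      ring
  have h3 : ∀ᵐ x ∂μ, ∀ᵐ y ∂ν, g (x, y) = 0 := by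
    filter_upwards [ae_all_iff.2 h1, hg.prod_right_ae] with x hx hgx
    exact hb _ hgx hx
  exact ae_eq_zero_of_ae_ae hg.1 h3

/-- Trigonometric polynomials are uniformly dense in the continuous functions on the circle, and `F
↦ ∫ F g` is continuous in the uniform norm because `g` is integrable. So `g` annihilates all
continuous periodic functions, in particular all test functions on `(-1,1)`. -/
theorem separates_mode : Separates (volume.restrict (Ioo (-1 : ℝ) 1)) mode := by
  intro g hg h0
  have : Fact (0 < (2 : ℝ)) := ⟨by norm_num⟩
  have hcs : ∀ k : ℤ, ∫ s in Ioo (-1 : ℝ) 1, g s * Real.cos (Real.pi * k * s) = 0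
      ∧ ∫ s in Ioo (-1 : ℝ) 1, g s * Real.sin (Real.pi * k * s) = 0 := by
    intro k
    have hi : ∀ j, Integrable (fun s => g s * mode j s) (volume.restrict (Ioo (-1 : ℝ) 1)) :=
      fun j => integrable_mul_of_bound hg (mode_continuous j).aestronglyMeasurable (mode_abs_le j)
    have h2 : (√2 : ℝ) ≠ 0 := by positivity
    have hsq := sqrt_two_mul_self
    have e3 : ∀ s, Real.pi * (-(k : ℝ)) * s = -(Real.pi * k * s) := fun s => by ring
    constructor
    · have : ∀ s, g s * Real.cos (Real.pi * k * s)
          = (g s * mode k s + g s * mode (-k) s) * (√2 / 2) := by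
        intro s
        unfold mode
        push_cast
        rw [e3, Real.cos_neg, Real.sin_neg]
        field_simp
        ring
      simp_rw [this]
      rw [integral_mul_const, integral_add (hi _) (hi _), h0, h0]
      simp
    · have : ∀ s, g s * Real.sin (Real.pi * k * s)
          = (g s * mode k s - g s * mode (-k) s) * (√2 / 2) := by
        intro s
        unfold mode
        push_cast
        rw [e3, Real.cos_neg, Real.sin_neg]
        field_simp
        ring
      simp_rw [this]
      rw [integral_mul_const, integral_sub (hi _) (hi _), h0, h0]
      simp
  have hint : ∀ F : C(AddCircle (2 : ℝ), ℂ), Integrable (fun s : ℝ => F (s : AddCircle (2 : ℝ)) * (g s : ℂ))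
      (volume.restrict (Ioo (-1 : ℝ) 1)) := by
    intro F
    refine (hg.ofReal (𝕜 := ℂ)).bdd_mul (c := ‖F‖) ?_ (ae_of_all _ fun s => F.norm_coe_le_norm _)
    exact (F.continuous.comp (AddCircle.continuous_mk' 2)).aestronglyMeasurable
  let L₀ : C(AddCircle (2 : ℝ), ℂ) →ₗ[ℂ] ℂ :=
    { toFun := fun F => ∫ s in Ioo (-1 : ℝ) 1, F (s : AddCircle (2 : ℝ)) * (g s : ℂ)
      map_add' := fun F G => by
        rw [← integral_add (hint F) (hint G)]
        simp [add_mul]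
      map_smul' := fun c F => by
        simp [mul_assoc, integral_const_mul] }
  let L := L₀.mkContinuous (∫ s in Ioo (-1 : ℝ) 1, ‖(g s : ℂ)‖) (by
    intro F
    rw [mul_comm, ← integral_const_mul]
    refine norm_integral_le_of_norm_le ?_ (ae_of_all _ fun s => ?_)
    · exact ((hg.ofReal (𝕜 := ℂ)).norm).const_mul _
    · rw [norm_mul]
      gcongr
      exact F.norm_coe_le_norm _)
  have hker : (⊤ : Submodule ℂ C(AddCircle (2 : ℝ), ℂ)) ≤ LinearMap.ker (L : C(AddCircle (2 : ℝ), ℂ) →ₗ[ℂ] ℂ) := by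
    rw [← span_fourier_closure_eq_top (T := 2)]
    refine Submodule.topologicalClosure_minimal _ ?_ L.isClosed_ker
    rw [Submodule.span_le]
    rintro _ ⟨k, rfl⟩
    change ∫ s in Ioo (-1 : ℝ) 1, fourier k (s : AddCircle (2 : ℝ)) * (g s : ℂ) = 0
    have : ∀ s : ℝ, fourier k (s : AddCircle (2 : ℝ)) * (g s : ℂ)
        = ((g s * Real.cos (Real.pi * k * s) : ℝ) : ℂ)
          + Complex.I * ((g s * Real.sin (Real.pi * k * s) : ℝ) : ℂ) := by
      intro s
      rw [fourier_coe_apply, show 2 * (Real.pi : ℂ) * Complex.I * k * s / (2 : ℝ)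
        = ((Real.pi * k * s : ℝ) : ℂ) * Complex.I by push_cast; ring, Complex.exp_mul_I]
      push_cast
      ring
    simp_rw [this]
    have hc := hcs k
    rw [integral_add, integral_const_mul, integral_complex_ofReal, integral_complex_ofReal, hc.1, hc.2]
    · simp
    · refine (integrable_mul_of_bound hg (Continuous.aestronglyMeasurable (by fun_prop)) (M := 1)
        fun s => Real.abs_cos_le_one _).ofReal
    · refine (integrable_mul_of_bound hg (Continuous.aestronglyMeasurable (by fun_prop)) (M := 1)
        fun s => Real.abs_sin_le_one _).ofReal.const_mul _
  have key := isOpen_Ioo.ae_eq_zero_of_integral_contDiff_smul_eq_zero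
    (f := g) (U := Ioo (-1 : ℝ) 1) (μ := volume) (IntegrableOn.locallyIntegrableOn hg) (by
      intro η hη hηc hηs
      have hz : ∀ s, s ∉ Ioo (-1 : ℝ) 1 → η s = 0 := fun s hs =>
        image_eq_zero_of_notMem_tsupport fun h => hs (hηs h)
      -- A test function vanishes at both ends of the period and therefore descends to a continuous
      -- function on the circle.
      let φ : C(AddCircle (2 : ℝ), ℂ) := ⟨AddCircle.liftIco 2 (-1) (fun s => (η s : ℂ)),
        AddCircle.liftIco_continuous (by rw [hz (-1) (by simp), hz (-1 + 2) (by norm_num)])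
          (by have := hη.continuous; fun_prop)⟩
      have h1 : L φ = 0 := hker (Submodule.mem_top (x := φ))
      have h2 : L φ = ((∫ s in Ioo (-1 : ℝ) 1, η s * g s : ℝ) : ℂ) := by
        rw [← integral_complex_ofReal]
        change ∫ s in Ioo (-1 : ℝ) 1, φ (s : AddCircle (2 : ℝ)) * (g s : ℂ) = _
        refine setIntegral_congr_fun measurableSet_Ioo fun s hs => ?_
        have : φ (s : AddCircle (2 : ℝ)) = (η s : ℂ) :=
          AddCircle.liftIco_coe_apply (p := 2) (a := -1) (f := fun s => (η s : ℂ))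
            ⟨hs.1.le, by linarith [hs.2]⟩
        simp only [this]
        norm_cast
      rw [h1] at h2
      have h3 : ∫ s in Ioo (-1 : ℝ) 1, η s * g s = 0 := by exact_mod_cast h2.symm
      rw [← h3]
      simp only [smul_eq_mul]
      rw [setIntegral_eq_integral_of_forall_compl_eq_zero]
      intro s hs
      rw [hz s hs, zero_mul])
  rw [Filter.EventuallyEq, ae_restrict_iff' measurableSet_Ioo]
  exact key

/-! ### Parseval's identity on the box -/

/-- On a finite measure space an `L²` function orthogonal to the family is integrable, hence zero by
separation. A bounded orthonormal separating family is therefore a Hilbert basis, and this is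
Parseval's identity. -/
theorem hasSum_coeff_mul {X ι : Type*} [MeasurableSpace X] [DecidableEq ι] {μ : Measure X} [IsFiniteMeasure μ]
    {a : ι → X → ℝ} (ham : ∀ k, Measurable (a k)) {M : ℝ} (haM : ∀ k x, |a k x| ≤ M)
    (hon : ∀ k l, ∫ x, a k x * a l x ∂μ = if k = l then 1 else 0) (hs : Separates μ a)
    {g h : X → ℝ} (hg : MemLp g 2 μ) (hh : MemLp h 2 μ) :
    HasSum (fun k => (∫ x, g x * a k x ∂μ) * ∫ x, h x * a k x ∂μ) (∫ x, g x * h x ∂μ) := by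
  have hmem : ∀ k, MemLp (a k) 2 μ := fun k =>
    MemLp.of_bound (ham k).aestronglyMeasurable M (ae_of_all _ fun x => haM k x)
  let v : ι → Lp ℝ 2 μ := fun k => (hmem k).toLp (a k)
  have hinner : ∀ {u w : X → ℝ} (hu : MemLp u 2 μ) (hw : MemLp w 2 μ),
      inner ℝ (hu.toLp u) (hw.toLp w) = ∫ x, u x * w x ∂μ := by
    intro u w hu hw
    rw [L2.inner_def]
    refine integral_congr_ae ?_
    filter_upwards [hu.coeFn_toLp, hw.coeFn_toLp] with x h1 h2
    rw [h1, h2]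
    simp [mul_comm]
  have hv : Orthonormal ℝ v := by
    rw [orthonormal_iff_ite]
    intro k l
    rw [hinner, hon]
  have hbot : (Submodule.span ℝ (range v))ᗮ = ⊥ := by
    rw [Submodule.eq_bot_iff]
    intro w hw
    have h0 : ∀ k, ∫ x, w x * a k x ∂μ = 0 := by
      intro k
      have h1 : inner ℝ (v k) w = 0 := hw _ (Submodule.subset_span ⟨k, rfl⟩)
      rw [← h1, L2.inner_def]
      refine integral_congr_ae ?_
      filter_upwards [(hmem k).coeFn_toLp] with x hx
      simp [v, hx]
    have h2 := hs w ((Lp.memLp w).integrable (by norm_num)) h0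
    exact (Lp.eq_zero_iff_ae_eq_zero).2 h2
  let b := HilbertBasis.mkOfOrthogonalEqBot hv hbot
  have hb : ∀ k, b k = v k := fun k => by simp [b]
  have h1 := b.hasSum_inner_mul_inner (hg.toLp g) (hh.toLp h)
  rw [hinner] at h1
  have h2 : (fun k => (∫ x, g x * a k x ∂μ) * ∫ x, h x * a k x ∂μ)
      = fun k => inner ℝ (hg.toLp g) (b k) * inner ℝ (b k) (hh.toLp h) := by
    funext k
    rw [hb, hinner, hinner]
    congr 1
    exact integral_congr_ae (ae_of_all _ fun x => mul_comm _ _)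
  rw [h2]
  exact h1

/-- The normalized measure spaces `(-1,1)`, `G`, `Ω`. -/
abbrev volI : Measure ℝ := volume.restrict (Ioo (-1 : ℝ) 1)

abbrev volG : Measure (ℝ × ℝ) := volume.restrict horiz

abbrev volBox : Measure Space := volume.restrict box

theorem volG_eq : volG = volI.prod volI := by
  rw [Measure.prod_restrict]
  rfl

theorem volBox_eq : volBox = volI.prod volG := by
  rw [Measure.prod_restrict]
  rfl

instance : IsFiniteMeasure volI := ⟨by simp⟩

instance : IsFiniteMeasure volG := by rw [volG_eq]; infer_instance

instance : IsFiniteMeasure volBox := by rw [volBox_eq]; infer_instance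

theorem integral_volI (g : ℝ → ℝ) : ∫ s, g s ∂volI = ∫ s in (-1 : ℝ)..1, g s := by
  rw [intervalIntegral.integral_of_le (by norm_num), integral_Ioc_eq_integral_Ioo]

/-- The indices of the modes on the torus. -/
abbrev Freq := ℤ × ℤ × ℤ

/-- The modes in the horizontal variables. -/
def modeG (l : ℤ × ℤ) (w : ℝ × ℝ) : ℝ := mode l.1 w.1 * mode l.2 w.2

/-- The modes in all spatial variables. -/
def modeBox (k : Freq) (x : Space) : ℝ := mode k.1 x.1 * modeG k.2 x.2

theorem modeG_contDiff (l : ℤ × ℤ) {n : WithTop ℕ∞} : ContDiff ℝ n (modeG l) :=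
  ((mode_contDiff l.1).comp contDiff_fst).mul ((mode_contDiff l.2).comp contDiff_snd)

theorem modeBox_contDiff (k : Freq) {n : WithTop ℕ∞} : ContDiff ℝ n (modeBox k) :=
  ((mode_contDiff k.1).comp contDiff_fst).mul ((modeG_contDiff k.2).comp contDiff_snd)

theorem modeG_abs_le (l : ℤ × ℤ) (w : ℝ × ℝ) : |modeG l w| ≤ 8 := by
  have := mul_le_mul (mode_abs_le l.1 w.1) (mode_abs_le l.2 w.2) (abs_nonneg _) (by norm_num)
  rw [modeG, abs_mul]
  linarith

theorem modeBox_abs_le (k : Freq) (x : Space) : |modeBox k x| ≤ 16 := by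
  have := mul_le_mul (mode_abs_le k.1 x.1) (modeG_abs_le k.2 x.2) (abs_nonneg _) (by norm_num)
  rw [modeBox, abs_mul]
  linarith

theorem separates_modeG : Separates volG modeG := by
  rw [volG_eq]
  exact separates_mode.prod separates_mode (fun k => (mode_continuous k).measurable)
    (fun k => (mode_continuous k).measurable) mode_abs_le mode_abs_le

theorem separates_modeBox : Separates volBox modeBox := by
  rw [volBox_eq]
  exact separates_mode.prod separates_modeG (fun k => (mode_continuous k).measurable)
    (fun k => (modeG_contDiff k (n := 0)).continuous.measurable)
    (fun k s => (mode_abs_le k s).trans (by norm_num : (2 : ℝ) ≤ 8)) modeG_abs_le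

theorem integral_modeG_mul (k l : ℤ × ℤ) :
    ∫ w, modeG k w * modeG l w ∂volG = if k = l then 1 else 0 := by
  have h1 : ∀ w : ℝ × ℝ, modeG k w * modeG l w
      = (mode k.1 w.1 * mode l.1 w.1) * (mode k.2 w.2 * mode l.2 w.2) := by
    intro w
    unfold modeG
    ring
  simp_rw [h1]
  rw [volG_eq, integral_prod_mul (fun s => mode k.1 s * mode l.1 s) (fun s => mode k.2 s * mode l.2 s),
    integral_volI, integral_volI, integral_mode_mul, integral_mode_mul]
  obtain ⟨k1, k2⟩ := k
  obtain ⟨l1, l2⟩ := l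
  simp only [Prod.mk.injEq]
  split_ifs <;> simp_all

theorem integral_modeBox_mul (k l : Freq) :
    ∫ x, modeBox k x * modeBox l x ∂volBox = if k = l then 1 else 0 := by
  have h1 : ∀ x : Space, modeBox k x * modeBox l x
      = (mode k.1 x.1 * mode l.1 x.1) * (modeG k.2 x.2 * modeG l.2 x.2) := by
    intro w
    unfold modeBox
    ring
  simp_rw [h1]
  rw [volBox_eq, integral_prod_mul (fun s => mode k.1 s * mode l.1 s)
    (fun w => modeG k.2 w * modeG l.2 w), integral_volI, integral_mode_mul, integral_modeG_mul]
  obtain ⟨k1, k2⟩ := k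
  obtain ⟨l1, l2⟩ := l
  simp only [Prod.mk.injEq]
  split_ifs <;> simp_all

/-- The coefficients of a function on the box. -/
def coeff (g : Space → ℝ) (k : Freq) : ℝ := ∫ x, g x * modeBox k x ∂volBox

theorem hasSum_coeff {g h : Space → ℝ} (hg : MemLp g 2 volBox) (hh : MemLp h 2 volBox) :
    HasSum (fun k => coeff g k * coeff h k) (∫ x, g x * h x ∂volBox) :=
  hasSum_coeff_mul (fun k => (modeBox_contDiff k (n := 0)).continuous.measurable) modeBox_abs_le
    integral_modeBox_mul separates_modeBox hg hh

theorem hasSum_coeff_sq {g : Space → ℝ} (hg : MemLp g 2 volBox) :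
    HasSum (fun k => coeff g k ^ 2) (∫ x, g x ^ 2 ∂volBox) := by
  simpa only [sq] using hasSum_coeff hg hg

theorem modeBox_aesm (k : Freq) (μ : Measure Space) : AEStronglyMeasurable (modeBox k) μ :=
  (modeBox_contDiff k (n := 0)).continuous.aestronglyMeasurable

theorem coeff_add {g h : Space → ℝ} (hg : Integrable g volBox) (hh : Integrable h volBox)
    (k : Freq) : coeff (fun x => g x + h x) k = coeff g k + coeff h k := by
  unfold coeff
  rw [← integral_add (integrable_mul_of_bound hg (modeBox_aesm k _) (modeBox_abs_le k))
    (integrable_mul_of_bound hh (modeBox_aesm k _) (modeBox_abs_le k))]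
  simp only [add_mul]

theorem coeff_const_mul (c : ℝ) (g : Space → ℝ) (k : Freq) :
    coeff (fun x => c * g x) k = c * coeff g k := by
  unfold coeff
  rw [← integral_const_mul]
  simp only [mul_assoc]

theorem coeff_sub {g h : Space → ℝ} (hg : Integrable g volBox) (hh : Integrable h volBox)
    (k : Freq) : coeff (fun x => g x - h x) k = coeff g k - coeff h k := by
  unfold coeff
  rw [← integral_sub (integrable_mul_of_bound hg (modeBox_aesm k _) (modeBox_abs_le k))
    (integrable_mul_of_bound hh (modeBox_aesm k _) (modeBox_abs_le k))]
  simp only [sub_mul]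

theorem coeff_congr {g h : Space → ℝ} (hgh : g =ᵐ[volBox] h) (k : Freq) :
    coeff g k = coeff h k :=
  integral_congr_ae (hgh.mono fun x hx => by simp only [hx])

theorem ae_eq_of_coeff_eq {g h : Space → ℝ} (hg : Integrable g volBox) (hh : Integrable h volBox)
    (h0 : ∀ k, coeff g k = coeff h k) : g =ᵐ[volBox] h := by
  have h1 := separates_modeBox (fun x => g x - h x) (hg.sub hh) fun k => by
    have := coeff_sub hg hh k
    rw [h0, sub_self] at this
    exact this
  filter_upwards [h1] with x hx
  exact sub_eq_zero.1 hx

/-- The sum `∑ c_k E_k` over a finite set of modes. -/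
def trigSum (F : Finset Freq) (c : Freq → ℝ) (x : Space) : ℝ := ∑ k ∈ F, c k * modeBox k x

theorem memLp_modeBox (k : Freq) : MemLp (modeBox k) 2 volBox :=
  MemLp.of_bound (modeBox_aesm k _) 16 (ae_of_all _ fun x => modeBox_abs_le k x)

theorem memLp_trigSum (F : Finset Freq) (c : Freq → ℝ) : MemLp (trigSum F c) 2 volBox :=
  memLp_finsetSum F fun k _ => (memLp_modeBox k).const_mul (c k)

theorem coeff_trigSum (F : Finset Freq) (c : Freq → ℝ) (k : Freq) :
    coeff (trigSum F c) k = if k ∈ F then c k else 0 := by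
  have h1 : coeff (trigSum F c) k
      = ∑ l ∈ F, c l * ∫ x, modeBox l x * modeBox k x ∂volBox := by
    unfold coeff trigSum
    simp_rw [Finset.sum_mul]
    rw [integral_finsetSum]
    · simp_rw [mul_assoc, integral_const_mul]
    · intro l _
      have := (((memLp_modeBox l).integrable (by norm_num)).const_mul (c l))
      exact integrable_mul_of_bound this (modeBox_aesm k _) (modeBox_abs_le k)
  rw [h1]
  simp_rw [integral_modeBox_mul]
  simp

theorem coeff_sub_trigSum {g : Space → ℝ} (hg : MemLp g 2 volBox) (F : Finset Freq) (k : Freq) :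
    coeff (fun x => g x - trigSum F (coeff g) x) k = if k ∈ F then 0 else coeff g k := by
  rw [coeff_sub (hg.integrable (by norm_num)) ((memLp_trigSum _ _).integrable (by norm_num)),
    coeff_trigSum]
  split_ifs <;> simp

/-! ### Absolutely continuous functions of one variable -/

theorem intervalIntegrable_of_volI {f : ℝ → ℝ} (hf : Integrable f volI) :
    IntervalIntegrable f volume (-1) 1 := by
  rw [intervalIntegrable_iff_integrableOn_Ioo_of_le (by norm_num)]
  exact hf

theorem volI_ae_of {p : ℝ → Prop} (h : ∀ s ∈ Ioo (-1 : ℝ) 1, p s) : ∀ᵐ s ∂volI, p s :=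
  (ae_restrict_iff' measurableSet_Ioo).2 (ae_of_all _ h)

/-- The product rule for absolutely continuous functions, in integrated form. -/
theorem integral_product_rule {f g f' g' : ℝ → ℝ} {a b : ℝ} (hab : a ≤ b)
    (hf' : IntervalIntegrable f' volume a b) (hg' : IntervalIntegrable g' volume a b)
    (hf : ∀ x ∈ Icc a b, f x = f a + ∫ s in a..x, f' s)
    (hg : ∀ x ∈ Icc a b, g x = g a + ∫ s in a..x, g' s) :
    ∫ x in a..b, (f' x * g x + f x * g' x) = f b * g b - f a * g a := by
  -- The functions are prescribed on `[a,b]` only. Their primitives are defined everywhere, are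
  -- absolutely continuous on `[a,b]` and agree with them there, so the product rule is applied to
  -- the primitives.
  have key : ∀ (u u' : ℝ → ℝ), IntervalIntegrable u' volume a b →
      AbsolutelyContinuousOnInterval (fun x => u a + ∫ s in a..x, u' s) a b
      ∧ ∀ᵐ x, x ∈ uIcc a b → deriv (fun x => u a + ∫ s in a..x, u' s) x = u' x := by
    intro u u' hu
    constructor
    · refine AbsolutelyContinuousOnInterval.add ?_
        (hu.absolutelyContinuousOnInterval_intervalIntegral left_mem_uIcc)
      exact (contDiffOn_const (n := 1)).absolutelyContinuousOnInterval
    · filter_upwards [hu.ae_hasDerivAt_integral] with x hx hxm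
      simpa using ((hx hxm a left_mem_uIcc).const_add (u a)).deriv
  obtain ⟨F1, F2⟩ := key f f' hf'
  obtain ⟨G1, G2⟩ := key g g' hg'
  have h1 := F1.integral_deriv_mul_eq_sub G1
  rw [← hf b (right_mem_Icc.2 hab), ← hg b (right_mem_Icc.2 hab), ← hf a (left_mem_Icc.2 hab),
    ← hg a (left_mem_Icc.2 hab)] at h1
  rw [← h1]
  refine intervalIntegral.integral_congr_ae ?_
  filter_upwards [F2, G2] with x hF hG hx
  have hx' := uIoc_subset_uIcc hx
  rw [hF hx', hG hx']
  rw [uIcc_of_le hab] at hx'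
  rw [← hf x hx', ← hg x hx']

theorem memLp_bdd_mul {X : Type*} [MeasurableSpace X] {μ : Measure X} {b f : X → ℝ} {M : ℝ}
    (hf : MemLp f 2 μ) (hb : AEStronglyMeasurable b μ) (hM : ∀ x, ‖b x‖ ≤ M) :
    MemLp (fun x => b x * f x) 2 μ :=
  hf.of_le_mul (hb.mul hf.1) (ae_of_all _ fun x => by
    rw [norm_mul]
    exact mul_le_mul_of_nonneg_right (hM x) (norm_nonneg _))

theorem integral_mul_sq_le {X : Type*} [MeasurableSpace X] {μ : Measure X} {f g : X → ℝ}
    (hf : MemLp f 2 μ) (hg : MemLp g 2 μ) :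
    ∫ x, |f x * g x| ∂μ ≤ √(∫ x, f x ^ 2 ∂μ) * √(∫ x, g x ^ 2 ∂μ) := by
  have h := integral_mul_le_Lp_mul_Lq_of_nonneg (μ := μ) (p := 2) (q := 2)
    (Real.HolderConjugate.two_two) (f := fun x => |f x|) (g := fun x => |g x|)
    (ae_of_all _ fun x => abs_nonneg _) (ae_of_all _ fun x => abs_nonneg _)
    (by simpa using hf.norm) (by simpa using hg.norm)
  rw [Real.sqrt_eq_rpow, Real.sqrt_eq_rpow]
  simpa [abs_mul] using h

theorem integral_bdd_mul_le {X : Type*} [MeasurableSpace X] {μ : Measure X} {b f g : X → ℝ} {M : ℝ}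
    (hM : 0 ≤ M) (hb : ∀ᵐ x ∂μ, |b x| ≤ M) (hf : MemLp f 2 μ) (hg : MemLp g 2 μ) :
    |∫ x, b x * (f x * g x) ∂μ| ≤ M * (√(∫ x, f x ^ 2 ∂μ) * √(∫ x, g x ^ 2 ∂μ)) := by
  refine le_trans ?_ (mul_le_mul_of_nonneg_left (integral_mul_sq_le hf hg) hM)
  rw [← integral_const_mul]
  refine norm_integral_le_of_norm_le (G := ℝ) ((hf.integrable_mul hg).abs.const_mul M) ?_
  filter_upwards [hb] with x hx
  rw [norm_mul]
  exact mul_le_mul_of_nonneg_right hx (abs_nonneg _)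

theorem abs_integral_mul_le {X : Type*} [MeasurableSpace X] {μ : Measure X} {f g : X → ℝ}
    (hf : MemLp f 2 μ) (hg : MemLp g 2 μ) :
    |∫ x, f x * g x ∂μ| ≤ √(∫ x, f x ^ 2 ∂μ) * √(∫ x, g x ^ 2 ∂μ) := by
  simpa using integral_bdd_mul_le (b := fun _ => 1) (M := 1) zero_le_one (by simp) hf hg

/-- Cauchy-Schwarz; the factor `2` is the length of the interval. -/
theorem sq_sub_le_of_prim {f f' : ℝ → ℝ} (hf' : MemLp f' 2 volI)
    (h : ∀ y ∈ Icc (-1 : ℝ) 1, ∀ z ∈ Icc (-1 : ℝ) 1, f z - f y = ∫ s in y..z, f' s)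
    {y z : ℝ} (hy : y ∈ Icc (-1 : ℝ) 1) (hz : z ∈ Icc (-1 : ℝ) 1) :
    (f z - f y) ^ 2 ≤ 2 * ∫ s, f' s ^ 2 ∂volI := by
  have hsub : |f z - f y| ≤ ∫ s, |f' s| ∂volI := by
    rw [h y hy z hz]
    refine (intervalIntegral.norm_integral_le_integral_norm_uIoc (E := ℝ)).trans ?_
    rw [← integral_Ioc_eq_integral_Ioo]
    refine setIntegral_mono_set ?_ (ae_of_all _ fun _ => norm_nonneg _) ?_
    · exact (integrableOn_Ioc_iff_integrableOn_Ioo (by simp)).2 (hf'.integrable (by norm_num)).norm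
    · refine ae_of_all _ fun s hs => ?_
      have hs : s ∈ uIoc y z := hs
      rw [uIoc, mem_Ioc] at hs
      exact ⟨lt_of_le_of_lt (le_min hy.1 hz.1) hs.1, hs.2.trans (max_le hy.2 hz.2)⟩
  have hD : (∫ s, |f' s| ∂volI) ^ 2 ≤ 2 * ∫ s, f' s ^ 2 ∂volI := by
    have h1 := integral_mul_sq_le hf' (memLp_const (1 : ℝ) (μ := volI) (p := 2))
    simp only [mul_one, one_pow, integral_const, smul_eq_mul] at h1
    have h2 : volI.real univ = 2 := by simp [Measure.real]; norm_num
    rw [h2] at h1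
    have h3 : 0 ≤ ∫ s, f' s ^ 2 ∂volI := integral_nonneg fun _ => sq_nonneg _
    calc (∫ s, |f' s| ∂volI) ^ 2 ≤ (√(∫ s, f' s ^ 2 ∂volI) * √2) ^ 2 :=
          pow_le_pow_left₀ (integral_nonneg fun _ => abs_nonneg _) h1 2
      _ = _ := by rw [mul_pow, Real.sq_sqrt h3, Real.sq_sqrt (by norm_num)]; ring
  rw [← sq_abs]
  exact (pow_le_pow_left₀ (abs_nonneg _) hsub 2).trans hD

/-- The sup bound `f² ≤ 4 ∫ (f² + f'²)` on the interval `(-1,1)`. -/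
theorem sq_le_of_prim {f f' : ℝ → ℝ} (hc : ContinuousOn f (Icc (-1) 1)) (hf' : MemLp f' 2 volI)
    (h : ∀ y ∈ Icc (-1 : ℝ) 1, ∀ z ∈ Icc (-1 : ℝ) 1, f z - f y = ∫ s in y..z, f' s)
    {z : ℝ} (hz : z ∈ Icc (-1 : ℝ) 1) :
    f z ^ 2 ≤ 4 * ((∫ s, f s ^ 2 ∂volI) + ∫ s, f' s ^ 2 ∂volI) := by
  -- `f(z)² ≤ 2 f(y)² + 2 (f(z) - f(y))²`; this is then averaged over `y`.
  have hpt : ∀ y ∈ Ioo (-1 : ℝ) 1, f z ^ 2 ≤ 2 * f y ^ 2 + 4 * ∫ s, f' s ^ 2 ∂volI := by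
    intro y hy
    have h1 := sq_sub_le_of_prim hf' h (Ioo_subset_Icc_self hy) hz
    nlinarith [sq_nonneg (f z - 2 * f y)]
  have hint : Integrable (fun y => f y ^ 2) volI :=
    ((hc.pow 2).integrableOn_Icc).mono_set Ioo_subset_Icc_self
  have h1 : ∫ _y : ℝ, f z ^ 2 ∂volI ≤ ∫ y, (2 * f y ^ 2 + 4 * ∫ s, f' s ^ 2 ∂volI) ∂volI := by
    refine integral_mono_ae (integrable_const _) ((hint.const_mul 2).add (integrable_const _)) ?_
    exact volI_ae_of hpt
  have h2 : volI.real univ = 2 := by simp [Measure.real]; norm_num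
  rw [integral_add (hint.const_mul 2) (integrable_const _), integral_const, integral_const,
    integral_const_mul, h2, smul_eq_mul, smul_eq_mul] at h1
  have h3 : 0 ≤ ∫ s, f s ^ 2 ∂volI := integral_nonneg fun _ => sq_nonneg _
  linarith

/-! ### Periodic functions of one variable -/

/-- The `2`-periodic extension of a function on `[-1,1)`. -/
def pext (g : ℝ → ℝ) (z : ℝ) : ℝ := g (toIcoMod (two_pos : (0 : ℝ) < 2) (-1) z)

theorem pext_periodic (g : ℝ → ℝ) : Function.Periodic (pext g) 2 := fun z => by
  unfold pext
  rw [toIcoMod_add_right]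

theorem pext_eq (g : ℝ → ℝ) {z : ℝ} (hz : z ∈ Ico (-1 : ℝ) 1) : pext g z = g z := by
  unfold pext
  rw [(toIcoMod_eq_self _).2 ⟨hz.1, by linarith [hz.2]⟩]

theorem pext_ae_eq (g : ℝ → ℝ) : pext g =ᵐ[volI] g :=
  volI_ae_of fun _ hs => pext_eq g (Ioo_subset_Ico_self hs)

theorem periodic_ext {f g : ℝ → ℝ} (hf : Function.Periodic f 2) (hg : Function.Periodic g 2)
    (h : ∀ z ∈ Ico (-1 : ℝ) 1, f z = g z) : f = g := by
  funext z
  have h2 : (0 : ℝ) < 2 := two_pos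
  have e1 : ∀ p : ℝ → ℝ, Function.Periodic p 2 → p z = p (toIcoMod h2 (-1) z) := by
    intro p hp
    rw [toIcoMod, hp.sub_zsmul_eq]
  have h3 := toIcoMod_mem_Ico h2 (-1) z
  rw [e1 f hf, e1 g hg, h _ ⟨h3.1, by linarith [h3.2]⟩]

/-- `p` is `2`-periodic and absolutely continuous with derivative `q`, where `q` is `2`-periodic
and square integrable over a period. -/
structure PerH1 (p q : ℝ → ℝ) : Prop where
  periodic : Function.Periodic p 2
  periodic' : Function.Periodic q 2
  memLp : MemLp q 2 volI
  prim : ∀ a b, p b - p a = ∫ s in a..b, q s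

theorem periodic_intervalIntegrable {q : ℝ → ℝ} (hq : Function.Periodic q 2)
    (hi : Integrable q volI) (a b : ℝ) : IntervalIntegrable q volume a b := by
  refine hq.intervalIntegrable two_ne_zero (t := -1) ?_ a b
  norm_num
  exact intervalIntegrable_of_volI hi

theorem periodic_integral {q : ℝ → ℝ} (hq : Function.Periodic q 2) (a : ℝ) :
    ∫ s in a..a + 2, q s = ∫ s, q s ∂volI := by
  rw [integral_volI, hq.intervalIntegral_add_eq a (-1)]
  norm_num

theorem periodic_integral_shift {q : ℝ → ℝ} (hq : Function.Periodic q 2) (h : ℝ) :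
    ∫ s, q (s + h) ∂volI = ∫ s, q s ∂volI := by
  rw [integral_volI, intervalIntegral.integral_comp_add_right (fun s => q s),
    ← periodic_integral hq (-1 + h)]
  congr 1
  ring

theorem PerH1.intervalIntegrable {p q : ℝ → ℝ} (h : PerH1 p q) (a b : ℝ) :
    IntervalIntegrable q volume a b :=
  periodic_intervalIntegrable h.periodic' (h.memLp.integrable (by norm_num)) a b

theorem PerH1.continuous {p q : ℝ → ℝ} (h : PerH1 p q) : Continuous p := by
  have h1 : p = fun b => p 0 + ∫ s in (0 : ℝ)..b, q s := by
    funext b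
    rw [← h.prim]
    ring
  rw [h1]
  exact continuous_const.add (intervalIntegral.continuous_primitive h.intervalIntegrable 0)

theorem memLp_of_continuous {p : ℝ → ℝ} (h : Continuous p) : MemLp p 2 volI := by
  obtain ⟨M, hM⟩ := isCompact_Icc.exists_bound_of_continuousOn (s := Icc (-1 : ℝ) 1) h.continuousOn
  exact MemLp.of_bound h.aestronglyMeasurable M
    (volI_ae_of fun s hs => hM s (Ioo_subset_Icc_self hs))

theorem PerH1.hasDerivAt {p q : ℝ → ℝ} (h : PerH1 p q) (hq : Continuous q) (z : ℝ) :
    HasDerivAt p (q z) z := by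
  have h1 : p = fun b => p 0 + ∫ s in (0 : ℝ)..b, q s := by
    funext b
    rw [← h.prim]
    ring
  rw [h1]
  exact (intervalIntegral.integral_hasDerivAt_right (h.intervalIntegrable _ _)
    (hq.stronglyMeasurableAtFilter _ _) hq.continuousAt).const_add _

theorem PerH1.sq_le {p q : ℝ → ℝ} (h : PerH1 p q) (z : ℝ) :
    p z ^ 2 ≤ 4 * ((∫ s, p s ^ 2 ∂volI) + ∫ s, q s ^ 2 ∂volI) := by
  have h3 := toIcoMod_mem_Ico (two_pos : (0 : ℝ) < 2) (-1) z
  have h4 : p z = p (toIcoMod two_pos (-1) z) := by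
    rw [toIcoMod, h.periodic.sub_zsmul_eq]
  rw [h4]
  exact sq_le_of_prim h.continuous.continuousOn h.memLp (fun y _ z _ => h.prim y z)
    ⟨h3.1, by linarith [h3.2]⟩

/-- The difference quotient. -/
def dq (h : ℝ) (p : ℝ → ℝ) (z : ℝ) : ℝ := (p (z + h) - p z) / h

theorem dq_continuous {p : ℝ → ℝ} (hp : Continuous p) (h : ℝ) : Continuous (dq h p) := by
  unfold dq
  fun_prop

/-- By Jensen's inequality `|D_h p(z)|²` is at most the mean of `q²` over `[z, z + h]`, and the
integral of these means over a period is the integral of `q²`. The primitive `Q` of `q²` takes the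
place of Fubini's theorem here. -/
theorem PerH1.integral_dq_sq_le {p q : ℝ → ℝ} (hp : PerH1 p q) {h : ℝ} (hh : 0 < h) :
    ∫ s, dq h p s ^ 2 ∂volI ≤ ∫ s, q s ^ 2 ∂volI := by
  have hq2 : Function.Periodic (fun s => q s ^ 2) 2 := fun s => by simp only [hp.periodic' s]
  have hi2 : ∀ a b, IntervalIntegrable (fun s => q s ^ 2) volume a b :=
    periodic_intervalIntegrable hq2 hp.memLp.integrable_sq
  let Q : ℝ → ℝ := fun z => ∫ s in (0 : ℝ)..z, q s ^ 2
  have hQc : Continuous Q := intervalIntegral.continuous_primitive hi2 0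
  have hQ2 : ∀ z, Q (z + 2) = Q z + ∫ s, q s ^ 2 ∂volI := by
    intro z
    rw [← periodic_integral hq2 z]
    exact (intervalIntegral.integral_add_adjacent_intervals (hi2 _ _) (hi2 _ _)).symm
  have hpt : ∀ z, dq h p z ^ 2 ≤ (Q (z + h) - Q z) / h := by
    intro z
    have h1 : Q (z + h) - Q z = ∫ s in z..z + h, q s ^ 2 :=
      intervalIntegral.integral_interval_sub_left (hi2 _ _) (hi2 _ _)
    rw [h1]
    unfold dq
    rw [hp.prim, div_pow, div_le_div_iff₀ (by positivity) hh]
    set m := ∫ s in z..z + h, q s with hm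
    have h2 : 0 ≤ ∫ s in z..z + h, (q s - m / h) ^ 2 :=
      -- Jensen's inequality in the form of a nonnegative variance: `m / h` is the mean of `q` over
      -- the interval.
      intervalIntegral.integral_nonneg (by linarith) fun _ _ => sq_nonneg _
    have h3 : ∫ s in z..z + h, (q s - m / h) ^ 2
        = (∫ s in z..z + h, q s ^ 2) - (2 * (m / h)) * m + h * (m / h) ^ 2 := by
      have : ∀ s, (q s - m / h) ^ 2 = q s ^ 2 - (2 * (m / h)) * q s + (m / h) ^ 2 := fun s => by ring
      simp_rw [this]
      rw [intervalIntegral.integral_add, intervalIntegral.integral_sub (hi2 _ _),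
        intervalIntegral.integral_const_mul, intervalIntegral.integral_const]
      · simp [hm]
      · exact (hp.intervalIntegrable _ _).const_mul _
      · exact (hi2 _ _).sub ((hp.intervalIntegrable _ _).const_mul _)
      · simp
    rw [h3] at h2
    have h4 : (2 * (m / h)) * m - h * (m / h) ^ 2 = m ^ 2 / h := by
      field_simp
      ring
    have h5 : m ^ 2 / h ≤ ∫ s in z..z + h, q s ^ 2 := by linarith
    rw [div_le_iff₀ hh] at h5
    nlinarith
  have hcs : Continuous (fun z => Q (z + h)) := by fun_prop
  have key : ∫ s, (Q (s + h) - Q s) ∂volI = h * ∫ s, q s ^ 2 ∂volI := by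
    have hcI : ∀ a b, IntervalIntegrable Q volume a b := hQc.intervalIntegrable
    rw [integral_volI, intervalIntegral.integral_sub (hcs.intervalIntegrable _ _) (hcI _ _),
      intervalIntegral.integral_comp_add_right (fun s => Q s)]
    -- The two integrals differ only on the end pieces of length `h`, and there `Q` differs by its
    -- increment over one period.
    have e1 : (∫ s in (-1 + h)..(1 + h), Q s) - ∫ s in (-1 : ℝ)..1, Q s
        = (∫ s in (1 : ℝ)..(1 + h), Q s) - ∫ s in (-1 : ℝ)..(-1 + h), Q s := by
      rw [intervalIntegral.integral_interval_sub_interval_comm (hcI _ _) (hcI _ _) (hcI _ _),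
        intervalIntegral.integral_symm (-1 : ℝ) (-1 + h), intervalIntegral.integral_symm (1 + h) 1]
      rw [intervalIntegral.integral_symm (1 : ℝ) (1 + h)]
      ring
    have e2 : ∫ s in (1 : ℝ)..(1 + h), Q s = ∫ s in (-1 : ℝ)..(-1 + h), Q (s + 2) := by
      rw [intervalIntegral.integral_comp_add_right (fun s => Q s)]
      congr 1 <;> ring
    have hs2 : Continuous (fun z => Q (z + 2)) := by fun_prop
    rw [e1, e2, ← intervalIntegral.integral_sub
      (hs2.intervalIntegrable _ _) (hcI _ _)]
    simp_rw [hQ2]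
    simp
  calc ∫ s, dq h p s ^ 2 ∂volI ≤ ∫ s, (Q (s + h) - Q s) / h ∂volI := by
        refine integral_mono ?_ ?_ hpt
        · exact (memLp_of_continuous (dq_continuous hp.continuous h)).integrable_sq
        · exact (memLp_of_continuous ((hcs.sub hQc).div_const h)).integrable (by norm_num)
    _ = ∫ s, q s ^ 2 ∂volI := by
        rw [integral_div, key]
        field_simp

/-- Summation by parts for the second difference quotient. -/
theorem integral_mul_second_diff {f u : ℝ → ℝ} (hf : Continuous f) (hu : Continuous u)
    (hfp : Function.Periodic f 2) (hup : Function.Periodic u 2) {h : ℝ} :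
    ∫ s, f s * ((2 * u s - u (s + h) - u (s - h)) / h ^ 2) ∂volI
      = ∫ s, dq h f s * dq h u s ∂volI := by
  have hI : ∀ {g : ℝ → ℝ}, Continuous g → Integrable g volI := fun hg =>
    (memLp_of_continuous hg).integrable (by norm_num)
  have e1 : ∫ s, f (s + h) * u (s + h) ∂volI = ∫ s, f s * u s ∂volI :=
    periodic_integral_shift (hfp.mul hup) h
  have e2 : ∫ s, f (s + h) * u s ∂volI = ∫ s, f s * u (s - h) ∂volI := by
    have hp : Function.Periodic (fun s => f s * u (s - h)) 2 := fun s => by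
      simp only
      rw [hfp, show s + 2 - h = s - h + 2 by ring, hup]
    rw [← periodic_integral_shift hp h]
    simp
  have h1 : ∀ s, f s * ((2 * u s - u (s + h) - u (s - h)) / h ^ 2)
      = (2 * (f s * u s) - f s * u (s + h) - f s * u (s - h)) / h ^ 2 := fun s => by ring
  have h2 : ∀ s, dq h f s * dq h u s
      = (f (s + h) * u (s + h) - f (s + h) * u s - f s * u (s + h) + f s * u s) / h ^ 2 := by
    intro s
    unfold dq
    rw [div_mul_div_comm, ← sq]
    ring
  simp_rw [h1, h2]
  rw [integral_div, integral_div]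
  congr 1
  rw [integral_sub, integral_sub, integral_const_mul, integral_add, integral_sub, integral_sub, e1, e2]
  · ring
  all_goals exact hI (by fun_prop)

theorem PerH1.integral_parts {p q a b : ℝ → ℝ} (hp : PerH1 p q) (ha : PerH1 a b) :
    ∫ s, p s * b s ∂volI = - ∫ s, q s * a s ∂volI := by
  have h1 := integral_product_rule (a := -1) (b := 1) (by norm_num) (hp.intervalIntegrable _ _)
    (ha.intervalIntegrable _ _) (fun x _ => by rw [← hp.prim]; ring)
    (fun x _ => by rw [← ha.prim]; ring)
  have e1 := hp.periodic (-1)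
  have e2 := ha.periodic (-1)
  norm_num at e1 e2
  rw [e1, e2, sub_self, intervalIntegral.integral_add
    ((hp.intervalIntegrable _ _).mul_continuousOn ha.continuous.continuousOn)
    ((ha.intervalIntegrable _ _).continuousOn_mul hp.continuous.continuousOn)] at h1
  rw [integral_volI, integral_volI]
  linarith

theorem PerH1.shift {p q : ℝ → ℝ} (hp : PerH1 p q) (h : ℝ) :
    PerH1 (fun s => p (s + h)) fun s => q (s + h) where
  periodic s := by simp only; rw [add_right_comm, hp.periodic]
  periodic' s := by simp only; rw [add_right_comm, hp.periodic']
  memLp := by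
    have h1 : Function.Periodic (fun s => q (s + h) ^ 2) 2 := fun s => by
      simp only; rw [add_right_comm, hp.periodic']
    have hq2 : Function.Periodic (fun s => q s ^ 2) 2 := fun s => by simp only [hp.periodic' s]
    have hm : ∀ {r : ℝ → ℝ}, (∀ a b, IntervalIntegrable r volume a b) →
        Integrable (fun s => r (s + h)) volI := by
      intro r hr
      have := (hr (-1 + h) (1 + h)).comp_add_right h
      simp only [add_sub_cancel_right] at this
      rwa [intervalIntegrable_iff_integrableOn_Ioo_of_le (by norm_num)] at this
    rw [memLp_two_iff_integrable_sq (hm hp.intervalIntegrable).1]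
    exact hm (periodic_intervalIntegrable hq2 hp.memLp.integrable_sq)
  prim a b := by
    rw [hp.prim, intervalIntegral.integral_comp_add_right (fun s => q s)]

theorem PerH1.sub {p q a b : ℝ → ℝ} (hp : PerH1 p q) (ha : PerH1 a b) :
    PerH1 (fun s => p s - a s) fun s => q s - b s where
  periodic := hp.periodic.sub ha.periodic
  periodic' := hp.periodic'.sub ha.periodic'
  memLp := hp.memLp.sub ha.memLp
  prim c d := by
    rw [intervalIntegral.integral_sub (hp.intervalIntegrable _ _) (ha.intervalIntegrable _ _),
      ← hp.prim, ← ha.prim]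
    ring

theorem PerH1.div_const {p q : ℝ → ℝ} (hp : PerH1 p q) (c : ℝ) :
    PerH1 (fun s => p s / c) fun s => q s / c where
  periodic s := by simp only [hp.periodic s]
  periodic' s := by simp only [hp.periodic' s]
  memLp := by simpa [div_eq_mul_inv] using hp.memLp.mul_const c⁻¹
  prim a b := by rw [intervalIntegral.integral_div, ← hp.prim]; ring

theorem PerH1.dq {p q : ℝ → ℝ} (hp : PerH1 p q) (h : ℝ) : PerH1 (dq h p) (dq h q) :=
  ((hp.shift h).sub hp).div_const h

theorem PerH1.mul {p q a b : ℝ → ℝ} (hp : PerH1 p q) (ha : PerH1 a b) :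
    PerH1 (fun s => p s * a s) fun s => q s * a s + p s * b s where
  periodic := hp.periodic.mul ha.periodic
  periodic' s := by simp only [hp.periodic s, hp.periodic' s, ha.periodic s, ha.periodic' s]
  memLp := by
    have hbd : ∀ {c d : ℝ → ℝ}, PerH1 c d → ∀ s, ‖c s‖ ≤
        √(4 * ((∫ s, c s ^ 2 ∂volI) + ∫ s, d s ^ 2 ∂volI)) := fun hc s =>
      Real.le_sqrt_of_sq_le (by simpa using hc.sq_le s)
    refine MemLp.add ?_ ?_
    · simpa [mul_comm] using memLp_bdd_mul hp.memLp ha.continuous.aestronglyMeasurable (hbd ha)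
    · exact memLp_bdd_mul ha.memLp hp.continuous.aestronglyMeasurable (hbd hp)
  prim c d := by
    rcases le_total c d with hcd | hcd
    · rw [integral_product_rule hcd (hp.intervalIntegrable _ _) (ha.intervalIntegrable _ _)
        (fun x _ => by rw [← hp.prim]; ring) (fun x _ => by rw [← ha.prim]; ring)]
    · rw [intervalIntegral.integral_symm, integral_product_rule hcd (hp.intervalIntegrable _ _)
        (ha.intervalIntegrable _ _)
        (fun x _ => by rw [← hp.prim]; ring) (fun x _ => by rw [← ha.prim]; ring)]
      ring

/-! ### Absolutely continuous representatives from relations between coefficients -/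

/-- If `g'` is the weak derivative of `g` on the circle `ℝ/2ℤ`, then `g` is a primitive of `g'`. -/
theorem exists_prim_of_coeff {g g' : ℝ → ℝ} (hg : Integrable g volI) (hg' : Integrable g' volI)
    (h : ∀ k : ℤ, ∫ s, g s * (Real.pi * k * mode (-k) s) ∂volI = - ∫ s, g' s * mode k s ∂volI) :
    ∫ s, g' s ∂volI = 0 ∧ ∃ c, ∀ᵐ z ∂volI, g z = c + ∫ s in (-1 : ℝ)..z, g' s := by
  have hi' := intervalIntegrable_of_volI hg'
  -- The constant mode has zero derivative, so the relation for `k = 0` says that `g'` has mean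
  -- zero. The primitive of `g'` is then periodic.
  have h0 : ∫ s, g' s ∂volI = 0 := by
    have h1 := h 0
    simp only [mode_zero, Int.cast_zero, mul_zero, zero_mul, integral_zero] at h1
    rw [integral_mul_const] at h1
    have : (1 / √2 : ℝ) ≠ 0 := by positivity
    have h2 : (∫ s, g' s ∂volI) * (1 / √2) = 0 := by linarith
    exact (mul_eq_zero.1 h2).resolve_right this
  refine ⟨h0, ?_⟩
  let G : ℝ → ℝ := fun z => ∫ s in (-1 : ℝ)..z, g' s
  have hGc : ContinuousOn G (Icc (-1) 1) := by
    have := intervalIntegral.continuousOn_primitive_interval' hi' (left_mem_uIcc)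
    rwa [uIcc_of_le (by norm_num)] at this
  have hGi : Integrable G volI := hGc.integrableOn_Icc.mono_set Ioo_subset_Icc_self
  have hG1 : G 1 = 0 := by rw [← h0, integral_volI]
  have hGm : G (-1) = 0 := by simp [G]
  -- `G` vanishes at both ends, so it satisfies the same relations as `g`. Hence `g - G` has no
  -- coefficient except the constant one, which `c` removes.
  have hparts : ∀ k : ℤ, ∫ s, G s * (Real.pi * k * mode (-k) s) ∂volI
      = - ∫ s, g' s * mode k s ∂volI := by
    intro k
    have hcm : Continuous fun s => Real.pi * k * mode (-k) s :=
      continuous_const.mul (mode_continuous _)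
    have h1 := integral_product_rule (f := G) (f' := g') (g := mode k)
      (g' := fun s => Real.pi * k * mode (-k) s) (a := -1) (b := 1) (by norm_num) hi'
      (hcm.intervalIntegrable _ _) (fun x _ => by rw [hGm, zero_add])
      (fun x _ => by
        rw [intervalIntegral.integral_eq_sub_of_hasDerivAt (fun s _ => mode_hasDerivAt k s)
          (hcm.intervalIntegrable _ _)]
        ring)
    rw [hG1, hGm, zero_mul, zero_mul, sub_zero, ← integral_volI, integral_add] at h1
    · linarith
    · exact integrable_mul_of_bound hg' (mode_continuous k).aestronglyMeasurable (mode_abs_le k)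
    · exact ((hGc.mul hcm.continuousOn).integrableOn_Icc).mono_set Ioo_subset_Icc_self
  let c : ℝ := (∫ s, (g s - G s) ∂volI) / 2
  refine ⟨c, ?_⟩
  have hgG : Integrable (fun s => g s - G s) volI := hg.sub hGi
  have hd : Integrable (fun s => g s - G s - c) volI := hgG.sub (integrable_const c)
  have h2 : (fun s => g s - G s - c) =ᵐ[volI] 0 := by
    refine separates_mode _ hd fun k => ?_
    by_cases hk : k = 0
    · subst hk
      simp only [mode_zero]
      rw [integral_mul_const, integral_sub hgG (integrable_const c), integral_const]
      have h2 : volI.real univ = 2 := by simp [Measure.real]; norm_num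
      rw [h2]
      simp [c]
      ring
    · have hb : ∀ {u : ℝ → ℝ}, Integrable u volI →
          Integrable (fun s => u s * mode k s) volI := fun hu =>
        integrable_mul_of_bound hu (mode_continuous k).aestronglyMeasurable (mode_abs_le k)
      -- Differentiation exchanges the modes `k` and `-k`, so the coefficient `k` is found from the
      -- relation for `-k`.
      have h3 := (h (-k)).trans (hparts (-k)).symm
      simp only [neg_neg] at h3
      have e1 : ∀ u : ℝ → ℝ, ∫ s, u s * (Real.pi * ((-k : ℤ) : ℝ) * mode k s) ∂volI
          = (-(Real.pi * k)) * ∫ s, u s * mode k s ∂volI := by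
        intro u
        rw [← integral_const_mul]
        refine integral_congr_ae (ae_of_all _ fun s => ?_)
        push_cast
        ring
      rw [e1, e1] at h3
      have hk' : (-(Real.pi * k) : ℝ) ≠ 0 := by
        have : (k : ℝ) ≠ 0 := by exact_mod_cast hk
        have := Real.pi_ne_zero
        simp [*]
      have h4 := mul_left_cancel₀ hk' h3
      have e2 : ∀ s, (g s - G s - c) * mode k s = g s * mode k s - G s * mode k s - c * mode k s :=
        fun s => by ring
      simp_rw [e2]
      have hbd : Integrable (fun s => g s * mode k s - G s * mode k s) volI := (hb hg).sub (hb hGi)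
      rw [integral_sub hbd (hb (integrable_const c)),
        integral_sub (hb hg) (hb hGi), h4, integral_const_mul, integral_volI,
        integral_volI, integral_mode k hk]
      ring
  filter_upwards [h2] with z hz
  have : g z - G z - c = 0 := hz
  simp only [G] at this
  linarith

/-- The periodic extension of an absolutely continuous function with equal values at `±1`. -/
theorem perH1_pext {f f' : ℝ → ℝ} (hf' : MemLp f' 2 volI)
    (h : ∀ z ∈ Icc (-1 : ℝ) 1, f z = f (-1) + ∫ s in (-1 : ℝ)..z, f' s) (h1 : f 1 = f (-1)) :
    PerH1 (pext f) (pext f') := by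
  have hm : MemLp (pext f') 2 volI := hf'.ae_eq (pext_ae_eq f').symm
  have hi : ∀ a b, IntervalIntegrable (pext f') volume a b :=
    periodic_intervalIntegrable (pext_periodic f') (hm.integrable (by norm_num))
  have h0 : ∫ s, f' s ∂volI = 0 := by
    rw [integral_volI]
    have := h 1 (by norm_num)
    linarith
  let F : ℝ → ℝ := fun z => f (-1) + ∫ s in (-1 : ℝ)..z, pext f' s
  have hFp : Function.Periodic F 2 := by
    intro z
    have e1 := intervalIntegral.integral_add_adjacent_intervals (hi (-1) z) (hi z (z + 2))
    rw [periodic_integral (pext_periodic f'), integral_congr_ae (pext_ae_eq f'), h0, add_zero] at e1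
    simp only [F]
    rw [e1]
  have hF : pext f = F := by
    refine periodic_ext (pext_periodic f) hFp fun z hz => ?_
    rw [pext_eq f hz, h z (Ico_subset_Icc_self hz)]
    simp only [F]
    congr 1
    refine intervalIntegral.integral_congr_ae ?_
    have : ∀ᵐ s, s ≠ (1 : ℝ) := by simp [ae_iff, measure_singleton]
    filter_upwards with s hs
    rw [uIoc_of_le hz.1] at hs
    exact (pext_eq f' ⟨hs.1.le, hs.2.trans_lt hz.2⟩).symm
  refine ⟨pext_periodic f, pext_periodic f', hm, fun a b => ?_⟩
  rw [hF]
  simp only [F]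
  rw [← intervalIntegral.integral_add_adjacent_intervals (hi (-1) a) (hi a b)]
  ring

/-- Two functions on `(-1,1)`, the second being the weak derivative of the first on the circle. -/
theorem exists_perH1 {g g' : ℝ → ℝ} (hg : Integrable g volI) (hg' : MemLp g' 2 volI)
    (h : ∀ k : ℤ, ∫ s, g s * (Real.pi * k * mode (-k) s) ∂volI = - ∫ s, g' s * mode k s ∂volI) :
    ∃ p, PerH1 p (pext g') ∧ g =ᵐ[volI] p := by
  obtain ⟨h0, c, hc⟩ := exists_prim_of_coeff hg (hg'.integrable (by norm_num)) h
  let f : ℝ → ℝ := fun z => c + ∫ s in (-1 : ℝ)..z, g' s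
  refine ⟨pext f, perH1_pext hg' (fun z _ => by simp [f]) ?_, ?_⟩
  · simp only [f]
    rw [← integral_volI, h0]
    simp
  · filter_upwards [hc, pext_ae_eq f] with z h1 h2
    rw [h2, h1]

/-- Replaces the derivative of a periodic function by an almost everywhere equal one. -/
theorem PerH1.congr {p q r : ℝ → ℝ} (hp : PerH1 p q) (hr : Function.Periodic r 2)
    (h : q =ᵐ[volI] r) : PerH1 p r where
  periodic := hp.periodic
  periodic' := hr
  memLp := hp.memLp.ae_eq h
  prim := by
    have hm : MemLp r 2 volI := hp.memLp.ae_eq h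
    have hd : PerH1 (pext fun z => ∫ s in (-1 : ℝ)..z, r s) (pext r) := by
      refine perH1_pext hm (fun z _ => by simp) ?_
      rw [← integral_volI, ← integral_congr_ae h, integral_volI, ← hp.prim]
      have := hp.periodic (-1)
      norm_num at this
      simp [this]
    have hr' : pext r = r := periodic_ext (pext_periodic r) hr fun z hz => pext_eq r hz
    rw [hr'] at hd
    have hpd : (fun z => p z - p (-1)) = pext fun z => ∫ s in (-1 : ℝ)..z, r s := by
      refine periodic_ext (fun z => by simp only [hp.periodic z]) (pext_periodic _) fun z hz => ?_
      rw [pext_eq _ hz, hp.prim]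
      refine intervalIntegral.integral_congr_ae ?_
      have h1 := (ae_restrict_iff' measurableSet_Ioo).1 h
      filter_upwards [h1] with s hs hsz
      rw [uIoc_of_le hz.1] at hsz
      exact hs ⟨hsz.1, hsz.2.trans_lt hz.2⟩
    intro a b
    rw [← hd.prim, ← hpd]
    ring

/-- The function `g` on `(-1,1)` with derivatives `g'` and `g''` on the circle. -/
theorem exists_perH2 {g g' g'' : ℝ → ℝ} (hg : Integrable g volI) (hg' : MemLp g' 2 volI)
    (hg'' : MemLp g'' 2 volI)
    (h : ∀ k : ℤ, ∫ s, g s * (Real.pi * k * mode (-k) s) ∂volI = - ∫ s, g' s * mode k s ∂volI)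
    (h' : ∀ k : ℤ, ∫ s, g' s * (Real.pi * k * mode (-k) s) ∂volI
      = - ∫ s, g'' s * mode k s ∂volI) :
    ∃ p q, PerH1 p q ∧ PerH1 q (pext g'') ∧ g =ᵐ[volI] p ∧ g' =ᵐ[volI] q := by
  obtain ⟨p, hp, hgp⟩ := exists_perH1 hg hg' h
  obtain ⟨q, hq, hgq⟩ := exists_perH1 (hg'.integrable (by norm_num)) hg'' h'
  exact ⟨p, q, hp.congr hq.periodic ((pext_ae_eq g').trans hgq), hq, hgp, hgq⟩

/-! ### The trilinear estimates in the vertical variable -/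

/-- The vertical derivative of the test function `u + D_h^* D_h u`, in terms of `q = u'`. -/
def testDeriv (h : ℝ) (q : ℝ → ℝ) (s : ℝ) : ℝ := q s + (2 * q s - q (s + h) - q (s - h)) / h ^ 2

theorem integral_mul_testDeriv {f q : ℝ → ℝ} (hf : Continuous f) (hq : Continuous q)
    (hfp : Function.Periodic f 2) (hqp : Function.Periodic q 2) {h : ℝ} :
    ∫ s, f s * testDeriv h q s ∂volI
      = (∫ s, f s * q s ∂volI) + ∫ s, dq h f s * dq h q s ∂volI := by
  rw [← integral_mul_second_diff hf hq hfp hqp, ← integral_add]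
  · simp only [testDeriv, mul_add]
  · exact (memLp_of_continuous (hf.mul hq)).integrable (by norm_num)
  · exact (memLp_of_continuous (by fun_prop)).integrable (by norm_num)

theorem abs_dq_le {p q : ℝ → ℝ} (hp : PerH1 p q) {M : ℝ} (hM : ∀ s, |q s| ≤ M) {h : ℝ}
    (hh : 0 < h) (z : ℝ) : |dq h p z| ≤ M := by
  unfold dq
  rw [hp.prim, abs_div, abs_of_pos hh, div_le_iff₀ hh]
  have := intervalIntegral.norm_integral_le_of_norm_le_const (a := z) (b := z + h) (f := q) (C := M)
    (fun s _ => hM s)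
  simpa [abs_of_pos hh] using this

/-- The transport term, tested with `u + D_h^* D_h u`. -/
theorem sq_integral_transport_le {w w' w'' u u' u'' : ℝ → ℝ} (hw : PerH1 w w') (hw' : PerH1 w' w'')
    (hu : PerH1 u u') (hu' : PerH1 u' u'') {h : ℝ} (hh : 0 < h) :
    (∫ s, w s * u s * testDeriv h u' s ∂volI) ^ 2
      ≤ 100 * (((∫ s, w' s ^ 2 ∂volI) + ∫ s, w'' s ^ 2 ∂volI)
        * ((∫ s, u s ^ 2 ∂volI) + ∫ s, u' s ^ 2 ∂volI) ^ 2) := by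
  set a := (∫ s, w' s ^ 2 ∂volI) + ∫ s, w'' s ^ 2 ∂volI with ha
  set n := (∫ s, u s ^ 2 ∂volI) + ∫ s, u' s ^ 2 ∂volI with hn
  have pos : ∀ f : ℝ → ℝ, 0 ≤ ∫ s, f s ^ 2 ∂volI := fun f => integral_nonneg fun _ => sq_nonneg _
  have ha0 : 0 ≤ a := add_nonneg (pos _) (pos _)
  have hn0 : 0 ≤ n := add_nonneg (pos _) (pos _)
  have hsq : ∀ (x y : ℝ), 0 ≤ y → x ^ 2 ≤ 4 * y → |x| ≤ 2 * √y := by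
    intro x y hy hxy
    refine abs_le_of_sq_le_sq ?_ (by positivity)
    rw [mul_pow, Real.sq_sqrt hy]
    linarith
  have bw' : ∀ s, |w' s| ≤ 2 * √a := fun s => hsq _ _ ha0 (hw'.sq_le s)
  have bu : ∀ s, |u s| ≤ 2 * √n := fun s => hsq _ _ hn0 (hu.sq_le s)
  have bdw : ∀ s, |dq h w s| ≤ 2 * √a := fun s => abs_dq_le hw bw' hh s
  have mem : ∀ {p q : ℝ → ℝ}, PerH1 p q → MemLp p 2 volI := fun hp =>
    memLp_of_continuous hp.continuous
  have su : √(∫ s, u s ^ 2 ∂volI) ≤ √n := Real.sqrt_le_sqrt (by linarith [pos u'])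
  have su' : √(∫ s, u' s ^ 2 ∂volI) ≤ √n := Real.sqrt_le_sqrt (by linarith [pos u])
  have sdu : √(∫ s, dq h u s ^ 2 ∂volI) ≤ √n :=
    Real.sqrt_le_sqrt ((hu.integral_dq_sq_le hh).trans (by linarith [pos u]))
  have sdw' : √(∫ s, dq h w' s ^ 2 ∂volI) ≤ √a :=
    Real.sqrt_le_sqrt ((hw'.integral_dq_sq_le hh).trans (by linarith [pos w']))
  have hnn : √n * √n = n := Real.mul_self_sqrt hn0
  -- the undifferenced part
  have t1 : |∫ s, w s * u s * u' s ∂volI| ≤ √a * n := by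
    -- Since `2 u u' = (u²)'`, the derivative falls on `w`; neither `w` itself nor `u''` remains.
    have e1 := hw.integral_parts (hu.mul hu)
    have e2 : ∫ s, w s * (u' s * u s + u s * u' s) ∂volI = 2 * ∫ s, w s * u s * u' s ∂volI := by
      rw [← integral_const_mul]
      exact integral_congr_ae (ae_of_all _ fun s => by ring)
    have e3 := integral_bdd_mul_le (b := w') (by positivity) (ae_of_all _ bw') (mem hu) (mem hu)
    have e4 : ∫ s, w s * u s * u' s ∂volI = -(1 / 2) * ∫ s, w' s * (u s * u s) ∂volI := by linarith
    rw [e4, abs_mul]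
    have e5 : √(∫ s, u s ^ 2 ∂volI) * √(∫ s, u s ^ 2 ∂volI) ≤ √n * √n := by gcongr
    rw [hnn] at e5
    have e6 : 2 * √a * (√(∫ s, u s ^ 2 ∂volI) * √(∫ s, u s ^ 2 ∂volI)) ≤ 2 * √a * n := by gcongr
    norm_num
    linarith
  -- the differenced part, first term
  have t2 : |∫ s, w (s + h) * dq h u s * dq h u' s ∂volI| ≤ √a * n := by
    have hd := hu.dq h
    have e1 := (hw.shift h).integral_parts (hd.mul hd)
    have e2 : ∫ s, w (s + h) * (dq h u' s * dq h u s + dq h u s * dq h u' s) ∂volI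
        = 2 * ∫ s, w (s + h) * dq h u s * dq h u' s ∂volI := by
      rw [← integral_const_mul]
      exact integral_congr_ae (ae_of_all _ fun s => by ring)
    have e3 := integral_bdd_mul_le (b := fun s => w' (s + h)) (by positivity)
      (ae_of_all _ fun s => bw' (s + h)) (mem hd) (mem hd)
    have e4 : ∫ s, w (s + h) * dq h u s * dq h u' s ∂volI
        = -(1 / 2) * ∫ s, w' (s + h) * (dq h u s * dq h u s) ∂volI := by linarith
    rw [e4, abs_mul]
    have e5 : √(∫ s, dq h u s ^ 2 ∂volI) * √(∫ s, dq h u s ^ 2 ∂volI) ≤ √n * √n := by gcongr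
    rw [hnn] at e5
    have e6 : 2 * √a * (√(∫ s, dq h u s ^ 2 ∂volI) * √(∫ s, dq h u s ^ 2 ∂volI)) ≤ 2 * √a * n := by
      gcongr
    norm_num
    linarith
  -- the differenced part, second term
  have t3 : |∫ s, dq h w s * u s * dq h u' s ∂volI| ≤ 4 * (√a * n) := by
    -- `D_h u'` would cost `u''`. Moving the derivative away from it leaves `D_h u`, bounded by `u'`
    -- in `L²`, against `D_h w'` and `D_h w`, bounded by `w''` in `L²` and by `w'` uniformly.
    have e1 := ((hw.dq h).mul hu).integral_parts (hu.dq h)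
    have e2 : ∫ s, (dq h w' s * u s + dq h w s * u' s) * dq h u s ∂volI
        = (∫ s, u s * (dq h w' s * dq h u s) ∂volI) + ∫ s, dq h w s * (u' s * dq h u s) ∂volI := by
      rw [← integral_add]
      · exact integral_congr_ae (ae_of_all _ fun s => by ring)
      · exact (memLp_of_continuous (hu.continuous.mul
          ((hw'.dq h).continuous.mul (hu.dq h).continuous))).integrable (by norm_num)
      · exact (memLp_of_continuous ((hw.dq h).continuous.mul
          (hu'.continuous.mul (hu.dq h).continuous))).integrable (by norm_num)
    have e3 := integral_bdd_mul_le (b := u) (by positivity) (ae_of_all _ bu) (mem (hw'.dq h))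
      (mem (hu.dq h))
    have e4 := integral_bdd_mul_le (b := dq h w) (by positivity) (ae_of_all _ bdw) (mem hu')
      (mem (hu.dq h))
    have e5 : 2 * √n * (√(∫ s, dq h w' s ^ 2 ∂volI) * √(∫ s, dq h u s ^ 2 ∂volI))
        ≤ 2 * √n * (√a * √n) := by gcongr
    have e6 : 2 * √a * (√(∫ s, u' s ^ 2 ∂volI) * √(∫ s, dq h u s ^ 2 ∂volI))
        ≤ 2 * √a * (√n * √n) := by gcongr
    rw [hnn] at e6
    have e7 : 2 * √n * (√a * √n) = 2 * (√a * n) := by linear_combination 2 * √a * hnn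
    rw [e1, e2, abs_neg]
    refine (abs_add_le _ _).trans ?_
    linarith
  -- Discrete Leibniz rule: `D_h (w u) = w(· + h) D_h u + (D_h w) u`.
  have main : ∫ s, w s * u s * testDeriv h u' s ∂volI
      = (∫ s, w s * u s * u' s ∂volI) + ((∫ s, w (s + h) * dq h u s * dq h u' s ∂volI)
        + ∫ s, dq h w s * u s * dq h u' s ∂volI) := by
    have i1 : Integrable (fun s => w (s + h) * dq h u s * dq h u' s) volI :=
      (memLp_of_continuous (((hw.shift h).continuous.mul (hu.dq h).continuous).mul
          (hu'.dq h).continuous)).integrable (by norm_num)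
    have i2 : Integrable (fun s => dq h w s * u s * dq h u' s) volI :=
      (memLp_of_continuous (((hw.dq h).continuous.mul hu.continuous).mul
          (hu'.dq h).continuous)).integrable (by norm_num)
    rw [← integral_add i1 i2, integral_mul_testDeriv (f := fun s => w s * u s)
      (hw.continuous.mul hu.continuous) hu'.continuous
      (hw.periodic.mul hu.periodic) hu'.periodic]
    congr 1
    refine integral_congr_ae (ae_of_all _ fun s => ?_)
    simp only [dq]
    ring
  have h6 : |∫ s, w s * u s * testDeriv h u' s ∂volI| ≤ 6 * (√a * n) := by
    rw [main]
    have := abs_add_le (∫ s, w s * u s * u' s ∂volI)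
      ((∫ s, w (s + h) * dq h u s * dq h u' s ∂volI) + ∫ s, dq h w s * u s * dq h u' s ∂volI)
    have := abs_add_le (∫ s, w (s + h) * dq h u s * dq h u' s ∂volI)
      (∫ s, dq h w s * u s * dq h u' s ∂volI)
    linarith
  rw [← sq_abs]
  calc |∫ s, w s * u s * testDeriv h u' s ∂volI| ^ 2 ≤ (6 * (√a * n)) ^ 2 :=
        pow_le_pow_left₀ (abs_nonneg _) h6 2
    _ = 36 * (a * n ^ 2) := by rw [mul_pow, mul_pow, Real.sq_sqrt ha0]; ring
    _ ≤ 100 * (a * n ^ 2) := by nlinarith [mul_nonneg ha0 (sq_nonneg n)]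

/-- `f` is absolutely continuous on `[-1,1]` with square integrable derivative `f'`. -/
structure PrimOn (f f' : ℝ → ℝ) : Prop where
  memLp : MemLp f' 2 volI
  prim : ∀ z ∈ Icc (-1 : ℝ) 1, f z = f (-1) + ∫ s in (-1 : ℝ)..z, f' s

theorem PrimOn.intervalIntegrable {f f' : ℝ → ℝ} (h : PrimOn f f') :
    IntervalIntegrable f' volume (-1) 1 :=
  intervalIntegrable_of_volI (h.memLp.integrable (by norm_num))

theorem PrimOn.intervalIntegrable_sub {f f' : ℝ → ℝ} (h : PrimOn f f') {y z : ℝ}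
    (hy : y ∈ Icc (-1 : ℝ) 1) (hz : z ∈ Icc (-1 : ℝ) 1) : IntervalIntegrable f' volume y z := by
  refine h.intervalIntegrable.mono_set ?_
  rw [uIcc_of_le (by norm_num : (-1 : ℝ) ≤ 1)]
  exact uIcc_subset_Icc hy hz

theorem PrimOn.continuousOn {f f' : ℝ → ℝ} (h : PrimOn f f') : ContinuousOn f (Icc (-1) 1) := by
  have h1 := intervalIntegral.continuousOn_primitive_interval' h.intervalIntegrable left_mem_uIcc
  rw [uIcc_of_le (by norm_num)] at h1
  exact (continuousOn_const.add h1).congr fun z hz => h.prim z hz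

theorem PrimOn.sub_eq {f f' : ℝ → ℝ} (h : PrimOn f f') :
    ∀ y ∈ Icc (-1 : ℝ) 1, ∀ z ∈ Icc (-1 : ℝ) 1, f z - f y = ∫ s in y..z, f' s := by
  intro y hy z hz
  have hm : (-1 : ℝ) ∈ Icc (-1 : ℝ) 1 := by norm_num
  rw [h.prim z hz, h.prim y hy, ← intervalIntegral.integral_add_adjacent_intervals
    (h.intervalIntegrable_sub hm hy) (h.intervalIntegrable_sub hy hz)]
  ring

theorem PrimOn.memLp_self {f f' : ℝ → ℝ} (h : PrimOn f f') : MemLp f 2 volI := by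
  obtain ⟨M, hM⟩ := isCompact_Icc.exists_bound_of_continuousOn h.continuousOn
  exact MemLp.of_bound ((h.continuousOn.mono Ioo_subset_Icc_self).aestronglyMeasurable
    measurableSet_Ioo) M (volI_ae_of fun s hs => hM s (Ioo_subset_Icc_self hs))

theorem PrimOn.sq_le {f f' : ℝ → ℝ} (h : PrimOn f f') {z : ℝ} (hz : z ∈ Icc (-1 : ℝ) 1) :
    f z ^ 2 ≤ 4 * ((∫ s, f s ^ 2 ∂volI) + ∫ s, f' s ^ 2 ∂volI) :=
  sq_le_of_prim h.continuousOn h.memLp h.sub_eq hz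

theorem memLp_continuousOn_mul {b f : ℝ → ℝ} (hb : ContinuousOn b (Icc (-1) 1))
    (hf : MemLp f 2 volI) : MemLp (fun s => b s * f s) 2 volI := by
  obtain ⟨M, hM⟩ := isCompact_Icc.exists_bound_of_continuousOn hb
  refine hf.of_le_mul (c := M) (((hb.mono Ioo_subset_Icc_self).aestronglyMeasurable
    measurableSet_Ioo).mul hf.1) (volI_ae_of fun s hs => ?_)
  rw [norm_mul]
  exact mul_le_mul_of_nonneg_right (hM s (Ioo_subset_Icc_self hs)) (norm_nonneg _)

theorem PrimOn.mul {f f' g g' : ℝ → ℝ} (hf : PrimOn f f') (hg : PrimOn g g') :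
    PrimOn (fun s => f s * g s) fun s => f' s * g s + f s * g' s where
  memLp := by
    refine MemLp.add ?_ (memLp_continuousOn_mul hf.continuousOn hg.memLp)
    simpa only [mul_comm] using memLp_continuousOn_mul hg.continuousOn hf.memLp
  prim z hz := by
    have hm : (-1 : ℝ) ∈ Icc (-1 : ℝ) 1 := by norm_num
    rw [integral_product_rule hz.1 (hf.intervalIntegrable_sub hm hz)
      (hg.intervalIntegrable_sub hm hz) (fun x hx => hf.prim x ⟨hx.1, hx.2.trans hz.2⟩)
      (fun x hx => hg.prim x ⟨hx.1, hx.2.trans hz.2⟩)]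
    ring

theorem PrimOn.add {f f' g g' : ℝ → ℝ} (hf : PrimOn f f') (hg : PrimOn g g') :
    PrimOn (fun s => f s + g s) fun s => f' s + g' s where
  memLp := hf.memLp.add hg.memLp
  prim z hz := by
    have hm : (-1 : ℝ) ∈ Icc (-1 : ℝ) 1 := by norm_num
    rw [intervalIntegral.integral_add (hf.intervalIntegrable_sub hm hz)
      (hg.intervalIntegrable_sub hm hz), hf.prim z hz, hg.prim z hz]
    ring

theorem PerH1.primOn {p q : ℝ → ℝ} (h : PerH1 p q) : PrimOn p q :=
  ⟨h.memLp, fun z _ => by rw [← h.prim]; ring⟩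

theorem primOn_linear (c : ℝ) : PrimOn (fun s => c * s) fun _ => c where
  memLp := memLp_const c
  prim z _ := by
    simp
    ring

theorem primOn_const (c : ℝ) : PrimOn (fun _ => c) fun _ => 0 where
  memLp := memLp_const 0
  prim z _ := by simp

theorem integral_volI_neg (f : ℝ → ℝ) : ∫ s, f (-s) ∂volI = ∫ s, f s ∂volI := by
  rw [integral_volI, integral_volI, intervalIntegral.integral_comp_neg]
  simp

theorem integral_volI_odd {f : ℝ → ℝ} (hf : ∀ s, f (-s) = -f s) : ∫ s, f s ∂volI = 0 := by
  have h := integral_volI_neg f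
  simp_rw [hf, integral_neg] at h
  linarith

theorem integral_sq_le_of_le {f : ℝ → ℝ} {M : ℝ} (hf : MemLp f 2 volI)
    (h : ∀ s ∈ Ioo (-1 : ℝ) 1, f s ^ 2 ≤ M) : ∫ s, f s ^ 2 ∂volI ≤ 2 * M := by
  have h1 := integral_mono_ae hf.integrable_sq (integrable_const M) (volI_ae_of h)
  have h2 : volI.real univ = 2 := by simp [Measure.real]; norm_num
  rwa [integral_const, h2, smul_eq_mul] at h1

theorem integral_mul_sq_le_of_le {b f : ℝ → ℝ} {M : ℝ} (hb : ContinuousOn b (Icc (-1) 1))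
    (hf : MemLp f 2 volI) (h : ∀ s ∈ Ioo (-1 : ℝ) 1, b s ^ 2 ≤ M) :
    ∫ s, (b s * f s) ^ 2 ∂volI ≤ M * ∫ s, f s ^ 2 ∂volI := by
  rw [← integral_const_mul]
  refine integral_mono_ae (memLp_continuousOn_mul hb hf).integrable_sq
    (hf.integrable_sq.const_mul M) (volI_ae_of fun s hs => ?_)
  simp only [mul_pow]
  exact mul_le_mul_of_nonneg_right (h s hs) (sq_nonneg _)

theorem integral_add_sq_le {a b c : ℝ → ℝ} (ha : MemLp a 2 volI) (hb : MemLp b 2 volI)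
    (hc : MemLp c 2 volI) : ∫ s, (a s + 2 * b s + c s) ^ 2 ∂volI
      ≤ 3 * ((∫ s, a s ^ 2 ∂volI) + 4 * (∫ s, b s ^ 2 ∂volI) + ∫ s, c s ^ 2 ∂volI) := by
  have i1 : Integrable (fun s => a s ^ 2 + 4 * b s ^ 2) volI :=
    ha.integrable_sq.add (hb.integrable_sq.const_mul 4)
  rw [← integral_const_mul, ← integral_add ha.integrable_sq (hb.integrable_sq.const_mul 4),
    ← integral_add i1 hc.integrable_sq, ← integral_const_mul]
  refine integral_mono ((ha.add (hb.const_mul 2)).add hc).integrable_sq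
    ((i1.add hc.integrable_sq).const_mul 3) fun s => ?_
  nlinarith [sq_nonneg (a s - 2 * b s), sq_nonneg (a s - c s), sq_nonneg (2 * b s - c s)]

/-- The pairing of an absolutely continuous `m` with `u + D_h^* D_h u`. -/
theorem sq_integral_testDeriv_le {m m' m'' u u' u'' : ℝ → ℝ} (hm : PerH1 m m')
    (hm' : PerH1 m' m'') (hu : PerH1 u u') (hu' : PerH1 u' u'') {h : ℝ} (hh : 0 < h) :
    (∫ s, m s * testDeriv h u' s ∂volI) ^ 2
      ≤ 2 * (((∫ s, m s ^ 2 ∂volI) + ∫ s, m'' s ^ 2 ∂volI) * ∫ s, u' s ^ 2 ∂volI) := by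
  have pos : ∀ f : ℝ → ℝ, 0 ≤ ∫ s, f s ^ 2 ∂volI := fun f => integral_nonneg fun _ => sq_nonneg _
  have mem : ∀ {p q : ℝ → ℝ}, PerH1 p q → MemLp p 2 volI := fun hp =>
    memLp_of_continuous hp.continuous
  have sq : ∀ {f g : ℝ → ℝ}, MemLp f 2 volI → MemLp g 2 volI →
      (∫ s, f s * g s ∂volI) ^ 2 ≤ (∫ s, f s ^ 2 ∂volI) * ∫ s, g s ^ 2 ∂volI := by
    intro f g hf hg
    rw [← sq_abs]
    refine (pow_le_pow_left₀ (abs_nonneg _) (abs_integral_mul_le hf hg) 2).trans_eq ?_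
    rw [mul_pow, Real.sq_sqrt (pos _), Real.sq_sqrt (pos _)]
  -- After summation by parts the derivative of `D_h u'` is moved to `D_h m`, so that only `u'` and
  -- `m''` are needed, uniformly in `h`.
  rw [integral_mul_testDeriv hm.continuous hu'.continuous hm.periodic hu'.periodic,
    (hm.dq h).integral_parts (hu.dq h)]
  have h1 := sq (mem hm) (mem hu')
  have h2 := sq (mem (hm'.dq h)) (mem (hu.dq h))
  have h3 := mul_le_mul (hm'.integral_dq_sq_le hh) (hu.integral_dq_sq_le hh) (pos _) (pos _)
  nlinarith [sq_nonneg ((∫ s, m s * u' s ∂volI) + ∫ s, dq h m' s * dq h u s ∂volI)]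

/-- The term with the non-periodic field `v`, tested with `u + D_h^* D_h u`. -/
theorem sq_integral_vertical_le {g g' g'' u u' u'' v v' v'' : ℝ → ℝ} (hg : PerH1 g g')
    (hg' : PerH1 g' g'') (hu : PerH1 u u') (hu' : PerH1 u' u'') (hv : PrimOn v v')
    (hv' : PrimOn v' v'') (hodd : ∀ z, g (-z) = -g z)
    (hcase : v 1 = v (-1) ∨ ∀ z, u' (-z) = -u' z) {h : ℝ} (hh : 0 < h) :
    (∫ s, g s * v s * testDeriv h u' s ∂volI) ^ 2
      ≤ 4000 * (((∫ s, g' s ^ 2 ∂volI) + ∫ s, g'' s ^ 2 ∂volI)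
        * ((∫ s, v s ^ 2 ∂volI) + (∫ s, v' s ^ 2 ∂volI) + ∫ s, v'' s ^ 2 ∂volI)
        * ∫ s, u' s ^ 2 ∂volI) := by
  set γ := (∫ s, g' s ^ 2 ∂volI) + ∫ s, g'' s ^ 2 ∂volI with hγ
  set B := (∫ s, v s ^ 2 ∂volI) + (∫ s, v' s ^ 2 ∂volI) + ∫ s, v'' s ^ 2 ∂volI with hB
  have pos : ∀ f : ℝ → ℝ, 0 ≤ ∫ s, f s ^ 2 ∂volI := fun f => integral_nonneg fun _ => sq_nonneg _
  have hγ0 : 0 ≤ γ := add_nonneg (pos _) (pos _)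
  have hB0 : 0 ≤ B := add_nonneg (add_nonneg (pos _) (pos _)) (pos _)
  have hm : (-1 : ℝ) ∈ Icc (-1 : ℝ) 1 := by norm_num
  have h1 : (1 : ℝ) ∈ Icc (-1 : ℝ) 1 := by norm_num
  have h0 : (0 : ℝ) ∈ Icc (-1 : ℝ) 1 := by norm_num
  have hg1 : g 1 = g (-1) := by
    have := hg.periodic (-1)
    norm_num at this
    exact this
  have hg1' : g' 1 = g' (-1) := by
    have := hg'.periodic (-1)
    norm_num at this
    exact this
  have hgm0 : g (-1) = 0 := by
    have := hodd 1
    linarith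
  have hg00 : g 0 = 0 := by
    have := hodd 0
    simp at this
    linarith
  -- The line of slope `κ` has the same jump between the end points as `v`, so `y = v - κ s` takes
  -- equal values at `±1`.
  let κ := (v 1 - v (-1)) / 2
  let y : ℝ → ℝ := fun s => v s + (-κ) * s
  let y' : ℝ → ℝ := fun s => v' s + (-κ)
  have hy : PrimOn y y' := hv.add (primOn_linear (-κ))
  have hy' : PrimOn y' v'' := by simpa using hv'.add (primOn_const (-κ))
  have hy1 : y 1 = y (-1) := by
    simp only [y, κ]
    ring
  have hcT : Continuous (testDeriv h u') := by
    have := hu'.continuous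
    unfold testDeriv
    fun_prop
  -- The linear correction is invisible: either `κ = 0`, or `g`, `s` and the test function are all
  -- odd and so is their product.
  have hT : ∫ s, g s * v s * testDeriv h u' s ∂volI = ∫ s, g s * y s * testDeriv h u' s ∂volI := by
    have hodd0 : κ * ∫ s, g s * s * testDeriv h u' s ∂volI = 0 := by
      rcases hcase with hv1 | hu1
      · simp [κ, hv1]
      · rw [integral_volI_odd, mul_zero]
        intro s
        have e1 : u' (-s + h) = -u' (s - h) := by rw [← hu1]; ring_nf
        have e2 : u' (-s - h) = -u' (s + h) := by rw [← hu1]; ring_nf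
        simp only [testDeriv]
        rw [hodd, hu1, e1, e2]
        ring
    have e1 : ∀ s, g s * y s * testDeriv h u' s
        = g s * v s * testDeriv h u' s - κ * (g s * s * testDeriv h u' s) := fun s => by
      simp only [y]
      ring
    simp_rw [e1]
    rw [integral_sub, integral_const_mul, hodd0, sub_zero]
    · refine ((hg.continuous.continuousOn.mul hv.continuousOn).mul
        hcT.continuousOn).integrableOn_Icc.mono_set Ioo_subset_Icc_self
    · exact ((memLp_of_continuous ((hg.continuous.mul continuous_id).mul hcT)).integrable
        (by norm_num)).const_mul κ
  have M1 := hg.primOn.mul hy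
  have M2 := (hg'.primOn.mul hy).add (hg.primOn.mul hy')
  let m : ℝ → ℝ := fun s => g s * y s
  let m' : ℝ → ℝ := fun s => g' s * y s + g s * y' s
  let m'' : ℝ → ℝ := fun s => g'' s * y s + g' s * y' s + (g' s * y' s + g s * v'' s)
  -- The end values match: `g` vanishes at `±1`, so `m = g y` is zero there and `m' = g' y` there,
  -- with `g'` periodic and `y(1) = y(-1)`. Without the correction of `v` the function `m'` would
  -- jump.
  have P1 : PerH1 (pext m) (pext m') := perH1_pext M1.memLp M1.prim (by
    simp only [m]
    rw [hg1, hgm0]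
    ring)
  have P2 : PerH1 (pext m') (pext m'') := perH1_pext M2.memLp M2.prim (by
    simp only [m']
    rw [hg1, hgm0, hg1', hy1]
    ring)
  have key := sq_integral_testDeriv_le P1 P2 hu hu' hh
  have c1 : ∀ f : ℝ → ℝ, ∫ s, pext f s ^ 2 ∂volI = ∫ s, f s ^ 2 ∂volI := fun f =>
    integral_congr_ae ((pext_ae_eq f).mono fun s hs => by simp only [hs])
  have c2 : ∫ s, pext m s * testDeriv h u' s ∂volI = ∫ s, g s * y s * testDeriv h u' s ∂volI :=
    integral_congr_ae ((pext_ae_eq m).mono fun s hs => by simp only [hs, m])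
  rw [c1, c1, c2, ← hT] at key
  -- As `g` vanishes at `0`, it is controlled by `g'` alone. This is essential, because
  -- incompressibility bounds `ε⁻¹ ∂_z U₃` and not `ε⁻¹ U₃` directly.
  have bg : ∀ s ∈ Icc (-1 : ℝ) 1, g s ^ 2 ≤ 2 * γ := by
    intro s hs
    have := sq_sub_le_of_prim hg.memLp hg.primOn.sub_eq h0 hs
    rw [hg00, sub_zero] at this
    linarith [pos g'']
  have bg' : ∀ s ∈ Icc (-1 : ℝ) 1, g' s ^ 2 ≤ 4 * γ := fun s _ => hg'.sq_le s
  have bv : ∀ s ∈ Icc (-1 : ℝ) 1, v s ^ 2 ≤ 4 * B := fun s hs =>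
    (hv.sq_le hs).trans (by linarith [pos v''])
  have bv' : ∀ s ∈ Icc (-1 : ℝ) 1, v' s ^ 2 ≤ 4 * B := fun s hs =>
    (hv'.sq_le hs).trans (by linarith [pos v])
  have bκ : κ ^ 2 ≤ B := by
    have := sq_sub_le_of_prim hv.memLp hv.sub_eq hm h1
    have e : κ ^ 2 = (v 1 - v (-1)) ^ 2 / 4 := by simp only [κ]; ring
    rw [e]
    linarith [pos v, pos v'', pos v']
  have by_ : ∀ s ∈ Icc (-1 : ℝ) 1, y s ^ 2 ≤ 16 * B := by
    intro s hs
    have e1 := bv s hs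
    have e2 : s ^ 2 ≤ 1 := by nlinarith [hs.1, hs.2]
    have e3 : (κ * s) ^ 2 ≤ B := by
      rw [mul_pow]
      nlinarith [sq_nonneg κ]
    simp only [y]
    nlinarith [sq_nonneg (v s + κ * s)]
  have by' : ∀ s ∈ Icc (-1 : ℝ) 1, y' s ^ 2 ≤ 16 * B := by
    intro s hs
    have e1 := bv' s hs
    simp only [y']
    nlinarith [sq_nonneg (v' s + κ)]
  have hsub := Ioo_subset_Icc_self (a := (-1 : ℝ)) (b := 1)
  have E1 : ∫ s, m s ^ 2 ∂volI ≤ 64 * (γ * B) := by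
    have := integral_sq_le_of_le (M := 2 * γ * (16 * B)) M1.memLp_self fun s hs => by
      rw [mul_pow]
      exact mul_le_mul (bg s (hsub hs)) (by_ s (hsub hs)) (sq_nonneg _) (by positivity)
    linarith
  -- `1590 = 3 (16 + 4 · 128 + 2)`, where `128 = 2 · 4 · 16` comes from the pointwise bounds of `g'`
  -- and `y'` on an interval of length `2`.
  have E2 : ∫ s, m'' s ^ 2 ∂volI ≤ 1590 * (γ * B) := by
    have f1 := integral_mul_sq_le_of_le hy.continuousOn hg'.memLp fun s hs => by_ s (hsub hs)
    have f2 := integral_mul_sq_le_of_le hg.continuous.continuousOn hv'.memLp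
      fun s hs => bg s (hsub hs)
    have l3 := (hg'.primOn.mul hy').memLp_self
    have f3 := integral_sq_le_of_le (M := 4 * γ * (16 * B)) l3 fun s hs => by
      rw [mul_pow]
      exact mul_le_mul (bg' s (hsub hs)) (by' s (hsub hs)) (sq_nonneg _) (by positivity)
    have l1 := memLp_continuousOn_mul hy.continuousOn hg'.memLp
    have l2 := memLp_continuousOn_mul hg.continuous.continuousOn hv'.memLp
    have f4 : ∫ s, m'' s ^ 2 ∂volI ≤ 3 * ((∫ s, (y s * g'' s) ^ 2 ∂volI)
        + 4 * (∫ s, (g' s * y' s) ^ 2 ∂volI) + ∫ s, (g s * v'' s) ^ 2 ∂volI) := by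
      refine le_trans (le_of_eq ?_) (integral_add_sq_le l1 l3 l2)
      refine integral_congr_ae (ae_of_all _ fun s => ?_)
      simp only [m'']
      ring
    have f5 : 16 * B * ∫ s, g'' s ^ 2 ∂volI ≤ 16 * (γ * B) := by
      nlinarith [mul_nonneg hB0 (pos g')]
    have f6 : 2 * γ * ∫ s, v'' s ^ 2 ∂volI ≤ 2 * (γ * B) := by
      nlinarith [mul_nonneg hγ0 (pos v), mul_nonneg hγ0 (pos v')]
    linarith
  refine key.trans ?_
  have hγB : 0 ≤ γ * B := mul_nonneg hγ0 hB0
  have e1 := mul_le_mul_of_nonneg_right (add_le_add E1 E2) (pos u')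
  have e2 := mul_nonneg hγB (pos u')
  linarith

/-! ### Weak derivatives in the interior of the interval -/

/-- A smooth `2`-periodic cutoff function that vanishes near `±1`. -/
def cut (n : ℕ) (s : ℝ) : ℝ := Real.smoothTransition (n * (1 + Real.cos (Real.pi * s)) - 1)

theorem cut_contDiff (n : ℕ) : ContDiff ℝ (⊤ : ℕ∞) (cut n) := by
  unfold cut
  exact Real.smoothTransition.contDiff.comp (by fun_prop)

theorem cut_periodic (n : ℕ) (s : ℝ) : cut n (s + 2) = cut n s := by
  unfold cut
  rw [mul_add Real.pi, mul_comm Real.pi 2, Real.cos_add_two_pi]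

theorem cut_abs_le (n : ℕ) (s : ℝ) : |cut n s| ≤ 1 := by
  unfold cut
  rw [abs_of_nonneg (Real.smoothTransition.nonneg _)]
  exact Real.smoothTransition.le_one _

theorem cut_continuous (n : ℕ) : Continuous (cut n) := (cut_contDiff n).continuous

theorem cut_deriv_continuous (n : ℕ) : Continuous (deriv (cut n)) :=
  (cut_contDiff n).continuous_deriv (by simp)

theorem cut_deriv_periodic (n : ℕ) : Function.Periodic (deriv (cut n)) 2 := by
  intro s
  rw [← deriv_comp_add_const]
  congr 1
  funext z
  exact cut_periodic n z

theorem exists_cut_deriv_bound (n : ℕ) : ∃ M, ∀ s, |deriv (cut n) s| ≤ M := by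
  obtain ⟨M, hM⟩ := isCompact_Icc.exists_bound_of_continuousOn (s := Icc (-1 : ℝ) 1)
    (cut_deriv_continuous n).continuousOn
  refine ⟨M, fun s => ?_⟩
  have h3 := toIcoMod_mem_Ico (two_pos : (0 : ℝ) < 2) (-1) s
  have h4 : deriv (cut n) s = deriv (cut n) (toIcoMod two_pos (-1) s) := by
    rw [toIcoMod, (cut_deriv_periodic n).sub_zsmul_eq]
  rw [h4]
  exact hM _ ⟨h3.1, by linarith [h3.2]⟩

theorem cut_hasDerivAt (n : ℕ) (s : ℝ) : HasDerivAt (cut n) (deriv (cut n) s) s :=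
  ((cut_contDiff n).differentiable (by simp) s).hasDerivAt

/-- The interval on which the cutoff function is equal to `1`. -/
def cutSet (n : ℕ) : Set ℝ := {s | s ∈ Ioo (-1 : ℝ) 1 ∧ 2 < n * (1 + Real.cos (Real.pi * s))}

theorem isOpen_cutSet (n : ℕ) : IsOpen (cutSet n) :=
  isOpen_Ioo.inter (isOpen_lt continuous_const
    (by fun_prop : Continuous fun s : ℝ => (n : ℝ) * (1 + Real.cos (Real.pi * s))))

theorem cut_eq_one {n : ℕ} {s : ℝ} (hs : s ∈ cutSet n) : cut n s = 1 :=
  Real.smoothTransition.one_of_one_le (by linarith [hs.2])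

theorem cut_deriv_eq_zero {n : ℕ} {s : ℝ} (hs : s ∈ cutSet n) : deriv (cut n) s = 0 := by
  have h : cut n =ᶠ[𝓝 s] fun _ => 1 := by
    filter_upwards [(isOpen_cutSet n).mem_nhds hs] with z hz using cut_eq_one hz
  rw [h.deriv_eq, deriv_const]

theorem cutSet_mono {n m : ℕ} (h : n ≤ m) : cutSet n ⊆ cutSet m := by
  intro s hs
  refine ⟨hs.1, hs.2.trans_le ?_⟩
  have : (n : ℝ) ≤ m := by exact_mod_cast h
  have := Real.neg_one_le_cos (Real.pi * s)
  gcongr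
  linarith

theorem zero_mem_cutSet : (0 : ℝ) ∈ cutSet 2 := by
  refine ⟨by norm_num, ?_⟩
  norm_num

theorem mem_cutSet_of_abs_le {n : ℕ} {s z : ℝ} (hz : z ∈ cutSet n) (h : |s| ≤ |z|) :
    s ∈ cutSet n := by
  have hz1 : |z| < 1 := abs_lt.2 ⟨hz.1.1, hz.1.2⟩
  have h1 : Real.cos (Real.pi * z) ≤ Real.cos (Real.pi * s) := by
    rw [← Real.cos_abs (Real.pi * z), ← Real.cos_abs (Real.pi * s), abs_mul, abs_mul,
      abs_of_pos Real.pi_pos]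
    apply Real.cos_le_cos_of_nonneg_of_le_pi (by positivity)
    · nlinarith [Real.pi_pos]
    · exact mul_le_mul_of_nonneg_left h Real.pi_pos.le
  have h2 := abs_lt.1 (h.trans_lt hz1)
  exact ⟨⟨h2.1, h2.2⟩, hz.2.trans_le (by gcongr)⟩

theorem exists_mem_cutSet {s : ℝ} (hs : s ∈ Ioo (-1 : ℝ) 1) : ∃ n, s ∈ cutSet n := by
  have h0 : 0 < 1 + Real.cos (Real.pi * s) := by
    have h1 : Real.cos Real.pi < Real.cos (Real.pi * |s|) := by
      apply Real.cos_lt_cos_of_nonneg_of_le_pi (by positivity) le_rfl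
      have : |s| < 1 := abs_lt.2 ⟨hs.1, hs.2⟩
      nlinarith [Real.pi_pos]
    have h2 : Real.cos (Real.pi * |s|) = Real.cos (Real.pi * s) := by
      rw [← Real.cos_abs (Real.pi * s), abs_mul, abs_of_pos Real.pi_pos]
    rw [Real.cos_pi, h2] at h1
    linarith
  obtain ⟨n, hn⟩ := exists_nat_gt (2 / (1 + Real.cos (Real.pi * s)))
  exact ⟨n, hs, by rwa [div_lt_iff₀ h0] at hn⟩

/-- If `v'` is the weak derivative of `v` in the interior of `(-1,1)`, then `v` is a primitive of
`v'`. -/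
theorem exists_prim_of_cut {v v' : ℝ → ℝ} (hv : Integrable v volI) (hv' : Integrable v' volI)
    (h : ∀ (n : ℕ) (k : ℤ), ∫ s, v s * (deriv (cut n) s * mode k s
        + cut n s * (Real.pi * k * mode (-k) s)) ∂volI
      = - ∫ s, v' s * (cut n s * mode k s) ∂volI) :
    ∃ c, ∀ᵐ z ∂volI, v z = c + ∫ s in (-1 : ℝ)..z, v' s := by
  have hiv' := intervalIntegrable_of_volI hv'
  have hic : ∀ n, Integrable (fun s => v s * cut n s) volI := fun n =>
    integrable_mul_of_bound hv (cut_continuous n).aestronglyMeasurable (cut_abs_le n)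
  have hic' : ∀ n, Integrable (fun s => v' s * cut n s) volI := fun n =>
    integrable_mul_of_bound hv' (cut_continuous n).aestronglyMeasurable (cut_abs_le n)
  have hid : ∀ n, Integrable (fun s => v s * deriv (cut n) s) volI := fun n => by
    obtain ⟨M, hM⟩ := exists_cut_deriv_bound n
    exact integrable_mul_of_bound hv (cut_deriv_continuous n).aestronglyMeasurable hM
  have him : ∀ {g : ℝ → ℝ} (k : ℤ), Integrable g volI → Integrable (fun s => g s * mode k s) volI :=
    fun k hg => integrable_mul_of_bound hg (mode_continuous k).aestronglyMeasurable (mode_abs_le k)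
  have hgi : ∀ n, Integrable (fun s => v' s * cut n s + v s * deriv (cut n) s) volI := fun n =>
    (hic' n).add (hid n)
  -- The product of `v` with the cutoff is periodic with weak derivative `v' cut + v cut'`, so the
  -- result for the circle applies to it.
  have hn : ∀ n, ∃ c, ∀ᵐ z ∂volI, v z * cut n z
      = c + ∫ s in (-1 : ℝ)..z, (v' s * cut n s + v s * deriv (cut n) s) := by
    intro n
    refine (exists_prim_of_coeff (hic n) (hgi n) fun k => ?_).2
    have h1 := h n k
    have e1 : ∀ s, v s * (deriv (cut n) s * mode k s + cut n s * (Real.pi * k * mode (-k) s))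
        = v s * deriv (cut n) s * mode k s + (Real.pi * k) * (v s * cut n s * mode (-k) s) :=
      fun s => by ring
    have e2 : ∀ s, v' s * (cut n s * mode k s) = v' s * cut n s * mode k s := fun s => by ring
    have e3 : ∀ s, v s * cut n s * (Real.pi * k * mode (-k) s)
        = (Real.pi * k) * (v s * cut n s * mode (-k) s) := fun s => by ring
    simp_rw [e1, e2] at h1
    simp_rw [e3, add_mul]
    rw [integral_add (him k (hid n)) ((him (-k) (hic n)).const_mul _)] at h1
    rw [integral_add (him k (hic' n)) (him k (hid n))]
    linarith
  -- on `cutSet n`, the difference between `v` and a primitive of `v'` is constant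
  have hK : ∀ n, 2 ≤ n → ∃ K, ∀ᵐ z ∂volI, z ∈ cutSet n → v z = K + ∫ s in (-1 : ℝ)..z, v' s := by
    intro n hn2
    obtain ⟨c, hc⟩ := hn n
    have hiw := intervalIntegrable_of_volI (hgi n)
    have hsub : ∀ {q : ℝ → ℝ}, IntervalIntegrable q volume (-1) 1 → ∀ {y z : ℝ},
        y ∈ Icc (-1 : ℝ) 1 → z ∈ Icc (-1 : ℝ) 1 → IntervalIntegrable q volume y z := by
      intro q hq y z hy hz
      refine hq.mono_set ?_
      rw [uIcc_of_le (by norm_num : (-1 : ℝ) ≤ 1)]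
      exact uIcc_subset_Icc hy hz
    have hm : (-1 : ℝ) ∈ Icc (-1 : ℝ) 1 := by norm_num
    have h0 : (0 : ℝ) ∈ Icc (-1 : ℝ) 1 := by norm_num
    refine ⟨c + (∫ s in (-1 : ℝ)..0, (v' s * cut n s + v s * deriv (cut n) s))
      - ∫ s in (-1 : ℝ)..0, v' s, ?_⟩
    filter_upwards [hc] with z hz hzn
    have hzI : z ∈ Icc (-1 : ℝ) 1 := Ioo_subset_Icc_self hzn.1
    rw [cut_eq_one hzn, mul_one, ← intervalIntegral.integral_add_adjacent_intervals
      (hsub hiw hm h0) (hsub hiw h0 hzI)] at hz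
    rw [hz, ← intervalIntegral.integral_add_adjacent_intervals
      (hsub hiv' hm h0) (hsub hiv' h0 hzI)]
    have e1 : ∫ s in (0 : ℝ)..z, (v' s * cut n s + v s * deriv (cut n) s)
        = ∫ s in (0 : ℝ)..z, v' s := by
      refine intervalIntegral.integral_congr fun s hs => ?_
      have hs' : |s| ≤ |z| := by
        rcases le_total 0 z with h0z | h0z
        · rw [uIcc_of_le h0z] at hs
          rw [abs_of_nonneg hs.1, abs_of_nonneg h0z]
          exact hs.2
        · rw [uIcc_of_ge h0z] at hs
          rw [abs_of_nonpos hs.2, abs_of_nonpos h0z]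
          linarith [hs.1]
      have := mem_cutSet_of_abs_le hzn hs'
      rw [cut_eq_one this, cut_deriv_eq_zero this]
      ring
    rw [e1]
    ring
  choose! K hK using hK
  -- The intervals increase with `n` and the one for `n = 2` has positive measure, so the constants
  -- are compared at a common point.
  have hKc : ∀ n, 2 ≤ n → K n = K 2 := by
    intro n hn2
    have hpos : volI (cutSet 2) ≠ 0 := by
      rw [Measure.restrict_apply (isOpen_cutSet 2).measurableSet,
        inter_eq_self_of_subset_left fun s hs => hs.1]
      exact (isOpen_cutSet 2).measure_ne_zero volume ⟨0, zero_mem_cutSet⟩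
    have h1 : ∃ᵐ z ∂volI, z ∈ cutSet 2 := frequently_ae_mem_iff.2 hpos
    obtain ⟨z, hz, h2, h3⟩ := (h1.and_eventually ((hK 2 le_rfl).and (hK n hn2))).exists
    have e2 := h2 hz
    have e3 := h3 (cutSet_mono hn2 hz)
    linarith
  refine ⟨K 2, ?_⟩
  have hall : ∀ᵐ z ∂volI, ∀ n, 2 ≤ n → z ∈ cutSet n → v z = K n + ∫ s in (-1 : ℝ)..z, v' s :=
    ae_all_iff.2 fun n => by
      by_cases hn2 : 2 ≤ n
      · filter_upwards [hK n hn2] with z hz _ using hz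
      · exact ae_of_all _ fun z h2 => absurd h2 hn2
  filter_upwards [hall, ae_restrict_mem measurableSet_Ioo] with z hz hzI
  obtain ⟨n, hzn⟩ := exists_mem_cutSet hzI
  have h2 : 2 ≤ max n 2 := le_max_right _ _
  rw [hz (max n 2) h2 (cutSet_mono (le_max_left _ _) hzn), hKc _ h2]

/-- A function and its two weak derivatives in the interior of `(-1,1)`. -/
theorem exists_primOn_of_cut {v v' v'' : ℝ → ℝ} (hv : Integrable v volI) (hv' : MemLp v' 2 volI)
    (hv'' : MemLp v'' 2 volI)
    (h : ∀ (n : ℕ) (k : ℤ), ∫ s, v s * (deriv (cut n) s * mode k s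
        + cut n s * (Real.pi * k * mode (-k) s)) ∂volI
      = - ∫ s, v' s * (cut n s * mode k s) ∂volI)
    (h' : ∀ (n : ℕ) (k : ℤ), ∫ s, v' s * (deriv (cut n) s * mode k s
        + cut n s * (Real.pi * k * mode (-k) s)) ∂volI
      = - ∫ s, v'' s * (cut n s * mode k s) ∂volI) :
    ∃ p p', PrimOn p p' ∧ PrimOn p' v'' ∧ v =ᵐ[volI] p ∧ v' =ᵐ[volI] p' := by
  obtain ⟨c, hc⟩ := exists_prim_of_cut hv (hv'.integrable (by norm_num)) h
  obtain ⟨c', hc'⟩ := exists_prim_of_cut (hv'.integrable (by norm_num))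
    (hv''.integrable (by norm_num)) h'
  refine ⟨fun z => c + ∫ s in (-1 : ℝ)..z, v' s, fun z => c' + ∫ s in (-1 : ℝ)..z, v'' s,
    ⟨hv'.ae_eq hc', fun z hz => ?_⟩, ⟨hv'', fun z _ => by simp⟩, hc, hc'⟩
  simp only [intervalIntegral.integral_same, add_zero]
  congr 1
  refine intervalIntegral.integral_congr_ae ?_
  have h1 := (ae_restrict_iff' measurableSet_Ioo).1 hc'
  have h2 : ∀ᵐ s, s ≠ (1 : ℝ) := by simp [ae_iff, measure_singleton]
  filter_upwards [h1, h2] with s hs hs1 hsz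
  rw [uIoc_of_le hz.1] at hsz
  exact hs ⟨hsz.1, lt_of_le_of_ne (hsz.2.trans hz.2) hs1⟩

/-! ### Restriction to vertical lines -/

/-- The frequency in the direction `j`. -/
def freq (j : Fin 3) (k : Freq) : ℤ := ![k.2.1, k.2.2, k.1] j

/-- Flips the sign of the frequency in the direction `j`. -/
def flip (j : Fin 3) (k : Freq) : Freq :=
  ![(k.1, -k.2.1, k.2.2), (k.1, k.2.1, -k.2.2), (-k.1, k.2.1, k.2.2)] j

/-- `g'` is the weak derivative of `g` in the direction `j`, tested with the modes. -/
def CoeffDeriv (j : Fin 3) (g g' : Space → ℝ) : Prop :=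
  ∀ k, coeff g' k = -(Real.pi * freq j k * coeff g (flip j k))

theorem flip_flip (j : Fin 3) (k : Freq) : flip j (flip j k) = k := by
  fin_cases j <;> simp [flip]

theorem freq_flip (j : Fin 3) (k : Freq) : freq j (flip j k) = -freq j k := by
  fin_cases j <;> simp [flip, freq]

/-- The vertical integral is a function on `G` all of whose coefficients vanish. In this way an
identity tested with product modes passes to almost every vertical line. -/
theorem fiber_ae_eq_zero {g : Space → ℝ} (hg : Integrable g volBox)
    (h : ∀ l, ∫ x, g x * modeG l x.2 ∂volBox = 0) : ∀ᵐ w ∂volG, ∫ s, g (s, w) ∂volI = 0 := by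
  rw [volBox_eq] at hg h
  refine separates_modeG (fun w => ∫ s, g (s, w) ∂volI) hg.integral_prod_right fun l => ?_
  rw [← h l, integral_prod_symm]
  · refine integral_congr_ae (ae_of_all _ fun w => ?_)
    simp only
    rw [integral_mul_const]
  · exact integrable_mul_of_bound hg
      ((modeG_contDiff l (n := 0)).continuous.comp continuous_snd).aestronglyMeasurable
      (fun x => modeG_abs_le l x.2)

theorem CoeffDeriv.fiber {g g' : Space → ℝ} (hg : Integrable g volBox) (hg' : Integrable g' volBox)
    (h : CoeffDeriv 2 g g') : ∀ᵐ w ∂volG, ∀ k : ℤ,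
      ∫ s, g (s, w) * (Real.pi * k * mode (-k) s) ∂volI = - ∫ s, g' (s, w) * mode k s ∂volI := by
  rw [ae_all_iff]
  intro k
  have hm : ∀ {u : Space → ℝ} (j : ℤ), Integrable u volBox →
      Integrable (fun x : Space => u x * mode j x.1) volBox := fun j hu =>
    integrable_mul_of_bound hu ((mode_continuous j).comp continuous_fst).aestronglyMeasurable
      (fun x => mode_abs_le j x.1)
  have hml : ∀ {u : Space → ℝ} (l : ℤ × ℤ), Integrable u volBox →
      Integrable (fun x : Space => u x * modeG l x.2) volBox := fun l hu =>
    integrable_mul_of_bound hu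
      ((modeG_contDiff l (n := 0)).continuous.comp continuous_snd).aestronglyMeasurable
      (fun x => modeG_abs_le l x.2)
  have hi : Integrable (fun x : Space => Real.pi * k * (g x * mode (-k) x.1) + g' x * mode k x.1)
      volBox := ((hm (-k) hg).const_mul _).add (hm k hg')
  have h1 := fiber_ae_eq_zero hi fun l => by
    have h2 := h (k, l)
    have e1 : ∀ x : Space, (Real.pi * k * (g x * mode (-k) x.1) + g' x * mode k x.1) * modeG l x.2
        = Real.pi * k * (g x * modeBox (-k, l) x) + g' x * modeBox (k, l) x := by
      intro x
      unfold modeBox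
      ring
    simp_rw [e1]
    have hb : ∀ {u : Space → ℝ} (l : Freq), Integrable u volBox →
        Integrable (fun x => u x * modeBox l x) volBox := fun l hu =>
      integrable_mul_of_bound hu (modeBox_aesm l _) (modeBox_abs_le l)
    rw [integral_add ((hb _ hg).const_mul _) (hb _ hg'), integral_const_mul]
    simp only [coeff, freq, flip, Matrix.cons_val] at h2
    rw [h2]
    ring
  have hgf : ∀ᵐ w ∂volG, Integrable (fun s => g (s, w)) volI := by
    rw [volBox_eq] at hg
    exact hg.prod_left_ae
  have hgf' : ∀ᵐ w ∂volG, Integrable (fun s => g' (s, w)) volI := by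
    rw [volBox_eq] at hg'
    exact hg'.prod_left_ae
  filter_upwards [h1, hgf, hgf'] with w hw hw1 hw2
  have hb : ∀ {u : ℝ → ℝ} (l : ℤ), Integrable u volI →
      Integrable (fun x => u x * mode l x) volI := fun l hu =>
    integrable_mul_of_bound hu (mode_continuous l).aestronglyMeasurable (mode_abs_le l)
  rw [integral_add ((hb _ hw1).const_mul _) (hb _ hw2), integral_const_mul] at hw
  have e2 : ∀ s, g (s, w) * (Real.pi * k * mode (-k) s)
      = Real.pi * k * (g (s, w) * mode (-k) s) := fun s => by ring
  simp_rw [e2]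
  rw [integral_const_mul]
  linarith

theorem fiber_memLp {g : Space → ℝ} (hg : MemLp g 2 volBox) :
    ∀ᵐ w ∂volG, MemLp (fun s => g (s, w)) 2 volI := by
  have h1 : AEStronglyMeasurable g (volI.prod volG) := by rw [← volBox_eq]; exact hg.1
  have h2 : Integrable (fun x => g x ^ 2) (volI.prod volG) := by
    rw [← volBox_eq]; exact hg.integrable_sq
  filter_upwards [h1.prodMk_right, h2.prod_left_ae] with w hw1 hw2
  exact (memLp_two_iff_integrable_sq hw1).2 hw2

/-- The vertical lines of a function on the box with two weak derivatives in `z`. -/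
theorem CoeffDeriv.fiber_perH2 {g g' g'' : Space → ℝ} (hg : MemLp g 2 volBox)
    (hg' : MemLp g' 2 volBox) (hg'' : MemLp g'' 2 volBox) (h : CoeffDeriv 2 g g')
    (h' : CoeffDeriv 2 g' g'') : ∀ᵐ w ∂volG, ∃ p q, PerH1 p q ∧ PerH1 q (pext fun s => g'' (s, w))
      ∧ (fun s => g (s, w)) =ᵐ[volI] p ∧ (fun s => g' (s, w)) =ᵐ[volI] q := by
  filter_upwards [h.fiber (hg.integrable (by norm_num)) (hg'.integrable (by norm_num)),
    h'.fiber (hg'.integrable (by norm_num)) (hg''.integrable (by norm_num)),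
    fiber_memLp hg, fiber_memLp hg', fiber_memLp hg''] with w h1 h2 m m' m''
  exact exists_perH2 (m.integrable (by norm_num)) m' m'' h1 h2

/-! ### Partial sums of the expansion in modes -/

/-- The frequencies bounded by `N` in each direction. -/
def freqBox (N : ℕ) : Finset Freq :=
  Finset.Icc (-(N : ℤ)) N ×ˢ (Finset.Icc (-(N : ℤ)) N ×ˢ Finset.Icc (-(N : ℤ)) N)

theorem mem_freqBox {N : ℕ} {k : Freq} : k ∈ freqBox N ↔ ∀ j, |freq j k| ≤ N := by
  simp only [freqBox, Finset.mem_product, Finset.mem_Icc, Fin.forall_fin_succ, freq, abs_le]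
  simp
  tauto

theorem tendsto_freqBox : Tendsto freqBox atTop atTop := by
  refine tendsto_atTop_finset_of_monotone (fun M N h k hk => ?_) fun k => ?_
  · rw [mem_freqBox] at hk ⊢
    exact fun j => (hk j).trans (by exact_mod_cast h)
  · refine ⟨(|freq 0 k| + |freq 1 k| + |freq 2 k|).toNat, ?_⟩
    rw [mem_freqBox]
    have h0 := abs_nonneg (freq 0 k)
    have h1 := abs_nonneg (freq 1 k)
    have h2 := abs_nonneg (freq 2 k)
    rw [Int.toNat_of_nonneg (by positivity)]
    intro j
    fin_cases j <;> simp <;> linarith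

theorem flip_mem_freqBox {N : ℕ} (j : Fin 3) {k : Freq} : flip j k ∈ freqBox N ↔ k ∈ freqBox N := by
  have key : ∀ k, k ∈ freqBox N → flip j k ∈ freqBox N := by
    intro k hk
    rw [mem_freqBox] at hk ⊢
    intro i
    refine le_trans (le_of_eq ?_) (hk i)
    fin_cases j <;> fin_cases i <;> simp [flip, freq]
  refine ⟨fun h => ?_, key k⟩
  rw [← flip_flip j k]
  exact key _ h

/-- The truncation is symmetric under change of sign of each frequency, so shifting a derivative
from one factor to another is exact on truncated sums, without a remainder. -/
theorem sum_flip {E : Type*} [AddCommMonoid E] (N : ℕ) (j : Fin 3) (a : Freq → E) :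
    ∑ k ∈ freqBox N, a (flip j k) = ∑ k ∈ freqBox N, a k :=
  Finset.sum_bij' (fun k _ => flip j k) (fun k _ => flip j k)
    (fun _ h => (flip_mem_freqBox j).2 h) (fun _ h => (flip_mem_freqBox j).2 h)
    (fun k _ => flip_flip j k) (fun k _ => flip_flip j k) (fun _ _ => rfl)

theorem CoeffDeriv.coeff_flip {j : Fin 3} {g g' : Space → ℝ} (h : CoeffDeriv j g g') (k : Freq) :
    coeff g' (flip j k) = Real.pi * freq j k * coeff g k := by
  rw [h, flip_flip, freq_flip]
  push_cast
  ring

theorem integral_trigSum_sq (F : Finset Freq) (c : Freq → ℝ) :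
    ∫ x, trigSum F c x ^ 2 ∂volBox = ∑ k ∈ F, c k ^ 2 := by
  have h1 := hasSum_coeff_sq (memLp_trigSum F c)
  simp_rw [coeff_trigSum] at h1
  have h2 : HasSum (fun k => (if k ∈ F then c k else 0) ^ 2) (∑ k ∈ F, c k ^ 2) := by
    have h3 : HasSum (fun k => (if k ∈ F then c k else 0) ^ 2)
        (∑ k ∈ F, (if k ∈ F then c k else 0) ^ 2) :=
      hasSum_sum_of_ne_finset_zero fun k hk => by simp [hk]
    rwa [Finset.sum_congr rfl fun k hk => by rw [if_pos hk]] at h3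
  exact h1.unique h2

theorem integral_trigSum_coeff_sq_le {g : Space → ℝ} (hg : MemLp g 2 volBox) (F : Finset Freq) :
    ∫ x, trigSum F (coeff g) x ^ 2 ∂volBox ≤ ∫ x, g x ^ 2 ∂volBox := by
  rw [integral_trigSum_sq]
  exact sum_le_hasSum F (fun _ _ => sq_nonneg _) (hasSum_coeff_sq hg)

theorem tendsto_integral_sub_trigSum {g : Space → ℝ} (hg : MemLp g 2 volBox) :
    Tendsto (fun N => ∫ x, (g x - trigSum (freqBox N) (coeff g) x) ^ 2 ∂volBox) atTop (𝓝 0) := by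
  have h1 : ∀ F : Finset Freq, ∫ x, (g x - trigSum F (coeff g) x) ^ 2 ∂volBox
      = (∫ x, g x ^ 2 ∂volBox) - ∑ k ∈ F, coeff g k ^ 2 := by
    intro F
    have e1 := hasSum_coeff_sq (hg.sub (memLp_trigSum F (coeff g)))
    have e2 : HasSum (fun k => if k ∈ F then coeff g k ^ 2 else 0) (∑ k ∈ F, coeff g k ^ 2) := by
      have h3 : HasSum (fun k => if k ∈ F then coeff g k ^ 2 else 0)
          (∑ k ∈ F, if k ∈ F then coeff g k ^ 2 else 0) :=
        hasSum_sum_of_ne_finset_zero fun k hk => by simp [hk]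
      rwa [Finset.sum_congr rfl fun k hk => by rw [if_pos hk]] at h3
    have e3 := (hasSum_coeff_sq hg).sub e2
    refine e1.unique ?_
    have e4 : (fun k => coeff (g - trigSum F (coeff g)) k ^ 2)
        = fun k => coeff g k ^ 2 - if k ∈ F then coeff g k ^ 2 else 0 := by
      funext k
      have := coeff_sub_trigSum hg F k
      change coeff (fun x => g x - trigSum F (coeff g) x) k ^ 2 = _
      rw [this]
      split_ifs <;> simp
    rw [e4]
    exact e3
  simp_rw [h1]
  have h2 := ((hasSum_coeff_sq hg).comp tendsto_freqBox).const_sub (∫ x, g x ^ 2 ∂volBox)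
  rw [sub_self] at h2
  exact h2

/-! ### Ladyzhenskaya's inequality -/

/-- `f(x)² ≤ f(y)² + ∫ 2 |f f'|`, averaged over `y`. -/
theorem ofReal_sq_le_lintegral {f f' : ℝ → ℝ} (hf : ∀ s, HasDerivAt f (f' s) s)
    (hf' : Continuous f') {x : ℝ} (hx : x ∈ Icc (-1 : ℝ) 1) :
    ENNReal.ofReal (f x ^ 2) ≤ ∫⁻ s, ENNReal.ofReal (|f s| * (|f s| + 2 * |f' s|)) ∂volI := by
  have hc : Continuous f := continuous_iff_continuousAt.2 fun s => (hf s).continuousAt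
  have hci : Integrable (fun s => |f s| * (|f s| + 2 * |f' s|)) volI :=
    (memLp_of_continuous (by fun_prop)).integrable (by norm_num)
  rw [← ofReal_integral_eq_lintegral_ofReal hci (ae_of_all _ fun s => by positivity)]
  refine ENNReal.ofReal_le_ofReal ?_
  have hd : ∀ s, HasDerivAt (fun s => f s ^ 2) (2 * f s * f' s) s := fun s => by
    exact ((hf s).fun_pow 2).congr_deriv (by simp)
  have hi2 : Integrable (fun s => 2 * (|f s| * |f' s|)) volI :=
    (memLp_of_continuous (by fun_prop)).integrable (by norm_num)
  have hi1 : Integrable (fun s => f s ^ 2) volI :=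
    (memLp_of_continuous (by fun_prop)).integrable (by norm_num)
  have hsub : ∀ y ∈ Ioo (-1 : ℝ) 1, f x ^ 2 ≤ f y ^ 2 + ∫ s, 2 * (|f s| * |f' s|) ∂volI := by
    intro y hy
    have h1 := intervalIntegral.integral_eq_sub_of_hasDerivAt (a := y) (b := x)
      (fun s _ => hd s) ((by fun_prop : Continuous fun s => 2 * f s * f' s).intervalIntegrable _ _)
    have h2 : |∫ s in y..x, 2 * f s * f' s| ≤ ∫ s, 2 * (|f s| * |f' s|) ∂volI := by
      refine (intervalIntegral.norm_integral_le_integral_norm_uIoc (E := ℝ)).trans ?_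
      have e1 : ∀ s, ‖2 * f s * f' s‖ = 2 * (|f s| * |f' s|) := fun s => by
        simp [mul_assoc]
      simp_rw [e1]
      rw [← integral_Ioc_eq_integral_Ioo]
      refine setIntegral_mono_set ?_ (ae_of_all _ fun _ => by positivity) ?_
      · exact (integrableOn_Ioc_iff_integrableOn_Ioo enorm_ne_top).2 hi2
      · refine ae_of_all _ fun s hs => ?_
        have hs : s ∈ uIoc y x := hs
        rw [uIoc, mem_Ioc] at hs
        exact ⟨lt_of_le_of_lt (le_min hy.1.le hx.1) hs.1, hs.2.trans (max_le hy.2.le hx.2)⟩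
    rw [h1] at h2
    linarith [le_abs_self (f x ^ 2 - f y ^ 2)]
  have h3 := integral_mono_ae (integrable_const _) (hi1.add (integrable_const _)) (volI_ae_of hsub)
  have h2 : volI.real univ = 2 := by simp [Measure.real]; norm_num
  simp only [Pi.add_apply] at h3
  rw [integral_add hi1 (integrable_const _), integral_const, integral_const, h2, smul_eq_mul,
    smul_eq_mul] at h3
  have h4 : ∫ s, |f s| * (|f s| + 2 * |f' s|) ∂volI
      = (∫ s, f s ^ 2 ∂volI) + ∫ s, 2 * (|f s| * |f' s|) ∂volI := by
    rw [← integral_add hi1 hi2]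
    refine integral_congr_ae (ae_of_all _ fun s => ?_)
    have := sq_abs (f s)
    simp only
    rw [← this]
    ring
  rw [h4]
  have h5 : 0 ≤ ∫ s, f s ^ 2 ∂volI := integral_nonneg fun _ => sq_nonneg _
  linarith

/-- The vertical integral of `g²`, a function of the horizontal variables. -/
def vert (g : Space → ℝ) (w : ℝ × ℝ) : ℝ≥0∞ := ∫⁻ s, ENNReal.ofReal (g (s, w) ^ 2) ∂volI

theorem memLp_box_of_continuous {g : Space → ℝ} (hg : Continuous g) : MemLp g 2 volBox := by
  have hc : IsCompact (Icc (-1 : ℝ) 1 ×ˢ (Icc (-1 : ℝ) 1 ×ˢ Icc (-1 : ℝ) 1)) :=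
    isCompact_Icc.prod (isCompact_Icc.prod isCompact_Icc)
  obtain ⟨M, hM⟩ := hc.exists_bound_of_continuousOn hg.continuousOn
  have hsub : box ⊆ Icc (-1 : ℝ) 1 ×ˢ (Icc (-1 : ℝ) 1 ×ˢ Icc (-1 : ℝ) 1) :=
    prod_mono Ioo_subset_Icc_self (prod_mono Ioo_subset_Icc_self Ioo_subset_Icc_self)
  have hmeas : MeasurableSet box :=
    measurableSet_Ioo.prod (measurableSet_Ioo.prod measurableSet_Ioo)
  exact MemLp.of_bound hg.aestronglyMeasurable M
    ((ae_restrict_iff' hmeas).2 (ae_of_all _ fun x hx => hM x (hsub hx)))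

/-- Ladyzhenskaya's argument with values in `L²_z`: the one-dimensional bound in `x` dominates `vert
b` by a function of `y` alone, the bound in `y` by a function of `x` alone. The integral of the
product of these two functions factorizes, and each factor is estimated by Cauchy-Schwarz. -/
theorem lintegral_vert_sq_le_of_smooth {b b₁ b₂ : Space → ℝ} (hb : Continuous b)
    (hb₁ : Continuous b₁) (hb₂ : Continuous b₂)
    (h₁ : ∀ z x y, HasDerivAt (fun x => b (z, x, y)) (b₁ (z, x, y)) x)
    (h₂ : ∀ z x y, HasDerivAt (fun y => b (z, x, y)) (b₂ (z, x, y)) y) :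
    ∫⁻ w, vert b w ^ 2 ∂volG ≤ ENNReal.ofReal (8 * ((∫ x, b x ^ 2 ∂volBox)
      * ((∫ x, b x ^ 2 ∂volBox) + (∫ x, b₁ x ^ 2 ∂volBox) + ∫ x, b₂ x ^ 2 ∂volBox))) := by
  let d : (Space → ℝ) → Space → ℝ≥0∞ := fun c x =>
    ENNReal.ofReal (|b x| * (|b x| + 2 * |c x|))
  have hdm : ∀ c, Continuous c → Measurable (d c) := fun c hc => by
    have : Continuous fun x => |b x| * (|b x| + 2 * |c x|) := by fun_prop
    exact this.measurable.ennreal_ofReal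
  let p : ℝ → ℝ≥0∞ := fun y => ∫⁻ z, ∫⁻ x, d b₁ (z, x, y) ∂volI ∂volI
  let q : ℝ → ℝ≥0∞ := fun x => ∫⁻ z, ∫⁻ y, d b₂ (z, x, y) ∂volI ∂volI
  have hp : ∀ w ∈ horiz, vert b w ≤ p w.2 := fun w hw =>
    lintegral_mono fun z => ofReal_sq_le_lintegral (fun x => h₁ z x w.2) (by fun_prop)
      (Ioo_subset_Icc_self hw.1)
  have hq : ∀ w ∈ horiz, vert b w ≤ q w.1 := fun w hw =>
    lintegral_mono fun z => ofReal_sq_le_lintegral (fun y => h₂ z w.1 y) (by fun_prop)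
      (Ioo_subset_Icc_self hw.2)
  have mp : Measurable fun r : ℝ × ℝ × ℝ => d b₁ (r.2.1, r.2.2, r.1) :=
    (hdm _ hb₁).comp (by fun_prop)
  have mq : Measurable fun r : ℝ × ℝ × ℝ => d b₂ (r.2.1, r.1, r.2.2) :=
    (hdm _ hb₂).comp (by fun_prop)
  have hpm : Measurable p := by
    have h1 : Measurable fun r : ℝ × ℝ => ∫⁻ x, d b₁ (r.2, x, r.1) ∂volI :=
      Measurable.lintegral_prod_right' (f := fun r : (ℝ × ℝ) × ℝ => d b₁ (r.1.2, r.2, r.1.1))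
        ((hdm _ hb₁).comp (by fun_prop))
    exact h1.lintegral_prod_right'
  have hqm : Measurable q := by
    have h1 : Measurable fun r : ℝ × ℝ => ∫⁻ y, d b₂ (r.2, r.1, y) ∂volI :=
      Measurable.lintegral_prod_right' (f := fun r : (ℝ × ℝ) × ℝ => d b₂ (r.1.2, r.1.1, r.2))
        ((hdm _ hb₂).comp (by fun_prop))
    exact h1.lintegral_prod_right'
  have horm : MeasurableSet horiz := measurableSet_Ioo.prod measurableSet_Ioo
  have hIp : ∫⁻ y, p y ∂volI = ∫⁻ x, d b₁ x ∂volBox := by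
    rw [volBox_eq, volG_eq, lintegral_prod _ (hdm _ hb₁).aemeasurable, lintegral_lintegral_swap]
    · refine lintegral_congr fun z => ?_
      have hm : Measurable fun w : ℝ × ℝ => d b₁ (z, w) := (hdm _ hb₁).comp (by fun_prop)
      rw [lintegral_prod_symm _ hm.aemeasurable]
    · exact (Measurable.lintegral_prod_right' (f := fun r : (ℝ × ℝ) × ℝ => d b₁ (r.1.2, r.2, r.1.1))
        ((hdm _ hb₁).comp (by fun_prop))).aemeasurable
  have hIq : ∫⁻ y, q y ∂volI = ∫⁻ x, d b₂ x ∂volBox := by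
    rw [volBox_eq, volG_eq, lintegral_prod _ (hdm _ hb₂).aemeasurable, lintegral_lintegral_swap]
    · refine lintegral_congr fun z => ?_
      have hm : Measurable fun w : ℝ × ℝ => d b₂ (z, w) := (hdm _ hb₂).comp (by fun_prop)
      rw [lintegral_prod _ hm.aemeasurable]
    · exact (Measurable.lintegral_prod_right' (f := fun r : (ℝ × ℝ) × ℝ => d b₂ (r.1.2, r.1.1, r.2))
        ((hdm _ hb₂).comp (by fun_prop))).aemeasurable
  have hmain : ∫⁻ w, vert b w ^ 2 ∂volG ≤ (∫⁻ x, d b₂ x ∂volBox) * ∫⁻ x, d b₁ x ∂volBox := by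
    rw [← hIp, ← hIq, ← lintegral_prod_mul hqm.aemeasurable hpm.aemeasurable, ← volG_eq]
    refine lintegral_mono_ae ((ae_restrict_iff' horm).2 (ae_of_all _ fun w hw => ?_))
    rw [sq]
    exact mul_le_mul' (hq w hw) (hp w hw)
  refine hmain.trans ?_
  have mb := memLp_box_of_continuous hb
  have hreal : ∀ c : Space → ℝ, Continuous c →
      ∫⁻ x, d c x ∂volBox = ENNReal.ofReal (∫ x, |b x| * (|b x| + 2 * |c x|) ∂volBox)
      ∧ (∫ x, |b x| * (|b x| + 2 * |c x|) ∂volBox) ^ 2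
        ≤ (∫ x, b x ^ 2 ∂volBox) * (2 * (∫ x, b x ^ 2 ∂volBox) + 8 * ∫ x, c x ^ 2 ∂volBox) := by
    intro c hc
    have mc := memLp_box_of_continuous hc
    have ms : MemLp (fun x => |b x| + 2 * |c x|) 2 volBox :=
      memLp_box_of_continuous (by fun_prop)
    constructor
    · rw [ofReal_integral_eq_lintegral_ofReal]
      · exact (memLp_box_of_continuous (by fun_prop)).integrable (by norm_num)
      · exact ae_of_all _ fun x => by positivity
    · have h1 := integral_mul_sq_le mb.abs ms
      have e1 : ∀ x, |(|b x|) * (|b x| + 2 * |c x|)| = |b x| * (|b x| + 2 * |c x|) := fun x =>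
        abs_of_nonneg (by positivity)
      simp only [Pi.abs_apply, e1, sq_abs] at h1
      have h2 : ∫ x, (|b x| + 2 * |c x|) ^ 2 ∂volBox
          ≤ 2 * (∫ x, b x ^ 2 ∂volBox) + 8 * ∫ x, c x ^ 2 ∂volBox := by
        rw [← integral_const_mul, ← integral_const_mul,
          ← integral_add (mb.integrable_sq.const_mul 2) (mc.integrable_sq.const_mul 8)]
        refine integral_mono ms.integrable_sq
          ((mb.integrable_sq.const_mul 2).add (mc.integrable_sq.const_mul 8)) fun x => ?_
        have := sq_abs (b x)
        have := sq_abs (c x)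
        nlinarith [sq_nonneg (|b x| - 2 * |c x|)]
      have hb0 : 0 ≤ ∫ x, b x ^ 2 ∂volBox := integral_nonneg fun _ => sq_nonneg _
      have hs0 : 0 ≤ ∫ x, (|b x| + 2 * |c x|) ^ 2 ∂volBox := integral_nonneg fun _ => sq_nonneg _
      calc _ ≤ (√(∫ x, b x ^ 2 ∂volBox) * √(∫ x, (|b x| + 2 * |c x|) ^ 2 ∂volBox)) ^ 2 :=
            pow_le_pow_left₀ (integral_nonneg fun _ => by positivity) h1 2
        _ = (∫ x, b x ^ 2 ∂volBox) * ∫ x, (|b x| + 2 * |c x|) ^ 2 ∂volBox := by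
            rw [mul_pow, Real.sq_sqrt hb0, Real.sq_sqrt hs0]
        _ ≤ _ := mul_le_mul_of_nonneg_left h2 hb0
  obtain ⟨r1, s1⟩ := hreal b₁ hb₁
  obtain ⟨r2, s2⟩ := hreal b₂ hb₂
  rw [r1, r2, ← ENNReal.ofReal_mul (integral_nonneg fun _ => by positivity)]
  refine ENNReal.ofReal_le_ofReal ?_
  have hb0 : 0 ≤ ∫ x, b x ^ 2 ∂volBox := integral_nonneg fun _ => sq_nonneg _
  have hb1 : 0 ≤ ∫ x, b₁ x ^ 2 ∂volBox := integral_nonneg fun _ => sq_nonneg _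
  have hb2 : 0 ≤ ∫ x, b₂ x ^ 2 ∂volBox := integral_nonneg fun _ => sq_nonneg _
  -- The product of the two factors is at most half the sum of their squares.
  nlinarith [sq_nonneg ((∫ x, |b x| * (|b x| + 2 * |b₁ x|) ∂volBox)
    - ∫ x, |b x| * (|b x| + 2 * |b₂ x|) ∂volBox), mul_nonneg hb0 hb0, mul_nonneg hb0 hb1,
    mul_nonneg hb0 hb2]

theorem trigSum_continuous (F : Finset Freq) (c : Freq → ℝ) : Continuous (trigSum F c) := by
  unfold trigSum
  exact continuous_finsetSum _ fun k _ =>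
    continuous_const.mul (modeBox_contDiff k (n := 0)).continuous

theorem CoeffDeriv.trigSum_eq {j : Fin 3} {g g' : Space → ℝ} (h : CoeffDeriv j g g') (N : ℕ)
    (x : Space) : trigSum (freqBox N) (coeff g') x
      = ∑ k ∈ freqBox N, coeff g k * (Real.pi * freq j k * modeBox (flip j k) x) := by
  unfold trigSum
  rw [← sum_flip N j]
  refine Finset.sum_congr rfl fun k _ => ?_
  rw [h.coeff_flip]
  ring

/-- Partial sums of `g` are smooth and their horizontal derivatives are partial sums of `g₁` and
`g₂`, so Bessel's inequality bounds them uniformly. A subsequence converges almost everywhere, and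
Fatou's lemma is used twice, on vertical lines and on `G`. -/
theorem lintegral_vert_sq_le {g g₁ g₂ : Space → ℝ} (hg : MemLp g 2 volBox)
    (hg₁ : MemLp g₁ 2 volBox) (hg₂ : MemLp g₂ 2 volBox) (h₁ : CoeffDeriv 0 g g₁)
    (h₂ : CoeffDeriv 1 g g₂) :
    ∫⁻ w, vert g w ^ 2 ∂volG ≤ ENNReal.ofReal (8 * ((∫ x, g x ^ 2 ∂volBox)
      * ((∫ x, g x ^ 2 ∂volBox) + (∫ x, g₁ x ^ 2 ∂volBox) + ∫ x, g₂ x ^ 2 ∂volBox))) := by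
  let b : ℕ → Space → ℝ := fun N => trigSum (freqBox N) (coeff g)
  have hb : ∀ N, ∫⁻ w, vert (b N) w ^ 2 ∂volG ≤ ENNReal.ofReal (8 * ((∫ x, g x ^ 2 ∂volBox)
      * ((∫ x, g x ^ 2 ∂volBox) + (∫ x, g₁ x ^ 2 ∂volBox) + ∫ x, g₂ x ^ 2 ∂volBox))) := by
    intro N
    refine (lintegral_vert_sq_le_of_smooth (trigSum_continuous _ _)
      (trigSum_continuous (freqBox N) (coeff g₁)) (trigSum_continuous (freqBox N) (coeff g₂))
      (fun z x y => ?_) (fun z x y => ?_)).trans ?_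
    · rw [h₁.trigSum_eq]
      refine HasDerivAt.fun_sum fun k _ => HasDerivAt.const_mul _ ?_
      refine (((mode_hasDerivAt k.2.1 x).mul_const (mode k.2.2 y)).const_mul
        (mode k.1 z)).congr_deriv ?_
      simp only [freq, flip, modeBox, modeG, Matrix.cons_val]
      ring
    · rw [h₂.trigSum_eq]
      refine HasDerivAt.fun_sum fun k _ => HasDerivAt.const_mul _ ?_
      refine (((mode_hasDerivAt k.2.2 y).const_mul (mode k.2.1 x)).const_mul
        (mode k.1 z)).congr_deriv ?_
      simp only [freq, flip, modeBox, modeG, Matrix.cons_val]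
      ring
    · refine ENNReal.ofReal_le_ofReal ?_
      have hp : ∀ f : Space → ℝ, 0 ≤ ∫ x, f x ^ 2 ∂volBox := fun f =>
        integral_nonneg fun _ => sq_nonneg _
      have e0 := integral_trigSum_coeff_sq_le hg (freqBox N)
      have e1 := integral_trigSum_coeff_sq_le hg₁ (freqBox N)
      have e2 := integral_trigSum_coeff_sq_le hg₂ (freqBox N)
      have e3 := mul_le_mul e0 (add_le_add (add_le_add e0 e1) e2)
        (add_nonneg (add_nonneg (hp _) (hp _)) (hp _)) (hp g)
      linarith
  have hL2 : Tendsto (fun N => eLpNorm (b N - g) 2 volBox) atTop (𝓝 0) := by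
    have h1 := (ENNReal.tendsto_ofReal (tendsto_integral_sub_trigSum hg))
    rw [ENNReal.ofReal_zero] at h1
    have h2 : ∀ N, eLpNorm (b N - g) 2 volBox
        = (ENNReal.ofReal (∫ x, (g x - trigSum (freqBox N) (coeff g) x) ^ 2 ∂volBox)) ^ (1 / 2 : ℝ) := by
      intro N
      have hi : Integrable (fun x => (g x - trigSum (freqBox N) (coeff g) x) ^ 2) volBox :=
        (hg.sub (memLp_trigSum _ _)).integrable_sq
      rw [ofReal_integral_eq_lintegral_ofReal hi (ae_of_all _ fun x => sq_nonneg _),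
        eLpNorm_eq_lintegral_rpow_enorm_toReal (by norm_num) (by norm_num)]
      simp only [ENNReal.toReal_ofNat, ENNReal.rpow_ofNat]
      congr 1
      refine lintegral_congr fun x => ?_
      rw [Pi.sub_apply, ← ofReal_norm, ← ENNReal.ofReal_pow (norm_nonneg _), Real.norm_eq_abs,
        sq_abs]
      congr 1
      ring
    simp_rw [h2]
    have h3 := h1.ennrpow_const (1 / 2 : ℝ)
    rwa [ENNReal.zero_rpow_of_pos (by norm_num)] at h3
  have hmeas := tendstoInMeasure_of_tendsto_eLpNorm (two_ne_zero)
    (fun N => (memLp_trigSum (freqBox N) (coeff g)).1) hg.1 hL2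
  obtain ⟨ns, -, hns⟩ := hmeas.exists_seq_tendsto_ae
  have hfib : ∀ᵐ w ∂volG, ∀ᵐ s ∂volI, Tendsto (fun i => b (ns i) (s, w)) atTop (𝓝 (g (s, w))) := by
    rw [volBox_eq] at hns
    have h1 : ∀ᵐ r ∂(volG.prod volI), Tendsto (fun i => b (ns i) r.swap) atTop (𝓝 (g r.swap)) :=
      Measure.measurePreserving_swap.quasiMeasurePreserving.ae hns
    exact Measure.ae_ae_of_ae_prod h1
  have hbm : ∀ N, Measurable fun r : Space => ENNReal.ofReal (b N r ^ 2) := fun N =>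
    ((trigSum_continuous _ _).pow 2).measurable.ennreal_ofReal
  have hvm : ∀ N, Measurable (vert (b N)) := fun N => (hbm N).lintegral_prod_left'
  calc ∫⁻ w, vert g w ^ 2 ∂volG
      ≤ ∫⁻ w, liminf (fun i => vert (b (ns i)) w ^ 2) atTop ∂volG := by
        refine lintegral_mono_ae ?_
        filter_upwards [hfib] with w hw
        have h1 : vert g w ≤ liminf (fun i => vert (b (ns i)) w) atTop := by
          refine le_trans (le_of_eq ?_) (lintegral_liminf_le fun i =>
            (hbm (ns i)).comp (measurable_id.prodMk measurable_const))
          refine lintegral_congr_ae ?_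
          filter_upwards [hw] with s hs
          exact ((ENNReal.tendsto_ofReal (hs.pow 2)).liminf_eq).symm
        have hmono : Monotone fun x : ℝ≥0∞ => x ^ 2 := fun a c h => pow_le_pow_left' h 2
        refine (hmono h1).trans (le_of_eq ?_)
        exact hmono.map_liminf_of_continuousAt (fun i => vert (b (ns i)) w)
          (ENNReal.continuous_pow 2).continuousAt
    _ ≤ liminf (fun i => ∫⁻ w, vert (b (ns i)) w ^ 2 ∂volG) atTop :=
        lintegral_liminf_le fun i => (hvm (ns i)).pow_const 2
    _ ≤ _ := by
        refine (liminf_le_liminf (Eventually.of_forall fun i => hb (ns i))).trans_eq ?_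
        exact liminf_const _

/-! ### Vertical translations on the box -/

/-- Vertical translation by `h` modulo `2`. -/
def shiftBox (h : ℝ) (x : Space) : Space := (toIcoMod (two_pos : (0 : ℝ) < 2) (-1) (x.1 + h), x.2)

theorem measurable_toIcoMod_two : Measurable (toIcoMod (two_pos : (0 : ℝ) < 2) (-1)) := by
  have h : toIcoMod (two_pos : (0 : ℝ) < 2) (-1)
      = fun b => (-1) + Int.fract ((b - (-1)) / 2) * 2 := by
    funext b
    exact toIcoMod_eq_add_fract_mul _ _ _
  rw [h]
  fun_prop

theorem measurePreserving_shift (h : ℝ) :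
    MeasurePreserving (fun s => toIcoMod (two_pos : (0 : ℝ) < 2) (-1) (s + h)) volI volI := by
  have hm : Measurable fun s => toIcoMod (two_pos : (0 : ℝ) < 2) (-1) (s + h) :=
    measurable_toIcoMod_two.comp (by fun_prop)
  refine ⟨hm, ?_⟩
  ext s hs
  rw [Measure.map_apply hm hs, ← measureReal_eq_measureReal_iff, ← integral_indicator_one hs,
    ← integral_indicator_one (hm hs)]
  have h1 := periodic_integral_shift (pext_periodic (s.indicator 1)) h
  rw [integral_congr_ae (pext_ae_eq (s.indicator 1))] at h1
  exact h1

theorem measurePreserving_shiftBox (h : ℝ) : MeasurePreserving (shiftBox h) volBox volBox := by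
  rw [volBox_eq]
  exact (measurePreserving_shift h).prod (MeasurePreserving.id _)

theorem mode_toIcoMod (k : ℤ) (s : ℝ) :
    mode k (toIcoMod (two_pos : (0 : ℝ) < 2) (-1) s) = mode k s := by
  rw [toIcoMod, Function.Periodic.sub_zsmul_eq (mode_periodic k)]

theorem memLp_shift {g : Space → ℝ} (hg : MemLp g 2 volBox) (h : ℝ) :
    MemLp (fun x => g (shiftBox h x)) 2 volBox :=
  hg.comp_measurePreserving (measurePreserving_shiftBox h)

theorem coeff_shift {g : Space → ℝ} (hg : Integrable g volBox) (h : ℝ) (k : Freq) :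
    coeff (fun x => g (shiftBox h x)) k
      = Real.cos (Real.pi * k.1 * h) * coeff g k
        - Real.sin (Real.pi * k.1 * h) * coeff g (flip 2 k) := by
  -- The mode is expressed through the modes at the translated point, so that invariance of the
  -- measure applies to the whole integrand.
  have e1 : ∀ x : Space, modeBox k x = Real.cos (Real.pi * k.1 * h) * modeBox k (shiftBox h x)
      - Real.sin (Real.pi * k.1 * h) * modeBox (flip 2 k) (shiftBox h x) := by
    intro x
    have h1 := mode_add k.1 (x.1 + h) (-h)
    rw [add_neg_cancel_right, mul_neg, Real.cos_neg, Real.sin_neg] at h1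
    simp only [modeBox, shiftBox, mode_toIcoMod, flip, Matrix.cons_val]
    rw [h1]
    ring
  have hb : ∀ l : Freq, Integrable (fun x => g x * modeBox l x) volBox := fun l =>
    integrable_mul_of_bound hg (modeBox_aesm l _) (modeBox_abs_le l)
  have hi : Integrable (fun x => Real.cos (Real.pi * k.1 * h) * (g x * modeBox k x)
      - Real.sin (Real.pi * k.1 * h) * (g x * modeBox (flip 2 k) x)) volBox :=
    ((hb k).const_mul _).sub ((hb _).const_mul _)
  have h2 : coeff (fun x => g (shiftBox h x)) k = ∫ x, (fun x => Real.cos (Real.pi * k.1 * h)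
      * (g x * modeBox k x) - Real.sin (Real.pi * k.1 * h) * (g x * modeBox (flip 2 k) x))
        (shiftBox h x) ∂volBox := by
    unfold coeff
    refine integral_congr_ae (ae_of_all _ fun x => ?_)
    simp only
    rw [e1 x]
    ring
  have h3 := (measurePreserving_shiftBox h).map_eq
  have h4 := integral_map (μ := volBox) (φ := shiftBox h)
    (measurePreserving_shiftBox h).measurable.aemeasurable (f := fun x =>
      Real.cos (Real.pi * k.1 * h) * (g x * modeBox k x)
      - Real.sin (Real.pi * k.1 * h) * (g x * modeBox (flip 2 k) x)) (by rw [h3]; exact hi.1)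
  rw [h2, ← h4, h3, integral_sub ((hb k).const_mul _) ((hb _).const_mul _),
    integral_const_mul, integral_const_mul]
  rfl

/-- The operator `1 + D_h^* D_h` with the difference quotient `D_h` in the vertical direction. -/
def testOp (h : ℝ) (g : Space → ℝ) (x : Space) : ℝ :=
  g x + (2 * g x - g (shiftBox h x) - g (shiftBox (-h) x)) / h ^ 2

/-- The Fourier multiplier of `testOp`. -/
def mult (h : ℝ) (k : Freq) : ℝ := 1 + (2 - 2 * Real.cos (Real.pi * k.1 * h)) / h ^ 2

theorem memLp_testOp {g : Space → ℝ} (hg : MemLp g 2 volBox) (h : ℝ) :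
    MemLp (testOp h g) 2 volBox := by
  have h1 := ((hg.const_mul 2).sub (memLp_shift hg h)).sub (memLp_shift hg (-h))
  have h2 := hg.add (h1.mul_const (h ^ 2)⁻¹)
  have e : testOp h g = g + fun x => (2 * g x - g (shiftBox h x) - g (shiftBox (-h) x))
      * (h ^ 2)⁻¹ := by
    funext x
    simp [testOp, div_eq_mul_inv]
  rw [e]
  exact h2

theorem coeff_testOp {g : Space → ℝ} (hg : MemLp g 2 volBox) (h : ℝ) (k : Freq) :
    coeff (testOp h g) k = mult h k * coeff g k := by
  have hi := hg.integrable (q := 2) (by norm_num)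
  have i1 := (memLp_shift hg h).integrable (q := 2) (by norm_num)
  have i2 := (memLp_shift hg (-h)).integrable (q := 2) (by norm_num)
  have i3 : Integrable (fun x => 2 * g x - g (shiftBox h x)) volBox := (hi.const_mul 2).sub i1
  have i4 : Integrable (fun x => 2 * g x - g (shiftBox h x) - g (shiftBox (-h) x)) volBox :=
    i3.sub i2
  have e1 : testOp h g = fun x => g x
      + (h ^ 2)⁻¹ * (2 * g x - g (shiftBox h x) - g (shiftBox (-h) x)) := by
    funext x
    rw [testOp, div_eq_inv_mul]
  rw [e1, coeff_add hi (i4.const_mul _), coeff_const_mul, coeff_sub i3 i2,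
    coeff_sub (hi.const_mul 2) i1, coeff_const_mul, coeff_shift hi, coeff_shift hi, mult, mul_neg,
    Real.cos_neg, Real.sin_neg]
  ring

theorem mult_flip (h : ℝ) (j : Fin 3) (k : Freq) : mult h (flip j k) = mult h k := by
  fin_cases j <;> simp [mult, flip]

theorem one_le_mult (h : ℝ) (k : Freq) : 1 ≤ mult h k := by
  have := Real.cos_le_one (Real.pi * k.1 * h)
  have : 0 ≤ (2 - 2 * Real.cos (Real.pi * k.1 * h)) / h ^ 2 :=
    div_nonneg (by linarith) (sq_nonneg _)
  unfold mult
  linarith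

/-- `cos x ≥ 1 - x²/2`: the multiplier of `1 + D_h^* D_h` stays below that of `1 - ∂_z²`. -/
theorem mult_le {h : ℝ} (hh : 0 < h) (k : Freq) : mult h k ≤ 1 + (Real.pi * k.1) ^ 2 := by
  have h1 := Real.one_sub_sq_div_two_le_cos (x := Real.pi * k.1 * h)
  unfold mult
  gcongr
  rw [div_le_iff₀ (by positivity)]
  nlinarith

/-- The multiplier is even in each frequency, so the operator commutes with all derivatives. -/
theorem CoeffDeriv.testOp {j : Fin 3} {g g' : Space → ℝ} (hg : MemLp g 2 volBox)
    (hg' : MemLp g' 2 volBox) (H : CoeffDeriv j g g') (h : ℝ) :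
    CoeffDeriv j (testOp h g) (testOp h g') := by
  intro k
  rw [coeff_testOp hg', coeff_testOp hg, mult_flip, H k]
  ring

/-- On vertical lines, `testOp` acts as `testDeriv` on a continuous representative. -/
theorem testOp_fiber {g : Space → ℝ} {w : ℝ × ℝ} {q : ℝ → ℝ} (hq : Function.Periodic q 2)
    (h : (fun s => g (s, w)) =ᵐ[volI] q) (r : ℝ) :
    (fun s => testOp r g (s, w)) =ᵐ[volI] testDeriv r q := by
  have h1 : ∀ a : ℝ, ∀ᵐ s ∂volI, g (shiftBox a (s, w)) = q (s + a) := by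
    intro a
    have h2 := (measurePreserving_shift a).quasiMeasurePreserving.ae h
    filter_upwards [h2] with s hs
    have h3 : q (toIcoMod (two_pos : (0 : ℝ) < 2) (-1) (s + a)) = q (s + a) := by
      rw [toIcoMod, hq.sub_zsmul_eq]
    rw [← h3]
    exact hs
  filter_upwards [h, h1 r, h1 (-r)] with s h2 h3 h4
  rw [testOp, testDeriv, h3, h4, h2, sub_eq_add_neg s r]

/-! ### Interior derivatives on vertical lines -/

/-- `v'` is the weak derivative of `v` in the vertical direction away from `z = ±1`. -/
def CutDeriv (v v' : Space → ℝ) : Prop :=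
  ∀ (n : ℕ) (k : Freq),
    ∫ x, v x * (deriv (cut n) x.1 * modeBox k x
        + cut n x.1 * (Real.pi * k.1 * modeBox (flip 2 k) x)) ∂volBox
      = - ∫ x, v' x * (cut n x.1 * modeBox k x) ∂volBox

theorem CutDeriv.fiber {g g' : Space → ℝ} (hg : Integrable g volBox) (hg' : Integrable g' volBox)
    (h : CutDeriv g g') : ∀ᵐ w ∂volG, ∀ (n : ℕ) (k : ℤ),
      ∫ s, g (s, w) * (deriv (cut n) s * mode k s + cut n s * (Real.pi * k * mode (-k) s)) ∂volI
        = - ∫ s, g' (s, w) * (cut n s * mode k s) ∂volI := by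
  rw [ae_all_iff]
  intro n
  rw [ae_all_iff]
  intro k
  obtain ⟨M, hM⟩ := exists_cut_deriv_bound n
  let a : ℝ → ℝ := fun s => deriv (cut n) s * mode k s + cut n s * (Real.pi * k * mode (-k) s)
  let b : ℝ → ℝ := fun s => cut n s * mode k s
  have hac : Continuous a := ((cut_deriv_continuous n).mul (mode_continuous k)).add
    ((cut_continuous n).mul (continuous_const.mul (mode_continuous (-k))))
  have hbc : Continuous b := (cut_continuous n).mul (mode_continuous k)
  have hbM : ∀ s, |b s| ≤ 2 := fun s => by
    have := mul_le_mul (cut_abs_le n s) (mode_abs_le k s) (abs_nonneg _) zero_le_one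
    rw [abs_mul]
    linarith
  have haM : ∀ s, |a s| ≤ M * 2 + 1 * (|Real.pi * k| * 2) := fun s => by
    refine (abs_add_le _ _).trans ?_
    rw [abs_mul, abs_mul (cut n s), abs_mul (Real.pi * k)]
    have hM0 : 0 ≤ M := (abs_nonneg _).trans (hM s)
    gcongr
    · exact hM s
    · exact mode_abs_le k s
    · exact cut_abs_le n s
    · exact mode_abs_le (-k) s
  have hia : ∀ {u : Space → ℝ}, Integrable u volBox →
      Integrable (fun x : Space => u x * a x.1) volBox := fun hu =>
    integrable_mul_of_bound hu (hac.comp continuous_fst).aestronglyMeasurable fun x => haM x.1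
  have hib : ∀ {u : Space → ℝ}, Integrable u volBox →
      Integrable (fun x : Space => u x * b x.1) volBox := fun hu =>
    integrable_mul_of_bound hu (hbc.comp continuous_fst).aestronglyMeasurable fun x => hbM x.1
  have hml : ∀ {u : Space → ℝ} (l : ℤ × ℤ), Integrable u volBox →
      Integrable (fun x : Space => u x * modeG l x.2) volBox := fun l hu =>
    integrable_mul_of_bound hu
      ((modeG_contDiff l (n := 0)).continuous.comp continuous_snd).aestronglyMeasurable
      (fun x => modeG_abs_le l x.2)
  have h1 := fiber_ae_eq_zero ((hia hg).add (hib hg')) fun l => by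
    have h2 := h n (k, l)
    have e1 : ∀ x : Space, ((fun x : Space => g x * a x.1) + fun x : Space => g' x * b x.1) x
        * modeG l x.2 = g x * a x.1 * modeG l x.2 + g' x * b x.1 * modeG l x.2 := fun x => by
      rw [Pi.add_apply]
      ring
    simp_rw [e1]
    rw [integral_add (hml l (hia hg)) (hml l (hib hg'))]
    have e2 : ∀ x : Space, g x * (deriv (cut n) x.1 * modeBox (k, l) x
        + cut n x.1 * (Real.pi * k * modeBox (flip 2 (k, l)) x)) = g x * a x.1 * modeG l x.2 := by
      intro x
      simp only [a, modeBox, flip, Matrix.cons_val]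
      ring
    have e3 : ∀ x : Space, g' x * (cut n x.1 * modeBox (k, l) x) = g' x * b x.1 * modeG l x.2 := by
      intro x
      simp only [b, modeBox]
      ring
    simp only [e2, e3] at h2
    linarith
  have hgf : ∀ᵐ w ∂volG, Integrable (fun s => g (s, w)) volI := by
    rw [volBox_eq] at hg
    exact hg.prod_left_ae
  have hgf' : ∀ᵐ w ∂volG, Integrable (fun s => g' (s, w)) volI := by
    rw [volBox_eq] at hg'
    exact hg'.prod_left_ae
  filter_upwards [h1, hgf, hgf'] with w hw hw1 hw2
  simp only [Pi.add_apply] at hw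
  rw [integral_add (integrable_mul_of_bound hw1 hac.aestronglyMeasurable haM)
    (integrable_mul_of_bound hw2 hbc.aestronglyMeasurable hbM)] at hw
  linarith

theorem CutDeriv.fiber_primOn {v v' v'' : Space → ℝ} (hv : MemLp v 2 volBox)
    (hv' : MemLp v' 2 volBox) (hv'' : MemLp v'' 2 volBox) (h : CutDeriv v v')
    (h' : CutDeriv v' v'') : ∀ᵐ w ∂volG, ∃ p q, PrimOn p q ∧ PrimOn q (fun s => v'' (s, w))
      ∧ (fun s => v (s, w)) =ᵐ[volI] p ∧ (fun s => v' (s, w)) =ᵐ[volI] q := by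
  filter_upwards [h.fiber (hv.integrable (by norm_num)) (hv'.integrable (by norm_num)),
    h'.fiber (hv'.integrable (by norm_num)) (hv''.integrable (by norm_num)),
    fiber_memLp hv, fiber_memLp hv', fiber_memLp hv''] with w h1 h2 m m' m''
  exact exists_primOn_of_cut (m.integrable (by norm_num)) m' m'' h1 h2

/-! ### Functions with two square integrable derivatives are bounded -/

/-- A summable weight on the integers. -/
def decay (n : ℤ) : ℝ := |(n : ℝ)| ^ (-(4 / 3) : ℝ) + if n = 0 then 1 else 0

theorem decay_nonneg (n : ℤ) : 0 ≤ decay n :=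
  add_nonneg (Real.rpow_nonneg (abs_nonneg _) _) (by split_ifs <;> norm_num)

theorem summable_decay : Summable decay := by
  refine (Real.summable_abs_int_rpow (b := 4 / 3) (by norm_num)).add ?_
  exact (hasSum_ite_eq (0 : ℤ) (1 : ℝ)).summable

/-- The exponent is chosen so that three such factors, one for each direction, make up `Q⁻²`, while
each of them is still summable over the integers. -/
theorem rpow_le_decay {n : ℤ} {Q : ℝ} (hQ : 1 + (Real.pi * n) ^ 2 ≤ Q) :
    Q ^ (-(2 / 3) : ℝ) ≤ decay n := by
  have hQ1 : 1 ≤ Q := by nlinarith [sq_nonneg (Real.pi * n)]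
  by_cases h0 : n = 0
  · have h1 : Q ^ (-(2 / 3) : ℝ) ≤ 1 := Real.rpow_le_one_of_one_le_of_nonpos hQ1 (by norm_num)
    simp only [decay, h0, if_true]
    have := Real.rpow_nonneg (abs_nonneg ((0 : ℤ) : ℝ)) (-(4 / 3) : ℝ)
    linarith
  · have hn : 0 < |(n : ℝ)| := abs_pos.2 (by exact_mod_cast h0)
    rw [decay, if_neg h0, add_zero]
    have e1 : |(n : ℝ)| ^ (-(4 / 3) : ℝ) = (|(n : ℝ)| ^ 2) ^ (-(2 / 3) : ℝ) := by
      rw [← Real.rpow_natCast, ← Real.rpow_mul hn.le]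
      norm_num
    rw [e1]
    refine Real.rpow_le_rpow_of_nonpos (by positivity) ?_ (by norm_num)
    rw [sq_abs]
    have h1 : 1 ≤ Real.pi ^ 2 := one_le_pow₀ (by linarith [Real.pi_gt_three])
    rw [mul_pow] at hQ
    nlinarith [mul_le_mul_of_nonneg_right h1 (sq_nonneg (n : ℝ))]

theorem CoeffDeriv.coeff_second {j : Fin 3} {g g' g'' : Space → ℝ} (h : CoeffDeriv j g g')
    (h' : CoeffDeriv j g' g'') (k : Freq) :
    coeff g'' k = -((Real.pi * freq j k) ^ 2 * coeff g k) := by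
  rw [h', h.coeff_flip]
  ring

/-- The series of modes converges uniformly to a continuous function with the same coefficients. -/
theorem exists_bound_of_summable {u : Space → ℝ} (hu : Integrable u volBox)
    (hs : Summable fun k => |coeff u k|) : ∃ M, ∀ᵐ x ∂volBox, |u x| ≤ M := by
  have hs16 : Summable fun k => 16 * |coeff u k| := hs.mul_left 16
  have hb : ∀ k x, ‖coeff u k * modeBox k x‖ ≤ 16 * |coeff u k| := fun k x => by
    rw [norm_mul, Real.norm_eq_abs, Real.norm_eq_abs, mul_comm]
    exact mul_le_mul_of_nonneg_right (modeBox_abs_le k x) (abs_nonneg _)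
  let g : Space → ℝ := fun x => ∑' k, coeff u k * modeBox k x
  have hgc : Continuous g := continuous_tsum
    (fun k => continuous_const.mul (modeBox_contDiff k (n := 0)).continuous) hs16 hb
  have hgM : ∀ x, |g x| ≤ ∑' k, 16 * |coeff u k| := fun x =>
    tsum_of_norm_bounded hs16.hasSum fun k => hb k x
  have hgi : Integrable g volBox := (memLp_box_of_continuous hgc).integrable (by norm_num)
  refine ⟨∑' k, 16 * |coeff u k|, ?_⟩
  have hug : u =ᵐ[volBox] g := by
    refine ae_eq_of_coeff_eq hu hgi fun l => ?_
    have hF : ∀ k, Integrable (fun x => coeff u k * modeBox k x * modeBox l x) volBox := fun k =>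
      (memLp_box_of_continuous ((continuous_const.mul
        (modeBox_contDiff k (n := 0)).continuous).mul
          (modeBox_contDiff l (n := 0)).continuous)).integrable (by norm_num)
    have h1 := hasSum_integral_of_summable_integral_norm hF ?_
    · have h2 : ∀ k, ∫ x, coeff u k * modeBox k x * modeBox l x ∂volBox
          = if k = l then coeff u l else 0 := by
        intro k
        simp_rw [mul_assoc]
        rw [integral_const_mul, integral_modeBox_mul]
        split_ifs with h
        · rw [h, mul_one]
        · rw [mul_zero]
      simp_rw [h2] at h1
      have h3 := h1.unique (hasSum_ite_eq l (coeff u l))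
      rw [← h3, coeff]
      refine integral_congr_ae (ae_of_all _ fun x => ?_)
      exact tsum_mul_right
    · refine Summable.of_nonneg_of_le (fun k => integral_nonneg fun x => norm_nonneg _)
        (fun k => ?_) ((hs16.mul_right 16).mul_right (volBox.real univ))
      have h4 : ∫ x, ‖coeff u k * modeBox k x * modeBox l x‖ ∂volBox
          ≤ ∫ _, 16 * |coeff u k| * 16 ∂volBox :=
        integral_mono (hF k).norm (integrable_const _) fun x => by
          simp only
          rw [norm_mul]
          exact mul_le_mul (hb k x) (modeBox_abs_le l x) (norm_nonneg _) (by positivity)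
      refine h4.trans (le_of_eq ?_)
      rw [integral_const, smul_eq_mul, mul_comm]
  filter_upwards [hug] with x hx
  rw [hx]
  exact hgM x

/-- `H² ⊂ L^∞` in dimension three: `u - Δu` has the coefficients `Q û`, which are square summable,
and so is `Q⁻¹`. The bound is qualitative. It makes `ω U` and `U₃ ν` square integrable, as
Parseval's identity requires, and does not enter any constant. -/
theorem exists_bound_of_second_derivs {u : Space → ℝ} {d e : Fin 3 → Space → ℝ}
    (hu : MemLp u 2 volBox) (he : ∀ j, MemLp (e j) 2 volBox)
    (h : ∀ j, CoeffDeriv j u (d j)) (h' : ∀ j, CoeffDeriv j (d j) (e j)) :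
    ∃ M, ∀ᵐ x ∂volBox, |u x| ≤ M := by
  refine exists_bound_of_summable (hu.integrable (by norm_num)) ?_
  have hi : ∀ {g : Space → ℝ}, MemLp g 2 volBox → Integrable g volBox := fun hg =>
    hg.integrable (by norm_num)
  have m1 : MemLp (fun x => u x - e 0 x) 2 volBox := hu.sub (he 0)
  have m2 : MemLp (fun x => u x - e 0 x - e 1 x) 2 volBox := m1.sub (he 1)
  have m3 : MemLp (fun x => u x - e 0 x - e 1 x - e 2 x) 2 volBox := m2.sub (he 2)
  let Q : Freq → ℝ := fun k => 1 + (Real.pi * freq 0 k) ^ 2 + (Real.pi * freq 1 k) ^ 2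
    + (Real.pi * freq 2 k) ^ 2
  have hc : ∀ k, coeff (fun x => u x - e 0 x - e 1 x - e 2 x) k = Q k * coeff u k := by
    intro k
    rw [coeff_sub (hi m2) (hi (he 2)), coeff_sub (hi m1) (hi (he 1)), coeff_sub (hi hu) (hi (he 0)),
      (h 0).coeff_second (h' 0), (h 1).coeff_second (h' 1), (h 2).coeff_second (h' 2)]
    ring
  have s1 := (hasSum_coeff_sq m3).summable
  simp_rw [hc] at s1
  have s2 : Summable fun k : Freq => decay k.1 * (decay k.2.1 * decay k.2.2) :=
    summable_decay.mul_of_nonneg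
      (summable_decay.mul_of_nonneg summable_decay decay_nonneg decay_nonneg) decay_nonneg
      fun l => mul_nonneg (decay_nonneg _) (decay_nonneg _)
  refine Summable.of_nonneg_of_le (fun k => abs_nonneg _) (fun k => ?_) (s1.add s2)
  have hQ : 1 ≤ Q k := by
    simp only [Q]
    nlinarith [sq_nonneg (Real.pi * freq 0 k), sq_nonneg (Real.pi * freq 1 k),
      sq_nonneg (Real.pi * freq 2 k)]
  have h0 : 0 < Q k := by linarith
  have h3 : ∀ j, Q k ^ (-(2 / 3) : ℝ) ≤ decay (freq j k) := fun j => by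
    refine rpow_le_decay ?_
    simp only [Q]
    fin_cases j <;> simp <;> nlinarith [sq_nonneg (Real.pi * freq 0 k),
      sq_nonneg (Real.pi * freq 1 k), sq_nonneg (Real.pi * freq 2 k)]
  have hpos := Real.rpow_nonneg h0.le (-(2 / 3) : ℝ)
  -- `Q⁻² = (Q^(-2/3))³`, with one factor spent on each of the three frequencies.
  have h4 : (Q k)⁻¹ ^ 2 ≤ decay k.1 * (decay k.2.1 * decay k.2.2) := by
    have e1 : (Q k)⁻¹ ^ 2 = Q k ^ (-(2 / 3) : ℝ) * (Q k ^ (-(2 / 3) : ℝ) * Q k ^ (-(2 / 3) : ℝ)) := by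
      rw [← Real.rpow_add h0, ← Real.rpow_add h0]
      norm_num
    rw [e1]
    exact mul_le_mul (h3 2) (mul_le_mul (h3 0) (h3 1) hpos (decay_nonneg _)) (by positivity)
      (decay_nonneg _)
  have h5 : |coeff u k| = (Q k)⁻¹ * |Q k * coeff u k| := by
    rw [abs_mul, abs_of_pos h0]
    field_simp
  rw [h5]
  nlinarith [sq_nonneg ((Q k)⁻¹ - |Q k * coeff u k|), sq_abs (Q k * coeff u k),
    sq_nonneg (Q k)⁻¹, sq_nonneg (Q k * coeff u k)]

theorem memLp_mul_of_ae_bound {X : Type*} [MeasurableSpace X] {μ : Measure X} {b f : X → ℝ} {M : ℝ}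
    (hf : MemLp f 2 μ) (hb : AEStronglyMeasurable b μ) (hM : ∀ᵐ x ∂μ, |b x| ≤ M) :
    MemLp (fun x => f x * b x) 2 μ :=
  hf.of_le_mul (c := M) (hf.1.mul hb) (by
    filter_upwards [hM] with x hx
    rw [norm_mul, mul_comm]
    exact mul_le_mul_of_nonneg_right hx (norm_nonneg _))

/-! ### Vertical integrals -/

/-- Cauchy-Schwarz in a form without roots, fitted to the squared estimates on vertical lines that
are integrated over `G`. -/
theorem sq_integral_le_of_sq_le {X : Type*} [MeasurableSpace X] {μ : Measure X} {f a b : X → ℝ}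
    (ha : Integrable a μ) (hb : Integrable b μ) (ha0 : ∀ x, 0 ≤ a x) (hb0 : ∀ x, 0 ≤ b x)
    (h : ∀ᵐ x ∂μ, f x ^ 2 ≤ a x * b x) :
    (∫ x, f x ∂μ) ^ 2 ≤ (∫ x, a x ∂μ) * ∫ x, b x ∂μ := by
  have hs : ∀ {a : X → ℝ}, Integrable a μ → (∀ x, 0 ≤ a x) → MemLp (fun x => √(a x)) 2 μ := by
    intro a ha ha0
    refine (memLp_two_iff_integrable_sq
      (Real.continuous_sqrt.comp_aestronglyMeasurable ha.1)).2 ?_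
    simp_rw [Real.sq_sqrt (ha0 _)]
    exact ha
  have h1 := integral_mul_sq_le (hs ha ha0) (hs hb hb0)
  simp_rw [Real.sq_sqrt (ha0 _), Real.sq_sqrt (hb0 _)] at h1
  have h2 : ‖∫ x, f x ∂μ‖ ≤ ∫ x, |√(a x) * √(b x)| ∂μ := by
    refine norm_integral_le_of_norm_le (G := ℝ) ((hs ha ha0).integrable_mul (hs hb hb0)).abs ?_
    filter_upwards [h] with x hx
    rw [abs_of_nonneg (mul_nonneg (Real.sqrt_nonneg _) (Real.sqrt_nonneg _)),
      ← Real.sqrt_mul (ha0 x)]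
    exact Real.abs_le_sqrt hx
  have h3 := h2.trans h1
  rw [Real.norm_eq_abs, ← Real.sqrt_mul (integral_nonneg ha0)] at h3
  rw [← sq_abs]
  refine (pow_le_pow_left₀ (abs_nonneg _) h3 2).trans (le_of_eq (Real.sq_sqrt ?_))
  exact mul_nonneg (integral_nonneg ha0) (integral_nonneg hb0)

/-- The vertical integral of `g²` as a real number. -/
def vertR (g : Space → ℝ) (w : ℝ × ℝ) : ℝ := ∫ s, g (s, w) ^ 2 ∂volI

theorem vertR_nonneg (g : Space → ℝ) (w : ℝ × ℝ) : 0 ≤ vertR g w :=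
  integral_nonneg fun _ => sq_nonneg _

theorem integrable_vertR {g : Space → ℝ} (hg : MemLp g 2 volBox) : Integrable (vertR g) volG := by
  have h2 : Integrable (fun x => g x ^ 2) (volI.prod volG) := by
    rw [← volBox_eq]; exact hg.integrable_sq
  exact h2.integral_prod_right

theorem integral_vertR {g : Space → ℝ} (hg : MemLp g 2 volBox) :
    ∫ w, vertR g w ∂volG = ∫ x, g x ^ 2 ∂volBox := by
  have h2 : Integrable (fun x => g x ^ 2) (volI.prod volG) := by
    rw [← volBox_eq]; exact hg.integrable_sq
  rw [volBox_eq, integral_prod_symm _ h2]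
  rfl

theorem vert_eq_ofReal {g : Space → ℝ} (hg : MemLp g 2 volBox) :
    ∀ᵐ w ∂volG, vert g w = ENNReal.ofReal (vertR g w) := by
  filter_upwards [fiber_memLp hg] with w hw
  rw [vertR, ofReal_integral_eq_lintegral_ofReal hw.integrable_sq (ae_of_all _ fun s => sq_nonneg _),
    vert]

theorem integrable_of_lintegral_ofReal_le {X : Type*} [MeasurableSpace X] {μ : Measure X}
    {f : X → ℝ} (hf : AEStronglyMeasurable f μ) (h0 : ∀ x, 0 ≤ f x) {M : ℝ} (hM : 0 ≤ M)
    (h : ∫⁻ x, ENNReal.ofReal (f x) ∂μ ≤ ENNReal.ofReal M) :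
    Integrable f μ ∧ ∫ x, f x ∂μ ≤ M := by
  have hi : Integrable f μ := by
    refine ⟨hf, (hasFiniteIntegral_iff_ofReal (ae_of_all _ h0)).2 (h.trans_lt ENNReal.ofReal_lt_top)⟩
  refine ⟨hi, ?_⟩
  rw [← ofReal_integral_eq_lintegral_ofReal hi (ae_of_all _ h0)] at h
  exact (ENNReal.ofReal_le_ofReal_iff hM).1 h

theorem vertR_sq_le {g g₁ g₂ : Space → ℝ} (hg : MemLp g 2 volBox)
    (hg₁ : MemLp g₁ 2 volBox) (hg₂ : MemLp g₂ 2 volBox) (h₁ : CoeffDeriv 0 g g₁)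
    (h₂ : CoeffDeriv 1 g g₂) :
    Integrable (fun w => vertR g w ^ 2) volG ∧
    ∫ w, vertR g w ^ 2 ∂volG ≤ 8 * ((∫ x, g x ^ 2 ∂volBox)
      * ((∫ x, g x ^ 2 ∂volBox) + (∫ x, g₁ x ^ 2 ∂volBox) + ∫ x, g₂ x ^ 2 ∂volBox)) := by
  have hp : ∀ f : Space → ℝ, 0 ≤ ∫ x, f x ^ 2 ∂volBox := fun f => integral_nonneg fun _ => sq_nonneg _
  refine integrable_of_lintegral_ofReal_le ((integrable_vertR hg).1.pow 2) (fun w => sq_nonneg _)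
    (mul_nonneg (by norm_num) (mul_nonneg (hp _) (add_nonneg (add_nonneg (hp _) (hp _)) (hp _))))
    (le_trans (le_of_eq ?_) (lintegral_vert_sq_le hg hg₁ hg₂ h₁ h₂))
  refine lintegral_congr_ae ?_
  filter_upwards [vert_eq_ofReal hg] with w hw
  rw [hw, ← ENNReal.ofReal_pow (vertR_nonneg g w)]
  rfl

theorem integral_congr_sq {f g : ℝ → ℝ} (h : f =ᵐ[volI] g) :
    ∫ s, f s ^ 2 ∂volI = ∫ s, g s ^ 2 ∂volI :=
  integral_congr_ae (by filter_upwards [h] with s hs; rw [hs])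

/-- The transport term on the box, tested with `u + D_h^* D_h u`. -/
theorem sq_integral_box_transport_le {ω ω' ω'' u u' u'' u₁ u₂ u₁' u₂' : Space → ℝ}
    (mω : MemLp ω 2 volBox) (mω' : MemLp ω' 2 volBox) (mω'' : MemLp ω'' 2 volBox)
    (mu : MemLp u 2 volBox) (mu' : MemLp u' 2 volBox) (mu'' : MemLp u'' 2 volBox)
    (mu₁ : MemLp u₁ 2 volBox) (mu₂ : MemLp u₂ 2 volBox) (mu₁' : MemLp u₁' 2 volBox)
    (mu₂' : MemLp u₂' 2 volBox) (hω : CoeffDeriv 2 ω ω') (hω' : CoeffDeriv 2 ω' ω'')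
    (hu : CoeffDeriv 2 u u') (hu' : CoeffDeriv 2 u' u'') (h₁ : CoeffDeriv 0 u u₁)
    (h₂ : CoeffDeriv 1 u u₂) (h₁' : CoeffDeriv 0 u' u₁') (h₂' : CoeffDeriv 1 u' u₂')
    (hP : MemLp (fun x => ω x * u x) 2 volBox) {h : ℝ} (hh : 0 < h) :
    (∫ x, ω x * u x * testOp h u' x ∂volBox) ^ 2
      ≤ 1600 * (((∫ x, ω' x ^ 2 ∂volBox) + ∫ x, ω'' x ^ 2 ∂volBox)
        * (((∫ x, u x ^ 2 ∂volBox) + ∫ x, u' x ^ 2 ∂volBox)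
          * ((∫ x, u x ^ 2 ∂volBox) + (∫ x, u' x ^ 2 ∂volBox) + ((∫ x, u₁ x ^ 2 ∂volBox)
            + (∫ x, u₂ x ^ 2 ∂volBox) + (∫ x, u₁' x ^ 2 ∂volBox) + ∫ x, u₂' x ^ 2 ∂volBox)))) := by
  have hp : ∀ f : Space → ℝ, 0 ≤ ∫ x, f x ^ 2 ∂volBox := fun f => integral_nonneg fun _ => sq_nonneg _
  have hint : Integrable (fun x => ω x * u x * testOp h u' x) (volI.prod volG) := by
    rw [← volBox_eq]
    exact hP.integrable_mul (memLp_testOp mu' h)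
  obtain ⟨i1, b1⟩ := vertR_sq_le mu mu₁ mu₂ h₁ h₂
  obtain ⟨i2, b2⟩ := vertR_sq_le mu' mu₁' mu₂' h₁' h₂'
  have ia : Integrable (fun w => 100 * (vertR ω' w + vertR ω'' w)) volG :=
    ((integrable_vertR mω').add (integrable_vertR mω'')).const_mul 100
  have ib : Integrable (fun w => 2 * vertR u w ^ 2 + 2 * vertR u' w ^ 2) volG :=
    (i1.const_mul 2).add (i2.const_mul 2)
  have key := sq_integral_le_of_sq_le (f := fun w => ∫ s, ω (s, w) * u (s, w) * testOp h u' (s, w) ∂volI)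
    ia ib (fun w => mul_nonneg (by norm_num) (add_nonneg (vertR_nonneg _ _) (vertR_nonneg _ _)))
    (fun w => by positivity) (by
      filter_upwards [hω.fiber_perH2 mω mω' mω'' hω', hu.fiber_perH2 mu mu' mu'' hu'] with w h1 h2
      obtain ⟨p, p', hp1, hp2, e1, e2⟩ := h1
      obtain ⟨q, q', hq1, hq2, e3, e4⟩ := h2
      have h3 := sq_integral_transport_le hp1 hp2 hq1 hq2 hh
      rw [integral_congr_sq (pext_ae_eq _), ← integral_congr_sq e2, ← integral_congr_sq e3,
        ← integral_congr_sq e4] at h3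
      have h4 : ∫ s, ω (s, w) * u (s, w) * testOp h u' (s, w) ∂volI
          = ∫ s, p s * q s * testDeriv h q' s ∂volI := by
        refine integral_congr_ae ?_
        filter_upwards [e1, e3, testOp_fiber hq2.periodic e4 h] with s s1 s2 s3
        rw [s1, s2, s3]
      rw [h4]
      refine h3.trans ?_
      change 100 * ((vertR ω' w + vertR ω'' w) * (vertR u w + vertR u' w) ^ 2) ≤ _
      rw [← mul_assoc]
      refine mul_le_mul_of_nonneg_left ?_
        (mul_nonneg (by norm_num) (add_nonneg (vertR_nonneg _ _) (vertR_nonneg _ _)))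
      nlinarith [sq_nonneg (vertR u w - vertR u' w)])
  rw [← integral_prod_symm _ hint, ← volBox_eq, integral_const_mul,
    integral_add (integrable_vertR mω') (integrable_vertR mω''), integral_vertR mω',
    integral_vertR mω'', integral_add (i1.const_mul 2) (i2.const_mul 2), integral_const_mul,
    integral_const_mul] at key
  refine key.trans ?_
  have h5 : 2 * (∫ w, vertR u w ^ 2 ∂volG) + 2 * (∫ w, vertR u' w ^ 2 ∂volG)
      ≤ 16 * (((∫ x, u x ^ 2 ∂volBox) + ∫ x, u' x ^ 2 ∂volBox)
          * ((∫ x, u x ^ 2 ∂volBox) + (∫ x, u' x ^ 2 ∂volBox) + ((∫ x, u₁ x ^ 2 ∂volBox)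
            + (∫ x, u₂ x ^ 2 ∂volBox) + (∫ x, u₁' x ^ 2 ∂volBox) + ∫ x, u₂' x ^ 2 ∂volBox))) := by
    have := hp u
    have := hp u'
    have := hp u₁
    have := hp u₂
    have := hp u₁'
    have := hp u₂'
    generalize (∫ x, u x ^ 2 ∂volBox) = a at *
    generalize (∫ x, u' x ^ 2 ∂volBox) = a' at *
    generalize (∫ x, u₁ x ^ 2 ∂volBox) = c at *
    generalize (∫ x, u₂ x ^ 2 ∂volBox) = d at *
    generalize (∫ x, u₁' x ^ 2 ∂volBox) = c' at *
    generalize (∫ x, u₂' x ^ 2 ∂volBox) = d' at *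
    have p1 : 0 ≤ a * (a' + c' + d') := by positivity
    have p2 : 0 ≤ a' * (a + c + d) := by positivity
    linarith
  have h6 := mul_le_mul_of_nonneg_left h5
    (mul_nonneg (by norm_num : (0 : ℝ) ≤ 100) (add_nonneg (hp ω') (hp ω'')))
  linarith

/-- Continuity and periodicity extend the relation from almost every point of the interval to the
whole line. -/
theorem parity_of_ae {p : ℝ → ℝ} (hp : Function.Periodic p 2) (hc : Continuous p) {c : ℝ}
    (h : ∀ᵐ s ∂volI, p (-s) = c * p s) (s : ℝ) : p (-s) = c * p s := by
  have h1 : EqOn (fun s => p (-s)) (fun s => c * p s) (Icc (-1) 1) := by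
    refine Measure.eqOn_Icc_of_ae_eq volume (by norm_num) ?_ (by fun_prop) (by fun_prop)
    rw [← restrict_Ioo_eq_restrict_Icc]
    exact h
  have h2 := periodic_ext (f := fun s => p (-s)) (g := fun s => c * p s)
    (fun s => by
      have := hp (-s - 2)
      simp only
      rw [neg_add, ← sub_eq_add_neg, ← this]
      ring_nf) (fun s => by simp only; rw [hp]) fun s hs => h1 (Ico_subset_Icc_self hs)
  exact congrFun h2 s

theorem ae_fiber {p : Space → Prop} (h : ∀ᵐ x ∂volBox, p x) : ∀ᵐ w ∂volG, ∀ᵐ s ∂volI, p (s, w) := by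
  rw [volBox_eq] at h
  exact Measure.ae_ae_of_ae_prod (Measure.measurePreserving_swap.quasiMeasurePreserving.ae h)

/-- The term with the field that is not periodic, on the box, tested with `u + D_h^* D_h u`. -/
theorem sq_integral_box_vertical_le {g g' g'' v v' v'' u u' u'' : Space → ℝ}
    (mg : MemLp g 2 volBox) (mg' : MemLp g' 2 volBox) (mg'' : MemLp g'' 2 volBox)
    (mu : MemLp u 2 volBox) (mu' : MemLp u' 2 volBox) (mu'' : MemLp u'' 2 volBox)
    (mv : MemLp v 2 volBox) (mv' : MemLp v' 2 volBox) (mv'' : MemLp v'' 2 volBox)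
    (hg : CoeffDeriv 2 g g') (hg' : CoeffDeriv 2 g' g'') (hu : CoeffDeriv 2 u u')
    (hu' : CoeffDeriv 2 u' u'') (hv : CutDeriv v v') (hv' : CutDeriv v' v'')
    (hodd : ∀ᵐ x ∂volBox, g (-x.1, x.2) = -1 * g x)
    (hcase : CoeffDeriv 2 v v' ∨ ∀ᵐ x ∂volBox, u (-x.1, x.2) = 1 * u x)
    (hP : MemLp (fun x => g x * v x) 2 volBox)
    (hi : Integrable (fun w => (vertR v w + vertR v' w + vertR v'' w) * vertR u' w) volG)
    {h : ℝ} (hh : 0 < h) :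
    (∫ x, g x * v x * testOp h u' x ∂volBox) ^ 2
      ≤ 4000 * (((∫ x, g' x ^ 2 ∂volBox) + ∫ x, g'' x ^ 2 ∂volBox)
        * ∫ w, (vertR v w + vertR v' w + vertR v'' w) * vertR u' w ∂volG) := by
  have hint : Integrable (fun x => g x * v x * testOp h u' x) (volI.prod volG) := by
    rw [← volBox_eq]
    exact hP.integrable_mul (memLp_testOp mu' h)
  have ia : Integrable (fun w => 4000 * (vertR g' w + vertR g'' w)) volG :=
    ((integrable_vertR mg').add (integrable_vertR mg'')).const_mul 4000
  -- On a line, a weak derivative on the circle has mean zero, which is the absence of a jump of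
  -- `v`.
  have hcase' : ∀ᵐ w ∂volG, (∫ s, v' (s, w) ∂volI = 0) ∨
      ∀ᵐ s ∂volI, u (-s, w) = 1 * u (s, w) := by
    rcases hcase with h1 | h1
    · filter_upwards [h1.fiber (mv.integrable (by norm_num)) (mv'.integrable (by norm_num))]
        with w hw
      left
      have h2 := hw 0
      have e0 : ∀ s, mode 0 s = mode 0 0 := fun s => by simp [mode]
      have e1 : mode 0 0 ≠ 0 := by simp [mode]
      simp only [Int.cast_zero, mul_zero, zero_mul, integral_zero] at h2
      rw [integral_congr_ae (ae_of_all _ fun s => by rw [e0 s]), integral_mul_const] at h2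
      have h3 := neg_eq_zero.1 h2.symm
      exact (mul_eq_zero.1 h3).resolve_right e1
    · filter_upwards [ae_fiber h1] with w hw
      exact Or.inr hw
  have key := sq_integral_le_of_sq_le
    (f := fun w => ∫ s, g (s, w) * v (s, w) * testOp h u' (s, w) ∂volI)
    ia hi (fun w => mul_nonneg (by norm_num) (add_nonneg (vertR_nonneg _ _) (vertR_nonneg _ _)))
    (fun w => mul_nonneg (add_nonneg (add_nonneg (vertR_nonneg _ _) (vertR_nonneg _ _))
      (vertR_nonneg _ _)) (vertR_nonneg _ _)) (by
      filter_upwards [hg.fiber_perH2 mg mg' mg'' hg', hu.fiber_perH2 mu mu' mu'' hu',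
        hv.fiber_primOn mv mv' mv'' hv', ae_fiber hodd, hcase'] with w h1 h2 h5 ho hc
      obtain ⟨p, p', hp1, hp2, e1, e2⟩ := h1
      obtain ⟨q, q', hq1, hq2, e3, e4⟩ := h2
      obtain ⟨r, r', hr1, hr2, e5, e6⟩ := h5
      have hneg : ∀ {a b : ℝ → ℝ}, a =ᵐ[volI] b → ∀ᵐ s ∂volI, a (-s) = b (-s) := by
        intro a b hab
        have hq : Measure.QuasiMeasurePreserving (fun s : ℝ => -s) volI volI := by
          refine ⟨measurable_neg, ?_⟩
          have : Measure.map (fun s : ℝ => -s) volI = volI := by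
            have h7 := (Measure.measurePreserving_neg (volume : Measure ℝ)).restrict_preimage
              (measurableSet_Ioo (a := (-1 : ℝ)) (b := 1))
            have h8 : Neg.neg ⁻¹' Ioo (-1 : ℝ) 1 = Ioo (-1) 1 := by simp
            rw [h8] at h7
            exact h7.map_eq
          rw [this]
        exact hq.ae hab
      have hpodd : ∀ z, p (-z) = -p z := fun z => by
        have h6 := parity_of_ae (c := -1) hp1.periodic hp1.continuous (by
          filter_upwards [e1, hneg e1, ho] with s s1 s2 s3
          rw [← s1, ← s2, s3]) z
        rw [h6, neg_one_mul]
      have hcc : r 1 = r (-1) ∨ ∀ z, q' (-z) = -q' z := by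
        rcases hc with hc | hc
        · left
          rw [hr1.prim 1 (by norm_num), ← integral_volI, ← integral_congr_ae e6, hc, add_zero]
        · right
          intro z
          have h6 := parity_of_ae (c := 1) hq1.periodic hq1.continuous (by
            filter_upwards [e3, hneg e3, hc] with s s1 s2 s3
            rw [← s1, ← s2, s3])
          have h7 := (hq1.hasDerivAt hq2.continuous (-z)).scomp z (hasDerivAt_neg z)
          have h8 : q ∘ Neg.neg = q := by
            funext s
            have := h6 s
            simp only [one_mul] at this
            exact this
          rw [h8] at h7
          have h9 := h7.unique (hq1.hasDerivAt hq2.continuous z)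
          rw [neg_one_smul] at h9
          linarith
      have h3 := sq_integral_vertical_le hp1 hp2 hq1 hq2 hr1 hr2 hpodd hcc hh
      rw [integral_congr_sq (pext_ae_eq _), ← integral_congr_sq e2, ← integral_congr_sq e5,
        ← integral_congr_sq e4, ← integral_congr_sq e6] at h3
      have h4 : ∫ s, g (s, w) * v (s, w) * testOp h u' (s, w) ∂volI
          = ∫ s, p s * r s * testDeriv h q' s ∂volI := by
        refine integral_congr_ae ?_
        filter_upwards [e1, e5, testOp_fiber hq2.periodic e4 h] with s s1 s2 s3
        rw [s1, s2, s3]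
      rw [h4]
      refine h3.trans (le_of_eq ?_)
      change 4000 * ((vertR g' w + vertR g'' w) * (vertR v w + vertR v' w + vertR v'' w)
        * vertR u' w) = _
      ring)
  rw [← integral_prod_symm _ hint, ← volBox_eq, integral_const_mul,
    integral_add (integrable_vertR mg') (integrable_vertR mg''), integral_vertR mg',
    integral_vertR mg''] at key
  linarith

/-! ### The mixed norm of the field -/

/-- The vertical integral is taken outside first, and Hölder's inequality is applied on each
horizontal section. This order produces `L⁴(G)` inside and the integral over `z` outside, as in the
norm of `H²_z L⁴_xy`. -/
theorem lintegral_vert_mul_le {v : Space → ℝ} (hv : AEStronglyMeasurable v volBox) {b : ℝ × ℝ → ℝ≥0∞}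
    (hb : AEMeasurable b volG) (hb0 : ∀ w, b w ≠ ∞)
    (htop : ∫⁻ w, b w ^ 2 ∂volG ≠ ∞) :
    ∫⁻ w, vert v w * b w ∂volG
      ≤ (∫⁻ s, (∫⁻ w, ENNReal.ofReal ((v (s, w) ^ 2) ^ 2) ∂volG) ^ (1 / 2 : ℝ) ∂volI)
        * (∫⁻ w, b w ^ 2 ∂volG) ^ (1 / 2 : ℝ) := by
  rw [volBox_eq] at hv
  have hm : AEMeasurable (fun x : Space => ENNReal.ofReal (v x ^ 2)) (volI.prod volG) :=
    (hv.aemeasurable.pow_const 2).ennreal_ofReal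
  have hm2 : AEMeasurable (fun x : Space => ENNReal.ofReal (v x ^ 2) * b x.2) (volI.prod volG) :=
    hm.mul (hb.comp_quasiMeasurePreserving Measure.quasiMeasurePreserving_snd)
  have h1 : ∫⁻ w, vert v w * b w ∂volG
      = ∫⁻ s, ∫⁻ w, ENNReal.ofReal (v (s, w) ^ 2) * b w ∂volG ∂volI := by
    rw [lintegral_lintegral_swap hm2]
    refine lintegral_congr fun w => ?_
    rw [vert, lintegral_mul_const' _ _ (hb0 w)]
  rw [h1]
  rw [← lintegral_mul_const' _ _ (ENNReal.rpow_ne_top_of_nonneg (by norm_num) htop)]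
  refine lintegral_mono_ae ?_
  filter_upwards [hv.prodMk_left] with s hs
  have h2 := ENNReal.lintegral_mul_le_Lp_mul_Lq volG Real.HolderConjugate.two_two
    (hs.aemeasurable.pow_const 2).ennreal_ofReal hb
  refine h2.trans (le_of_eq ?_)
  simp only [ENNReal.rpow_ofNat]
  simp_rw [ENNReal.ofReal_pow (sq_nonneg _)]

/-- The square of the `L⁴(G)`-norm of a vector field on a horizontal section. -/
def sectionL4 (g : Fin 3 → Space → ℝ) (s : ℝ) : ℝ≥0∞ :=
  (∫⁻ w, ENNReal.ofReal ((∑ i, g i (s, w) ^ 2) ^ 2) ∂volG) ^ (1 / 2 : ℝ)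

theorem lintegral_vert_mul_le_sectionL4 {g : Fin 3 → Space → ℝ} {i : Fin 3}
    (hv : AEStronglyMeasurable (g i) volBox) {b : ℝ × ℝ → ℝ≥0∞}
    (hb : AEMeasurable b volG) (hb0 : ∀ w, b w ≠ ∞) (htop : ∫⁻ w, b w ^ 2 ∂volG ≠ ∞) :
    ∫⁻ w, vert (g i) w * b w ∂volG
      ≤ (∫⁻ s, sectionL4 g s ∂volI) * (∫⁻ w, b w ^ 2 ∂volG) ^ (1 / 2 : ℝ) := by
  refine (lintegral_vert_mul_le hv hb hb0 htop).trans ?_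
  refine mul_le_mul' (lintegral_mono fun s => ENNReal.rpow_le_rpow ?_ (by norm_num)) le_rfl
  refine lintegral_mono fun w => ENNReal.ofReal_le_ofReal (pow_le_pow_left₀ (sq_nonneg _) ?_ 2)
  exact Finset.single_le_sum (f := fun i => g i (s, w) ^ 2) (fun j _ => sq_nonneg _)
    (Finset.mem_univ i)

theorem integral_vertR_mul_le {ν ν' ν'' : Fin 3 → Space → ℝ} {i : Fin 3}
    (m : MemLp (ν i) 2 volBox) (m' : MemLp (ν' i) 2 volBox) (m'' : MemLp (ν'' i) 2 volBox)
    {N : ℝ} (hN0 : 0 ≤ N)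
    (hN : ∫⁻ s, (sectionL4 ν s + sectionL4 ν' s + sectionL4 ν'' s) ∂volI ≤ ENNReal.ofReal N)
    {u : Space → ℝ} (mu : MemLp u 2 volBox) (hu : Integrable (fun w => vertR u w ^ 2) volG) :
    Integrable (fun w => (vertR (ν i) w + vertR (ν' i) w + vertR (ν'' i) w) * vertR u w) volG
    ∧ ∫ w, (vertR (ν i) w + vertR (ν' i) w + vertR (ν'' i) w) * vertR u w ∂volG
      ≤ N * √(∫ w, vertR u w ^ 2 ∂volG) := by
  have aem : ∀ {g : Space → ℝ}, MemLp g 2 volBox → AEStronglyMeasurable (vertR g) volG :=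
    fun hg => (integrable_vertR hg).1
  refine integrable_of_lintegral_ofReal_le ((((aem m).add (aem m')).add (aem m'')).mul (aem mu))
    (fun w => mul_nonneg (add_nonneg (add_nonneg (vertR_nonneg _ _) (vertR_nonneg _ _))
      (vertR_nonneg _ _)) (vertR_nonneg _ _)) (by positivity) ?_
  let b : ℝ × ℝ → ℝ≥0∞ := fun w => ENNReal.ofReal (vertR u w)
  have hb : AEMeasurable b volG := (aem mu).aemeasurable.ennreal_ofReal
  have hb0 : ∀ w, b w ≠ ∞ := fun w => ENNReal.ofReal_ne_top
  have hb2 : ∫⁻ w, b w ^ 2 ∂volG = ENNReal.ofReal (∫ w, vertR u w ^ 2 ∂volG) := by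
    rw [ofReal_integral_eq_lintegral_ofReal hu (ae_of_all _ fun w => sq_nonneg _)]
    refine lintegral_congr fun w => ?_
    rw [ENNReal.ofReal_pow (vertR_nonneg _ _)]
  have htop : ∫⁻ w, b w ^ 2 ∂volG ≠ ∞ := by
    rw [hb2]
    exact ENNReal.ofReal_ne_top
  have vm : ∀ {g : Space → ℝ}, MemLp g 2 volBox → AEMeasurable (vert g) volG := fun hg =>
    ((aem hg).aemeasurable.ennreal_ofReal).congr (by
      filter_upwards [vert_eq_ofReal hg] with w hw
      rw [hw])
  calc ∫⁻ w, ENNReal.ofReal ((vertR (ν i) w + vertR (ν' i) w + vertR (ν'' i) w) * vertR u w) ∂volG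
      = ∫⁻ w, (vert (ν i) w * b w + vert (ν' i) w * b w + vert (ν'' i) w * b w) ∂volG := by
        refine lintegral_congr_ae ?_
        filter_upwards [vert_eq_ofReal m, vert_eq_ofReal m', vert_eq_ofReal m''] with w h1 h2 h3
        rw [h1, h2, h3, ← add_mul, ← add_mul, ← ENNReal.ofReal_add (vertR_nonneg _ _)
          (vertR_nonneg _ _), ← ENNReal.ofReal_add (add_nonneg (vertR_nonneg _ _)
          (vertR_nonneg _ _)) (vertR_nonneg _ _), ← ENNReal.ofReal_mul
          (add_nonneg (add_nonneg (vertR_nonneg _ _) (vertR_nonneg _ _)) (vertR_nonneg _ _))]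
    _ = (∫⁻ w, vert (ν i) w * b w ∂volG) + (∫⁻ w, vert (ν' i) w * b w ∂volG)
        + ∫⁻ w, vert (ν'' i) w * b w ∂volG := by
        have m1 : AEMeasurable (fun w => vert (ν i) w * b w) volG := (vm m).mul hb
        have m2 : AEMeasurable (fun w => vert (ν i) w * b w + vert (ν' i) w * b w) volG :=
          m1.add ((vm m').mul hb)
        rw [lintegral_add_left' m2, lintegral_add_left' m1]
    _ ≤ ((∫⁻ s, sectionL4 ν s ∂volI) + (∫⁻ s, sectionL4 ν' s ∂volI)
        + ∫⁻ s, sectionL4 ν'' s ∂volI) * (∫⁻ w, b w ^ 2 ∂volG) ^ (1 / 2 : ℝ) := by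
        rw [add_mul, add_mul]
        exact add_le_add (add_le_add (lintegral_vert_mul_le_sectionL4 m.1 hb hb0 htop)
          (lintegral_vert_mul_le_sectionL4 m'.1 hb hb0 htop))
          (lintegral_vert_mul_le_sectionL4 m''.1 hb hb0 htop)
    _ ≤ ENNReal.ofReal N * (∫⁻ w, b w ^ 2 ∂volG) ^ (1 / 2 : ℝ) := by
        refine mul_le_mul' (le_trans ?_ hN) le_rfl
        exact (add_le_add (le_lintegral_add _ _) le_rfl).trans (le_lintegral_add _ _)
    _ = ENNReal.ofReal (N * √(∫ w, vertR u w ^ 2 ∂volG)) := by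
        rw [hb2, ENNReal.ofReal_mul hN0, Real.sqrt_eq_rpow, ENNReal.ofReal_rpow_of_nonneg
          (integral_nonneg fun _ => sq_nonneg _) (by norm_num)]

/-! ### The dual pairing -/

theorem IsHorizTest.zero : IsHorizTest fun _ => 0 := ⟨contDiff_const, fun _ => rfl, fun _ => rfl⟩

theorem IsHorizTest.add {ψ χ : ℝ × ℝ → ℝ} (h : IsHorizTest ψ) (h' : IsHorizTest χ) :
    IsHorizTest fun w => ψ w + χ w where
  smooth := h.smooth.add h'.smooth
  periodic_x w := by rw [h.periodic_x, h'.periodic_x]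
  periodic_y w := by rw [h.periodic_y, h'.periodic_y]

theorem IsHorizTest.const_mul {ψ : ℝ × ℝ → ℝ} (h : IsHorizTest ψ) (c : ℝ) :
    IsHorizTest fun w => c * ψ w where
  smooth := contDiff_const.mul h.smooth
  periodic_x w := by rw [h.periodic_x]
  periodic_y w := by rw [h.periodic_y]

theorem IsHorizTest.coeFn_graph {ψ : ℝ × ℝ → ℝ} (h : IsHorizTest ψ) :
    h.graph 0 =ᵐ[volG] ψ ∧ h.graph 1 =ᵐ[volG] (fun w => fderiv ℝ ψ w (1, 0))
      ∧ h.graph 2 =ᵐ[volG] fun w => fderiv ℝ ψ w (0, 1) :=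
  ⟨(memLp_horiz h.smooth.continuous).coeFn_toLp,
    (memLp_horiz (h.continuous_fderiv (1, 0))).coeFn_toLp,
    (memLp_horiz (h.continuous_fderiv (0, 1))).coeFn_toLp⟩

theorem IsHorizTest.graph_eq {ψ : ℝ × ℝ → ℝ} (h : IsHorizTest ψ) {v : L2Triple}
    (h0 : v 0 =ᵐ[volG] ψ) (h1 : v 1 =ᵐ[volG] fun w => fderiv ℝ ψ w (1, 0))
    (h2 : v 2 =ᵐ[volG] fun w => fderiv ℝ ψ w (0, 1)) : h.graph = v := by
  obtain ⟨g0, g1, g2⟩ := h.coeFn_graph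
  refine PiLp.ext fun j => ?_
  match j with
  | 0 => exact Lp.ext (g0.trans h0.symm)
  | 1 => exact Lp.ext (g1.trans h1.symm)
  | 2 => exact Lp.ext (g2.trans h2.symm)

theorem IsHorizTest.toH1_zero : IsHorizTest.zero.toH1 = 0 := by
  refine Subtype.ext (IsHorizTest.zero.graph_eq ?_ ?_ ?_)
  · exact Lp.coeFn_zero _ _ _
  · exact (Lp.coeFn_zero _ _ _).trans (ae_of_all _ fun w => by simp)
  · exact (Lp.coeFn_zero _ _ _).trans (ae_of_all _ fun w => by simp)

theorem IsHorizTest.differentiableAt {ψ : ℝ × ℝ → ℝ} (h : IsHorizTest ψ) (w : ℝ × ℝ) :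
    DifferentiableAt ℝ ψ w := (h.smooth.differentiable (by simp)) w

theorem IsHorizTest.toH1_add {ψ χ : ℝ × ℝ → ℝ} (h : IsHorizTest ψ) (h' : IsHorizTest χ) :
    (h.add h').toH1 = h.toH1 + h'.toH1 := by
  have e : ∀ w d, fderiv ℝ (fun w => ψ w + χ w) w d = fderiv ℝ ψ w d + fderiv ℝ χ w d := by
    intro w d
    rw [fderiv_fun_add (h.differentiableAt w) (h'.differentiableAt w)]
    rfl
  obtain ⟨g0, g1, g2⟩ := h.coeFn_graph
  obtain ⟨k0, k1, k2⟩ := h'.coeFn_graph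
  refine Subtype.ext ((h.add h').graph_eq ?_ ?_ ?_)
  · exact (Lp.coeFn_add (h.graph 0) (h'.graph 0)).trans (g0.add k0)
  · refine (Lp.coeFn_add (h.graph 1) (h'.graph 1)).trans ((g1.add k1).trans ?_)
    exact ae_of_all _ fun w => (e w _).symm
  · refine (Lp.coeFn_add (h.graph 2) (h'.graph 2)).trans ((g2.add k2).trans ?_)
    exact ae_of_all _ fun w => (e w _).symm

theorem IsHorizTest.toH1_const_mul {ψ : ℝ × ℝ → ℝ} (h : IsHorizTest ψ) (c : ℝ) :
    (h.const_mul c).toH1 = c • h.toH1 := by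
  have e : ∀ w d, fderiv ℝ (fun w => c * ψ w) w d = c * fderiv ℝ ψ w d := by
    intro w d
    rw [fderiv_const_mul (h.differentiableAt w)]
    rfl
  obtain ⟨g0, g1, g2⟩ := h.coeFn_graph
  refine Subtype.ext ((h.const_mul c).graph_eq ?_ ?_ ?_)
  · exact (Lp.coeFn_smul c (h.graph 0)).trans (g0.const_smul c)
  · refine (Lp.coeFn_smul c (h.graph 1)).trans ((g1.const_smul c).trans ?_)
    exact ae_of_all _ fun w => (e w _).symm
  · refine (Lp.coeFn_smul c (h.graph 2)).trans ((g2.const_smul c).trans ?_)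
    exact ae_of_all _ fun w => (e w _).symm

theorem IsHorizTest.norm_toH1_sq {ψ : ℝ × ℝ → ℝ} (h : IsHorizTest ψ) :
    ‖h.toH1‖ ^ 2 = (∫ w, ψ w ^ 2 ∂volG) + (∫ w, fderiv ℝ ψ w (1, 0) ^ 2 ∂volG)
      + ∫ w, fderiv ℝ ψ w (0, 1) ^ 2 ∂volG := by
  have key : ∀ {g : ℝ × ℝ → ℝ} (hg : MemLp g 2 volG), ‖hg.toLp g‖ ^ 2 = ∫ w, g w ^ 2 ∂volG := by
    intro g hg
    rw [← real_inner_self_eq_norm_sq, L2.inner_def]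
    refine integral_congr_ae ?_
    filter_upwards [hg.coeFn_toLp] with w hw
    rw [hw]
    simp [sq]
  have h1 : ‖h.toH1‖ ^ 2 = ‖h.graph‖ ^ 2 := rfl
  rw [h1, PiLp.norm_sq_eq_of_L2, Fin.sum_univ_three, ← key (memLp_horiz h.smooth.continuous),
    ← key (memLp_horiz (h.continuous_fderiv (1, 0))),
    ← key (memLp_horiz (h.continuous_fderiv (0, 1)))]
  rfl

/-- The element of `H¹_per(G)` is built from a proof that the function is a test function. Induction
therefore produces this proof together with the identity. -/
theorem IsHorizTest.exists_sum {ι : Type*} (F : Finset ι) {ψ : ι → ℝ × ℝ → ℝ}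
    (h : ∀ k, IsHorizTest (ψ k)) (a : ι → ℝ) :
    ∃ H : IsHorizTest fun w => ∑ k ∈ F, a k * ψ k w, H.toH1 = ∑ k ∈ F, a k • (h k).toH1 := by
  classical
  induction F using Finset.induction_on with
  | empty =>
    simp only [Finset.sum_empty]
    exact ⟨IsHorizTest.zero, IsHorizTest.toH1_zero⟩
  | insert k F hk ih =>
    obtain ⟨H, hH⟩ := ih
    simp only [Finset.sum_insert hk]
    refine ⟨((h k).const_mul (a k)).add H, ?_⟩
    rw [((h k).const_mul (a k)).toH1_add H, (h k).toH1_const_mul, hH]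

/-! ### Functions with values in a dual space -/

theorem MemLp.integrable_apply {X E : Type*} [MeasurableSpace X] [NormedAddCommGroup E]
    [NormedSpace ℝ E] {μ : Measure X} [IsFiniteMeasure μ] {f : X → E →L[ℝ] ℝ} (hf : MemLp f 2 μ)
    (v : E) : Integrable (fun x => f x v) μ :=
  (ContinuousLinearMap.apply ℝ ℝ v).integrable_comp (hf.integrable (by norm_num))

theorem MemLp.abs_integral_apply_le {X E : Type*} [MeasurableSpace X] [NormedAddCommGroup E]
    [NormedSpace ℝ E] {μ : Measure X} {f : X → E →L[ℝ] ℝ} (hf : MemLp f 2 μ)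
    {v : X → E} (hv : MemLp (fun x => ‖v x‖) 2 μ) :
    |∫ x, f x (v x) ∂μ| ≤ √(∫ x, ‖f x‖ ^ 2 ∂μ) * √(∫ x, ‖v x‖ ^ 2 ∂μ) := by
  refine le_trans ?_ (integral_mul_sq_le hf.norm hv)
  refine norm_integral_le_of_norm_le (G := ℝ) (hf.norm.integrable_mul hv).abs
    (ae_of_all _ fun s => ?_)
  rw [abs_of_nonneg (by positivity)]
  exact (f s).le_opNorm _

theorem isHorizTest_modeG (l : ℤ × ℤ) : IsHorizTest (modeG l) where
  smooth := modeG_contDiff l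
  periodic_x w := by simp only [modeG]; rw [mode_periodic]
  periodic_y w := by simp only [modeG]; rw [mode_periodic]

/-- The horizontal modes as elements of `H¹_per(G)`. -/
def modeH1 (l : ℤ × ℤ) : H1 := (isHorizTest_modeG l).toH1

/-- The Fourier coefficients of a function of `z` with values in `H⁻¹_per(G)`. -/
def dualCoeff (f : ℝ → Hneg1) (k : Freq) : ℝ := ∫ s, mode k.1 s * f s (modeH1 k.2) ∂volI

/-- The coefficients of the derivative in the direction `j` of `∑ bₖ Eₖ`. -/
def derivCoeff (j : Fin 3) (b : Freq → ℝ) (k : Freq) : ℝ :=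
  b (flip j k) * (Real.pi * freq j (flip j k))

theorem trigSum_derivCoeff (j : Fin 3) (b : Freq → ℝ) (N : ℕ) (x : Space) :
    trigSum (freqBox N) (derivCoeff j b) x
      = ∑ k ∈ freqBox N, b k * (Real.pi * freq j k * modeBox (flip j k) x) := by
  unfold trigSum
  rw [← sum_flip N j]
  refine Finset.sum_congr rfl fun k _ => ?_
  rw [derivCoeff, flip_flip, mul_assoc]

theorem sum_derivCoeff_sq (j : Fin 3) (b : Freq → ℝ) (N : ℕ) :
    ∑ k ∈ freqBox N, derivCoeff j b k ^ 2 = ∑ k ∈ freqBox N, (Real.pi * freq j k) ^ 2 * b k ^ 2 := by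
  rw [← sum_flip N j]
  refine Finset.sum_congr rfl fun k _ => ?_
  rw [derivCoeff, flip_flip]
  ring

theorem fderiv_fst_eq {ψ : ℝ × ℝ → ℝ} {w : ℝ × ℝ} (h : DifferentiableAt ℝ ψ w) {d : ℝ}
    (hd : HasDerivAt (fun x => ψ (x, w.2)) d w.1) : fderiv ℝ ψ w (1, 0) = d :=
  (h.hasFDerivAt.comp_hasDerivAt (f := fun x => (x, w.2)) w.1
    ((hasDerivAt_id w.1).prodMk (hasDerivAt_const w.1 w.2))).unique hd

theorem fderiv_snd_eq {ψ : ℝ × ℝ → ℝ} {w : ℝ × ℝ} (h : DifferentiableAt ℝ ψ w) {d : ℝ}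
    (hd : HasDerivAt (fun y => ψ (w.1, y)) d w.2) : fderiv ℝ ψ w (0, 1) = d :=
  (h.hasFDerivAt.comp_hasDerivAt (f := fun y => (w.1, y)) w.2
    ((hasDerivAt_const w.2 w.1).prodMk (hasDerivAt_id w.2))).unique hd

/-- At a fixed height `s` the sum is the section of a trigonometric polynomial, and differentiation
in `x` or `y` permutes its modes. This expresses the `H¹(G)` norm by quantities to which Parseval's
identity on the box applies. -/
theorem norm_sum_modeH1_sq (b : Freq → ℝ) (N : ℕ) (s : ℝ) :
    ‖∑ k ∈ freqBox N, (b k * mode k.1 s) • modeH1 k.2‖ ^ 2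
      = (∫ w, trigSum (freqBox N) b (s, w) ^ 2 ∂volG)
        + (∫ w, trigSum (freqBox N) (derivCoeff 0 b) (s, w) ^ 2 ∂volG)
        + ∫ w, trigSum (freqBox N) (derivCoeff 1 b) (s, w) ^ 2 ∂volG := by
  obtain ⟨H, hH⟩ := IsHorizTest.exists_sum (freqBox N) (fun k : Freq => isHorizTest_modeG k.2)
    fun k => b k * mode k.1 s
  have h1 := H.norm_toH1_sq
  rw [hH] at h1
  refine h1.trans ?_
  have e0 : ∀ w, ∑ k ∈ freqBox N, b k * mode k.1 s * modeG k.2 w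
      = trigSum (freqBox N) b (s, w) := fun w =>
    Finset.sum_congr rfl fun k _ => by rw [modeBox, mul_assoc]
  have e1 : ∀ w, fderiv ℝ (fun w => ∑ k ∈ freqBox N, b k * mode k.1 s * modeG k.2 w) w (1, 0)
      = trigSum (freqBox N) (derivCoeff 0 b) (s, w) := by
    intro w
    refine fderiv_fst_eq (H.differentiableAt w) ?_
    rw [trigSum_derivCoeff]
    refine HasDerivAt.fun_sum fun k _ => ?_
    refine (((mode_hasDerivAt k.2.1 w.1).mul_const (mode k.2.2 w.2)).const_mul
        (b k * mode k.1 s)).congr_deriv ?_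
    simp only [freq, flip, modeBox, modeG, Matrix.cons_val]
    ring
  have e2 : ∀ w, fderiv ℝ (fun w => ∑ k ∈ freqBox N, b k * mode k.1 s * modeG k.2 w) w (0, 1)
      = trigSum (freqBox N) (derivCoeff 1 b) (s, w) := by
    intro w
    refine fderiv_snd_eq (H.differentiableAt w) ?_
    rw [trigSum_derivCoeff]
    refine HasDerivAt.fun_sum fun k _ => ?_
    refine (((mode_hasDerivAt k.2.2 w.2).const_mul (mode k.2.1 w.1)).const_mul
        (b k * mode k.1 s)).congr_deriv ?_
    simp only [freq, flip, modeBox, modeG, Matrix.cons_val]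
    ring
  simp_rw [e1, e2, e0]

theorem integral_section {g : Space → ℝ} (hg : Continuous g) :
    Integrable (fun s => ∫ w, g (s, w) ^ 2 ∂volG) volI
      ∧ ∫ s, ∫ w, g (s, w) ^ 2 ∂volG ∂volI = ∫ x, g x ^ 2 ∂volBox := by
  have h : Integrable (fun x => g x ^ 2) (volI.prod volG) := by
    rw [← volBox_eq]
    exact (memLp_box_of_continuous hg).integrable_sq
  refine ⟨h.integral_prod_left, ?_⟩
  rw [volBox_eq, integral_prod _ h]

/-- Bessel's inequality for functions with values in the dual space. -/
theorem abs_sum_dualCoeff_le {f : ℝ → Hneg1} (hf : MemLp f 2 volI) (N : ℕ) (b : Freq → ℝ) :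
    |∑ k ∈ freqBox N, b k * dualCoeff f k| ≤ √(∫ s, ‖f s‖ ^ 2 ∂volI)
      * √(∑ k ∈ freqBox N, (1 + (Real.pi * freq 0 k) ^ 2 + (Real.pi * freq 1 k) ^ 2) * b k ^ 2) := by
  -- The sum is the pairing of `f` with a trigonometric polynomial in `z` with values in
  -- `H¹_per(G)`. Its norm is computed from orthonormality.
  let v : ℝ → H1 := fun s => ∑ k ∈ freqBox N, (b k * mode k.1 s) • modeH1 k.2
  have hvc : Continuous v := continuous_finsetSum _ fun k _ =>
    (continuous_const.mul (mode_continuous k.1)).smul continuous_const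
  have hv : MemLp (fun s => ‖v s‖) 2 volI := memLp_of_continuous hvc.norm
  have hfi : ∀ l, Integrable (fun s => f s (modeH1 l)) volI := fun l =>
    MemLp.integrable_apply hf (modeH1 l)
  have hki : ∀ k : Freq, Integrable (fun s => mode k.1 s * f s (modeH1 k.2)) volI := fun k => by
    simp_rw [mul_comm (mode k.1 _)]
    exact integrable_mul_of_bound (hfi k.2) (mode_continuous k.1).aestronglyMeasurable
      (mode_abs_le k.1)
  have h1 : ∑ k ∈ freqBox N, b k * dualCoeff f k = ∫ s, f s (v s) ∂volI := by
    simp_rw [dualCoeff, ← integral_const_mul]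
    rw [← integral_finsetSum _ fun k _ => (hki k).const_mul _]
    refine integral_congr_ae (ae_of_all _ fun s => ?_)
    simp only [v, map_sum, map_smul, smul_eq_mul, mul_assoc]
  rw [h1]
  refine (MemLp.abs_integral_apply_le hf hv).trans (le_of_eq ?_)
  congr 2
  simp_rw [v, norm_sum_modeH1_sq]
  obtain ⟨i0, j0⟩ := integral_section (trigSum_continuous (freqBox N) b)
  obtain ⟨i1, j1⟩ := integral_section (trigSum_continuous (freqBox N) (derivCoeff 0 b))
  obtain ⟨i2, j2⟩ := integral_section (trigSum_continuous (freqBox N) (derivCoeff 1 b))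
  have i3 : Integrable (fun s => (∫ w, trigSum (freqBox N) b (s, w) ^ 2 ∂volG)
      + ∫ w, trigSum (freqBox N) (derivCoeff 0 b) (s, w) ^ 2 ∂volG) volI := i0.add i1
  rw [integral_add i3 i2, integral_add i0 i1, j0, j1, j2, integral_trigSum_sq, integral_trigSum_sq,
    integral_trigSum_sq, sum_derivCoeff_sq, sum_derivCoeff_sq, ← Finset.sum_add_distrib,
    ← Finset.sum_add_distrib]
  exact Finset.sum_congr rfl fun k _ => by ring

/-- The square root of the multiplier of `D_h^* D_h`, up to a factor bounded by one. -/
theorem exists_mult_eq {h : ℝ} (hh : 0 < h) (k : Freq) :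
    ∃ μ : ℝ, mult h k = 1 + μ * (Real.pi * freq 2 k) ∧ μ ^ 2 ≤ (Real.pi * freq 2 k) ^ 2 := by
  -- Away from vertical frequency zero, `μ` is the quotient of `mult h k - 1` by the frequency; its
  -- bound follows from `0 ≤ mult h k - 1 ≤ (πk)²`.
  by_cases h0 : Real.pi * (freq 2 k : ℝ) = 0
  · refine ⟨0, ?_, by simp [h0]⟩
    have h1 : Real.pi * (k.1 : ℝ) = 0 := h0
    simp [mult, h1]
  · refine ⟨(mult h k - 1) / (Real.pi * freq 2 k), by rw [div_mul_cancel₀ _ h0]; ring, ?_⟩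
    have h1 := one_le_mult h k
    have h2 : mult h k ≤ 1 + (Real.pi * freq 2 k) ^ 2 := mult_le hh k
    rw [div_pow, div_le_iff₀ (by positivity)]
    have h3 := pow_le_pow_left₀ (by linarith : 0 ≤ mult h k - 1)
      (by linarith : mult h k - 1 ≤ (Real.pi * freq 2 k) ^ 2) 2
    linarith

/-- The forcing term, tested with `u + D_h^* D_h u`. -/
theorem abs_sum_forcing_le {f fz : ℝ → Hneg1} (hf : MemLp f 2 volI) (hfz : MemLp fz 2 volI)
    (hz : ∀ k, dualCoeff fz k = -(Real.pi * freq 2 k * dualCoeff f (flip 2 k)))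
    {h : ℝ} (hh : 0 < h) (N : ℕ) (c : Freq → ℝ) {K : ℝ}
    (hK : ∑ k ∈ freqBox N, (1 + (Real.pi * freq 2 k) ^ 2)
      * (1 + (Real.pi * freq 0 k) ^ 2 + (Real.pi * freq 1 k) ^ 2) * c k ^ 2 ≤ K) :
    |∑ k ∈ freqBox N, mult h k * c k * dualCoeff f k|
      ≤ (√(∫ s, ‖f s‖ ^ 2 ∂volI) + √(∫ s, ‖fz s‖ ^ 2 ∂volI)) * √K := by
  choose μ hμ1 hμ2 using exists_mult_eq hh
  -- In `mult h k = 1 + μ πk` the factor `πk` is moved to `f`, where it yields `fz`. The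
  -- coefficients are left with `μ`, which costs no more than one vertical derivative.
  have h1 : ∑ k ∈ freqBox N, mult h k * c k * dualCoeff f k
      = (∑ k ∈ freqBox N, c k * dualCoeff f k)
        + ∑ k ∈ freqBox N, (μ (flip 2 k) * c (flip 2 k)) * dualCoeff fz k := by
    rw [← sum_flip N 2 fun k => (μ (flip 2 k) * c (flip 2 k)) * dualCoeff fz k,
      ← Finset.sum_add_distrib]
    refine Finset.sum_congr rfl fun k _ => ?_
    rw [hz, flip_flip, freq_flip, hμ1]
    push_cast
    ring
  rw [h1]
  refine (abs_add_le _ _).trans ?_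
  rw [add_mul]
  refine add_le_add ((abs_sum_dualCoeff_le hf N _).trans ?_)
    ((abs_sum_dualCoeff_le hfz N _).trans ?_)
  · refine mul_le_mul_of_nonneg_left (Real.sqrt_le_sqrt (le_trans ?_ hK)) (Real.sqrt_nonneg _)
    refine Finset.sum_le_sum fun k _ => ?_
    refine mul_le_mul_of_nonneg_right ?_ (sq_nonneg _)
    exact le_mul_of_one_le_left (by positivity) (by linarith [sq_nonneg (Real.pi * freq 2 k)])
  · refine mul_le_mul_of_nonneg_left (Real.sqrt_le_sqrt (le_trans ?_ hK)) (Real.sqrt_nonneg _)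
    rw [← sum_flip N 2]
    refine Finset.sum_le_sum fun k _ => ?_
    rw [flip_flip]
    have e : ∀ j : Fin 3, j ≠ 2 → freq j (flip 2 k) = freq j k := by
      intro j hj
      fin_cases j
      · rfl
      · rfl
      · exact absurd rfl hj
    rw [e 0 (by decide), e 1 (by decide), mul_pow (μ k), ← mul_assoc, mul_comm _ (μ k ^ 2)]
    gcongr
    linarith [hμ2 k]

/-! ### The system at a fixed time -/

/-- The data of the system at a fixed time, with all relations expressed by Fourier coefficients. -/
structure Slice (ε δ N : ℝ) (ω ω' ω'' : Space → ℝ) (ν ν' ν'' : Fin 3 → Space → ℝ)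
    (f fz : Fin 3 → ℝ → Hneg1) (u ut : Fin 3 → Space → ℝ) (d : Fin 3 → Fin 3 → Space → ℝ)
    (e : Fin 3 → Fin 3 → Fin 3 → Space → ℝ) (P : Space → ℝ) : Prop where
  mω : MemLp ω 2 volBox
  mω' : MemLp ω' 2 volBox
  mω'' : MemLp ω'' 2 volBox
  mν : ∀ i, MemLp (ν i) 2 volBox
  mν' : ∀ i, MemLp (ν' i) 2 volBox
  mν'' : ∀ i, MemLp (ν'' i) 2 volBox
  mf : ∀ i, MemLp (f i) 2 volI
  mfz : ∀ i, MemLp (fz i) 2 volI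
  mu : ∀ i, MemLp (u i) 2 volBox
  mdt : ∀ i, MemLp (ut i) 2 volBox
  md : ∀ i j, MemLp (d i j) 2 volBox
  me : ∀ i j k, MemLp (e i j k) 2 volBox
  N_nonneg : 0 ≤ N
  N_bound : ∫⁻ s, (sectionL4 ν s + sectionL4 ν' s + sectionL4 ν'' s) ∂volI ≤ ENNReal.ofReal N
  cω : CoeffDeriv 2 ω ω'
  cω' : CoeffDeriv 2 ω' ω''
  cν : ∀ i, CutDeriv (ν i) (ν' i)
  cν' : ∀ i, CutDeriv (ν' i) (ν'' i)
  cν₃ : CoeffDeriv 2 (ν 2) (ν' 2)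
  cf : ∀ i k, dualCoeff (fz i) k = -(Real.pi * freq 2 k * dualCoeff (f i) (flip 2 k))
  cu : ∀ i j, CoeffDeriv j (u i) (d i j)
  cd : ∀ i j k, CoeffDeriv k (d i j) (e i j k)
  div_free : ∀ᵐ x ∂volBox, ∑ i, gradScale ε i * d i i x = 0
  parity : ∀ i, ∀ᵐ x ∂volBox, u i (-x.1, x.2) = paritySign i * u i x
  momentum : ∀ i k, coeff (ut i) k - (coeff (e i 0 0) k + coeff (e i 1 1) k
      + δ * coeff (e i 2 2) k)
    - Real.pi * freq 2 k * coeff (fun x => ω x * u i x) (flip 2 k)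
    - Real.pi * freq 2 k * coeff (fun x => ε⁻¹ * u 2 x * ν i x) (flip 2 k)
    - gradScale ε i * (Real.pi * freq i k * coeff P (flip i k)) = dualCoeff (f i) k

/-- Integration by parts inside Parseval's identity: `P` needs no derivative, only its coefficients
are multiplied by the frequency. -/
theorem hasSum_parts {j : Fin 3} {u u' P : Space → ℝ} (mu' : MemLp u' 2 volBox)
    (mP : MemLp P 2 volBox) (h : CoeffDeriv j u u') :
    HasSum (fun k => coeff u k * (Real.pi * freq j k * coeff P (flip j k)))
      (∫ x, u' x * P x ∂volBox) := by
  have h1 := ((show Function.Involutive (flip j) from flip_flip j).toPerm _).hasSum_iff.2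
    (hasSum_coeff mu' mP)
  have h2 : (fun k => coeff u k * (Real.pi * freq j k * coeff P (flip j k)))
      = fun k => coeff u' (flip j k) * coeff P (flip j k) := by
    funext k
    rw [h.coeff_flip]
    ring
  rw [h2]
  exact h1

section

variable {ε δ N : ℝ} {ω ω' ω'' : Space → ℝ} {ν ν' ν'' : Fin 3 → Space → ℝ}
    {f fz : Fin 3 → ℝ → Hneg1} {u ut : Fin 3 → Space → ℝ} {d : Fin 3 → Fin 3 → Space → ℝ}
    {e : Fin 3 → Fin 3 → Fin 3 → Space → ℝ} {P : Space → ℝ}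

/-- The square of the norm of `u` in `H¹_z L²_xy`. -/
def energy (u : Space → ℝ) (d : Fin 3 → Space → ℝ) : ℝ :=
  (∫ x, u x ^ 2 ∂volBox) + ∫ x, d 2 x ^ 2 ∂volBox

/-- The square of the norm of `∇_xy u` in `H¹_z L²_xy`. -/
def dissipation (d : Fin 3 → Space → ℝ) (e : Fin 3 → Fin 3 → Space → ℝ) : ℝ :=
  (∫ x, d 0 x ^ 2 ∂volBox) + (∫ x, d 1 x ^ 2 ∂volBox) + (∫ x, e 2 0 x ^ 2 ∂volBox)
    + ∫ x, e 2 1 x ^ 2 ∂volBox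

theorem integral_sq_nonneg {X : Type*} [MeasurableSpace X] {μ : Measure X} (f : X → ℝ) :
    0 ≤ ∫ x, f x ^ 2 ∂μ := integral_nonneg fun _ => sq_nonneg _

theorem energy_nonneg (u : Space → ℝ) (d : Fin 3 → Space → ℝ) : 0 ≤ energy u d :=
  add_nonneg (integral_sq_nonneg _) (integral_sq_nonneg _)

theorem dissipation_nonneg (d : Fin 3 → Space → ℝ) (e : Fin 3 → Fin 3 → Space → ℝ) :
    0 ≤ dissipation d e :=
  add_nonneg (add_nonneg (add_nonneg (integral_sq_nonneg _) (integral_sq_nonneg _))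
    (integral_sq_nonneg _)) (integral_sq_nonneg _)

theorem Slice.exists_bound (S : Slice ε δ N ω ω' ω'' ν ν' ν'' f fz u ut d e P) (i : Fin 3) :
    ∃ M, ∀ᵐ x ∂volBox, |u i x| ≤ M :=
  exists_bound_of_second_derivs (S.mu i) (fun j => S.me i j j) (S.cu i) fun j => S.cd i j j

theorem Slice.memLp_transport (S : Slice ε δ N ω ω' ω'' ν ν' ν'' f fz u ut d e P) (i : Fin 3) :
    MemLp (fun x => ω x * u i x) 2 volBox := by
  obtain ⟨M, hM⟩ := S.exists_bound i
  exact memLp_mul_of_ae_bound S.mω (S.mu i).1 hM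

theorem Slice.memLp_vertical (S : Slice ε δ N ω ω' ω'' ν ν' ν'' f fz u ut d e P) (i : Fin 3) :
    MemLp (fun x => ε⁻¹ * u 2 x * ν i x) 2 volBox := by
  obtain ⟨M, hM⟩ := S.exists_bound 2
  have h := (memLp_mul_of_ae_bound (S.mν i) (S.mu 2).1 hM).const_mul ε⁻¹
  have e : (fun x => ε⁻¹ * u 2 x * ν i x) = fun x => ε⁻¹ * (ν i x * u 2 x) := by
    funext x
    ring
  rw [e]
  exact h

theorem Slice.transport_le (S : Slice ε δ N ω ω' ω'' ν ν' ν'' f fz u ut d e P) (i : Fin 3)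
    {h : ℝ} (hh : 0 < h) :
    (∫ x, testOp h (d i 2) x * (ω x * u i x) ∂volBox) ^ 2
      ≤ 1600 * ((∫ x, ω' x ^ 2 ∂volBox) + ∫ x, ω'' x ^ 2 ∂volBox)
        * energy (u i) (d i) * (energy (u i) (d i) + dissipation (d i) (e i)) := by
  have h1 := sq_integral_box_transport_le S.mω S.mω' S.mω'' (S.mu i) (S.md i 2) (S.me i 2 2)
    (S.md i 0) (S.md i 1) (S.me i 2 0) (S.me i 2 1) S.cω S.cω' (S.cu i 2) (S.cd i 2 2) (S.cu i 0)
    (S.cu i 1) (S.cd i 2 0) (S.cd i 2 1) (S.memLp_transport i) hh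
  simp_rw [mul_comm (testOp h (d i 2) _)]
  refine h1.trans (le_of_eq ?_)
  unfold energy dissipation
  ring

theorem coeffDeriv_const_mul {j : Fin 3} {g g' : Space → ℝ} (h : CoeffDeriv j g g') (c : ℝ) :
    CoeffDeriv j (fun x => c * g x) fun x => c * g' x := by
  intro k
  rw [coeff_const_mul, coeff_const_mul, h k]
  ring

/-- The incompressibility condition bounds `ε⁻¹ ∂_z u₃` in `H¹_z L²_xy` by horizontal derivatives. -/
theorem Slice.vertical_derivative_le (S : Slice ε δ N ω ω' ω'' ν ν' ν'' f fz u ut d e P) :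
    (∫ x, (ε⁻¹ * d 2 2 x) ^ 2 ∂volBox) + ∫ x, (ε⁻¹ * e 2 2 2 x) ^ 2 ∂volBox
      ≤ 2 * ∑ i, dissipation (d i) (e i) := by
  have hi : ∀ {g : Space → ℝ}, MemLp g 2 volBox → Integrable g volBox := fun hg =>
    hg.integrable (by norm_num)
  have key : ∀ {a b c : Space → ℝ}, MemLp a 2 volBox → MemLp b 2 volBox → MemLp c 2 volBox →
      (∀ᵐ x ∂volBox, c x = -(a x + b x)) →
      ∫ x, c x ^ 2 ∂volBox ≤ 2 * (∫ x, a x ^ 2 ∂volBox) + 2 * ∫ x, b x ^ 2 ∂volBox := by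
    intro a b c ha hb hc habc
    rw [← integral_const_mul, ← integral_const_mul,
      ← integral_add (ha.integrable_sq.const_mul 2) (hb.integrable_sq.const_mul 2)]
    refine integral_mono_ae hc.integrable_sq
      ((ha.integrable_sq.const_mul 2).add (hb.integrable_sq.const_mul 2)) ?_
    filter_upwards [habc] with x hx
    rw [hx]
    nlinarith [sq_nonneg (a x - b x)]
  have h1 : ∀ᵐ x ∂volBox, ε⁻¹ * d 2 2 x = -(d 0 0 x + d 1 1 x) := by
    filter_upwards [S.div_free] with x hx
    simp only [Fin.sum_univ_three, gradScale, Matrix.cons_val] at hx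
    linarith
  -- The divergence condition differentiated in `z`; the coefficients show that the mixed
  -- derivatives may be taken in this order.
  have h2 : (fun x => ε⁻¹ * e 2 2 2 x) =ᵐ[volBox] fun x => -1 * (e 0 2 0 x + e 1 2 1 x) := by
    refine ae_eq_of_coeff_eq (hi ((S.me 2 2 2).const_mul _))
      (((hi (S.me 0 2 0)).add (hi (S.me 1 2 1))).const_mul _) fun k => ?_
    rw [coeff_const_mul, coeff_const_mul, coeff_add (hi (S.me 0 2 0)) (hi (S.me 1 2 1)),
      S.cd 2 2 2 k, S.cd 0 2 0 k, S.cd 1 2 1 k, S.cu 0 2, S.cu 1 2]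
    have h3 := coeff_congr (g := fun x => ε⁻¹ * d 2 2 x)
      (h := fun x => -1 * (d 0 0 x + d 1 1 x)) (by
        filter_upwards [h1] with x hx
        rw [hx]
        ring) (flip 2 k)
    rw [coeff_const_mul, coeff_const_mul, coeff_add (hi (S.md 0 0)) (hi (S.md 1 1)), S.cu 0 0,
      S.cu 1 1] at h3
    have f0 : freq 0 (flip 2 k) = freq 0 k := rfl
    have f1 : freq 1 (flip 2 k) = freq 1 k := rfl
    have f2 : freq 2 (flip 0 k) = freq 2 k := rfl
    have f3 : freq 2 (flip 1 k) = freq 2 k := rfl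
    have c0 : flip 0 (flip 2 k) = flip 2 (flip 0 k) := rfl
    have c1 : flip 1 (flip 2 k) = flip 2 (flip 1 k) := rfl
    rw [f0, f1, c0, c1] at h3
    rw [f2, f3]
    linear_combination (-(Real.pi * freq 2 k)) * h3
  have b1 := key (S.md 0 0) (S.md 1 1) ((S.md 2 2).const_mul ε⁻¹) h1
  have b2 := key (S.me 0 2 0) (S.me 1 2 1) ((S.me 2 2 2).const_mul ε⁻¹) (by
    filter_upwards [h2] with x hx
    rw [hx]
    ring)
  refine (add_le_add b1 b2).trans ?_
  rw [Fin.sum_univ_three]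
  have := dissipation_nonneg (d 2) (e 2)
  have p := fun g : Space → ℝ => integral_sq_nonneg (μ := volBox) g
  have := p (d 0 1)
  have := p (d 1 0)
  have := p (e 0 2 1)
  have := p (e 1 2 0)
  unfold dissipation at *
  linarith

/-- The estimate on lines gives `X² ≤ 8000 E N √J`, with one power of the dissipation `E` from
incompressibility, and `J` is bounded by Ladyzhenskaya's inequality. A further squaring removes the
root; `N` is already the square of a norm of the field, so `N²` is its fourth power. -/
theorem Slice.vertical_le (S : Slice ε δ N ω ω' ω'' ν ν' ν'' f fz u ut d e P) (i : Fin 3)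
    {h : ℝ} (hh : 0 < h) :
    (∫ x, testOp h (d i 2) x * (ε⁻¹ * u 2 x * ν i x) ∂volBox) ^ 4
      ≤ 1000000000 * (∑ i, dissipation (d i) (e i)) ^ 2 * N ^ 2
        * (energy (u i) (d i) * (energy (u i) (d i) + dissipation (d i) (e i))) := by
  obtain ⟨i2, b2⟩ := vertR_sq_le (S.md i 2) (S.me i 2 0) (S.me i 2 1) (S.cd i 2 0) (S.cd i 2 1)
  obtain ⟨i3, b3⟩ := integral_vertR_mul_le (S.mν i) (S.mν' i) (S.mν'' i) S.N_nonneg S.N_bound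
    (S.md i 2) i2
  -- The third component uses periodicity of `ν₃`, the horizontal ones use evenness of `U₁` and
  -- `U₂`.
  have hcase : CoeffDeriv 2 (ν i) (ν' i) ∨ ∀ᵐ x ∂volBox, u i (-x.1, x.2) = 1 * u i x := by
    by_cases hi : i = 2
    · left
      rw [hi]
      exact S.cν₃
    · right
      have h1 : paritySign i = 1 := by
        fin_cases i
        · rfl
        · rfl
        · exact absurd rfl hi
      have := S.parity i
      rwa [h1] at this
  have hodd : ∀ᵐ x : Space ∂volBox, ε⁻¹ * u 2 (-x.1, x.2) = -1 * (ε⁻¹ * u 2 x) := by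
    filter_upwards [S.parity 2] with x hx
    rw [hx]
    simp [paritySign]
  have h1 := sq_integral_box_vertical_le ((S.mu 2).const_mul ε⁻¹) ((S.md 2 2).const_mul ε⁻¹)
    ((S.me 2 2 2).const_mul ε⁻¹) (S.mu i) (S.md i 2) (S.me i 2 2) (S.mν i) (S.mν' i) (S.mν'' i)
    (coeffDeriv_const_mul (S.cu 2 2) ε⁻¹) (coeffDeriv_const_mul (S.cd 2 2 2) ε⁻¹) (S.cu i 2)
    (S.cd i 2 2) (S.cν i) (S.cν' i) hodd hcase (S.memLp_vertical i) i3 hh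
  simp_rw [mul_comm (testOp h (d i 2) _)]
  set X := ∫ x, ε⁻¹ * u 2 x * ν i x * testOp h (d i 2) x ∂volBox
  set E := ∑ i, dissipation (d i) (e i)
  have hE : 0 ≤ E := Finset.sum_nonneg fun i _ => dissipation_nonneg _ _
  set J := ∫ w, vertR (d i 2) w ^ 2 ∂volG
  have hJ : 0 ≤ J := integral_sq_nonneg _
  have h2 : X ^ 2 ≤ 8000 * E * (N * √J) := by
    refine h1.trans ?_
    have h3 := mul_le_mul S.vertical_derivative_le b3 (integral_nonneg fun w => mul_nonneg
      (add_nonneg (add_nonneg (vertR_nonneg _ _) (vertR_nonneg _ _)) (vertR_nonneg _ _))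
      (vertR_nonneg _ _)) (by positivity)
    have h4 := mul_le_mul_of_nonneg_left h3 (by norm_num : (0 : ℝ) ≤ 4000)
    refine h4.trans (le_of_eq ?_)
    ring
  have h5 : (X ^ 2) ^ 2 ≤ (8000 * E * (N * √J)) ^ 2 := pow_le_pow_left₀ (sq_nonneg _) h2 2
  have h6 : (8000 * E * (N * √J)) ^ 2 = 64000000 * E ^ 2 * N ^ 2 * J := by
    rw [mul_pow, mul_pow, mul_pow, Real.sq_sqrt hJ]
    ring
  have h7 : J ≤ 8 * (energy (u i) (d i) * (energy (u i) (d i) + dissipation (d i) (e i))) := by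
    refine b2.trans ?_
    have p := fun g : Space → ℝ => integral_sq_nonneg (μ := volBox) g
    have := p (d i 0)
    have := p (d i 1)
    have := p (e i 2 0)
    have := p (e i 2 1)
    have := p (u i)
    have := p (d i 2)
    unfold energy dissipation
    refine mul_le_mul_of_nonneg_left (mul_le_mul ?_ ?_ ?_ ?_) (by norm_num)
    · linarith
    · linarith
    · linarith
    · linarith
  have h8 : X ^ 4 = (X ^ 2) ^ 2 := by ring
  have h9 := mul_le_mul_of_nonneg_left h7 (by positivity : 0 ≤ 64000000 * E ^ 2 * N ^ 2)
  have h10 : 0 ≤ E ^ 2 * N ^ 2 * (energy (u i) (d i)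
      * (energy (u i) (d i) + dissipation (d i) (e i))) :=
    mul_nonneg (by positivity) (mul_nonneg (energy_nonneg _ _)
      (add_nonneg (energy_nonneg _ _) (dissipation_nonneg _ _)))
  rw [h8]
  linarith

theorem hasSum_testOp_mul_self {g : Space → ℝ} (hg : MemLp g 2 volBox) (h : ℝ) :
    HasSum (fun k => mult h k * coeff g k ^ 2) (∫ x, testOp h g x * g x ∂volBox) := by
  have h1 := hasSum_coeff (memLp_testOp hg h) hg
  simp_rw [coeff_testOp hg, mul_assoc, ← sq] at h1
  exact h1

theorem integral_testOp_mul_self_nonneg {g : Space → ℝ} (hg : MemLp g 2 volBox) (h : ℝ) :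
    0 ≤ ∫ x, testOp h g x * g x ∂volBox :=
  (hasSum_testOp_mul_self hg h).nonneg fun k =>
    mul_nonneg (by linarith [one_le_mult h k]) (sq_nonneg _)

/-- Bessel's inequality for the six derivatives in `energy` and `dissipation`, whose symbols add up
to the product of the vertical and the horizontal factor. -/
theorem Slice.sum_coeff_le (S : Slice ε δ N ω ω' ω'' ν ν' ν'' f fz u ut d e P) (i : Fin 3) (M : ℕ) :
    ∑ k ∈ freqBox M, (1 + (Real.pi * freq 2 k) ^ 2)
      * (1 + (Real.pi * freq 0 k) ^ 2 + (Real.pi * freq 1 k) ^ 2) * coeff (u i) k ^ 2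
      ≤ energy (u i) (d i) + dissipation (d i) (e i) := by
  have b : ∀ {g : Space → ℝ}, MemLp g 2 volBox →
      ∑ k ∈ freqBox M, coeff g k ^ 2 ≤ ∫ x, g x ^ 2 ∂volBox := fun hg =>
    sum_le_hasSum _ (fun _ _ => sq_nonneg _) (hasSum_coeff_sq hg)
  have h1 : ∀ j, ∑ k ∈ freqBox M, coeff (d i j) k ^ 2
      = ∑ k ∈ freqBox M, (Real.pi * freq j k) ^ 2 * coeff (u i) k ^ 2 := fun j => by
    rw [← sum_flip M j]
    refine Finset.sum_congr rfl fun k _ => ?_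
    rw [(S.cu i j).coeff_flip]
    ring
  have h2 : ∀ j : Fin 3, j ≠ 2 → ∑ k ∈ freqBox M, coeff (e i 2 j) k ^ 2
      = ∑ k ∈ freqBox M, (Real.pi * freq 2 k) ^ 2 * (Real.pi * freq j k) ^ 2
        * coeff (u i) k ^ 2 := fun j hj => by
    rw [← sum_flip M j, ← sum_flip M 2]
    refine Finset.sum_congr rfl fun k _ => ?_
    have hf : freq j (flip 2 k) = freq j k := by
      fin_cases j
      · rfl
      · rfl
      · exact absurd rfl hj
    rw [(S.cd i 2 j).coeff_flip, (S.cu i 2).coeff_flip, hf]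
    ring
  have h3 : ∑ k ∈ freqBox M, (1 + (Real.pi * freq 2 k) ^ 2)
      * (1 + (Real.pi * freq 0 k) ^ 2 + (Real.pi * freq 1 k) ^ 2) * coeff (u i) k ^ 2
      = (∑ k ∈ freqBox M, coeff (u i) k ^ 2) + (∑ k ∈ freqBox M, coeff (d i 2) k ^ 2)
        + ((∑ k ∈ freqBox M, coeff (d i 0) k ^ 2) + (∑ k ∈ freqBox M, coeff (d i 1) k ^ 2)
        + (∑ k ∈ freqBox M, coeff (e i 2 0) k ^ 2) + ∑ k ∈ freqBox M, coeff (e i 2 1) k ^ 2) := by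
    rw [h1, h1, h1, h2 0 (by decide), h2 1 (by decide), ← Finset.sum_add_distrib,
      ← Finset.sum_add_distrib, ← Finset.sum_add_distrib, ← Finset.sum_add_distrib,
      ← Finset.sum_add_distrib]
    exact Finset.sum_congr rfl fun k _ => by ring
  rw [h3]
  unfold energy dissipation
  exact add_le_add (add_le_add (b (S.mu i)) (b (S.md i 2)))
    (add_le_add (add_le_add (add_le_add (b (S.md i 0)) (b (S.md i 1))) (b (S.me i 2 0)))
      (b (S.me i 2 1)))

/-- The multiplier is common to the three components, and shifting the derivatives from `P` to `u`
produces the coefficients of the divergence. Since `P` is merely integrable, its series need not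
converge; the cancellation takes place in each truncated sum. -/
theorem Slice.sum_pressure (S : Slice ε δ N ω ω' ω'' ν ν' ν'' f fz u ut d e P) (h : ℝ) (M : ℕ) :
    ∑ i, ∑ k ∈ freqBox M, coeff (testOp h (u i)) k
      * (gradScale ε i * (Real.pi * freq i k * coeff P (flip i k))) = 0 := by
  have hi : ∀ i, Integrable (d i i) volBox := fun i => (S.md i i).integrable (by norm_num)
  have h1 : ∀ i, ∑ k ∈ freqBox M, coeff (testOp h (u i)) k
      * (gradScale ε i * (Real.pi * freq i k * coeff P (flip i k)))
      = ∑ k ∈ freqBox M, mult h k * (gradScale ε i * coeff (d i i) k) * coeff P k := fun i => by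
    rw [← sum_flip M i fun k => mult h k * (gradScale ε i * coeff (d i i) k) * coeff P k]
    refine Finset.sum_congr rfl fun k _ => ?_
    rw [coeff_testOp (S.mu i), (S.cu i i).coeff_flip, mult_flip]
    ring
  simp_rw [h1]
  rw [Finset.sum_comm]
  refine Finset.sum_eq_zero fun k _ => ?_
  have h2 : ∑ i, gradScale ε i * coeff (d i i) k = 0 := by
    have h3 : ∫ x, (∑ i, gradScale ε i * d i i x) * modeBox k x ∂volBox = 0 := by
      rw [integral_congr_ae (g := fun _ => (0 : ℝ)), integral_zero]
      filter_upwards [S.div_free] with x hx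
      rw [hx, zero_mul]
    rw [← h3]
    simp_rw [coeff, ← integral_const_mul, Finset.sum_mul]
    rw [integral_finsetSum]
    · simp_rw [mul_assoc]
    · intro i _
      simp_rw [mul_assoc]
      exact (integrable_mul_of_bound (hi i) (modeBox_aesm k _) (modeBox_abs_le k)).const_mul _
  rw [← Finset.sum_mul, ← Finset.mul_sum, h2, mul_zero, zero_mul]

/-- Young's inequality: if `|x|` exceeds `Q/24`, then `Q < 24 |x|` and a factor `|x|` cancels. With
the weight `1/24`, the two nonlinear terms of each of three components and the force use `7/24` of
the dissipation. -/
theorem le_of_sq_le_mul {x q Q : ℝ} (hQ : 0 ≤ Q) (hq : 0 ≤ q) (h : x ^ 2 ≤ q * Q) :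
    |x| ≤ 1 / 24 * Q + 24 * q := by
  rcases le_or_gt |x| (1 / 24 * Q) with h1 | h1
  · linarith
  · have h2 : 0 < |x| := lt_of_le_of_lt (by positivity) h1
    rw [← sq_abs] at h
    have h3 : |x| * |x| ≤ 24 * q * |x| := by nlinarith
    have := le_of_mul_le_mul_right h3 h2
    linarith

/-- Young's inequality with exponents `4` and `4/3`, by the same cancellation, now of `|x|³`. -/
theorem le_of_pow_four_le_mul {x q Q : ℝ} (hQ : 0 ≤ Q) (hq : 0 ≤ q) (h : x ^ 4 ≤ q * Q ^ 3) :
    |x| ≤ 1 / 24 * Q + 24 ^ 3 * q := by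
  rcases le_or_gt |x| (1 / 24 * Q) with h1 | h1
  · have : 0 ≤ 24 ^ 3 * q := by positivity
    linarith
  · have h2 : 0 < |x| := lt_of_le_of_lt (by positivity) h1
    have h4 : x ^ 4 = |x| ^ 4 := by rw [show 4 = 2 * 2 from rfl, pow_mul, pow_mul, sq_abs]
    have h5 : Q ^ 3 ≤ (24 * |x|) ^ 3 := pow_le_pow_left₀ hQ (by linarith) 3
    have h3 : |x| * |x| ^ 3 ≤ 24 ^ 3 * q * |x| ^ 3 := by
      have := mul_le_mul_of_nonneg_left h5 hq
      rw [mul_pow] at this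
      rw [h4] at h
      nlinarith
    have := le_of_mul_le_mul_right h3 (by positivity)
    have : 0 ≤ 1 / 24 * Q := by positivity
    linarith

/-- The energy inequality at a fixed time, with the test function `u + D_h^* D_h u`. -/
theorem Slice.energy_le (S : Slice ε δ N ω ω' ω'' ν ν' ν'' f fz u ut d e P) (hδ : 0 ≤ δ)
    {h : ℝ} (hh : 0 < h) :
    (∑ i, ∫ x, testOp h (u i) x * ut i x ∂volBox)
      + ∑ i, ((∫ x, testOp h (d i 0) x * d i 0 x ∂volBox)
        + ∫ x, testOp h (d i 1) x * d i 1 x ∂volBox)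
      ≤ 1 / 2 * (∑ i, dissipation (d i) (e i))
        + 10 ^ 14 * (1 + ((∫ x, ω' x ^ 2 ∂volBox) + ∫ x, ω'' x ^ 2 ∂volBox) + N ^ 2)
          * (∑ i, energy (u i) (d i))
        + 10 ^ 14 * ∑ i, ((∫ s, ‖f i s‖ ^ 2 ∂volI) + ∫ s, ‖fz i s‖ ^ 2 ∂volI) := by
  set a := (∫ x, ω' x ^ 2 ∂volBox) + ∫ x, ω'' x ^ 2 ∂volBox with ha
  set Y := ∑ i, energy (u i) (d i) with hY
  set E := ∑ i, dissipation (d i) (e i) with hE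
  have ha0 : 0 ≤ a := add_nonneg (integral_sq_nonneg _) (integral_sq_nonneg _)
  have hY0 : 0 ≤ Y := Finset.sum_nonneg fun i _ => energy_nonneg _ _
  have hE0 : 0 ≤ E := Finset.sum_nonneg fun i _ => dissipation_nonneg _ _
  have hYi : ∀ i, energy (u i) (d i) ≤ Y := fun i =>
    Finset.single_le_sum (f := fun i => energy (u i) (d i)) (fun j _ => energy_nonneg _ _)
      (Finset.mem_univ i)
  have hEi : ∀ i, dissipation (d i) (e i) ≤ E := fun i =>
    Finset.single_le_sum (f := fun i => dissipation (d i) (e i)) (fun j _ => dissipation_nonneg _ _)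
      (Finset.mem_univ i)
  let A : Fin 3 → ℝ := fun i => ∫ x, testOp h (u i) x * ut i x ∂volBox
  let B : Fin 3 → Fin 3 → ℝ := fun i j => ∫ x, testOp h (d i j) x * d i j x ∂volBox
  let Tω : Fin 3 → ℝ := fun i => ∫ x, testOp h (d i 2) x * (ω x * u i x) ∂volBox
  let Tν : Fin 3 → ℝ := fun i => ∫ x, testOp h (d i 2) x * (ε⁻¹ * u 2 x * ν i x) ∂volBox
  -- All terms of the equation except pressure and force. They are products of square summable
  -- sequences, so their series converge.
  let L : Fin 3 → Freq → ℝ := fun i k => coeff (testOp h (u i)) k * (coeff (ut i) k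
    - (coeff (e i 0 0) k + coeff (e i 1 1) k + δ * coeff (e i 2 2) k)
    - Real.pi * freq 2 k * coeff (fun x => ω x * u i x) (flip 2 k)
    - Real.pi * freq 2 k * coeff (fun x => ε⁻¹ * u 2 x * ν i x) (flip 2 k))
  have hct : ∀ i j, CoeffDeriv j (testOp h (u i)) (testOp h (d i j)) := fun i j =>
    CoeffDeriv.testOp (S.mu i) (S.md i j) (S.cu i j) h
  have hL : ∀ i, HasSum (L i) (A i + (B i 0 + B i 1 + δ * B i 2) - Tω i - Tν i) := fun i => by
    have hB : ∀ j, HasSum (fun k => -(coeff (testOp h (u i)) k * coeff (e i j j) k)) (B i j) :=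
      fun j => by
        have h1 := hasSum_parts (memLp_testOp (S.md i j) h) (S.md i j) (hct i j)
        refine Eq.subst (motive := fun F => HasSum F (B i j)) ?_ h1
        funext k
        rw [S.cd i j j k]
        ring
    have h1 := (((hasSum_coeff (memLp_testOp (S.mu i) h) (S.mdt i)).add
      (((hB 0).add (hB 1)).add ((hB 2).mul_left δ))).sub
        (hasSum_parts (memLp_testOp (S.md i 2) h) (S.memLp_transport i) (hct i 2))).sub
        (hasSum_parts (memLp_testOp (S.md i 2) h) (S.memLp_vertical i) (hct i 2))
    refine Eq.subst (motive := fun F =>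
      HasSum F (A i + (B i 0 + B i 1 + δ * B i 2) - Tω i - Tν i)) ?_ h1
    funext k
    simp only [L]
    ring
  -- On a truncated sum the pressure is zero and the force is bounded independently of `M`. Thus
  -- neither of these two needs a limit.
  have hfin : ∀ M, ∑ i, ∑ k ∈ freqBox M, L i k
      ≤ ∑ i, (1 / 24 * (energy (u i) (d i) + dissipation (d i) (e i))
        + 12 * ((∫ s, ‖f i s‖ ^ 2 ∂volI) + ∫ s, ‖fz i s‖ ^ 2 ∂volI)) := fun M => by
    have h1 : ∑ i, ∑ k ∈ freqBox M, L i k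
        = ∑ i, ∑ k ∈ freqBox M, mult h k * coeff (u i) k * dualCoeff (f i) k := by
      rw [← sub_zero (∑ i, ∑ k ∈ freqBox M, L i k), ← S.sum_pressure h M,
        ← Finset.sum_sub_distrib]
      refine Finset.sum_congr rfl fun i _ => ?_
      rw [← Finset.sum_sub_distrib]
      refine Finset.sum_congr rfl fun k _ => ?_
      rw [← S.momentum i k, ← coeff_testOp (S.mu i)]
      simp only [L]
      ring
    rw [h1]
    refine Finset.sum_le_sum fun i _ => ?_
    have h2 := (le_abs_self _).trans (abs_sum_forcing_le (S.mf i) (S.mfz i) (S.cf i) hh M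
      (coeff (u i)) (S.sum_coeff_le i M))
    refine h2.trans ?_
    have hp : 0 ≤ energy (u i) (d i) + dissipation (d i) (e i) :=
      add_nonneg (energy_nonneg _ _) (dissipation_nonneg _ _)
    have s1 := Real.sq_sqrt (integral_nonneg fun s => sq_nonneg ‖f i s‖ :
      0 ≤ ∫ s, ‖f i s‖ ^ 2 ∂volI)
    have s2 := Real.sq_sqrt (integral_nonneg fun s => sq_nonneg ‖fz i s‖ :
      0 ≤ ∫ s, ‖fz i s‖ ^ 2 ∂volI)
    have s3 := Real.sq_sqrt hp
    nlinarith [sq_nonneg (√(∫ s, ‖f i s‖ ^ 2 ∂volI) - √(∫ s, ‖fz i s‖ ^ 2 ∂volI)),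
      sq_nonneg (12 * (√(∫ s, ‖f i s‖ ^ 2 ∂volI) + √(∫ s, ‖fz i s‖ ^ 2 ∂volI))
        - √(energy (u i) (d i) + dissipation (d i) (e i)))]
  have hlim : Tendsto (fun M => ∑ i, ∑ k ∈ freqBox M, L i k) atTop
      (𝓝 (∑ i, (A i + (B i 0 + B i 1 + δ * B i 2) - Tω i - Tν i))) :=
    tendsto_finsetSum _ fun i _ => (hL i).comp tendsto_freqBox
  have hmain := le_of_tendsto' hlim hfin
  have hω : ∀ i, Tω i ≤ 1 / 24 * (Y + E) + 24 * (1600 * a * Y) := fun i => by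
    refine (le_abs_self _).trans (le_of_sq_le_mul (by positivity) (by positivity) ?_)
    refine (S.transport_le i hh).trans ?_
    have h1 : energy (u i) (d i) * (energy (u i) (d i) + dissipation (d i) (e i)) ≤ Y * (Y + E) :=
      mul_le_mul (hYi i) (add_le_add (hYi i) (hEi i))
        (add_nonneg (energy_nonneg _ _) (dissipation_nonneg _ _)) hY0
    have := mul_le_mul_of_nonneg_left h1 (by positivity : 0 ≤ 1600 * a)
    linarith
  have hν : ∀ i, Tν i ≤ 1 / 24 * (Y + E) + 24 ^ 3 * (1000000000 * N ^ 2 * Y) := fun i => by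
    refine (le_abs_self _).trans (le_of_pow_four_le_mul (by positivity) (by positivity) ?_)
    refine (S.vertical_le i hh).trans ?_
    have h1 : energy (u i) (d i) * (energy (u i) (d i) + dissipation (d i) (e i)) ≤ Y * (Y + E) :=
      mul_le_mul (hYi i) (add_le_add (hYi i) (hEi i))
        (add_nonneg (energy_nonneg _ _) (dissipation_nonneg _ _)) hY0
    have h2 : E ^ 2 ≤ (Y + E) ^ 2 := pow_le_pow_left₀ hE0 (by linarith) 2
    have h3 : E ^ 2 * (energy (u i) (d i) * (energy (u i) (d i) + dissipation (d i) (e i)))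
        ≤ (Y + E) ^ 2 * (Y * (Y + E)) :=
      mul_le_mul h2 h1 (mul_nonneg (energy_nonneg _ _)
        (add_nonneg (energy_nonneg _ _) (dissipation_nonneg _ _))) (by positivity)
    have h4 := mul_le_mul_of_nonneg_left h3 (by positivity : 0 ≤ 1000000000 * N ^ 2)
    refine (le_of_eq ?_).trans (h4.trans (le_of_eq ?_))
    · ring
    · ring
  -- The vertical diffusion is only used through its sign.
  have hB2 : ∀ i, 0 ≤ δ * B i 2 := fun i =>
    mul_nonneg hδ (integral_testOp_mul_self_nonneg (S.md i 2) h)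
  have hN2 : 0 ≤ N ^ 2 * Y := by positivity
  have haY : 0 ≤ a * Y := by positivity
  have hf0 : 0 ≤ ∑ i, ((∫ s, ‖f i s‖ ^ 2 ∂volI) + ∫ s, ‖fz i s‖ ^ 2 ∂volI) :=
    Finset.sum_nonneg fun i _ => add_nonneg (integral_nonneg fun _ => sq_nonneg _)
      (integral_nonneg fun _ => sq_nonneg _)
  rw [Finset.sum_add_distrib, ← Finset.mul_sum, Finset.sum_add_distrib, ← hY, ← hE,
    ← Finset.mul_sum] at hmain
  change (∑ i, A i) + ∑ i, (B i 0 + B i 1) ≤ _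
  simp only [Fin.sum_univ_three] at hmain ⊢
  simp only [Fin.sum_univ_three] at hf0
  have w0 := hω 0
  have w1 := hω 1
  have w2 := hω 2
  have v0 := hν 0
  have v1 := hν 1
  have v2 := hν 2
  have b0 := hB2 0
  have b1 := hB2 1
  have b2 := hB2 2
  -- The coefficient of `E` is `6/24 + 1/24 ≤ 1/2`. The largest constant is that of `N² Y`, namely
  -- `3 · 24³ · 10⁹ < 10¹⁴`.
  nlinarith

end

/-! ### Test functions of the time variable -/

/-- The Lebesgue measure on `(0,T)`. -/
abbrev volT (T : ℝ) : Measure ℝ := volume.restrict (Ioo 0 T)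

instance (T : ℝ) : IsFiniteMeasure (volT T) := ⟨by simp⟩

theorem cyl_eq (T : ℝ) : (volume.restrict (cyl T) : Measure SpaceTime) = (volT T).prod volBox := by
  rw [Measure.prod_restrict]
  rfl

theorem rect_eq (T : ℝ) : (volume.restrict (rect T) : Measure (ℝ × ℝ)) = (volT T).prod volI := by
  rw [Measure.prod_restrict]
  rfl

/-- Smooth functions with compact support in `(0,T)`. -/
structure TimeTest (T : ℝ) (η : ℝ → ℝ) : Prop where
  smooth : ContDiff ℝ (⊤ : ℕ∞) η
  compact : HasCompactSupport η
  support : tsupport η ⊆ Ioo 0 T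

theorem TimeTest.exists_Icc {T : ℝ} {η : ℝ → ℝ} (h : TimeTest T η) (hT : 0 < T) :
    ∃ a b : ℝ, 0 < a ∧ b < T ∧ ∀ t, t ∉ Icc a b → η t = 0 := by
  rcases (tsupport η).eq_empty_or_nonempty with h0 | h0
  · refine ⟨T / 2, T / 2, by linarith, by linarith, fun t _ => ?_⟩
    exact image_eq_zero_of_notMem_tsupport (by rw [h0]; exact notMem_empty _)
  · have hc : IsCompact (tsupport η) := h.compact
    obtain ⟨a, ha⟩ := hc.exists_isLeast h0
    obtain ⟨b, hb⟩ := hc.exists_isGreatest h0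
    refine ⟨a, b, (h.support ha.1).1, (h.support hb.1).2, fun t ht => ?_⟩
    exact image_eq_zero_of_notMem_tsupport fun h1 => ht ⟨ha.2 h1, hb.2 h1⟩

theorem TimeTest.exists_bound {T : ℝ} {η : ℝ → ℝ} (h : TimeTest T η) : ∃ M, ∀ t, |η t| ≤ M :=
  h.compact.exists_bound_of_continuous h.smooth.continuous

theorem TimeTest.deriv {T : ℝ} {η : ℝ → ℝ} (h : TimeTest T η) : TimeTest T (deriv η) where
  smooth := (contDiff_infty_iff_deriv.1 h.smooth).2
  compact := h.compact.deriv
  support := (closure_minimal (support_deriv_subset) (isClosed_tsupport η)).trans h.support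

theorem ae_eq_zero_of_timeTest {T : ℝ} {G : ℝ → ℝ} (hG : Integrable G (volT T))
    (h : ∀ η, TimeTest T η → ∫ t, η t * G t ∂volT T = 0) : ∀ᵐ t ∂volT T, G t = 0 := by
  rw [ae_restrict_iff' measurableSet_Ioo]
  refine isOpen_Ioo.ae_eq_zero_of_integral_contDiff_smul_eq_zero
    (IntegrableOn.locallyIntegrableOn hG) fun η h1 h2 h3 => ?_
  have h4 := h η ⟨h1, h2, h3⟩
  rw [← h4]
  refine (setIntegral_eq_integral_of_forall_compl_eq_zero fun t ht => ?_).symm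
  rw [image_eq_zero_of_notMem_tsupport fun h5 => ht (h3 h5), zero_smul]

theorem TimeTest.isTest {T : ℝ} {η : ℝ → ℝ} (h : TimeTest T η) (hT : 0 < T) {g : Space → ℝ}
    (hg : ContDiff ℝ (⊤ : ℕ∞) g) (hp : ∀ (i : Fin 3) (x : Space), g (x + (2 : ℝ) • dir i) = g x) :
    IsTest T fun p => η p.1 * g p.2 where
  smooth := (h.smooth.comp contDiff_fst).mul (hg.comp contDiff_snd)
  periodic i t x := by simp only; rw [hp]
  support := by
    obtain ⟨a, b, ha, hb, hab⟩ := h.exists_Icc hT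
    exact ⟨a, b, ha, hb, fun t x ht => by simp only; rw [hab t ht, zero_mul]⟩

theorem hasFDerivAt_mul_space {η : ℝ → ℝ} {g : Space → ℝ} (hη : ContDiff ℝ (⊤ : ℕ∞) η)
    (hg : ContDiff ℝ (⊤ : ℕ∞) g) (p : SpaceTime) :
    HasFDerivAt (fun p : SpaceTime => η p.1 * g p.2)
      (η p.1 • (fderiv ℝ g p.2).comp (ContinuousLinearMap.snd ℝ ℝ Space)
        + g p.2 • (fderiv ℝ η p.1).comp (ContinuousLinearMap.fst ℝ ℝ Space)) p :=
  ((hη.differentiable (by simp) p.1).hasFDerivAt.comp p hasFDerivAt_fst).mul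
    ((hg.differentiable (by simp) p.2).hasFDerivAt.comp p hasFDerivAt_snd)

theorem pderiv_mul_space {η : ℝ → ℝ} {g : Space → ℝ} (hη : ContDiff ℝ (⊤ : ℕ∞) η)
    (hg : ContDiff ℝ (⊤ : ℕ∞) g) (j : Fin 3) (p : SpaceTime) :
    pderiv j (fun p : SpaceTime => η p.1 * g p.2) p = η p.1 * fderiv ℝ g p.2 (dir j) := by
  rw [pderiv, (hasFDerivAt_mul_space hη hg p).fderiv]
  simp

theorem tderiv_mul_space {η : ℝ → ℝ} {g : Space → ℝ} (hη : ContDiff ℝ (⊤ : ℕ∞) η)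
    (hg : ContDiff ℝ (⊤ : ℕ∞) g) (p : SpaceTime) :
    tderiv (fun p : SpaceTime => η p.1 * g p.2) p = deriv η p.1 * g p.2 := by
  rw [tderiv, (hasFDerivAt_mul_space hη hg p).fderiv]
  simp [mul_comm]

theorem fderiv_modeBox (k : Freq) (j : Fin 3) (x : Space) :
    fderiv ℝ (modeBox k) x (dir j) = Real.pi * freq j k * modeBox (flip j k) x := by
  have hd : HasFDerivAt (modeBox k) (fderiv ℝ (modeBox k) x) x :=
    ((modeBox_contDiff k (n := 1)).differentiable (by simp) x).hasFDerivAt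
  fin_cases j
  · have h1 := hd.comp_hasDerivAt (f := fun s => (x.1, s, x.2.2)) x.2.1
      ((hasDerivAt_const _ _).prodMk ((hasDerivAt_id _).prodMk (hasDerivAt_const _ _)))
    refine h1.unique ((((mode_hasDerivAt k.2.1 x.2.1).mul_const (mode k.2.2 x.2.2)).const_mul
        (mode k.1 x.1)).congr_deriv ?_)
    simp [freq, flip, modeBox, modeG]
    ring
  · have h1 := hd.comp_hasDerivAt (f := fun s => (x.1, x.2.1, s)) x.2.2
      ((hasDerivAt_const _ _).prodMk ((hasDerivAt_const _ _).prodMk (hasDerivAt_id _)))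
    refine h1.unique ((((mode_hasDerivAt k.2.2 x.2.2).const_mul (mode k.2.1 x.2.1)).const_mul
        (mode k.1 x.1)).congr_deriv ?_)
    simp [freq, flip, modeBox, modeG]
    ring
  · have h1 := hd.comp_hasDerivAt (f := fun s => (s, x.2)) x.1
      ((hasDerivAt_id _).prodMk (hasDerivAt_const _ _))
    refine h1.unique (((mode_hasDerivAt k.1 x.1).mul_const (modeG k.2 x.2)).congr_deriv ?_)
    simp [freq, flip, modeBox, mul_assoc]

theorem modeBox_periodic (k : Freq) (i : Fin 3) (x : Space) :
    modeBox k (x + (2 : ℝ) • dir i) = modeBox k x := by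
  fin_cases i <;> simp [modeBox, modeG, dir, mode_periodic]

theorem cutMode_contDiff (n : ℕ) (k : Freq) :
    ContDiff ℝ (⊤ : ℕ∞) fun x : Space => cut n x.1 * modeBox k x :=
  ((cut_contDiff n).comp contDiff_fst).mul (modeBox_contDiff k)

theorem fderiv_cutMode (n : ℕ) (k : Freq) (x : Space) :
    fderiv ℝ (fun x : Space => cut n x.1 * modeBox k x) x (dir 2)
      = deriv (cut n) x.1 * modeBox k x
        + cut n x.1 * (Real.pi * k.1 * modeBox (flip 2 k) x) := by
  have hd := ((cutMode_contDiff n k).differentiable (by simp) x).hasFDerivAt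
  have h1 := hd.comp_hasDerivAt (f := fun s => (s, x.2)) x.1
      ((hasDerivAt_id _).prodMk (hasDerivAt_const _ _))
  refine h1.unique (((cut_hasDerivAt n x.1).mul
    ((mode_hasDerivAt k.1 x.1).mul_const (modeG k.2 x.2))).congr_deriv ?_)
  simp [flip, modeBox, mul_assoc]

theorem cutMode_periodic (n : ℕ) (k : Freq) (i : Fin 3) (x : Space) :
    cut n (x + (2 : ℝ) • dir i).1 * modeBox k (x + (2 : ℝ) • dir i) = cut n x.1 * modeBox k x := by
  rw [modeBox_periodic]
  congr 1
  fin_cases i <;> simp [dir, cut_periodic]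

/-- Near `±1` one has `1 + cos πz = 1 - cos π(1 - |z|) ≤ (π (1 - |z|))² / 2`, which is small enough
once `1 - |z|` is below `1 / (10 (n + 1))`. The cutoff modes are therefore admissible in the
definition of an interior derivative. -/
theorem exists_cut_eq_zero (n : ℕ) : ∃ r < 1, ∀ z : ℝ, r ≤ |z| → |z| ≤ 1 → cut n z = 0 := by
  have hn : (0 : ℝ) ≤ n := Nat.cast_nonneg n
  refine ⟨1 - 1 / (10 * (n + 1)), by linarith [show (0 : ℝ) < 1 / (10 * (n + 1)) by positivity],
    fun z h1 h2 => Real.smoothTransition.zero_of_nonpos ?_⟩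
  have h3 : Real.cos (Real.pi * z) = -Real.cos (Real.pi * (1 - |z|)) := by
    rw [mul_sub, mul_one, Real.cos_pi_sub, neg_neg]
    rcases abs_choice z with h | h
    · rw [h]
    · rw [h, mul_neg, Real.cos_neg]
  have h4 := Real.one_sub_sq_div_two_le_cos (x := Real.pi * (1 - |z|))
  have h5 : 0 ≤ 1 - |z| := by linarith
  have h6 : 1 - |z| ≤ 1 / (10 * (n + 1)) := by linarith
  have h7 : Real.pi * (1 - |z|) ≤ 4 * (1 / (10 * (n + 1))) :=
    mul_le_mul Real.pi_le_four h6 h5 (by norm_num)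
  have h8 := pow_le_pow_left₀ (mul_nonneg Real.pi_pos.le h5) h7 2
  have h9 : (n : ℝ) * (4 * (1 / (10 * (n + 1)))) ^ 2 ≤ 1 := by
    have : (n : ℝ) * (4 * (1 / (10 * (n + 1)))) ^ 2 = 4 * n / (25 * (n + 1) ^ 2) := by
      field_simp
      ring
    rw [this, div_le_one (by positivity)]
    nlinarith
  rw [h3]
  nlinarith [mul_le_mul_of_nonneg_left h8 hn]

/-! ### Slices at fixed times -/

theorem memLp_slice {X Y E : Type*} [MeasurableSpace X] [MeasurableSpace Y] [NormedAddCommGroup E]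
    {μ : Measure X} {ν : Measure Y} [SFinite μ] [SFinite ν] {F : X × Y → E} (hF : MemLp F 2 (μ.prod ν)) :
    ∀ᵐ t ∂μ, MemLp (fun x => F (t, x)) 2 ν := by
  have h2 := (memLp_two_iff_integrable_sq_norm hF.1).1 hF
  filter_upwards [hF.1.prodMk_left, h2.prod_right_ae] with t h3 h4
  exact (memLp_two_iff_integrable_sq_norm h3).2 h4

theorem integrable_mul_continuous {T : ℝ} {F G : SpaceTime → ℝ}
    (hF : Integrable F ((volT T).prod volBox)) (hG : Continuous G) :
    Integrable (fun p => F p * G p) ((volT T).prod volBox) := by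
  rw [← cyl_eq] at hF ⊢
  have hc : IsCompact (Icc 0 T ×ˢ (Icc (-1 : ℝ) 1 ×ˢ (Icc (-1 : ℝ) 1 ×ˢ Icc (-1 : ℝ) 1))) :=
    isCompact_Icc.prod (isCompact_Icc.prod (isCompact_Icc.prod isCompact_Icc))
  have hsub : cyl T ⊆ Icc 0 T ×ˢ (Icc (-1 : ℝ) 1 ×ˢ (Icc (-1 : ℝ) 1 ×ˢ Icc (-1 : ℝ) 1)) :=
    prod_mono Ioo_subset_Icc_self (prod_mono Ioo_subset_Icc_self
      (prod_mono Ioo_subset_Icc_self Ioo_subset_Icc_self))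
  have hmeas : MeasurableSet (cyl T) :=
    measurableSet_Ioo.prod (measurableSet_Ioo.prod (measurableSet_Ioo.prod measurableSet_Ioo))
  exact IntegrableOn.mul_continuousOn_of_subset hF hG.continuousOn hmeas hc hsub

theorem integral_cyl_mul {T : ℝ} {F : SpaceTime → ℝ} (hF : Integrable F ((volT T).prod volBox))
    {η : ℝ → ℝ} (hη : Continuous η) {g : Space → ℝ} (hg : Continuous g) :
    ∫ p in cyl T, F p * (η p.1 * g p.2) = ∫ t, η t * ∫ x, F (t, x) * g x ∂volBox ∂volT T := by
  rw [cyl_eq, integral_prod _ (integrable_mul_continuous hF (by fun_prop))]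
  refine integral_congr_ae (ae_of_all _ fun t => ?_)
  simp only
  rw [← integral_const_mul]
  refine integral_congr_ae (ae_of_all _ fun x => ?_)
  simp only
  ring

theorem integrable_space_integral {T : ℝ} {F : SpaceTime → ℝ}
    (hF : Integrable F ((volT T).prod volBox)) {g : Space → ℝ} (hg : Continuous g) :
    Integrable (fun t => ∫ x, F (t, x) * g x ∂volBox) (volT T) :=
  (integrable_mul_continuous hF (hg.comp continuous_snd)).integral_prod_left

theorem TimeTest.integrable_mul {T : ℝ} {η G : ℝ → ℝ} (h : TimeTest T η)
    (hG : Integrable G (volT T)) : Integrable (fun t => η t * G t) (volT T) := by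
  obtain ⟨M, hM⟩ := h.exists_bound
  simp_rw [mul_comm (η _)]
  exact integrable_mul_of_bound hG h.smooth.continuous.aestronglyMeasurable hM

/-- Test functions of product form, with an arbitrary factor in time, localize the identity at
almost every `t`. It is applied to countably many spatial functions, which leaves a common null set.
-/
theorem slice_eq_of_weak {T : ℝ} {F₁ F₂ : SpaceTime → ℝ}
    (h₁ : Integrable F₁ ((volT T).prod volBox)) (h₂ : Integrable F₂ ((volT T).prod volBox))
    {g₁ g₂ : Space → ℝ} (hg₁ : Continuous g₁) (hg₂ : Continuous g₂)
    (h : ∀ η, TimeTest T η → ∫ p in cyl T, F₁ p * (η p.1 * g₁ p.2)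
      = - ∫ p in cyl T, F₂ p * (η p.1 * g₂ p.2)) :
    ∀ᵐ t ∂volT T, ∫ x, F₁ (t, x) * g₁ x ∂volBox = - ∫ x, F₂ (t, x) * g₂ x ∂volBox := by
  have i₁ := integrable_space_integral h₁ hg₁
  have i₂ := integrable_space_integral h₂ hg₂
  have h3 := ae_eq_zero_of_timeTest (i₁.add i₂) fun η hη => by
    have h4 := h η hη
    rw [integral_cyl_mul h₁ hη.smooth.continuous hg₁,
      integral_cyl_mul h₂ hη.smooth.continuous hg₂] at h4
    simp only [Pi.add_apply, mul_add]
    rw [integral_add (hη.integrable_mul i₁) (hη.integrable_mul i₂), h4, neg_add_cancel]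
  filter_upwards [h3] with t ht
  simp only [Pi.add_apply] at ht
  linarith

theorem modeBox_continuous (k : Freq) : Continuous (modeBox k) :=
  (modeBox_contDiff k (n := 0)).continuous

theorem HasWeakDeriv.slice {T : ℝ} (hT : 0 < T) {j : Fin 3} {u v : SpaceTime → ℝ}
    (hu : Integrable u ((volT T).prod volBox)) (hv : Integrable v ((volT T).prod volBox))
    (h : HasWeakDeriv T j u v) :
    ∀ᵐ t ∂volT T, CoeffDeriv j (fun x => u (t, x)) fun x => v (t, x) := by
  unfold CoeffDeriv
  rw [ae_all_iff]
  intro k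
  have h1 := slice_eq_of_weak hu hv (continuous_const.mul (modeBox_continuous (flip j k)))
    (modeBox_continuous k) (g₁ := fun x => Real.pi * freq j k * modeBox (flip j k) x) fun η hη => by
      have h2 := h _ (hη.isTest hT (modeBox_contDiff k) (modeBox_periodic k))
      rw [← h2]
      refine integral_congr_ae (ae_of_all _ fun p => ?_)
      simp only
      rw [pderiv_mul_space hη.smooth (modeBox_contDiff k), fderiv_modeBox]
  filter_upwards [h1] with t ht
  rw [coeff, coeff, ← integral_const_mul, ← neg_eq_iff_eq_neg, ← ht]
  refine integral_congr_ae (ae_of_all _ fun x => ?_)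
  simp only
  ring

theorem HasWeakDerivInterior.slice {T : ℝ} (hT : 0 < T) {u v : SpaceTime → ℝ}
    (hu : Integrable u ((volT T).prod volBox)) (hv : Integrable v ((volT T).prod volBox))
    (h : HasWeakDerivInterior T u v) :
    ∀ᵐ t ∂volT T, CutDeriv (fun x => u (t, x)) fun x => v (t, x) := by
  unfold CutDeriv
  rw [ae_all_iff]
  intro n
  rw [ae_all_iff]
  intro k
  have hc1 : Continuous fun x : Space => deriv (cut n) x.1 * modeBox k x
      + cut n x.1 * (Real.pi * k.1 * modeBox (flip 2 k) x) :=
    (((cut_deriv_continuous n).comp continuous_fst).mul (modeBox_continuous k)).add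
      (((cut_continuous n).comp continuous_fst).mul
        (continuous_const.mul (modeBox_continuous (flip 2 k))))
  refine slice_eq_of_weak hu hv hc1 (cutMode_contDiff n k).continuous fun η hη => ?_
  obtain ⟨r, hr, hz⟩ := exists_cut_eq_zero n
  have h2 := h _ (hη.isTest hT (cutMode_contDiff n k) (cutMode_periodic n k))
    ⟨r, hr, fun t z w h3 h4 => by simp only; rw [hz z h3 h4, zero_mul, mul_zero]⟩
  rw [← h2]
  refine integral_congr_ae (ae_of_all _ fun p => ?_)
  simp only
  rw [pderiv_mul_space hη.smooth (cutMode_contDiff n k), fderiv_cutMode]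

/-! ### Slices of functions with values in the dual space -/

theorem integrable_rect_mul_continuous {T : ℝ} {F G : ℝ × ℝ → ℝ}
    (hF : Integrable F ((volT T).prod volI)) (hG : Continuous G) :
    Integrable (fun p => F p * G p) ((volT T).prod volI) := by
  rw [← rect_eq] at hF ⊢
  exact IntegrableOn.mul_continuousOn_of_subset hF hG.continuousOn
    (measurableSet_Ioo.prod measurableSet_Ioo) (isCompact_Icc.prod isCompact_Icc)
    (prod_mono Ioo_subset_Icc_self Ioo_subset_Icc_self)

theorem integral_rect_mul {T : ℝ} {F : ℝ × ℝ → ℝ} (hF : Integrable F ((volT T).prod volI))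
    {η : ℝ → ℝ} (hη : Continuous η) {g : ℝ → ℝ} (hg : Continuous g) :
    ∫ p, η p.1 * g p.2 * F p ∂(volT T).prod volI = ∫ t, η t * ∫ s, g s * F (t, s) ∂volI ∂volT T := by
  have h1 : ∀ p : ℝ × ℝ, η p.1 * g p.2 * F p = F p * (η p.1 * g p.2) := fun p => mul_comm _ _
  simp_rw [h1]
  rw [integral_prod _ (integrable_rect_mul_continuous hF (by fun_prop))]
  refine integral_congr_ae (ae_of_all _ fun t => ?_)
  simp only
  rw [← integral_const_mul]
  refine integral_congr_ae (ae_of_all _ fun x => ?_)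
  simp only
  ring

theorem integrable_section_integral {T : ℝ} {F : ℝ × ℝ → ℝ}
    (hF : Integrable F ((volT T).prod volI)) {g : ℝ → ℝ} (hg : Continuous g) :
    Integrable (fun t => ∫ s, g s * F (t, s) ∂volI) (volT T) := by
  simp_rw [mul_comm (g _)]
  exact (integrable_rect_mul_continuous hF (hg.comp continuous_snd)).integral_prod_left

theorem MemLp.integral_smul_apply {X E : Type*} [MeasurableSpace X] [NormedAddCommGroup E]
    [NormedSpace ℝ E] {μ : Measure X} [IsFiniteMeasure μ] {f : X → E →L[ℝ] ℝ} (hf : MemLp f 2 μ)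
    {a : X → ℝ} (ha : AEStronglyMeasurable a μ) {M : ℝ} (hM : ∀ᵐ x ∂μ, ‖a x‖ ≤ M) (v : E) :
    (∫ x, a x • f x ∂μ) v = ∫ x, a x * f x v ∂μ := by
  have hi : Integrable (fun x => a x • f x) μ := (hf.integrable (by norm_num)).bdd_smul M ha hM
  rw [ContinuousLinearMap.integral_apply hi]
  rfl

/-- The identity between integrals in the dual space is evaluated at one horizontal mode. What
remains is scalar and is localized in time as before. -/
theorem HasWeakDerivDual.slice {T : ℝ} (hT : 0 < T) {f fz : ℝ × ℝ → Hneg1}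
    (hf : MemLp f 2 ((volT T).prod volI)) (hfz : MemLp fz 2 ((volT T).prod volI))
    (h : HasWeakDerivDual T f fz) :
    ∀ᵐ t ∂volT T, ∀ k, dualCoeff (fun s => fz (t, s)) k
      = -(Real.pi * freq 2 k * dualCoeff (fun s => f (t, s)) (flip 2 k)) := by
  rw [ae_all_iff]
  intro k
  have hi := MemLp.integrable_apply hf (modeH1 k.2)
  have hiz := MemLp.integrable_apply hfz (modeH1 k.2)
  have i1 := integrable_section_integral hi (g := fun s => Real.pi * k.1 * mode (-k.1) s)
    (continuous_const.mul (mode_continuous _))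
  have i2 := integrable_section_integral hiz (mode_continuous k.1)
  have h3 := ae_eq_zero_of_timeTest (i1.add i2) fun η hη => by
    obtain ⟨M, hM⟩ := hη.exists_bound
    have hd : ∀ q : ℝ × ℝ, HasFDerivAt (fun q : ℝ × ℝ => η q.1 * mode k.1 q.2)
        (η q.1 • (fderiv ℝ (mode k.1) q.2).comp (ContinuousLinearMap.snd ℝ ℝ ℝ)
        + mode k.1 q.2 • (fderiv ℝ η q.1).comp (ContinuousLinearMap.fst ℝ ℝ ℝ)) q := fun q =>
      ((hη.smooth.differentiable (by simp) q.1).hasFDerivAt.comp q hasFDerivAt_fst).mul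
        (((mode_contDiff k.1 (n := 1)).differentiable (by simp) q.2).hasFDerivAt.comp q
          hasFDerivAt_snd)
    have hd' : ∀ q : ℝ × ℝ, fderiv ℝ (fun q : ℝ × ℝ => η q.1 * mode k.1 q.2) q (0, 1)
        = η q.1 * (Real.pi * k.1 * mode (-k.1) q.2) := fun q => by
      rw [(hd q).fderiv]
      simp [mode_deriv]
    have h4 := h (fun q => η q.1 * mode k.1 q.2)
      ((hη.smooth.comp contDiff_fst).mul ((mode_contDiff k.1).comp contDiff_snd))
      (fun t z => by simp only; rw [mode_periodic]) (by
        obtain ⟨a, b, ha, hb, hab⟩ := hη.exists_Icc hT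
        exact ⟨a, b, ha, hb, fun t z ht => by simp only; rw [hab t ht, zero_mul]⟩)
    simp_rw [hd', rect_eq] at h4
    have hM0 : 0 ≤ M := (abs_nonneg _).trans (hM 0)
    have hη' := hη.smooth.continuous
    have hmc := mode_continuous k.1
    have hmc' := mode_continuous (-k.1)
    have e1 := MemLp.integral_smul_apply hf (a := fun q => η q.1 * (Real.pi * k.1 * mode (-k.1) q.2))
      (by fun_prop) (M := M * (|Real.pi * k.1| * 2)) (ae_of_all _ fun q => by
        rw [norm_mul, norm_mul]
        exact mul_le_mul (hM _) (mul_le_mul_of_nonneg_left (mode_abs_le _ _) (norm_nonneg _))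
          (by positivity) hM0) (modeH1 k.2)
    have e2 := MemLp.integral_smul_apply hfz (a := fun q => η q.1 * mode k.1 q.2)
      (by fun_prop) (M := M * 2) (ae_of_all _ fun q => by
        rw [norm_mul]
        exact mul_le_mul (hM _) (mode_abs_le _ _) (norm_nonneg _) hM0) (modeH1 k.2)
    have h5 := congrArg (fun A : Hneg1 => A (modeH1 k.2)) h4
    have h6 := e1.symm.trans (h5.trans (congrArg Neg.neg e2))
    rw [integral_rect_mul hi hη.smooth.continuous (g := fun s => Real.pi * k.1 * mode (-k.1) s)
      (by fun_prop), integral_rect_mul hiz hη.smooth.continuous hmc] at h6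
    simp only [Pi.add_apply, mul_add]
    rw [integral_add (hη.integrable_mul i1) (hη.integrable_mul i2), h6, neg_add_cancel]
  filter_upwards [h3] with t ht
  simp only [Pi.add_apply, mul_assoc] at ht
  rw [integral_const_mul, integral_const_mul] at ht
  simp only [dualCoeff, freq, flip, Matrix.cons_val]
  linarith

theorem IsHorizTest.toH1_congr {ψ χ : ℝ × ℝ → ℝ} (h : IsHorizTest ψ) (h' : IsHorizTest χ)
    (e : ψ = χ) : h.toH1 = h'.toH1 := by
  subst e
  rfl

theorem pairing_modeBox {T : ℝ} {g : ℝ × ℝ → Hneg1} (hg : MemLp g 2 ((volT T).prod volI))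
    {η : ℝ → ℝ} (hη : Continuous η) (k : Freq) (h : IsTest T fun p => η p.1 * modeBox k p.2) :
    pairing g h = ∫ t, η t * dualCoeff (fun s => g (t, s)) k ∂volT T := by
  have h1 : ∀ q, (h.slice q).toH1 = (η q.1 * mode k.1 q.2) • modeH1 k.2 := fun q => by
    rw [modeH1, ← (isHorizTest_modeG k.2).toH1_const_mul]
    refine IsHorizTest.toH1_congr _ _ ?_
    funext w
    simp only [modeBox]
    ring
  unfold pairing
  simp_rw [h1, map_smul, smul_eq_mul, rect_eq]
  exact integral_rect_mul (MemLp.integrable_apply hg (modeH1 k.2)) hη (mode_continuous k.1)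

theorem _root_.MeasureTheory.MemLp.slice_dual {X Y E : Type*} [MeasurableSpace X]
    [MeasurableSpace Y] [NormedAddCommGroup E] [NormedSpace ℝ E] {μ : Measure X} {ν : Measure Y}
    [SFinite μ] [SFinite ν] {F : X × Y → E →L[ℝ] ℝ} (hF : MemLp F 2 (μ.prod ν)) :
    ∀ᵐ t ∂μ, MemLp (fun x => F (t, x)) 2 ν :=
  memLp_slice hF

/-- The norm of the field in `H²_z L⁴_xy` at the time `t`. -/
def fieldNorm (ν ν' ν'' : Fin 3 → SpaceTime → ℝ) (t : ℝ) : ℝ≥0∞ :=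
  ∫⁻ s, (sectionL4 (fun i x => ν i (t, x)) s + sectionL4 (fun i x => ν' i (t, x)) s
    + sectionL4 (fun i x => ν'' i (t, x)) s) ∂volI

theorem aemeasurable_sectionL4 {T : ℝ} {g : Fin 3 → SpaceTime → ℝ}
    (hg : ∀ i, AEStronglyMeasurable (g i) ((volT T).prod volBox)) :
    AEMeasurable (fun q : ℝ × ℝ => sectionL4 (fun i x => g i (q.1, x)) q.2)
      ((volT T).prod volI) := by
  have h1 : AEMeasurable (fun p => ENNReal.ofReal ((∑ i, g i p ^ 2) ^ 2))
      ((volT T).prod (volI.prod volG)) := by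
    rw [← volBox_eq]
    refine (AEMeasurable.pow_const (Finset.aemeasurable_fun_sum _ fun i _ => ?_) 2).ennreal_ofReal
    exact (hg i).aemeasurable.pow_const 2
  have h2 := h1.comp_quasiMeasurePreserving
    (measurePreserving_prodAssoc (volT T) volI volG).quasiMeasurePreserving
  exact h2.lintegral_prod_right'.pow_const _

theorem aemeasurable_fieldNorm {T : ℝ} {ν ν' ν'' : Fin 3 → SpaceTime → ℝ}
    (h : ∀ i, AEStronglyMeasurable (ν i) ((volT T).prod volBox))
    (h' : ∀ i, AEStronglyMeasurable (ν' i) ((volT T).prod volBox))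
    (h'' : ∀ i, AEStronglyMeasurable (ν'' i) ((volT T).prod volBox)) :
    AEMeasurable (fieldNorm ν ν' ν'') (volT T) :=
  (((aemeasurable_sectionL4 h).add (aemeasurable_sectionL4 h')).add
    (aemeasurable_sectionL4 h'')).lintegral_prod_right'

/-- `L⁴(G) ⊂ L²(G)` on a set of finite measure: the Hölder estimate on sections is used with the
constant function `1`. -/
theorem memLp_of_sectionL4_le {T : ℝ} {g : Fin 3 → SpaceTime → ℝ}
    (hg : ∀ i, AEStronglyMeasurable (g i) ((volT T).prod volBox)) {N : ℝ → ℝ≥0∞}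
    (hN : ∫⁻ t, N t ^ 2 ∂volT T < ∞)
    (h : ∀ t, ∫⁻ s, sectionL4 (fun i x => g i (t, x)) s ∂volI ≤ N t) (i : Fin 3) :
    MemLp (g i) 2 ((volT T).prod volBox) := by
  let c : ℝ≥0∞ := (∫⁻ _, 1 ^ 2 ∂volG) ^ (1 / 2 : ℝ)
  have hc0 : ∫⁻ _, (1 : ℝ≥0∞) ^ 2 ∂volG ≠ ∞ := by
    simpa using measure_ne_top volG univ
  have hc : c ≠ ∞ := ENNReal.rpow_ne_top_of_nonneg (by norm_num) hc0
  refine (memLp_two_iff_integrable_sq (hg i)).2 ⟨(hg i).pow 2, ?_⟩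
  rw [hasFiniteIntegral_iff_ofReal (ae_of_all _ fun p => sq_nonneg _)]
  have hm : AEMeasurable (fun p => ENNReal.ofReal (g i p ^ 2)) ((volT T).prod volBox) :=
    ((hg i).aemeasurable.pow_const 2).ennreal_ofReal
  rw [lintegral_prod _ hm]
  have h1 : ∀ᵐ t ∂volT T, ∫⁻ x, ENNReal.ofReal (g i (t, x) ^ 2) ∂volBox ≤ (1 + N t ^ 2) * c := by
    filter_upwards [(hg i).prodMk_left] with t ht
    have h2 := lintegral_vert_mul_le_sectionL4 (g := fun i x => g i (t, x)) ht
      (b := fun _ => 1) aemeasurable_const (fun _ => ENNReal.one_ne_top) hc0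
    have h3 : ∫⁻ x, ENNReal.ofReal (g i (t, x) ^ 2) ∂volBox
        = ∫⁻ w, vert (fun x => g i (t, x)) w * 1 ∂volG := by
      have hmt : AEMeasurable (fun x => ENNReal.ofReal (g i (t, x) ^ 2)) (volI.prod volG) := by
        rw [← volBox_eq]
        exact (ht.aemeasurable.pow_const 2).ennreal_ofReal
      rw [volBox_eq, lintegral_prod_symm _ hmt]
      simp only [mul_one]
      rfl
    rw [h3]
    refine h2.trans (mul_le_mul' ((h t).trans ?_) le_rfl)
    -- `N ≤ 1 + N²` on the bounded time interval, where only `N²` is known to be integrable.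
    rcases le_total (N t) 1 with h4 | h4
    · exact h4.trans le_self_add
    · exact (le_self_pow h4 two_ne_zero).trans le_add_self
  refine (lintegral_mono_ae h1).trans_lt ?_
  rw [lintegral_mul_const' _ _ hc, lintegral_add_left measurable_const]
  refine ENNReal.mul_lt_top (ENNReal.add_lt_top.2 ⟨by simp, hN⟩) hc.lt_top

theorem MemL4H2L4.memLp {T : ℝ} {ν ν' ν'' : Fin 3 → SpaceTime → ℝ} (h : MemL4H2L4 T ν ν' ν'')
    (i : Fin 3) : MemLp (ν i) 2 ((volT T).prod volBox) ∧ MemLp (ν' i) 2 ((volT T).prod volBox)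
      ∧ MemLp (ν'' i) 2 ((volT T).prod volBox) := by
  have hm := h.meas
  have hm' := h.meas_z
  have hm'' := h.meas_zz
  rw [cyl_eq] at hm hm' hm''
  have hN : ∫⁻ t, fieldNorm ν ν' ν'' t ^ 2 ∂volT T < ∞ := h.finite
  exact ⟨memLp_of_sectionL4_le hm hN (fun t => lintegral_mono fun s =>
      le_self_add.trans le_self_add) i,
    memLp_of_sectionL4_le hm' hN (fun t => lintegral_mono fun s =>
      le_add_self.trans le_self_add) i,
    memLp_of_sectionL4_le hm'' hN (fun t => lintegral_mono fun s => le_add_self) i⟩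

theorem MemL4H2L4.ae_lt_top {T : ℝ} {ν ν' ν'' : Fin 3 → SpaceTime → ℝ} (h : MemL4H2L4 T ν ν' ν'') :
    AEMeasurable (fieldNorm ν ν' ν'') (volT T) ∧ ∀ᵐ t ∂volT T, fieldNorm ν ν' ν'' t < ∞ := by
  have hm := h.meas
  have hm' := h.meas_z
  have hm'' := h.meas_zz
  rw [cyl_eq] at hm hm' hm''
  have h1 := aemeasurable_fieldNorm hm hm' hm''
  refine ⟨h1, ?_⟩
  have hN : ∫⁻ t, fieldNorm ν ν' ν'' t ^ 2 ∂volT T ≠ ∞ := h.finite.ne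
  filter_upwards [ae_lt_top' (h1.pow_const 2) hN] with t ht
  by_contra hc
  rw [not_lt, top_le_iff] at hc
  rw [hc] at ht
  simp at ht

/-- The momentum equation at almost every time, tested with the modes. -/
theorem IsSolution.momentum_slice {T ε δ : ℝ} (hT : 0 < T) {ω : SpaceTime → ℝ}
    {ν : Fin 3 → SpaceTime → ℝ} {f : Fin 3 → ℝ × ℝ → Hneg1} {U₀ : Fin 3 → Space → ℝ}
    {U Ut : Fin 3 → SpaceTime → ℝ} {DU : Fin 3 → Fin 3 → SpaceTime → ℝ}
    {D2U : Fin 3 → Fin 3 → Fin 3 → SpaceTime → ℝ} {P : SpaceTime → ℝ}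
    (S : IsSolution T ε δ ω ν f U₀ U Ut DU D2U P) (hω : MemLp ω 2 ((volT T).prod volBox))
    (hν : ∀ i, MemLp (ν i) 2 ((volT T).prod volBox))
    (hf : ∀ i, MemLp (f i) 2 ((volT T).prod volI)) (i : Fin 3) (k : Freq) :
    ∀ᵐ t ∂volT T, coeff (fun x => Ut i (t, x)) k
      - (coeff (fun x => D2U i 0 0 (t, x)) k + coeff (fun x => D2U i 1 1 (t, x)) k
        + δ * coeff (fun x => D2U i 2 2 (t, x)) k)
      - Real.pi * freq 2 k * coeff (fun x => ω (t, x) * U i (t, x)) (flip 2 k)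
      - Real.pi * freq 2 k * coeff (fun x => ε⁻¹ * U 2 (t, x) * ν i (t, x)) (flip 2 k)
      - gradScale ε i * (Real.pi * freq i k * coeff (fun x => P (t, x)) (flip i k))
      = dualCoeff (fun s => f i (t, s)) k := by
  have mU := S.memE1.memLp
  have mt := S.memE1.memLp_t
  have m2 := S.memE1.memLp_D2
  have iP : Integrable P ((volT T).prod volBox) := by
    rw [← cyl_eq]
    exact S.pressure
  rw [cyl_eq] at mU mt m2
  have hi : ∀ {F : SpaceTime → ℝ}, MemLp F 2 ((volT T).prod volBox) →
      Integrable F ((volT T).prod volBox) := fun hF => hF.integrable (by norm_num)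
  let F₁ : SpaceTime → ℝ := fun p => Ut i p - (D2U i 0 0 p + D2U i 1 1 p + δ * D2U i 2 2 p)
  have h1 : Integrable F₁ ((volT T).prod volBox) :=
    hi ((mt i).sub (((m2 i 0 0).add (m2 i 1 1)).add ((m2 i 2 2).const_mul δ)))
  have h2 : Integrable (fun p => ω p * U i p) ((volT T).prod volBox) := hω.integrable_mul (mU i)
  have h3 : Integrable (fun p => ε⁻¹ * U 2 p * ν i p) ((volT T).prod volBox) :=
    ((mU 2).const_mul ε⁻¹).integrable_mul (hν i)
  have c0 := modeBox_continuous k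
  have c2 : Continuous fun x => Real.pi * freq 2 k * modeBox (flip 2 k) x :=
    continuous_const.mul (modeBox_continuous _)
  have c3 : Continuous fun x => gradScale ε i * (Real.pi * freq i k * modeBox (flip i k) x) :=
    continuous_const.mul (continuous_const.mul (modeBox_continuous _))
  have i1 := integrable_space_integral h1 c0
  have i2 := integrable_space_integral h2 c2
  have i3 := integrable_space_integral h3 c2
  have i4 := integrable_space_integral iP c3
  have i5 : Integrable (fun t => dualCoeff (fun s => f i (t, s)) k) (volT T) :=
    integrable_section_integral (MemLp.integrable_apply (hf i) (modeH1 k.2)) (mode_continuous k.1)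
  have h4 := ae_eq_zero_of_timeTest ((((i1.sub i2).sub i3).sub i4).sub i5) fun η hη => by
    have hη' := hη.smooth.continuous
    have ht := hη.isTest hT (modeBox_contDiff k) (modeBox_periodic k)
    have h5 := S.momentum i _ ht
    rw [pairing_modeBox (hf i) hη' k] at h5
    have e : ∀ j p, pderiv j (fun p : SpaceTime => η p.1 * modeBox k p.2) p
        = η p.1 * (Real.pi * freq j k * modeBox (flip j k) p.2) := fun j p => by
      rw [pderiv_mul_space hη.smooth (modeBox_contDiff k), fderiv_modeBox]
    have e' : ∀ p : SpaceTime, gradScale ε i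
        * (η p.1 * (Real.pi * freq i k * modeBox (flip i k) p.2))
        = η p.1 * (gradScale ε i * (Real.pi * freq i k * modeBox (flip i k) p.2)) := fun p => by
      ring
    simp_rw [e, e'] at h5
    rw [integral_cyl_mul h1 hη' c0, integral_cyl_mul h2 hη' c2, integral_cyl_mul h3 hη' c2,
      integral_cyl_mul iP hη' c3] at h5
    have j1 := hη.integrable_mul i1
    have j2 := hη.integrable_mul i2
    have j3 := hη.integrable_mul i3
    have j4 := hη.integrable_mul i4
    have j5 := hη.integrable_mul i5
    simp only [Pi.sub_apply, mul_sub]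
    have k2 := integral_sub j1 j2
    have k3 := integral_sub (j1.sub j2) j3
    have k4 := integral_sub ((j1.sub j2).sub j3) j4
    have k5 := integral_sub (((j1.sub j2).sub j3).sub j4) j5
    simp only [Pi.sub_apply] at k3 k4 k5
    rw [k5, k4, k3, k2, h5, sub_self]
  filter_upwards [h4, memLp_slice (mt i), memLp_slice (m2 i 0 0), memLp_slice (m2 i 1 1),
    memLp_slice (m2 i 2 2)] with t ht n0 n1 n2 n3
  have hj : ∀ {F : Space → ℝ}, MemLp F 2 volBox → Integrable F volBox := fun hF =>
    hF.integrable (by norm_num)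
  have k1 : ∫ x, F₁ (t, x) * modeBox k x ∂volBox = coeff (fun x => Ut i (t, x)) k
      - (coeff (fun x => D2U i 0 0 (t, x)) k + coeff (fun x => D2U i 1 1 (t, x)) k
        + δ * coeff (fun x => D2U i 2 2 (t, x)) k) := by
    have a1 : Integrable (fun x => D2U i 0 0 (t, x) + D2U i 1 1 (t, x)) volBox :=
      (hj n1).add (hj n2)
    have a2 : Integrable (fun x => D2U i 0 0 (t, x) + D2U i 1 1 (t, x) + δ * D2U i 2 2 (t, x))
      volBox := a1.add ((hj n3).const_mul δ)
    rw [← coeff_const_mul, ← coeff_add (hj n1) (hj n2), ← coeff_add a1 ((hj n3).const_mul δ),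
      ← coeff_sub (hj n0) a2]
    rfl
  have k2 : ∀ F : Space → ℝ, ∫ x, F x * (Real.pi * freq 2 k * modeBox (flip 2 k) x) ∂volBox
      = Real.pi * freq 2 k * coeff F (flip 2 k) := fun F => by
    rw [coeff, ← integral_const_mul]
    exact integral_congr_ae (ae_of_all _ fun x => by simp only; ring)
  have k3 : ∀ F : Space → ℝ, ∫ x, F x * (gradScale ε i * (Real.pi * freq i k
      * modeBox (flip i k) x)) ∂volBox
      = gradScale ε i * (Real.pi * freq i k * coeff F (flip i k)) := fun F => by
    rw [coeff, ← integral_const_mul, ← integral_const_mul]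
    exact integral_congr_ae (ae_of_all _ fun x => by simp only; ring)
  simp only [Pi.sub_apply] at ht
  rw [k1, k2 (fun x => ω (t, x) * U i (t, x)), k2 (fun x => ε⁻¹ * U 2 (t, x) * ν i (t, x)),
    k3 (fun x => P (t, x))] at ht
  linarith

/-- At almost every time, the slices satisfy the relations collected in `Slice`. -/
theorem IsSolution.slice {T ε δ : ℝ} (hT : 0 < T) {ω ωz ωzz : SpaceTime → ℝ}
    {ν νz νzz : Fin 3 → SpaceTime → ℝ} {f fz : Fin 3 → ℝ × ℝ → Hneg1} {U₀ : Fin 3 → Space → ℝ}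
    {U Ut : Fin 3 → SpaceTime → ℝ} {DU : Fin 3 → Fin 3 → SpaceTime → ℝ}
    {D2U : Fin 3 → Fin 3 → Fin 3 → SpaceTime → ℝ} {P : SpaceTime → ℝ}
    (S : IsSolution T ε δ ω ν f U₀ U Ut DU D2U P) (hf : MemL2Vdual T f fz)
    (hω : MemTransport T ω ωz ωzz) (hν : MemL4H2L4 T ν νz νzz) :
    ∀ᵐ t ∂volT T, Slice ε δ (fieldNorm ν νz νzz t).toReal (fun x => ω (t, x)) (fun x => ωz (t, x))
      (fun x => ωzz (t, x)) (fun i x => ν i (t, x)) (fun i x => νz i (t, x))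
      (fun i x => νzz i (t, x)) (fun i s => f i (t, s)) (fun i s => fz i (t, s))
      (fun i x => U i (t, x)) (fun i x => Ut i (t, x)) (fun i j x => DU i j (t, x))
      (fun i j k x => D2U i j k (t, x)) (fun x => P (t, x)) := by
  have mω := hω.memLp
  have mωz := hω.memLp_z
  have mωzz := hω.memLp_zz
  have mf := hf.memLp
  have mfz := hf.memLp_z
  have mU := S.memE1.memLp
  have mt := S.memE1.memLp_t
  have mD := S.memE1.memLp_D
  have m2 := S.memE1.memLp_D2
  have hdiv := S.div_free
  have hpar := S.parity_U
  rw [cyl_eq] at mω mωz mωzz mU mt mD m2 hdiv hpar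
  rw [rect_eq] at mf mfz
  have mν := fun i => (hν.memLp i).1
  have mν' := fun i => (hν.memLp i).2.1
  have mν'' := fun i => (hν.memLp i).2.2
  have hi : ∀ {F : SpaceTime → ℝ}, MemLp F 2 ((volT T).prod volBox) →
      Integrable F ((volT T).prod volBox) := fun hF => hF.integrable (by norm_num)
  have A1 := ae_all_iff.2 fun i => memLp_slice (mν i)
  have A2 := ae_all_iff.2 fun i => memLp_slice (mν' i)
  have A3 := ae_all_iff.2 fun i => memLp_slice (mν'' i)
  have A4 := ae_all_iff.2 fun i => (mf i).slice_dual
  have A5 := ae_all_iff.2 fun i => (mfz i).slice_dual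
  have A6 := ae_all_iff.2 fun i => memLp_slice (mU i)
  have A7 := ae_all_iff.2 fun i => memLp_slice (mt i)
  have A8 := ae_all_iff.2 fun i => ae_all_iff.2 fun j => memLp_slice (mD i j)
  have A9 := ae_all_iff.2 fun i => ae_all_iff.2 fun j => ae_all_iff.2 fun k => memLp_slice (m2 i j k)
  have B1 := ae_all_iff.2 fun i => (hν.deriv_z i).slice hT (hi (mν i)) (hi (mν' i))
  have B2 := ae_all_iff.2 fun i => (hν.deriv_zz i).slice hT (hi (mν' i)) (hi (mν'' i))
  have B3 := ae_all_iff.2 fun i => (hf.deriv_z i).slice hT (mf i) (mfz i)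
  have B4 := ae_all_iff.2 fun i => ae_all_iff.2 fun j =>
    (S.memE1.deriv i j).slice hT (hi (mU i)) (hi (mD i j))
  have B5 := ae_all_iff.2 fun i => ae_all_iff.2 fun j => ae_all_iff.2 fun k =>
    (S.memE1.deriv2 i j k).slice hT (hi (mD i j)) (hi (m2 i j k))
  have B6 := ae_all_iff.2 fun i => Measure.ae_ae_of_ae_prod (hpar i)
  have B7 := ae_all_iff.2 fun i => ae_all_iff.2 fun k => S.momentum_slice hT mω mν mf i k
  filter_upwards [memLp_slice mω, memLp_slice mωz, memLp_slice mωzz, A1, A2, A3, A4, A5, A6, A7, A8,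
    A9, hν.ae_lt_top.2, hω.deriv_z.slice hT (hi mω) (hi mωz),
    hω.deriv_zz.slice hT (hi mωz) (hi mωzz), B1, B2, hν.periodic.slice hT (hi (mν 2)) (hi (mν' 2)),
    B3, B4, B5, Measure.ae_ae_of_ae_prod hdiv, B6, B7]
    with t a1 a2 a3 a4 a5 a6 a7 a8 a9 a10 a11 a12 a14 a15 a16 a17 a18 a19 a20 a21 a22 a23 a24 a25
  exact ⟨a1, a2, a3, a4, a5, a6, a7, a8, a9, a10, a11, a12, ENNReal.toReal_nonneg,
    (ENNReal.ofReal_toReal a14.ne).symm.le.trans' le_rfl, a15, a16, a17, a18, a19, a20, a21, a22,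
    a23, a24, a25⟩

/-! ### Evolution of the Fourier coefficients -/

/-- Limits at an end point are taken along almost every time, since slices have a meaning only up to
null sets. Uniqueness of such limits requires the filter to be proper. -/
theorem neBot_inf_ae {l : Filter ℝ} (h : ∀ s ∈ l, volume s ≠ 0) : (l ⊓ ae volume).NeBot := by
  rw [neBot_iff]
  intro hb
  obtain ⟨s, hs, t, ht, hst⟩ := inf_eq_bot_iff.1 hb
  exact h s hs (measure_mono_null (fun x hx hxt => (hst ▸ ⟨hx, hxt⟩ : x ∈ (∅ : Set ℝ))) ht)

instance (a : ℝ) : (𝓝[>] a ⊓ ae volume).NeBot :=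
  neBot_inf_ae fun s hs => by
    obtain ⟨b, hb, hbs⟩ := mem_nhdsGT_iff_exists_Ioo_subset.1 hs
    have h1 : 0 < volume (Ioo a b) := by simpa using hb
    exact (h1.trans_le (measure_mono hbs)).ne'

instance (a : ℝ) : (𝓝[<] a ⊓ ae volume).NeBot :=
  neBot_inf_ae fun s hs => by
    obtain ⟨b, hb, hbs⟩ := mem_nhdsLT_iff_exists_Ioo_subset.1 hs
    have h1 : 0 < volume (Ioo b a) := by simpa using hb
    exact (h1.trans_le (measure_mono hbs)).ne'

theorem integral_volT {T : ℝ} (hT : 0 ≤ T) (g : ℝ → ℝ) : ∫ t, g t ∂volT T = ∫ t in (0 : ℝ)..T, g t := by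
  rw [intervalIntegral.integral_of_le hT, integral_Ioc_eq_integral_Ioo]

theorem intervalIntegrable_volT {T : ℝ} (hT : 0 ≤ T) {g : ℝ → ℝ} (hg : Integrable g (volT T)) :
    IntervalIntegrable g volume 0 T := by
  rwa [intervalIntegrable_iff_integrableOn_Ioo_of_le hT]

theorem TimeTest.sub_const_mul {T : ℝ} {η θ : ℝ → ℝ} (h : TimeTest T η) (h' : TimeTest T θ) (m : ℝ) :
    TimeTest T fun t => η t - m * θ t where
  smooth := h.smooth.sub (contDiff_const.mul h'.smooth)
  compact := h.compact.sub (h'.compact.mul_left (f := fun _ => m))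
  support := by
    refine (tsupport_sub (f := η) (g := fun t => m * θ t)).trans (union_subset h.support ?_)
    exact (tsupport_mul_subset_right (f := fun _ => m)).trans h'.support

/-- The vanishing mean makes the primitive zero to the right of the support as well. -/
theorem TimeTest.primitive {T : ℝ} (hT : 0 < T) {θ : ℝ → ℝ} (h : TimeTest T θ)
    (h0 : ∫ t, θ t ∂volT T = 0) : TimeTest T fun t => ∫ s in (0 : ℝ)..t, θ s := by
  obtain ⟨a, b, ha, hb, hab⟩ := h.exists_Icc hT
  have hi : ∀ x y, IntervalIntegrable θ volume x y :=
    fun x y => h.smooth.continuous.intervalIntegrable x y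
  rw [integral_volT hT.le] at h0
  have hz : ∀ t, t ∉ Icc a b → ∫ s in (0 : ℝ)..t, θ s = 0 := by
    intro t ht
    rcases lt_or_ge t a with h1 | h1
    · refine intervalIntegral.integral_zero_ae (ae_of_all _ fun s hs => hab s fun h2 => ?_)
      have := hs.2
      rcases max_choice 0 t with h3 | h3 <;> linarith [h2.1]
    · have h2 : b < t := not_le.1 fun h2 => ht ⟨h1, h2⟩
      rw [← intervalIntegral.integral_add_adjacent_intervals (hi 0 T) (hi T t), h0, zero_add]
      refine intervalIntegral.integral_zero_ae (ae_of_all _ fun s hs => hab s fun h3 => ?_)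
      have := hs.1
      rcases min_choice T t with h4 | h4 <;> linarith [h3.2]
  have hd : ∀ t, HasDerivAt (fun t => ∫ s in (0 : ℝ)..t, θ s) (θ t) t := fun t =>
    (h.smooth.continuous.integral_hasStrictDerivAt 0 t).hasDerivAt
  have hsub : tsupport (fun t => ∫ s in (0 : ℝ)..t, θ s) ⊆ Icc a b :=
    closure_minimal (fun t ht => not_not.1 fun h1 => ht (hz t h1)) isClosed_Icc
  refine ⟨contDiff_infty_iff_deriv.2 ⟨fun t => (hd t).differentiableAt, ?_⟩,
    isCompact_Icc.of_isClosed_subset (isClosed_tsupport _) hsub,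
    hsub.trans fun t ht => ⟨ha.trans_le ht.1, ht.2.trans_lt hb⟩⟩
  rw [funext fun t => (hd t).deriv]
  exact h.smooth

theorem exists_timeTest {T : ℝ} (hT : 0 < T) : ∃ η, TimeTest T η ∧ ∫ t, η t ∂volT T = 1 := by
  let f : ContDiffBump (T / 2) := ⟨T / 8, T / 4, by linarith, by linarith⟩
  have hs : tsupport (f.normed volume) ⊆ Ioo 0 T := by
    rw [f.tsupport_normed_eq, Real.closedBall_eq_Icc]
    intro t ht
    change t ∈ Icc (T / 2 - T / 4) (T / 2 + T / 4) at ht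
    exact ⟨by linarith [ht.1], by linarith [ht.2]⟩
  refine ⟨f.normed volume, ⟨f.contDiff_normed, f.hasCompactSupport_normed, hs⟩, ?_⟩
  rw [← f.integral_normed (μ := volume)]
  exact setIntegral_eq_integral_of_forall_compl_eq_zero fun t ht =>
    image_eq_zero_of_notMem_tsupport fun h5 => ht (hs h5)

/-- A function with an integrable weak derivative is a primitive of that derivative. -/
theorem exists_eq_primitive {T : ℝ} (hT : 0 < T) {c d : ℝ → ℝ} (hc : Integrable c (volT T))
    (hd : Integrable d (volT T))
    (h : ∀ η, TimeTest T η → ∫ t, deriv η t * c t ∂volT T = - ∫ t, η t * d t ∂volT T) :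
    ∃ C, ∀ᵐ t ∂volT T, c t = C + ∫ s in (0 : ℝ)..t, d s := by
  have hdi := intervalIntegrable_volT hT.le hd
  let D : ℝ → ℝ := fun t => ∫ s in (0 : ℝ)..t, d s
  have hDi : Integrable D (volT T) := by
    have h1 : ContinuousOn D (Icc 0 T) := by
      have := intervalIntegral.continuousOn_primitive_interval' hdi left_mem_uIcc
      rwa [uIcc_of_le hT.le] at this
    exact (h1.integrableOn_Icc).mono_set Ioo_subset_Icc_self
  have he : Integrable (fun t => c t - D t) (volT T) := hc.sub hDi
  -- The difference of `c` and a primitive of `d` has weak derivative zero.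
  have h0 : ∀ η, TimeTest T η → ∫ t, deriv η t * (c t - D t) ∂volT T = 0 := by
    intro η hη
    have i1 := hη.deriv.integrable_mul hc
    have i2 := hη.deriv.integrable_mul hDi
    have i3 := hη.integrable_mul hd
    have hη0 : η 0 = 0 := image_eq_zero_of_notMem_tsupport fun h1 => lt_irrefl _ (hη.support h1).1
    have hηT : η T = 0 := image_eq_zero_of_notMem_tsupport fun h1 => lt_irrefl _ (hη.support h1).2
    have h1 := integral_product_rule (f := η) (g := D) (f' := deriv η) (g' := d) hT.le
      (hη.deriv.smooth.continuous.intervalIntegrable _ _) hdi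
      (fun x _ => by
        rw [intervalIntegral.integral_deriv_eq_sub
          (fun y _ => hη.smooth.differentiable (by simp) y)
          (hη.deriv.smooth.continuous.intervalIntegrable _ _)]
        ring)
      (fun x _ => by simp [D])
    rw [hη0, hηT, zero_mul, zero_mul, sub_zero, ← integral_volT hT.le,
      integral_add i2 i3] at h1
    have h2 : (fun t => deriv η t * (c t - D t)) = fun t => deriv η t * c t - deriv η t * D t := by
      funext t; ring
    rw [h2, integral_sub i1 i2, h η hη]
    linarith
  obtain ⟨η₀, hη₀, h1⟩ := exists_timeTest hT
  refine ⟨∫ t, η₀ t * (c t - D t) ∂volT T, ?_⟩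
  set C := ∫ t, η₀ t * (c t - D t) ∂volT T
  have hi : Integrable (fun t => c t - D t - C) (volT T) := he.sub (integrable_const C)
  have h2 := ae_eq_zero_of_timeTest hi fun η hη => by
    have j1 := hη.integrable_mul he
    have j2 := hη₀.integrable_mul he
    have jη : Integrable η (volT T) := by
      simpa using hη.integrable_mul (integrable_const (1 : ℝ))
    have jη₀ : Integrable η₀ (volT T) := by
      simpa using hη₀.integrable_mul (integrable_const (1 : ℝ))
    -- Du Bois-Reymond's argument: subtracting a multiple of a fixed bump of integral one gives mean
    -- zero, so the result is the derivative of a test function.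
    have hθ := hη.sub_const_mul hη₀ (∫ t, η t ∂volT T)
    have hψ := hθ.primitive hT (by
      rw [integral_sub jη (jη₀.const_mul _), integral_const_mul, h1]
      ring)
    have h3 := h0 _ hψ
    have h4 : ∀ t, deriv (fun t => ∫ s in (0 : ℝ)..t, (η s - (∫ t, η t ∂volT T) * η₀ s)) t
        = η t - (∫ t, η t ∂volT T) * η₀ t := fun t =>
      (hθ.smooth.continuous.integral_hasStrictDerivAt 0 t).hasDerivAt.deriv
    simp_rw [h4] at h3
    have h5 : (fun t => (η t - (∫ t, η t ∂volT T) * η₀ t) * (c t - D t))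
        = fun t => η t * (c t - D t) - (∫ t, η t ∂volT T) * (η₀ t * (c t - D t)) := by
      funext t; ring
    rw [h5, integral_sub j1 (j2.const_mul _), integral_const_mul] at h3
    have h6 : (fun t => η t * (c t - D t - C))
        = fun t => η t * (c t - D t) - C * η t := by
      funext t; ring
    rw [h6, integral_sub j1 (jη.const_mul _), integral_const_mul]
    linarith
  filter_upwards [h2] with t ht
  linarith

theorem coeff_sq_le {g : Space → ℝ} (hg : MemLp g 2 volBox) (k : Freq) :
    coeff g k ^ 2 ≤ ∫ x, g x ^ 2 ∂volBox :=
  le_hasSum (hasSum_coeff_sq hg) k fun _ _ => sq_nonneg _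

/-- The Fourier coefficients of a function with a weak time derivative in `L²` are primitives. -/
theorem HasWeakTimeDeriv.coeff_eq {T : ℝ} (hT : 0 < T) {u v : SpaceTime → ℝ} {u₀ : Space → ℝ}
    (hu : MemLp u 2 ((volT T).prod volBox)) (hv : MemLp v 2 ((volT T).prod volBox))
    (hu₀ : MemLp u₀ 2 volBox) (h : HasWeakTimeDeriv T u v)
    (hi : Tendsto (fun t => ∫⁻ x in box, ENNReal.ofReal ((u (t, x) - u₀ x) ^ 2))
      (𝓝[>] 0 ⊓ ae volume) (𝓝 0)) (k : Freq) :
    ∀ᵐ t ∂volT T, coeff (fun x => u (t, x)) k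
      = coeff u₀ k + ∫ s in (0 : ℝ)..t, coeff (fun x => v (s, x)) k := by
  have iu := hu.integrable (by norm_num)
  have iv := hv.integrable (by norm_num)
  have ic := integrable_space_integral iu (modeBox_continuous k)
  have id := integrable_space_integral iv (modeBox_continuous k)
  obtain ⟨C, hC⟩ := exists_eq_primitive hT ic id fun η hη => by
    have h1 := h _ (hη.isTest hT (modeBox_contDiff k) (modeBox_periodic k))
    simp_rw [tderiv_mul_space hη.smooth (modeBox_contDiff k)] at h1
    rwa [integral_cyl_mul iu hη.deriv.smooth.continuous (modeBox_continuous k),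
      integral_cyl_mul iv hη.smooth.continuous (modeBox_continuous k)] at h1
  have hdi := intervalIntegrable_volT hT.le id
  let D : ℝ → ℝ := fun t => ∫ s in (0 : ℝ)..t, coeff (fun x => v (s, x)) k
  have hD : Tendsto D (𝓝[>] 0 ⊓ ae volume) (𝓝 0) := by
    have h1 := intervalIntegral.continuousOn_primitive_interval' hdi left_mem_uIcc
    rw [uIcc_of_le hT.le] at h1
    have h2 := (h1 0 (left_mem_Icc.2 hT.le)).tendsto
    simp only [intervalIntegral.integral_same] at h2
    refine h2.mono_left (inf_le_left.trans ?_)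
    rw [← nhdsWithin_Ioo_eq_nhdsGT hT]
    exact nhdsWithin_mono _ Ioo_subset_Icc_self
  -- By Bessel's inequality a single coefficient is controlled by the `L²` distance to the initial
  -- value. In the limit this identifies the constant `C`.
  have hev : ∀ᶠ t in 𝓝[>] 0 ⊓ ae volume, ENNReal.ofReal ((C + D t - coeff u₀ k) ^ 2)
      ≤ ∫⁻ x in box, ENNReal.ofReal ((u (t, x) - u₀ x) ^ 2) := by
    have e1 : ∀ᶠ t in 𝓝[>] 0 ⊓ ae volume, t ∈ Ioo 0 T :=
      mem_inf_of_left (Ioo_mem_nhdsGT hT)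
    have e2 : ∀ᶠ t in 𝓝[>] 0 ⊓ ae volume, t ∈ Ioo 0 T →
        coeff (fun x => u (t, x)) k = C + D t ∧ MemLp (fun x => u (t, x)) 2 volBox :=
      mem_inf_of_right ((ae_restrict_iff' measurableSet_Ioo).1 (hC.and (memLp_slice hu)))
    filter_upwards [e1, e2] with t h1 h2
    obtain ⟨h3, h4⟩ := h2 h1
    have h5 : MemLp (fun x => u (t, x) - u₀ x) 2 volBox := h4.sub hu₀
    rw [← h3, ← coeff_sub (h4.integrable (by norm_num)) (hu₀.integrable (by norm_num)),
      ← ofReal_integral_eq_lintegral_ofReal h5.integrable_sq (ae_of_all _ fun x => sq_nonneg _)]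
    exact ENNReal.ofReal_le_ofReal (coeff_sq_le h5 k)
  have hl : Tendsto (fun t => ENNReal.ofReal ((C + D t - coeff u₀ k) ^ 2)) (𝓝[>] 0 ⊓ ae volume)
      (𝓝 (ENNReal.ofReal ((C + 0 - coeff u₀ k) ^ 2))) :=
    ENNReal.tendsto_ofReal (((tendsto_const_nhds.add hD).sub_const _).pow 2)
  have h1 := le_of_tendsto_of_tendsto hl hi hev
  rw [nonpos_iff_eq_zero, ENNReal.ofReal_eq_zero, add_zero] at h1
  have h2 : C - coeff u₀ k = 0 := pow_eq_zero_iff (two_ne_zero) |>.1 (le_antisymm h1 (sq_nonneg _))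
  filter_upwards [hC] with t ht
  rw [coeff, ht, sub_eq_zero.1 h2]
  rfl

/-! ### The energy inequality from the evolution of the coefficients -/

theorem volT_le {t T : ℝ} (h : t ≤ T) : volT t ≤ volT T :=
  Measure.restrict_mono (Ioo_subset_Ioo_right h) le_rfl

theorem ae_mem_volT (T : ℝ) : ∀ᵐ t ∂volT T, t ∈ Ioo 0 T := ae_restrict_mem measurableSet_Ioo

theorem sq_eq_of_eq_primitive {T : ℝ} (hT : 0 < T) {c d : ℝ → ℝ} {c₀ : ℝ}
    (hd : Integrable d (volT T)) (h : ∀ᵐ t ∂volT T, c t = c₀ + ∫ s in (0 : ℝ)..t, d s) :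
    Integrable (fun t => c t * d t) (volT T) ∧
      ∀ᵐ t ∂volT T, c t ^ 2 = c₀ ^ 2 + 2 * ∫ s, c s * d s ∂volT t := by
  have hdi := intervalIntegrable_volT hT.le hd
  let p : ℝ → ℝ := fun t => c₀ + ∫ s in (0 : ℝ)..t, d s
  have hp : ContinuousOn p (Icc 0 T) := by
    have := intervalIntegral.continuousOn_primitive_interval' hdi left_mem_uIcc
    rw [uIcc_of_le hT.le] at this
    exact continuousOn_const.add this
  have hpd : Integrable (fun t => p t * d t) (volT T) := by
    have h1 : IntegrableOn d (Icc 0 T) := by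
      rwa [integrableOn_Icc_iff_integrableOn_Ioo]
    exact (h1.continuousOn_mul hp isCompact_Icc).mono_set Ioo_subset_Icc_self
  have hcd : (fun t => p t * d t) =ᵐ[volT T] fun t => c t * d t := by
    filter_upwards [h] with t ht
    rw [ht]
  refine ⟨hpd.congr hcd, ?_⟩
  filter_upwards [h, ae_mem_volT T] with t ht h0
  have hpt := hdi.mono_set (b := T) (c := 0) (d := t) (by
    rw [uIcc_of_le h0.1.le, uIcc_of_le hT.le]
    exact Icc_subset_Icc_right h0.2.le)
  have h1 := integral_product_rule (f := p) (g := p) (f' := d) (g' := d) h0.1.le hpt hpt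
    (fun x _ => by simp [p]) (fun x _ => by simp [p])
  have h2 : (fun x => d x * p x + p x * d x) = fun x => 2 * (p x * d x) := by
    funext x; ring
  rw [h2, intervalIntegral.integral_const_mul, ← integral_volT h0.1.le,
    integral_congr_ae (ae_mono (volT_le h0.2.le) hcd)] at h1
  have h3 : p 0 = c₀ := by simp [p]
  have h4 : p t = c t := ht.symm
  rw [h3, h4] at h1
  linarith

/-- Summation over modes of the identities for squared coefficients, with weights `m j`. These
weights are unbounded, so the sum of the `m j * p j` need not converge. The bounded weights `mₙ n j
≤ m j` allow the interchange of sum and time integral, and for them `R` bounds the result. The limit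
`n → ∞` is taken in finite sums, and only afterwards are these exhausted. -/
theorem energy_le_of_coeff {J : Type*} [Countable J] {T : ℝ} {q p w g : J → ℝ → ℝ} {q₀ m : J → ℝ}
    {mₙ : ℕ → J → ℝ} {b : ℕ → ℝ} {W y E R : ℝ → ℝ} {y₀ lam : ℝ}
    (hm₀ : ∀ n j, 0 ≤ mₙ n j) (hmb : ∀ n j, mₙ n j ≤ b n) (hml : ∀ n j, mₙ n j ≤ m j)
    (hm : ∀ j, Tendsto (fun n => mₙ n j) atTop (𝓝 (m j)))
    (ip : ∀ j, Integrable (p j) (volT T)) (ig : ∀ j, Integrable (g j) (volT T))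
    (hg : ∀ j t, 0 ≤ g j t) (hq₀ : ∀ j, 0 ≤ q₀ j)
    (hqn : ∀ j t, 0 ≤ q j t)
    (hq : ∀ j, ∀ᵐ t ∂volT T, q j t = q₀ j + 2 * ∫ s, p j s ∂volT t)
    (hw : ∀ᵐ t ∂volT T, ∀ j, |p j t| ≤ w j t) (hW : ∀ᵐ t ∂volT T, HasSum (fun j => w j t) (W t))
    (iW : Integrable W (volT T)) (hy : ∀ᵐ t ∂volT T, HasSum (fun j => m j * q j t) (y t))
    (hE : ∀ᵐ t ∂volT T, HasSum (fun j => m j * g j t) (E t)) (iE : Integrable E (volT T))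
    (hy₀ : HasSum (fun j => m j * q₀ j) y₀) (iR : Integrable R (volT T))
    (hR : ∀ n, ∀ᵐ s ∂volT T, ∀ F : Finset J,
      ∑' j, mₙ n j * p j s + lam * ∑ j ∈ F, mₙ n j * g j s ≤ R s) :
    ∀ᵐ t ∂volT T, y t + 2 * lam * ∫ s, E s ∂volT t ≤ y₀ + 2 * ∫ s, R s ∂volT t := by
  filter_upwards [ae_mem_volT T, ae_all_iff.2 hq, hy] with t ht hqt hyt
  have hle := volT_le ht.2.le
  have ip' := fun j => (ip j).mono_measure hle
  have ig' := fun j => (ig j).mono_measure hle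
  have hW' := ae_mono hle hW
  have hw' := ae_mono hle hw
  have hbn : ∀ n j, |mₙ n j| ≤ b n := fun n j => by
    rw [abs_of_nonneg (hm₀ n j)]
    exact hmb n j
  have step1 : ∀ n (F : Finset J), ∑ j ∈ F, mₙ n j * q j t + 2 * lam * ∑ j ∈ F, mₙ n j *
      ∫ s, g j s ∂volT t ≤ y₀ + 2 * ∫ s, R s ∂volT t := by
    intro n F
    have hS : ∀ᵐ s ∂volT t, HasSum (fun j => mₙ n j * p j s) (∑' j, mₙ n j * p j s) := by
      filter_upwards [hW', hw'] with s h1 h2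
      refine (Summable.of_norm_bounded (h1.mul_left (b n)).summable fun j => ?_).hasSum
      rw [Real.norm_eq_abs, abs_mul]
      exact mul_le_mul (hbn n j) (h2 j) (abs_nonneg _) ((abs_nonneg _).trans (hbn n j))
    have hbd : ∀ j, ∀ᵐ s ∂volT t, ‖mₙ n j * p j s‖ ≤ b n * w j s := fun j => by
      filter_upwards [hw'] with s h2
      rw [Real.norm_eq_abs, abs_mul]
      exact mul_le_mul (hbn n j) (h2 j) (abs_nonneg _) ((abs_nonneg _).trans (hbn n j))
    have hsb : ∀ᵐ s ∂volT t, HasSum (fun j => b n * w j s) (b n * W s) := by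
      filter_upwards [hW'] with s h1
      exact h1.mul_left _
    have hib : Integrable (fun s => ∑' j, b n * w j s) (volT t) := by
      refine ((iW.mono_measure hle).const_mul (b n)).congr ?_
      filter_upwards [hsb] with s h1
      exact h1.tsum_eq.symm
    -- For fixed `n` the terms are dominated by `b n * w j`, whose sum is integrable.
    have hsum := hasSum_integral_of_dominated_convergence (fun j s => b n * w j s)
      (fun j => ((ip' j).const_mul (mₙ n j)).1) hbd (hsb.mono fun s h => h.summable) hib hS
    have hiS : Integrable (fun s => ∑' j, mₙ n j * p j s) (volT t) := by
      have hms : AEStronglyMeasurable (fun s => ∑' j, mₙ n j * p j s) (volT t) :=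
        aestronglyMeasurable_of_tendsto_ae (atTop : Filter (Finset J))
          (f := fun F s => ∑ j ∈ F, mₙ n j * p j s)
          (fun F => (integrable_finsetSum F fun j _ => (ip' j).const_mul (mₙ n j)).1) hS
      refine Integrable.mono' hib hms ?_
      filter_upwards [hS, hsb, ae_all_iff.2 hbd] with s h1 h2 h3
      exact (norm_tsum_le_tsum_norm (h2.summable.of_nonneg_of_le (fun _ => norm_nonneg _) h3)).trans
        ((h2.summable.of_nonneg_of_le (fun _ => norm_nonneg _) h3).tsum_le_tsum h3 h2.summable)
    simp_rw [integral_const_mul] at hsum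
    have h₀ : Summable fun j => mₙ n j * q₀ j :=
      hy₀.summable.of_nonneg_of_le (fun j => mul_nonneg (hm₀ n j) (hq₀ j)) fun j =>
        mul_le_mul_of_nonneg_right (hml n j) (hq₀ j)
    have h₀le : ∑' j, mₙ n j * q₀ j ≤ y₀ := by
      rw [← hy₀.tsum_eq]
      exact h₀.tsum_le_tsum (fun j => mul_le_mul_of_nonneg_right (hml n j) (hq₀ j)) hy₀.summable
    have hqs := h₀.hasSum.add (hsum.mul_left 2)
    -- The terms `mₙ n j * q j t` are nonnegative, so a finite part may be kept and the others
    -- dropped.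
    have hF : ∑ j ∈ F, mₙ n j * q j t
        ≤ ∑' j, mₙ n j * q₀ j + 2 * ∫ s, ∑' j, mₙ n j * p j s ∂volT t := by
      have e1 : ∀ j, mₙ n j * q₀ j + 2 * (mₙ n j * ∫ s, p j s ∂volT t) = mₙ n j * q j t := fun j => by
        rw [hqt j]; ring
      simp_rw [e1] at hqs
      exact sum_le_hasSum F (fun j _ => mul_nonneg (hm₀ n j) (hqn j t)) hqs
    have igF : Integrable (fun s => ∑ j ∈ F, mₙ n j * g j s) (volT t) :=
      integrable_finsetSum F fun j _ => (ig' j).const_mul (mₙ n j)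
    have hi2 : Integrable (fun s => ∑' j, mₙ n j * p j s + lam * ∑ j ∈ F, mₙ n j * g j s) (volT t) :=
      hiS.add (igF.const_mul lam)
    have h5 := integral_mono_ae hi2 (iR.mono_measure hle)
      (Eventually.mono (ae_mono hle (hR n)) fun s h => h F)
    rw [integral_add hiS (igF.const_mul lam), integral_const_mul,
      integral_finsetSum F fun j _ => (ig' j).const_mul (mₙ n j)] at h5
    simp_rw [integral_const_mul] at h5
    linarith
  have step2 : ∀ F : Finset J, ∑ j ∈ F, m j * q j t + 2 * lam * ∑ j ∈ F, m j * ∫ s, g j s ∂volT t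
      ≤ y₀ + 2 * ∫ s, R s ∂volT t := fun F => by
    have h1 : Tendsto (fun n => ∑ j ∈ F, mₙ n j * q j t) atTop (𝓝 (∑ j ∈ F, m j * q j t)) :=
      tendsto_finsetSum F fun j _ => (hm j).mul_const _
    have h2 : Tendsto (fun n => ∑ j ∈ F, mₙ n j * ∫ s, g j s ∂volT t) atTop
        (𝓝 (∑ j ∈ F, m j * ∫ s, g j s ∂volT t)) :=
      tendsto_finsetSum F fun j _ => (hm j).mul_const _
    exact le_of_tendsto (h1.add (h2.const_mul (2 * lam))) (Eventually.of_forall fun n => step1 n F)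
  have hm₁ : ∀ j, 0 ≤ m j := fun j => (hm₀ 0 j).trans (hml 0 j)
  have hE' : ∀ᵐ s ∂volT t, HasSum (fun j => m j * g j s) (E s) := ae_mono hle hE
  have hEs : HasSum (fun j => m j * ∫ s, g j s ∂volT t) (∫ s, E s ∂volT t) := by
    have h1 := hasSum_integral_of_dominated_convergence (F := fun j s => m j * g j s) (f := E)
      (fun j s => m j * g j s)
      (fun j => ((ig' j).const_mul (m j)).1)
      (fun j => ae_of_all _ fun s => by
        rw [Real.norm_eq_abs, abs_of_nonneg (mul_nonneg (hm₁ j) (hg j s))])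
      (hE'.mono fun s h => h.summable)
      ((iE.mono_measure hle).congr (hE'.mono fun s h => h.tsum_eq.symm)) hE'
    simp_rw [integral_const_mul] at h1
    exact h1
  exact le_of_tendsto (Tendsto.add hyt (Tendsto.const_mul (2 * lam) hEs))
    (Eventually.of_forall step2)

/-- `2 - 2 cos x = 4 sin²(x/2)`, and the difference quotient of the sine at `0` converges to its
derivative. -/
theorem tendsto_mult (k : Freq) :
    Tendsto (fun n : ℕ => mult (1 / ((n : ℝ) + 1)) k) atTop (𝓝 (1 + (Real.pi * k.1) ^ 2)) := by
  let a : ℝ := Real.pi * k.1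
  have hd : HasDerivAt (fun h : ℝ => Real.sin (a / 2 * h)) (a / 2) 0 := by
    have := ((hasDerivAt_id (0 : ℝ)).const_mul (a / 2)).sin
    simpa using this
  have h1 := (hasDerivAt_iff_tendsto_slope_zero.1 hd).mono_left
    (nhdsWithin_mono (s := Ioi 0) (0 : ℝ) fun x hx => ne_of_gt hx)
  have h2 : Tendsto (fun n : ℕ => 1 / ((n : ℝ) + 1)) atTop (𝓝[>] 0) :=
    tendsto_nhdsWithin_iff.2 ⟨tendsto_one_div_add_atTop_nhds_zero_nat,
      Eventually.of_forall fun n => mem_Ioi.2 (by positivity)⟩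
  have h3 := (((h1.comp h2).pow 2).const_mul 4).const_add 1
  have e1 : 1 + 4 * (a / 2) ^ 2 = 1 + (Real.pi * k.1) ^ 2 := by
    simp only [a]; ring
  rw [e1] at h3
  refine h3.congr fun n => ?_
  have hn : (1 / ((n : ℝ) + 1)) ≠ 0 := by positivity
  simp only [Function.comp, zero_add, mul_zero, Real.sin_zero, sub_zero, smul_eq_mul, mult]
  have h4 : Real.cos (Real.pi * k.1 * (1 / ((n : ℝ) + 1)))
      = 1 - 2 * Real.sin (a / 2 * (1 / ((n : ℝ) + 1))) ^ 2 := by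
    have : Real.pi * k.1 * (1 / ((n : ℝ) + 1)) = 2 * (a / 2 * (1 / ((n : ℝ) + 1))) := by
      simp only [a]; ring
    rw [this, Real.cos_two_mul', Real.cos_sq']
    ring
  rw [h4]
  field_simp
  ring

theorem hasSum_sq_add_sq {g g' : Space → ℝ} (hg : MemLp g 2 volBox) (hg' : MemLp g' 2 volBox)
    (h : CoeffDeriv 2 g g') :
    HasSum (fun k : Freq => (1 + (Real.pi * k.1) ^ 2) * coeff g k ^ 2)
      ((∫ x, g x ^ 2 ∂volBox) + ∫ x, g' x ^ 2 ∂volBox) := by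
  have h1 := ((show Function.Involutive (flip 2) from flip_flip 2).toPerm _).hasSum_iff.2
    (hasSum_coeff_sq hg')
  have h2 := (hasSum_coeff_sq hg).add h1
  refine h2.congr_fun ?_
  intro k
  have h3 := h.coeff_flip k
  simp only [Function.comp, Function.Involutive.coe_toPerm]
  rw [h3]
  simp only [freq]
  simp
  ring

/-- Mixed weak derivatives commute because their symbols do. -/
theorem CoeffDeriv.comm {j l : Fin 3} {u a b c : Space → ℝ} (h₁ : CoeffDeriv j u a)
    (h₂ : CoeffDeriv l a b) (h₃ : CoeffDeriv l u c) (hjl : j ≠ l) : CoeffDeriv j c b := by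
  intro k
  have e1 : freq j (flip l k) = freq j k := by
    fin_cases j <;> fin_cases l <;> simp_all [freq, flip]
  have e2 : freq l (flip j k) = freq l k := by
    fin_cases j <;> fin_cases l <;> simp_all [freq, flip]
  have e3 : flip j (flip l k) = flip l (flip j k) := by
    fin_cases j <;> fin_cases l <;> simp [flip]
  rw [h₂, h₁, h₃, e1, e2, e3]
  ring

theorem HasWeakDerivSpace.coeffDeriv {u v : Space → ℝ} (h : HasWeakDerivSpace u v) :
    CoeffDeriv 2 u v := by
  intro k
  have h1 := h _ (modeBox_contDiff k) (modeBox_periodic k)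
  simp_rw [fderiv_modeBox] at h1
  have h2 : ∫ x in box, u x * (Real.pi * freq 2 k * modeBox (flip 2 k) x)
      = Real.pi * freq 2 k * coeff u (flip 2 k) := by
    rw [coeff, ← integral_const_mul]
    exact integral_congr_ae (ae_of_all _ fun x => by simp only; ring)
  rw [h2] at h1
  rw [h1, neg_neg]
  rfl

theorem integrable_slice_sq {T : ℝ} {F : SpaceTime → ℝ} (hF : MemLp F 2 ((volT T).prod volBox)) :
    Integrable (fun t => ∫ x, F (t, x) ^ 2 ∂volBox) (volT T) :=
  hF.integrable_sq.integral_prod_left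

theorem integrable_coeff_sq {T : ℝ} {F : SpaceTime → ℝ} (hF : MemLp F 2 ((volT T).prod volBox))
    (k : Freq) : Integrable (fun t => coeff (fun x => F (t, x)) k ^ 2) (volT T) := by
  have h1 := integrable_space_integral (hF.integrable (by norm_num)) (modeBox_continuous k)
  refine (integrable_slice_sq hF).mono' (h1.1.pow 2) ?_
  filter_upwards [memLp_slice hF] with t ht
  rw [Real.norm_eq_abs, abs_of_nonneg (sq_nonneg _)]
  exact coeff_sq_le ht k

/-- For a fixed step the difference operator is bounded on `L²`: `2 - 2 cos ≤ 4`. -/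
theorem mult_le_const (n : ℕ) (k : Freq) :
    mult (1 / ((n : ℝ) + 1)) k ≤ 1 + 4 * ((n : ℝ) + 1) ^ 2 := by
  have h1 : mult (1 / ((n : ℝ) + 1)) k
      = 1 + (2 - 2 * Real.cos (Real.pi * k.1 * (1 / ((n : ℝ) + 1)))) * ((n : ℝ) + 1) ^ 2 := by
    unfold mult
    field_simp
  rw [h1]
  have h2 := Real.neg_one_le_cos (Real.pi * k.1 * (1 / ((n : ℝ) + 1)))
  have h3 := mul_le_mul_of_nonneg_right
    (show 2 - 2 * Real.cos (Real.pi * k.1 * (1 / ((n : ℝ) + 1))) ≤ 4 by linarith)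
    (sq_nonneg ((n : ℝ) + 1))
  linarith

theorem hasSum_testOp_mul {g g' : Space → ℝ} (hg : MemLp g 2 volBox) (hg' : MemLp g' 2 volBox)
    (h : ℝ) : HasSum (fun k => mult h k * (coeff g k * coeff g' k))
      (∫ x, testOp h g x * g' x ∂volBox) := by
  have h1 := hasSum_coeff (memLp_testOp hg h) hg'
  simp_rw [coeff_testOp hg, mul_assoc] at h1
  exact h1

/-- The energy at time `t`. -/
def energyAt (U : Fin 3 → SpaceTime → ℝ) (DU : Fin 3 → Fin 3 → SpaceTime → ℝ) (t : ℝ) : ℝ :=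
  ∑ i, energy (fun x => U i (t, x)) fun j x => DU i j (t, x)

/-- The dissipation at time `t`. -/
def dissipationAt (DU : Fin 3 → Fin 3 → SpaceTime → ℝ) (D2U : Fin 3 → Fin 3 → Fin 3 → SpaceTime → ℝ)
    (t : ℝ) : ℝ :=
  ∑ i, dissipation (fun j x => DU i j (t, x)) fun j k x => D2U i j k (t, x)

theorem MemE1.integrable_dissipationAt {T : ℝ} {U Ut : Fin 3 → SpaceTime → ℝ}
    {DU : Fin 3 → Fin 3 → SpaceTime → ℝ} {D2U : Fin 3 → Fin 3 → Fin 3 → SpaceTime → ℝ}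
    (hU : MemE1 T U Ut DU D2U) : Integrable (dissipationAt DU D2U) (volT T) := by
  have mD := hU.memLp_D
  have m2 := hU.memLp_D2
  rw [cyl_eq] at mD m2
  exact integrable_finsetSum _ fun i _ => (((integrable_slice_sq (mD i 0)).add
    (integrable_slice_sq (mD i 1))).add (integrable_slice_sq (m2 i 2 0))).add
      (integrable_slice_sq (m2 i 2 1))

theorem MemE1.integrable_energyAt {T : ℝ} {U Ut : Fin 3 → SpaceTime → ℝ}
    {DU : Fin 3 → Fin 3 → SpaceTime → ℝ} {D2U : Fin 3 → Fin 3 → Fin 3 → SpaceTime → ℝ}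
    (hU : MemE1 T U Ut DU D2U) : Integrable (energyAt U DU) (volT T) := by
  have mU := hU.memLp
  have mD := hU.memLp_D
  rw [cyl_eq] at mU mD
  exact integrable_finsetSum _ fun i _ => (integrable_slice_sq (mU i)).add
    (integrable_slice_sq (mD i 2))

/-- The energy inequality: a bound of `∂ₜU`, tested with the regularised `U - ∂_z²U`, by an
integrable function yields a bound of the energy. -/
theorem MemE1.energy_inequality {T : ℝ} (hT : 0 < T) {U Ut : Fin 3 → SpaceTime → ℝ}
    {DU : Fin 3 → Fin 3 → SpaceTime → ℝ} {D2U : Fin 3 → Fin 3 → Fin 3 → SpaceTime → ℝ}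
    (hU : MemE1 T U Ut DU D2U) {U₀ U₀z : Fin 3 → Space → ℝ} (hU₀ : MemH U₀ U₀z)
    (hi : ∀ i, Tendsto (fun t => ∫⁻ x in box, ENNReal.ofReal ((U i (t, x) - U₀ i x) ^ 2))
      (𝓝[>] 0 ⊓ ae volume) (𝓝 0)) {lam : ℝ} (hlam : 0 ≤ lam) {R : ℝ → ℝ}
    (iR : Integrable R (volT T))
    (hR : ∀ h > 0, ∀ᵐ t ∂volT T,
      (∑ i, ∫ x, testOp h (fun x => U i (t, x)) x * Ut i (t, x) ∂volBox)
        + lam * ∑ i, ((∫ x, testOp h (fun x => DU i 0 (t, x)) x * DU i 0 (t, x) ∂volBox)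
          + ∫ x, testOp h (fun x => DU i 1 (t, x)) x * DU i 1 (t, x) ∂volBox) ≤ R t) :
    ∀ᵐ t ∂volT T, energyAt U DU t + 2 * lam * ∫ s, dissipationAt DU D2U s ∂volT t
      ≤ ∑ i, ((∫ x, U₀ i x ^ 2 ∂volBox) + ∫ x, U₀z i x ^ 2 ∂volBox) + 2 * ∫ s, R s ∂volT t := by
  have mU := hU.memLp
  have mt := hU.memLp_t
  have mD := hU.memLp_D
  have m2 := hU.memLp_D2
  rw [cyl_eq] at mU mt mD m2
  have hi' : ∀ {F : SpaceTime → ℝ}, MemLp F 2 ((volT T).prod volBox) →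
      Integrable F ((volT T).prod volBox) := fun hF => hF.integrable (by norm_num)
  have sU := ae_all_iff.2 fun i => memLp_slice (mU i)
  have st := ae_all_iff.2 fun i => memLp_slice (mt i)
  have sD := ae_all_iff.2 fun i => ae_all_iff.2 fun j => memLp_slice (mD i j)
  have s2 := ae_all_iff.2 fun i => ae_all_iff.2 fun j => ae_all_iff.2 fun k => memLp_slice (m2 i j k)
  have cU := ae_all_iff.2 fun i => ae_all_iff.2 fun j =>
    (hU.deriv i j).slice hT (hi' (mU i)) (hi' (mD i j))
  have cD := ae_all_iff.2 fun i => ae_all_iff.2 fun j => ae_all_iff.2 fun k =>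
    (hU.deriv2 i j k).slice hT (hi' (mD i j)) (hi' (m2 i j k))
  have hc := fun i k => sq_eq_of_eq_primitive hT
    (integrable_space_integral (hi' (mt i)) (modeBox_continuous k))
    ((hU.deriv_t i).coeff_eq hT (mU i) (mt i) (hU₀.memLp i) (hi i) k)
  -- The steps are `h = 1/(n + 1)`. The multipliers are bounded in `k` for each `n` and stay below
  -- their limit `1 + (πk)²`.
  refine energy_le_of_coeff (J := Freq) (T := T)
    (q := fun k t => ∑ i, coeff (fun x => U i (t, x)) k ^ 2)
    (p := fun k t => ∑ i, coeff (fun x => U i (t, x)) k * coeff (fun x => Ut i (t, x)) k)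
    (w := fun k t => ∑ i, (coeff (fun x => U i (t, x)) k ^ 2 + coeff (fun x => Ut i (t, x)) k ^ 2))
    (g := fun k t => ∑ i, (coeff (fun x => DU i 0 (t, x)) k ^ 2
      + coeff (fun x => DU i 1 (t, x)) k ^ 2))
    (q₀ := fun k => ∑ i, coeff (U₀ i) k ^ 2) (m := fun k => 1 + (Real.pi * k.1) ^ 2)
    (mₙ := fun n k => mult (1 / ((n : ℝ) + 1)) k) (b := fun n => 1 + 4 * ((n : ℝ) + 1) ^ 2)
    (W := fun t => ∑ i, ((∫ x, U i (t, x) ^ 2 ∂volBox) + ∫ x, Ut i (t, x) ^ 2 ∂volBox))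
    (fun n k => zero_le_one.trans (one_le_mult _ k)) mult_le_const
    (fun n k => mult_le (by positivity) k) tendsto_mult
    (fun k => integrable_finsetSum _ fun i _ => (hc i k).1)
    (fun k => integrable_finsetSum _ fun i _ =>
      (integrable_coeff_sq (mD i 0) k).add (integrable_coeff_sq (mD i 1) k))
    (fun k t => Finset.sum_nonneg fun i _ => add_nonneg (sq_nonneg _) (sq_nonneg _))
    (fun k => Finset.sum_nonneg fun i _ => sq_nonneg _)
    (fun k t => Finset.sum_nonneg fun i _ => sq_nonneg _) (fun k => ?_)
    (ae_of_all _ fun t k => ?_) ?_ ?_ ?_ ?_ hU.integrable_dissipationAt ?_ iR fun n => ?_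
  · filter_upwards [ae_all_iff.2 fun i => (hc i k).2, ae_mem_volT T] with t h1 h2
    simp_rw [h1]
    rw [Finset.sum_add_distrib, ← Finset.mul_sum,
      ← integral_finsetSum _ fun i _ => (hc i k).1.mono_measure (volT_le h2.2.le)]
    rfl
  · refine (Finset.abs_sum_le_sum_abs _ _).trans (Finset.sum_le_sum fun i _ => ?_)
    rw [abs_le]
    constructor <;> nlinarith [sq_nonneg (coeff (fun x => U i (t, x)) k + coeff (fun x => Ut i (t, x)) k),
      sq_nonneg (coeff (fun x => U i (t, x)) k - coeff (fun x => Ut i (t, x)) k)]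
  · filter_upwards [sU, st] with t h1 h2
    exact hasSum_sum fun i _ => (hasSum_coeff_sq (h1 i)).add (hasSum_coeff_sq (h2 i))
  · exact integrable_finsetSum _ fun i _ => (integrable_slice_sq (mU i)).add
      (integrable_slice_sq (mt i))
  · filter_upwards [sU, sD, cU] with t h1 h2 h3
    simp_rw [Finset.mul_sum]
    exact hasSum_sum fun i _ => hasSum_sq_add_sq (h1 i) (h2 i 2) (h3 i 2)
  · filter_upwards [sU, sD, s2, cU, cD] with t h1 h2 h3 h4 h5
    simp_rw [Finset.mul_sum, mul_add]
    refine hasSum_sum fun i _ => ?_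
    -- The weight applied to `∂_x U` produces its vertical derivative, while the dissipation
    -- contains `∂_x` of `∂_z U`; these are identified by commuting the derivatives.
    have a0 := hasSum_sq_add_sq (h2 i 0) (h3 i 2 0)
      ((h4 i 2).comm (h5 i 2 0) (h4 i 0) (by decide))
    have a1 := hasSum_sq_add_sq (h2 i 1) (h3 i 2 1)
      ((h4 i 2).comm (h5 i 2 1) (h4 i 1) (by decide))
    have e : dissipation (fun j x => DU i j (t, x)) (fun j k x => D2U i j k (t, x))
        = ((∫ x, DU i 0 (t, x) ^ 2 ∂volBox) + ∫ x, D2U i 2 0 (t, x) ^ 2 ∂volBox)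
          + ((∫ x, DU i 1 (t, x) ^ 2 ∂volBox) + ∫ x, D2U i 2 1 (t, x) ^ 2 ∂volBox) := by
      unfold dissipation
      ring
    rw [e]
    exact a0.add a1
  · simp_rw [Finset.mul_sum]
    exact hasSum_sum fun i _ => hasSum_sq_add_sq (hU₀.memLp i) (hU₀.memLp_z i)
      (hU₀.deriv_z i).coeffDeriv
  · have hn : 0 < 1 / ((n : ℝ) + 1) := by positivity
    filter_upwards [hR _ hn, sU, st, sD] with t h1 h2 h3 h4 F
    have b1 : HasSum (fun k => mult (1 / ((n : ℝ) + 1)) k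
        * ∑ i, coeff (fun x => U i (t, x)) k * coeff (fun x => Ut i (t, x)) k)
        (∑ i, ∫ x, testOp (1 / ((n : ℝ) + 1)) (fun x => U i (t, x)) x * Ut i (t, x) ∂volBox) := by
      simp_rw [Finset.mul_sum]
      exact hasSum_sum fun i _ => hasSum_testOp_mul (h2 i) (h3 i) _
    have b2 : HasSum (fun k => mult (1 / ((n : ℝ) + 1)) k * ∑ i, (coeff (fun x => DU i 0 (t, x)) k ^ 2
        + coeff (fun x => DU i 1 (t, x)) k ^ 2))
        (∑ i, ((∫ x, testOp (1 / ((n : ℝ) + 1)) (fun x => DU i 0 (t, x)) x * DU i 0 (t, x) ∂volBox)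
          + ∫ x, testOp (1 / ((n : ℝ) + 1)) (fun x => DU i 1 (t, x)) x * DU i 1 (t, x) ∂volBox)) := by
      simp_rw [Finset.mul_sum, mul_add]
      exact hasSum_sum fun i _ => (hasSum_testOp_mul_self (h4 i 0) _).add
        (hasSum_testOp_mul_self (h4 i 1) _)
    rw [b1.tsum_eq]
    have b3 := sum_le_hasSum F (fun k _ => mul_nonneg (zero_le_one.trans (one_le_mult _ k))
      (Finset.sum_nonneg fun i _ => add_nonneg (sq_nonneg _) (sq_nonneg _))) b2
    exact (add_le_add le_rfl (mul_le_mul_of_nonneg_left b3 hlam)).trans h1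

/-! ### Gronwall's inequality -/

/-- `b βⁿ` is the derivative of `βⁿ⁺¹/(n + 1)`, by induction with the product rule for absolutely
continuous functions; `b` is only integrable. -/
theorem pow_primitive {T : ℝ} (hT : 0 < T) {b : ℝ → ℝ} (hb : Integrable b (volT T)) (n : ℕ) :
    ∀ t ∈ Icc 0 T, Integrable (fun s => b s * (∫ r in (0 : ℝ)..s, b r) ^ n) (volT t) ∧
      ∫ s, b s * (∫ r in (0 : ℝ)..s, b r) ^ n ∂volT t
        = (∫ r in (0 : ℝ)..t, b r) ^ (n + 1) / (n + 1) := by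
  have hbi := intervalIntegrable_volT hT.le hb
  let β : ℝ → ℝ := fun t => ∫ s in (0 : ℝ)..t, b s
  have hβ : ContinuousOn β (Icc 0 T) := by
    have := intervalIntegral.continuousOn_primitive_interval' hbi left_mem_uIcc
    rwa [uIcc_of_le hT.le] at this
  have hint : ∀ n : ℕ, Integrable (fun s => b s * β s ^ n) (volT T) := fun n => by
    have h1 : IntegrableOn b (Icc 0 T) := by
      rwa [integrableOn_Icc_iff_integrableOn_Ioo]
    exact (h1.mul_continuousOn (hβ.pow n) isCompact_Icc).mono_set Ioo_subset_Icc_self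
  have hii : ∀ n : ℕ, ∀ t ∈ Icc 0 T, IntervalIntegrable (fun s => b s * β s ^ n) volume 0 t :=
    fun n t ht => intervalIntegrable_volT ht.1 ((hint n).mono_measure (volT_le ht.2))
  have key : ∀ n : ℕ, ∀ t ∈ Icc 0 T, β t ^ (n + 1) = ∫ s in (0 : ℝ)..t, (n + 1) * (b s * β s ^ n) := by
    intro n
    induction n with
    | zero =>
      intro t _
      simp [β]
    | succ n ih =>
      intro t ht
      have hb0 : β 0 = 0 := by simp [β]
      have h1 := integral_product_rule (f := fun s => β s ^ (n + 1)) (g := β)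
        (f' := fun s => (n + 1) * (b s * β s ^ n)) (g' := b) ht.1 ((hii n t ht).const_mul _)
        (intervalIntegrable_volT ht.1 (hb.mono_measure (volT_le ht.2)))
        (fun x hx => by
          rw [ih x ⟨hx.1, hx.2.trans ht.2⟩]
          simp [hb0])
        (fun x _ => by simp [β])
      have e : (fun s => (n + 1) * (b s * β s ^ n) * β s + β s ^ (n + 1) * b s)
          = fun s => (((n + 1 : ℕ) : ℝ) + 1) * (b s * β s ^ (n + 1)) := by
        funext s
        push_cast
        ring
      rw [e, hb0, mul_zero, sub_zero] at h1
      rw [h1, pow_succ]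
  intro t ht
  refine ⟨(hint n).mono_measure (volT_le ht.2), ?_⟩
  rw [integral_volT ht.1]
  have h1 := key n t ht
  rw [intervalIntegral.integral_const_mul] at h1
  have h2 : ((n : ℝ) + 1) ≠ 0 := by positivity
  rw [eq_div_iff h2]
  linarith

/-- Gronwall's inequality for bounded functions and integrable coefficients. -/
theorem gronwall {T : ℝ} (hT : 0 < T) {y b : ℝ → ℝ} {A M : ℝ} (hA : 0 ≤ A)
    (hb : Integrable b (volT T)) (hb₀ : ∀ t, 0 ≤ b t)
    (hby : Integrable (fun t => b t * y t) (volT T)) (hM : ∀ᵐ t ∂volT T, y t ≤ M)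
    (h : ∀ᵐ t ∂volT T, y t ≤ A + ∫ s, b s * y s ∂volT t) :
    ∀ᵐ t ∂volT T, y t ≤ A * Real.exp (∫ s, b s ∂volT T) := by
  let β : ℝ → ℝ := fun t => ∫ s in (0 : ℝ)..t, b s
  -- Iterating the integral inequality produces the partial sums of the exponential series, and the
  -- a priori bound `M` survives only in a remainder `M βⁿ/n!`.
  have hn : ∀ n : ℕ, ∀ᵐ t ∂volT T,
      y t ≤ A * (∑ j ∈ Finset.range n, β t ^ j / j.factorial) + M * (β t ^ n / n.factorial) := by
    intro n
    induction n with
    | zero =>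
      filter_upwards [hM] with t ht
      simpa using ht
    | succ n ih =>
      filter_upwards [h, ae_mem_volT T] with t h1 h2
      have hle := volT_le h2.2.le
      have ht : t ∈ Icc 0 T := ⟨h2.1.le, h2.2.le⟩
      have hp : ∀ j : ℕ, Integrable (fun s => b s * β s ^ j) (volT t) :=
        fun j => (pow_primitive hT hb j t ht).1
      have e : (fun s => b s * (A * (∑ j ∈ Finset.range n, β s ^ j / j.factorial)
          + M * (β s ^ n / n.factorial)))
          = fun s => (∑ j ∈ Finset.range n, A / j.factorial * (b s * β s ^ j))
            + M / n.factorial * (b s * β s ^ n) := by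
        funext s
        rw [mul_add, Finset.mul_sum, Finset.mul_sum]
        congr 1
        · exact Finset.sum_congr rfl fun j _ => by ring
        · ring
      have i1 : Integrable (fun s => ∑ j ∈ Finset.range n, A / j.factorial * (b s * β s ^ j))
          (volT t) := integrable_finsetSum _ fun j _ => (hp j).const_mul _
      have i2 : Integrable (fun s => M / n.factorial * (b s * β s ^ n)) (volT t) :=
        (hp n).const_mul _
      have i3 : Integrable (fun s => b s * (A * (∑ j ∈ Finset.range n, β s ^ j / j.factorial)
          + M * (β s ^ n / n.factorial))) (volT t) := by
        rw [e]
        exact i1.add i2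
      have h3 := integral_mono_ae (hby.mono_measure hle) i3 (by
        filter_upwards [ae_mono hle ih] with s hs
        exact mul_le_mul_of_nonneg_left hs (hb₀ s))
      have h4 : ∀ j : ℕ, ∫ s, b s * β s ^ j ∂volT t = β t ^ (j + 1) / (j + 1) :=
        fun j => (pow_primitive hT hb j t ht).2
      rw [e, integral_add i1 i2, integral_finsetSum _ fun j _ => (hp j).const_mul _,
        integral_const_mul, h4] at h3
      simp_rw [integral_const_mul] at h3
      simp_rw [h4] at h3
      have h5 : ∀ j : ℕ, ∀ c : ℝ, c / j.factorial * (β t ^ (j + 1) / (j + 1))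
          = c * (β t ^ (j + 1) / (j + 1).factorial) := fun j c => by
        rw [Nat.factorial_succ]
        push_cast
        field_simp
      simp_rw [h5, ← Finset.mul_sum] at h3
      rw [Finset.sum_range_succ']
      simp only [pow_zero, Nat.factorial_zero, Nat.cast_one, div_one]
      linarith
  filter_upwards [ae_all_iff.2 hn, ae_mem_volT T] with t h1 h2
  have hβ₀ : 0 ≤ β t := intervalIntegral.integral_nonneg h2.1.le fun s _ => hb₀ s
  have hβ : β t ≤ ∫ s, b s ∂volT T := by
    rw [show β t = ∫ s, b s ∂volT t from (integral_volT h2.1.le b).symm]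
    exact integral_mono_measure (volT_le h2.2.le) (ae_of_all _ hb₀) hb
  have h3 : Tendsto (fun n : ℕ => A * Real.exp (∫ s, b s ∂volT T) + M * (β t ^ n / n.factorial))
      atTop (𝓝 (A * Real.exp (∫ s, b s ∂volT T) + M * 0)) :=
    ((FloorSemiring.tendsto_pow_div_factorial_atTop (β t)).const_mul M).const_add _
  rw [mul_zero, add_zero] at h3
  refine ge_of_tendsto h3 (Eventually.of_forall fun n => (h1 n).trans ?_)
  refine add_le_add (mul_le_mul_of_nonneg_left ?_ hA) le_rfl
  exact (Real.sum_le_exp_of_nonneg hβ₀ n).trans (Real.exp_le_exp.2 hβ)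

/-! ### The a priori bound -/

/-- A bound uniform in the step: `mult h k ≤ 1 + (πk)²` and Young's inequality, at the price of the
second vertical derivative. It serves only for qualitative purposes. -/
theorem integral_testOp_mul_le {u ut : Space → ℝ} {u' u'' : Space → ℝ} (mu : MemLp u 2 volBox)
    (mt : MemLp ut 2 volBox) (m2 : MemLp u'' 2 volBox) (h₁ : CoeffDeriv 2 u u')
    (h₂ : CoeffDeriv 2 u' u'') {h : ℝ} (hh : 0 < h) :
    ∫ x, testOp h u x * ut x ∂volBox
      ≤ (∫ x, u x ^ 2 ∂volBox) + (∫ x, u'' x ^ 2 ∂volBox) + ∫ x, ut x ^ 2 ∂volBox := by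
  refine hasSum_le (fun k => ?_) (hasSum_testOp_mul mu mt h)
    (((hasSum_coeff_sq mu).add (hasSum_coeff_sq m2)).add (hasSum_coeff_sq mt))
  have h1 := h₁.coeff_second h₂ k
  have h2 := mult_le hh k
  have h3 := one_le_mult h k
  have hf : freq 2 k = k.1 := by simp [freq]
  rw [hf] at h1
  rw [h1]
  have h4 : (mult h k * coeff u k) ^ 2 ≤ ((1 + (Real.pi * k.1) ^ 2) * coeff u k) ^ 2 := by
    rw [mul_pow, mul_pow]
    exact mul_le_mul_of_nonneg_right (pow_le_pow_left₀ (by linarith) h2 2) (sq_nonneg _)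
  nlinarith [sq_nonneg (mult h k * coeff u k - coeff ut k), sq_nonneg (coeff ut k),
    sq_nonneg (coeff u k - (Real.pi * k.1) ^ 2 * coeff u k)]

/-- Gronwall's inequality needs a function known to be bounded. Here the energy inequality is used
without dissipation (`lam = 0`) and with a right-hand side that is integrable merely because `U ∈
𝔼₁(T)`. The bound does not enter the final constant. -/
theorem MemE1.exists_energy_bound {T : ℝ} (hT : 0 < T) {U Ut : Fin 3 → SpaceTime → ℝ}
    {DU : Fin 3 → Fin 3 → SpaceTime → ℝ} {D2U : Fin 3 → Fin 3 → Fin 3 → SpaceTime → ℝ}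
    (hU : MemE1 T U Ut DU D2U) {U₀ U₀z : Fin 3 → Space → ℝ} (hU₀ : MemH U₀ U₀z)
    (hi : ∀ i, Tendsto (fun t => ∫⁻ x in box, ENNReal.ofReal ((U i (t, x) - U₀ i x) ^ 2))
      (𝓝[>] 0 ⊓ ae volume) (𝓝 0)) :
    ∃ M, ∀ᵐ t ∂volT T, energyAt U DU t ≤ M := by
  have mU := hU.memLp
  have mt := hU.memLp_t
  have mD := hU.memLp_D
  have m2 := hU.memLp_D2
  rw [cyl_eq] at mU mt mD m2
  have hi' : ∀ {F : SpaceTime → ℝ}, MemLp F 2 ((volT T).prod volBox) →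
      Integrable F ((volT T).prod volBox) := fun hF => hF.integrable (by norm_num)
  let R : ℝ → ℝ := fun t => ∑ i, ((∫ x, U i (t, x) ^ 2 ∂volBox)
    + (∫ x, D2U i 2 2 (t, x) ^ 2 ∂volBox) + ∫ x, Ut i (t, x) ^ 2 ∂volBox)
  have iR : Integrable R (volT T) := integrable_finsetSum _ fun i _ =>
    ((integrable_slice_sq (mU i)).add (integrable_slice_sq (m2 i 2 2))).add
      (integrable_slice_sq (mt i))
  have hR₀ : ∀ t, 0 ≤ R t := fun t => Finset.sum_nonneg fun i _ =>
    add_nonneg (add_nonneg (integral_sq_nonneg _) (integral_sq_nonneg _)) (integral_sq_nonneg _)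
  have h1 := hU.energy_inequality hT hU₀ hi (lam := 0) le_rfl iR fun h hh => by
    filter_upwards [ae_all_iff.2 fun i => memLp_slice (mU i), ae_all_iff.2 fun i => memLp_slice (mt i),
      ae_all_iff.2 fun i => memLp_slice (m2 i 2 2),
      ae_all_iff.2 fun i => (hU.deriv i 2).slice hT (hi' (mU i)) (hi' (mD i 2)),
      ae_all_iff.2 fun i => (hU.deriv2 i 2 2).slice hT (hi' (mD i 2)) (hi' (m2 i 2 2))]
      with t a1 a2 a3 a4 a5
    rw [zero_mul, add_zero]
    exact Finset.sum_le_sum fun i _ => integral_testOp_mul_le (a1 i) (a2 i) (a3 i) (a4 i) (a5 i) hh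
  refine ⟨∑ i, ((∫ x, U₀ i x ^ 2 ∂volBox) + ∫ x, U₀z i x ^ 2 ∂volBox) + 2 * ∫ s, R s ∂volT T, ?_⟩
  filter_upwards [h1, ae_mem_volT T] with t h2 h3
  rw [mul_zero, zero_mul, add_zero] at h2
  have h4 : ∫ s, R s ∂volT t ≤ ∫ s, R s ∂volT T :=
    integral_mono_measure (volT_le h3.2.le) (ae_of_all _ hR₀) iR
  linarith

/-- The integral is continuous in its upper limit, so the bound at almost all times before `T`
passes to `T`. -/
theorem integral_volT_le_of_ae_le {T K : ℝ} (hT : 0 < T) {E : ℝ → ℝ} (iE : Integrable E (volT T))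
    (h : ∀ᵐ t ∂volT T, ∫ s, E s ∂volT t ≤ K) : ∫ s, E s ∂volT T ≤ K := by
  have hE := intervalIntegrable_volT hT.le iE
  have h1 := intervalIntegral.continuousOn_primitive_interval' hE left_mem_uIcc
  rw [uIcc_of_le hT.le] at h1
  have h2 := (h1 T (right_mem_Icc.2 hT.le)).tendsto
  have h3 : 𝓝[<] T ⊓ ae volume ≤ 𝓝[Icc 0 T] T := by
    refine inf_le_left.trans ?_
    rw [← nhdsWithin_Ioo_eq_nhdsLT hT]
    exact nhdsWithin_mono _ Ioo_subset_Icc_self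
  rw [integral_volT hT.le]
  refine le_of_tendsto (h2.mono_left h3) ?_
  have e1 : ∀ᶠ t in 𝓝[<] T ⊓ ae volume, t ∈ Ioo 0 T := mem_inf_of_left (Ioo_mem_nhdsLT hT)
  have e2 : ∀ᶠ t in 𝓝[<] T ⊓ ae volume, t ∈ Ioo 0 T → ∫ s, E s ∂volT t ≤ K :=
    mem_inf_of_right ((ae_restrict_iff' measurableSet_Ioo).1 h)
  filter_upwards [e1, e2] with t h4 h5
  rw [← integral_volT h4.1.le]
  exact h5 h4

/-! ### The norms as integrals -/

theorem lintegral_ofReal_sum_sq {X ι : Type*} [MeasurableSpace X] [Fintype ι] {μ : Measure X}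
    {g : ι → X → ℝ} (hg : ∀ i, MemLp (g i) 2 μ) :
    ∫⁻ x, ENNReal.ofReal (∑ i, g i x ^ 2) ∂μ = ENNReal.ofReal (∑ i, ∫ x, g i x ^ 2 ∂μ) := by
  rw [← integral_finsetSum _ fun i _ => (hg i).integrable_sq,
    ofReal_integral_eq_lintegral_ofReal (integrable_finsetSum _ fun i _ => (hg i).integrable_sq)
      (ae_of_all _ fun x => Finset.sum_nonneg fun i _ => sq_nonneg _)]

theorem sqNormH_eq {u v : Fin 3 → Space → ℝ} (hu : ∀ i, MemLp (u i) 2 volBox)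
    (hv : ∀ i, MemLp (v i) 2 volBox) :
    sqNormH u v = ENNReal.ofReal (∑ i, ((∫ x, u i x ^ 2 ∂volBox) + ∫ x, v i x ^ 2 ∂volBox)) := by
  have h := lintegral_ofReal_sum_sq (μ := volBox) (g := fun p : Fin 3 × Fin 2 => ![u p.1, v p.1] p.2)
    fun p => by
      obtain ⟨i, j⟩ := p
      fin_cases j
      exacts [hu i, hv i]
  simp only [Fintype.sum_prod_type, Fin.sum_univ_two, Matrix.cons_val_zero, Matrix.cons_val_one] at h
  exact h

theorem integral_sq_prod {T : ℝ} {F : SpaceTime → ℝ} (hF : MemLp F 2 ((volT T).prod volBox)) :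
    ∫ p, F p ^ 2 ∂(volT T).prod volBox = ∫ t, ∫ x, F (t, x) ^ 2 ∂volBox ∂volT T :=
  integral_prod _ hF.integrable_sq

theorem MemTransport.sqNorm_eq {T : ℝ} {ω ωz ωzz : SpaceTime → ℝ} (h : MemTransport T ω ωz ωzz) :
    Integrable (fun t => (∫ x, ωz (t, x) ^ 2 ∂volBox) + ∫ x, ωzz (t, x) ^ 2 ∂volBox) (volT T) ∧
    (sqNormTransport T ωz ωzz).toReal
      = ∫ t, ((∫ x, ωz (t, x) ^ 2 ∂volBox) + ∫ x, ωzz (t, x) ^ 2 ∂volBox) ∂volT T := by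
  have h1 := h.memLp_z
  have h2 := h.memLp_zz
  rw [cyl_eq] at h1 h2
  refine ⟨(integrable_slice_sq h1).add (integrable_slice_sq h2), ?_⟩
  have h3 := lintegral_ofReal_sum_sq (g := ![ωz, ωzz]) (μ := (volT T).prod volBox) fun i => by
    fin_cases i
    exacts [h1, h2]
  simp only [Fin.sum_univ_two, Matrix.cons_val_zero, Matrix.cons_val_one] at h3
  rw [integral_add (integrable_slice_sq h1) (integrable_slice_sq h2), ← integral_sq_prod h1,
    ← integral_sq_prod h2, sqNormTransport, cyl_eq, h3]
  exact ENNReal.toReal_ofReal (add_nonneg (integral_sq_nonneg _) (integral_sq_nonneg _))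

/-- `fieldNorm` is the square of the norm in space, so its square is the fourth power that is
integrated in time. -/
theorem MemL4H2L4.normPowFour_toReal {T : ℝ} {ν ν' ν'' : Fin 3 → SpaceTime → ℝ}
    (h : MemL4H2L4 T ν ν' ν'') :
    Integrable (fun t => (fieldNorm ν ν' ν'' t).toReal ^ 2) (volT T) ∧
    (normPowFourL4H2L4 T ν ν' ν'').toReal = ∫ t, (fieldNorm ν ν' ν'' t).toReal ^ 2 ∂volT T := by
  obtain ⟨hm, hlt⟩ := h.ae_lt_top
  have hN : ∫⁻ t, fieldNorm ν ν' ν'' t ^ 2 ∂volT T ≠ ∞ := h.finite.ne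
  have h1 := integrable_toReal_of_lintegral_ne_top (hm.pow_const 2) hN
  have h2 := integral_toReal (hm.pow_const 2) (hlt.mono fun t ht => ENNReal.pow_lt_top ht)
  simp_rw [ENNReal.toReal_pow] at h1 h2
  exact ⟨h1, h2.symm⟩

theorem _root_.MeasureTheory.MemLp.sq_norm_slice_dual {X Y E : Type*} [MeasurableSpace X]
    [MeasurableSpace Y] [NormedAddCommGroup E] [NormedSpace ℝ E] {μ : Measure X} {ν : Measure Y}
    [SFinite μ] [SFinite ν] {F : X × Y → E →L[ℝ] ℝ} (hF : MemLp F 2 (μ.prod ν)) :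
    Integrable (fun t => ∫ s, ‖F (t, s)‖ ^ 2 ∂ν) μ ∧ AEMeasurable (fun p => ‖F p‖ₑ ^ 2) (μ.prod ν) ∧
      ∫⁻ p, ‖F p‖ₑ ^ 2 ∂μ.prod ν = ENNReal.ofReal (∫ t, ∫ s, ‖F (t, s)‖ ^ 2 ∂ν ∂μ) := by
  have h1 := (memLp_two_iff_integrable_sq_norm hF.1).1 hF
  refine ⟨h1.integral_prod_left, hF.1.enorm.pow_const 2, ?_⟩
  rw [← integral_prod _ h1, ofReal_integral_eq_lintegral_ofReal h1 (ae_of_all _ fun _ => sq_nonneg _)]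
  refine lintegral_congr fun p => ?_
  rw [ENNReal.ofReal_pow (norm_nonneg _), ofReal_norm]

theorem MemL2Vdual.sqNorm_eq {T : ℝ} {f fz : Fin 3 → ℝ × ℝ → Hneg1} (h : MemL2Vdual T f fz) :
    Integrable (fun t => ∑ i, ((∫ s, ‖f i (t, s)‖ ^ 2 ∂volI) + ∫ s, ‖fz i (t, s)‖ ^ 2 ∂volI))
      (volT T) ∧
    sqNormL2Vdual T f fz = ENNReal.ofReal
      (∫ t, ∑ i, ((∫ s, ‖f i (t, s)‖ ^ 2 ∂volI) + ∫ s, ‖fz i (t, s)‖ ^ 2 ∂volI) ∂volT T) := by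
  have mf := h.memLp
  have mfz := h.memLp_z
  rw [rect_eq] at mf mfz
  have h1 := fun i => (mf i).sq_norm_slice_dual
  have h2 := fun i => (mfz i).sq_norm_slice_dual
  have hi : ∀ i, Integrable (fun t => (∫ s, ‖f i (t, s)‖ ^ 2 ∂volI) + ∫ s, ‖fz i (t, s)‖ ^ 2 ∂volI)
      (volT T) := fun i => (h1 i).1.add (h2 i).1
  have hm : ∀ i, AEMeasurable (fun p => ‖f i p‖ₑ ^ 2 + ‖fz i p‖ₑ ^ 2) ((volT T).prod volI) :=
    fun i => (h1 i).2.1.add (h2 i).2.1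
  refine ⟨integrable_finsetSum _ fun i _ => hi i, ?_⟩
  have hn : ∀ i, 0 ≤ (∫ t, ∫ s, ‖f i (t, s)‖ ^ 2 ∂volI ∂volT T)
      ∧ 0 ≤ ∫ t, ∫ s, ‖fz i (t, s)‖ ^ 2 ∂volI ∂volT T := fun i =>
    ⟨integral_nonneg fun _ => integral_nonneg fun _ => sq_nonneg _,
      integral_nonneg fun _ => integral_nonneg fun _ => sq_nonneg _⟩
  have e1 : ∫ t, ∑ i, ((∫ s, ‖f i (t, s)‖ ^ 2 ∂volI) + ∫ s, ‖fz i (t, s)‖ ^ 2 ∂volI) ∂volT T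
      = ∑ i, ((∫ t, ∫ s, ‖f i (t, s)‖ ^ 2 ∂volI ∂volT T)
        + ∫ t, ∫ s, ‖fz i (t, s)‖ ^ 2 ∂volI ∂volT T) := by
    rw [integral_finsetSum _ fun i _ => hi i]
    exact Finset.sum_congr rfl fun i _ => integral_add (h1 i).1 (h2 i).1
  rw [e1, ENNReal.ofReal_sum_of_nonneg fun i _ => add_nonneg (hn i).1 (hn i).2, sqNormL2Vdual,
    rect_eq, lintegral_finsetSum' _ fun i _ => hm i]
  refine Finset.sum_congr rfl fun i _ => ?_
  rw [lintegral_add_left' (h1 i).2.1, (h1 i).2.2, (h2 i).2.2, ENNReal.ofReal_add (hn i).1 (hn i).2]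

theorem MemE1.sqNormL2V_eq {T : ℝ} {U Ut : Fin 3 → SpaceTime → ℝ}
    {DU : Fin 3 → Fin 3 → SpaceTime → ℝ} {D2U : Fin 3 → Fin 3 → Fin 3 → SpaceTime → ℝ}
    (hU : MemE1 T U Ut DU D2U) : sqNormL2V T U DU D2U
      = ENNReal.ofReal ((∫ t, energyAt U DU t ∂volT T) + ∫ t, dissipationAt DU D2U t ∂volT T) := by
  have mU := hU.memLp
  have mD := hU.memLp_D
  have m2 := hU.memLp_D2
  rw [cyl_eq] at mU mD m2
  have h := lintegral_ofReal_sum_sq (μ := (volT T).prod volBox) (g := fun p : Fin 3 × Fin 6 =>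
    ![U p.1, DU p.1 0, DU p.1 1, DU p.1 2, D2U p.1 2 0, D2U p.1 2 1] p.2) fun p => by
      obtain ⟨i, j⟩ := p
      fin_cases j
      exacts [mU i, mD i 0, mD i 1, mD i 2, m2 i 2 0, m2 i 2 1]
  simp only [Fintype.sum_prod_type, Fin.sum_univ_six] at h
  have e1 : ∫ t, energyAt U DU t ∂volT T = ∑ i, ((∫ p, U i p ^ 2 ∂(volT T).prod volBox)
      + ∫ p, DU i 2 p ^ 2 ∂(volT T).prod volBox) := by
    unfold energyAt energy
    refine (integral_finsetSum _ fun i _ => (integrable_slice_sq (mU i)).add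
      (integrable_slice_sq (mD i 2))).trans ?_
    refine Finset.sum_congr rfl fun i _ => ?_
    rw [integral_sq_prod (mU i), integral_sq_prod (mD i 2)]
    exact integral_add (integrable_slice_sq (mU i)) (integrable_slice_sq (mD i 2))
  have e2 : ∫ t, dissipationAt DU D2U t ∂volT T = ∑ i, ((∫ p, DU i 0 p ^ 2 ∂(volT T).prod volBox)
      + (∫ p, DU i 1 p ^ 2 ∂(volT T).prod volBox) + (∫ p, D2U i 2 0 p ^ 2 ∂(volT T).prod volBox)
      + ∫ p, D2U i 2 1 p ^ 2 ∂(volT T).prod volBox) := by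
    unfold dissipationAt dissipation
    have i0 := fun i => integrable_slice_sq (mD i 0)
    have i1 := fun i => integrable_slice_sq (mD i 1)
    have i2 := fun i => integrable_slice_sq (m2 i 2 0)
    have i3 := fun i => integrable_slice_sq (m2 i 2 1)
    have i01 : ∀ i, Integrable (fun t => (∫ x, DU i 0 (t, x) ^ 2 ∂volBox)
      + ∫ x, DU i 1 (t, x) ^ 2 ∂volBox) (volT T) := fun i => (i0 i).add (i1 i)
    have i012 : ∀ i, Integrable (fun t => (∫ x, DU i 0 (t, x) ^ 2 ∂volBox)
      + (∫ x, DU i 1 (t, x) ^ 2 ∂volBox) + ∫ x, D2U i 2 0 (t, x) ^ 2 ∂volBox) (volT T) :=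
      fun i => (i01 i).add (i2 i)
    refine (integral_finsetSum _ fun i _ => (i012 i).add (i3 i)).trans ?_
    refine Finset.sum_congr rfl fun i _ => ?_
    rw [integral_sq_prod (mD i 0), integral_sq_prod (mD i 1), integral_sq_prod (m2 i 2 0),
      integral_sq_prod (m2 i 2 1), ← integral_add (i0 i) (i1 i), ← integral_add (i01 i) (i2 i),
      ← integral_add (i012 i) (i3 i)]
    rfl
  rw [e1, e2, ← Finset.sum_add_distrib, sqNormL2V, cyl_eq]
  refine h.trans (congrArg ENNReal.ofReal (Finset.sum_congr rfl fun i _ => ?_))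
  simp only [Matrix.cons_val]
  ring

/-! ### The estimate -/

section

variable {T ε δ : ℝ} {U₀ U₀z : Fin 3 → Space → ℝ} {f fz : Fin 3 → ℝ × ℝ → Hneg1}
    {ω ωz ωzz : SpaceTime → ℝ} {ν νz νzz : Fin 3 → SpaceTime → ℝ} {U Ut : Fin 3 → SpaceTime → ℝ}
    {DU : Fin 3 → Fin 3 → SpaceTime → ℝ} {D2U : Fin 3 → Fin 3 → Fin 3 → SpaceTime → ℝ}
    {P : SpaceTime → ℝ}

theorem energyAt_nonneg (t : ℝ) : 0 ≤ energyAt U DU t :=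
  Finset.sum_nonneg fun _ _ => energy_nonneg _ _

theorem dissipationAt_nonneg (t : ℝ) : 0 ≤ dissipationAt DU D2U t :=
  Finset.sum_nonneg fun _ _ => dissipation_nonneg _ _

/-- The real form of the estimate: the energy inequality with the bound of `Slice.energy_le`,
absorption of the dissipation, and Gronwall's inequality. -/
theorem IsSolution.exists_bound (hT : 0 < T) (hδ : 0 ≤ δ) (h₀ : MemH U₀ U₀z)
    (hf : MemL2Vdual T f fz) (hω : MemTransport T ω ωz ωzz) (hν : MemL4H2L4 T ν νz νzz)
    (S : IsSolution T ε δ ω ν f U₀ U Ut DU D2U P) :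
    ∃ A B : ℝ, 0 ≤ A ∧ ENNReal.ofReal A ≤ ENNReal.ofReal (2 * 10 ^ 14)
        * (sqNormH U₀ U₀z + sqNormL2Vdual T f fz) ∧
      B = 2 * 10 ^ 14 * (T + (sqNormTransport T ωz ωzz).toReal
        + (normPowFourL4H2L4 T ν νz νzz).toReal) ∧
      (∀ᵐ t ∂volT T, energyAt U DU t ≤ A * Real.exp B) ∧
      ∫ t, dissipationAt DU D2U t ∂volT T ≤ A + A * Real.exp B * B := by
  obtain ⟨ia, ea⟩ := hω.sqNorm_eq
  obtain ⟨iN, eN⟩ := hν.normPowFour_toReal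
  obtain ⟨iφ, eφ⟩ := hf.sqNorm_eq
  have iE := S.memE1.integrable_dissipationAt
  have iY := S.memE1.integrable_energyAt
  have eH := sqNormH_eq h₀.memLp h₀.memLp_z
  set a : ℝ → ℝ := fun t => (∫ x, ωz (t, x) ^ 2 ∂volBox) + ∫ x, ωzz (t, x) ^ 2 ∂volBox with ha
  set N : ℝ → ℝ := fun t => (fieldNorm ν νz νzz t).toReal with hN
  set φ : ℝ → ℝ := fun t => ∑ i, ((∫ s, ‖f i (t, s)‖ ^ 2 ∂volI) + ∫ s, ‖fz i (t, s)‖ ^ 2 ∂volI)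
    with hφ
  set y₀ : ℝ := ∑ i, ((∫ x, U₀ i x ^ 2 ∂volBox) + ∫ x, U₀z i x ^ 2 ∂volBox) with hy₀
  have hy₀n : 0 ≤ y₀ := Finset.sum_nonneg fun i _ => add_nonneg (integral_sq_nonneg _)
    (integral_sq_nonneg _)
  have hφn : ∀ t, 0 ≤ φ t := fun t => Finset.sum_nonneg fun i _ =>
    add_nonneg (integral_nonneg fun _ => sq_nonneg _) (integral_nonneg fun _ => sq_nonneg _)
  have han : ∀ t, 0 ≤ a t := fun t => add_nonneg (integral_sq_nonneg _) (integral_sq_nonneg _)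
  have hφi : 0 ≤ ∫ t, φ t ∂volT T := integral_nonneg hφn
  -- Twice the coefficient of the energy in `Slice.energy_le`, because the square of a coefficient
  -- has derivative `2 c c'`.
  let b : ℝ → ℝ := fun t => 2 * 10 ^ 14 * (1 + a t + N t ^ 2)
  have hbn : ∀ t, 0 ≤ b t := fun t => by
    have := han t
    have := sq_nonneg (N t)
    positivity
  have i1a : Integrable (fun t => 1 + a t) (volT T) := (integrable_const 1).add ia
  have i1aN : Integrable (fun t => 1 + a t + N t ^ 2) (volT T) := i1a.add iN
  have ib : Integrable b (volT T) := i1aN.const_mul _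
  have eb : ∫ t, b t ∂volT T = 2 * 10 ^ 14 * (T + (∫ t, a t ∂volT T) + ∫ t, N t ^ 2 ∂volT T) := by
    simp only [b]
    rw [integral_const_mul, integral_add i1a iN, integral_add (integrable_const 1) ia]
    rw [integral_const, measureReal_restrict_apply_univ, Real.volume_real_Ioo_of_le hT.le, sub_zero,
      smul_eq_mul, mul_one]
  obtain ⟨M, hM⟩ := S.memE1.exists_energy_bound hT h₀ S.initial
  have ibY : Integrable (fun t => b t * energyAt U DU t) (volT T) := by
    refine (ib.mul_const M).mono' (ib.1.mul iY.1) ?_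
    filter_upwards [hM] with t ht
    rw [Real.norm_eq_abs, abs_of_nonneg (mul_nonneg (hbn t) (energyAt_nonneg t))]
    exact mul_le_mul_of_nonneg_left ht (hbn t)
  let R : ℝ → ℝ := fun t => 1 / 2 * dissipationAt DU D2U t + 1 / 2 * (b t * energyAt U DU t)
    + 10 ^ 14 * φ t
  have iEY : Integrable (fun t => 1 / 2 * dissipationAt DU D2U t
      + 1 / 2 * (b t * energyAt U DU t)) (volT T) := (iE.const_mul _).add (ibY.const_mul _)
  have iR : Integrable R (volT T) := iEY.add (iφ.const_mul _)
  have h1 := S.memE1.energy_inequality hT h₀ S.initial (lam := 1) zero_le_one iR fun h hh => by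
    filter_upwards [S.slice hT hf hω hν] with t ht
    have h2 := ht.energy_le hδ hh
    rw [one_mul]
    refine h2.trans (le_of_eq ?_)
    simp only [R, b, a, N, φ, energyAt, dissipationAt]
    ring
  -- The left side carries twice the dissipation and `2 ∫ R` returns it once, so one copy is kept.
  have h2 : ∀ᵐ t ∂volT T, energyAt U DU t + ∫ s, dissipationAt DU D2U s ∂volT t
      ≤ y₀ + 2 * 10 ^ 14 * (∫ s, φ s ∂volT T) + ∫ s, b s * energyAt U DU s ∂volT t := by
    filter_upwards [h1, ae_mem_volT T] with t ht h0
    have hle := volT_le h0.2.le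
    have e : ∫ s, R s ∂volT t = 1 / 2 * (∫ s, dissipationAt DU D2U s ∂volT t)
        + 1 / 2 * (∫ s, b s * energyAt U DU s ∂volT t) + 10 ^ 14 * ∫ s, φ s ∂volT t := by
      simp only [R]
      rw [integral_add (iEY.mono_measure hle) ((iφ.const_mul _).mono_measure hle),
        integral_add ((iE.const_mul _).mono_measure hle) ((ibY.const_mul _).mono_measure hle),
        integral_const_mul, integral_const_mul, integral_const_mul]
    have h3 : ∫ s, φ s ∂volT t ≤ ∫ s, φ s ∂volT T :=
      integral_mono_measure hle (ae_of_all _ hφn) iφ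
    rw [e] at ht
    linarith
  set A : ℝ := y₀ + 2 * 10 ^ 14 * (∫ s, φ s ∂volT T) with hAdef
  have hA : 0 ≤ A := by positivity
  have h3 : ∀ᵐ t ∂volT T, energyAt U DU t ≤ A * Real.exp (∫ s, b s ∂volT T) := by
    refine gronwall hT hA ib hbn ibY hM ?_
    filter_upwards [h2] with t ht
    have : 0 ≤ ∫ s, dissipationAt DU D2U s ∂volT t :=
      integral_nonneg dissipationAt_nonneg
    linarith
  have h4 : ∫ t, dissipationAt DU D2U t ∂volT T
      ≤ A + A * Real.exp (∫ s, b s ∂volT T) * ∫ s, b s ∂volT T := by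
    -- The inequality before Gronwall is used again: inserting the bound of the energy into its
    -- right-hand side controls the dissipation.
    refine integral_volT_le_of_ae_le hT iE ?_
    have h5 : ∫ s, b s * energyAt U DU s ∂volT T
        ≤ A * Real.exp (∫ s, b s ∂volT T) * ∫ s, b s ∂volT T := by
      rw [← integral_const_mul]
      refine integral_mono_ae ibY (ib.const_mul _) ?_
      filter_upwards [h3] with t ht
      rw [mul_comm (A * _)]
      exact mul_le_mul_of_nonneg_left ht (hbn t)
    filter_upwards [h2, ae_mem_volT T] with t ht h0
    have h6 : ∫ s, b s * energyAt U DU s ∂volT t ≤ ∫ s, b s * energyAt U DU s ∂volT T :=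
      integral_mono_measure (volT_le h0.2.le)
        (ae_of_all _ fun s => mul_nonneg (hbn s) (energyAt_nonneg s)) ibY
    have h7 : 0 ≤ energyAt U DU t := energyAt_nonneg t
    linarith
  refine ⟨A, ∫ s, b s ∂volT T, hA, ?_, by rw [eb, ea, eN], h3, h4⟩
  rw [eH, eφ, ← ENNReal.ofReal_add hy₀n hφi, ← ENNReal.ofReal_mul (by norm_num)]
  exact ENNReal.ofReal_le_ofReal (by rw [hAdef]; linarith)

end

end AnisoTransport

end

/-! ### Final bound in the stated norms -/

open AnisoTransport in
theorem proposition5p3 :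
    ∃ C : ℝ, 0 < C ∧
      ∀ (T ε δ : ℝ), 0 < T → 0 < ε → 0 < δ →
      ∀ (U₀ U₀z : Fin 3 → Space → ℝ), MemH U₀ U₀z →
      ∀ (f fz : Fin 3 → ℝ × ℝ → Hneg1), MemL2Vdual T f fz →
      ∀ (ω ωz ωzz : SpaceTime → ℝ), MemTransport T ω ωz ωzz →
      ∀ (ν νz νzz : Fin 3 → SpaceTime → ℝ), MemL4H2L4 T ν νz νzz →
      ∀ (U Ut : Fin 3 → SpaceTime → ℝ) (DU : Fin 3 → Fin 3 → SpaceTime → ℝ)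
        (D2U : Fin 3 → Fin 3 → Fin 3 → SpaceTime → ℝ) (P : SpaceTime → ℝ),
        IsSolution T ε δ ω ν f U₀ U Ut DU D2U P →
        sqNormLinftyH T U DU + sqNormL2V T U DU D2U ≤
          ENNReal.ofReal C * (sqNormH U₀ U₀z + sqNormL2Vdual T f fz) *
            ENNReal.ofReal (Real.exp (C * (T + (sqNormTransport T ωz ωzz).toReal
              + (normPowFourL4H2L4 T ν νz νzz).toReal))) := by
  -- Twice the constant `2 * 10 ^ 14`: once for the prefactor `2 A`, and once for the exponent,
  -- since factors `T` and `B` are absorbed into `exp (2 * B)`.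
  refine ⟨4 * 10 ^ 14, by norm_num, ?_⟩
  intro T ε δ hT _ hδ U₀ U₀z h₀ f fz hf ω ωz ωzz hω ν νz νzz hν U Ut DU D2U P S
  obtain ⟨A, B, hA, hAle, hB, hY, hE⟩ := S.exists_bound hT hδ.le h₀ hf hω hν
  have mU := S.memE1.memLp
  have mD := S.memE1.memLp_D
  rw [cyl_eq] at mU mD
  have hTB : T ≤ B := by
    have h1 := (sqNormTransport T ωz ωzz).toReal_nonneg
    have h2 := (normPowFourL4H2L4 T ν νz νzz).toReal_nonneg
    rw [hB]
    linarith
  have hB₀ : 0 ≤ B := hT.le.trans hTB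
  have hsup : sqNormLinftyH T U DU ≤ ENNReal.ofReal (A * Real.exp B) := by
    refine essSup_le_of_ae_le _ ?_
    filter_upwards [hY, ae_all_iff.2 fun i => memLp_slice (mU i),
      ae_all_iff.2 fun i => memLp_slice (mD i 2)] with t h1 h2 h3
    rw [sqNormH_eq h2 h3]
    exact ENNReal.ofReal_le_ofReal h1
  have hint : ∫ t, energyAt U DU t ∂volT T ≤ T * (A * Real.exp B) := by
    have h1 := integral_mono_ae S.memE1.integrable_energyAt
      (integrable_const (A * Real.exp B)) hY
    rw [integral_const] at h1
    simpa [measureReal_def, hT.le] using h1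
  have hexp := Real.add_one_le_exp B
  have hexp₁ : 1 ≤ Real.exp B := by linarith
  have hAe : 0 ≤ A * Real.exp B := mul_nonneg hA (Real.exp_pos B).le
  -- The energy integrated in time brings a factor `T ≤ B` and the dissipation a factor `B`. Both
  -- are absorbed by `1 + B ≤ exp B`.
  have htot : A * Real.exp B + ((∫ t, energyAt U DU t ∂volT T) + ∫ t, dissipationAt DU D2U t ∂volT T)
      ≤ 2 * A * Real.exp (2 * B) := by
    have h1 : Real.exp (2 * B) = Real.exp B * Real.exp B := by
      rw [two_mul, Real.exp_add]
    have h2 := mul_le_mul_of_nonneg_left hexp hAe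
    have h3 := mul_le_mul_of_nonneg_left hexp₁ hA
    have h4 := mul_le_mul_of_nonneg_right hTB hAe
    rw [h1]
    linarith
  calc sqNormLinftyH T U DU + sqNormL2V T U DU D2U
      ≤ ENNReal.ofReal (A * Real.exp B) + ENNReal.ofReal ((∫ t, energyAt U DU t ∂volT T)
        + ∫ t, dissipationAt DU D2U t ∂volT T) := add_le_add hsup S.memE1.sqNormL2V_eq.le
    _ = ENNReal.ofReal (A * Real.exp B + ((∫ t, energyAt U DU t ∂volT T)
        + ∫ t, dissipationAt DU D2U t ∂volT T)) := by
      rw [ENNReal.ofReal_add hAe (add_nonneg (integral_nonneg energyAt_nonneg)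
        (integral_nonneg dissipationAt_nonneg))]
    _ ≤ ENNReal.ofReal (2 * A * Real.exp (2 * B)) := ENNReal.ofReal_le_ofReal htot
    _ = ENNReal.ofReal 2 * ENNReal.ofReal A * ENNReal.ofReal (Real.exp (2 * B)) := by
      rw [ENNReal.ofReal_mul (by positivity), ENNReal.ofReal_mul (by norm_num)]
    _ ≤ ENNReal.ofReal 2 * (ENNReal.ofReal (2 * 10 ^ 14) * (sqNormH U₀ U₀z + sqNormL2Vdual T f fz))
        * ENNReal.ofReal (Real.exp (2 * B)) := by gcongr
    _ = _ := by
      rw [← mul_assoc (ENNReal.ofReal 2), ← ENNReal.ofReal_mul (by norm_num), hB]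
      congr 3
      · norm_num
      · ring_nf
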